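/- **Setting.** Let $d\in\{2,3\}$, let $\Omega\subset\mathbb R^d$ be a nonempty bounded convex polytopal open set, and let $\mathscr A,\mathscr B$ be nonempty compact metric spaces. Let $a$ (symmetric $d\times d$ matrix-valued), $b$ ($\mathbb R^d$-valued) and $c,f$ (real-valued) be continuous on $\overline\Omega\times\mathscr A\times\mathscr B$; write $a^{\alpha\beta}(x)=a(x,\alpha,\beta)$, etc. Assume $c^{\alpha\beta}\ge 0$ in $\Omega$, and that there are constants $\underline\nu,\overline\nu>0$ with $\underline\nu|\xi|^2\le \xi^\top a^{\alpha\beta}(x)\xi\le\overline\nu|\xi|^2$ for all $x\in\Omega$, $\xi\in\mathbb R^d$, $(\alpha,\beta)\in\mathscr A\times\mathscr B$. Let $\nu\in(0,1]$ and $\lambda\ge0$ be such that the Cordes condition holds (with $|a|$ the Frobenius norm): * if $b\equiv0$ and $c\equiv 0$, then $\lambda=0$ and $\dfrac{|a^{\alpha\beta}|^2}{(\operatorname{Tr}a^{\alpha\beta})^2}\le\dfrac1{d-1+\nu}$ in $\Omega$ for all $(\alpha,\beta)$; * otherwise, $\lambda>0$ and $\dfrac{|a^{\alpha\beta}|^2+|b^{\alpha\beta}|^2/(2\lambda)+(c^{\alpha\beta}/\lambda)^2}{(\operatorname{Tr}a^{\alpha\beta}+c^{\alpha\beta}/\lambda)^2}\le\dfrac1{d+\nu}$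 in $\Omega$ for all $(\alpha,\beta)$. Let $L^{\alpha\beta}v=a^{\alpha\beta}:\nabla^2v+b^{\alpha\beta}\cdot\nabla v-c^{\alpha\beta}v$ and $$F[v]=\inf_{\alpha\in\mathscr A}\sup_{\beta\in\mathscr B}\left[L^{\alpha\beta}v-f^{\alpha\beta}\right],\qquad F_\gamma[v]=\inf_{\alpha\in\mathscr A}\sup_{\beta\in\mathscr B}\left[\gamma^{\alpha\beta}(L^{\alpha\beta}v-f^{\alpha\beta})\right],$$ where $\gamma^{\alpha\beta}=\operatorname{Tr}a^{\alpha\beta}/|a^{\alpha\beta}|^2$ if $b\equiv0$ and $c\equiv0$, and $\gamma^{\alpha\beta}=\dfrac{\operatorname{Tr}a^{\alpha\beta}+c^{\alpha\beta}/\lambda}{|a^{\alpha\beta}|^2+|b^{\alpha\beta}|^2/(2\lambda)+|c^{\alpha\beta}|^2/\lambda^2}$ otherwise. Let $u\in H^2(\Omega)\cap H^1_0(\Omega)$ be the exact solution, i.e. $F[u]=0$ a.e. in $\Omega$. **Meshes and spaces.** For a finite conforming partition $\mathcal T$ of $\Omega$ into closed simplices, let $\mathcal F$ and $\mathcal F^I$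 be the sets of its $(d-1)$-dimensional faces and of its interior faces, $h_K=|K|^{1/d}$ for $K\in\mathcal T$, and $h_F=(\mathcal H^{d-1}(F))^{1/(d-1)}$ for $F\in\mathcal F$. The shape-regularity parameter of $\mathcal T$ is $\max_{K\in\mathcal T}\operatorname{diam}K/\rho_K$, with $\rho_K$ the diameter of the largest ball inscribed in $K$. Fix $p\ge2$ and $s\in\{0,1\}$, and let $$V^0_{\mathcal T}=\{v\in L^2(\Omega): v|_K\in\mathbb P_p\ \ \forall K\in\mathcal T\},\qquad V^1_{\mathcal T}=V^0_{\mathcal T}\cap H^1_0(\Omega),$$ with $\mathbb P_p$ the polynomials of total degree at most $p$. On $V^s_{\mathcal T}+H^2(\Omega)\cap H^1_0(\Omega)$ let $$\|v\|_{\mathcal T}^2=\int_\Omega\left[|\nabla^2v|^2+|\nabla v|^2+|v|^2\right]+|v|_{J,\mathcal T}^2,\qquad |v|_{J,\mathcal T}^2=\sum_{F\in\mathcal F^I}\int_Fh_F^{-1}|[\![\nabla v]\!]|^2+\sum_{F\in\mathcal F}\int_Fh_F^{-3}|[\![v]\!]|^2,$$ where $\nabla v$, $\nabla^2v$ are the elementwise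 derivatives (also in $F_\gamma[v]$), and $[\![\cdot]\!]$ is the difference of the traces from the two adjacent elements on an interior face and the trace on a boundary face. **Statement.** Let $\{\mathcal T_k\}_{k\in\mathbb N}$ be a sequence of such meshes whose shape-regularity parameters are uniformly bounded and with $\max_{K\in\mathcal T_k}h_K\to0$ as $k\to\infty$. For each $k$ let $A_{\mathcal T_k}(\cdot;\cdot)\colon V^s_{\mathcal T_k}\times V^s_{\mathcal T_k}\to\mathbb R$ be linear in its second argument, and suppose that there are positive constants $C_{\mathrm{Lip}},C_{\mathrm{cons}},C_L,C_{\mathrm{mon}}$ (possibly depending on $k$, but uniformly bounded with respect to $k$) such that, with $\mathcal T=\mathcal T_k$: * (A1) $|A_{\mathcal T}(w;v)-A_{\mathcal T}(z;v)|\le C_{\mathrm{Lip}}\|w-z\|_{\mathcal T}\|v\|_{\mathcal T}$ for all $w,z,v\in V^s_{\mathcal T}$; * (A2) there is a linear operator $L_{\mathcal T}\colon V^s_{\mathcal T}\to L^2(\Omega)$ such that, for all $w,v\in V^s_{\mathcal T}$, $\left|A_{\mathcal T}(w;v)-\int_\Omega F_\gamma[w]\,L_{\mathcal T}v\right|\le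 C_{\mathrm{cons}}|w|_{J,\mathcal T}\|v\|_{\mathcal T}$ and $\|L_{\mathcal T}v\|_{L^2(\Omega)}\le C_L\|v\|_{\mathcal T}$; * (A3) $C_{\mathrm{mon}}^{-1}\|w-v\|_{\mathcal T}^2\le A_{\mathcal T}(w;w-v)-A_{\mathcal T}(v;w-v)$ for all $w,v\in V^s_{\mathcal T}$. Let $u_{\mathcal T_k}\in V^s_{\mathcal T_k}$ be the numerical solution, i.e. $A_{\mathcal T_k}(u_{\mathcal T_k};v)=0$ for all $v\in V^s_{\mathcal T_k}$. Then $$\lim_{k\to\infty}\|u-u_{\mathcal T_k}\|_{\mathcal T_k}=0.$$ No regularity of $u$ beyond $H^2(\Omega)\cap H^1_0(\Omega)$ is assumed. -/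

import Mathlib

open MeasureTheory Filter Topology
open scoped ContDiff ENNReal

noncomputable section

namespace IsaacsFEM

/-- Euclidean space `ℝ^d`. -/
abbrev Space (d : ℕ) : Type := EuclideanSpace ℝ (Fin d)

/-- The real Hilbert space `L²(Ω)`. -/
abbrev L2 {d : ℕ} (Ω : Set (Space d)) : Type := Lp ℝ 2 (volume.restrict Ω)

/-- Bounded convex polytopal (nonempty) open subsets of `ℝ^d`. -/
structure IsConvexPolytopalDomain {d : ℕ} (Ω : Set (Space d)) : Prop where
  isOpen : IsOpen Ω
  nonempty : Ω.Nonempty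
  isBounded : Bornology.IsBounded Ω
  convex : Convex ℝ Ω
  polytopal : ∃ S : Finset (Space d), closure Ω = convexHull ℝ (S : Set (Space d))

/-! ### Weak derivatives and Sobolev spaces -/

/-- The classical partial derivative `∂φ/∂x_i`. -/
def pderiv {d : ℕ} (i : Fin d) (φ : Space d → ℝ) (x : Space d) : ℝ :=
  fderiv ℝ φ x (EuclideanSpace.single i 1)

/-- `C₀^∞(U)`: smooth functions with compact support contained in `U`. -/
def IsTestFunction {d : ℕ} (U : Set (Space d)) (φ : Space d → ℝ) : Prop :=
  ContDiff ℝ ∞ φ ∧ HasCompactSupport φ ∧ tsupport φ ⊆ U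

/-- `g` is a weak partial derivative of `v` in direction `x_i` on the open set `U`. -/
def IsWeakDeriv {d : ℕ} (U : Set (Space d)) (i : Fin d) (v g : Space d → ℝ) : Prop :=
  LocallyIntegrableOn v U volume ∧ LocallyIntegrableOn g U volume ∧
    ∀ φ, IsTestFunction U φ → ∫ x in U, v x * pderiv i φ x = - ∫ x in U, g x * φ x

open Classical in
/-- The weak partial derivative `∂v/∂x_i` on the open set `U` (a representative of it, unique up to
null subsets of `U`; it is `0` if `v` has no such weak derivative). -/
def weakDeriv {d : ℕ} (U : Set (Space d)) (i : Fin d) (v : Space d → ℝ) : Space d → ℝ :=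
  if h : ∃ g, IsWeakDeriv U i v g then h.choose else 0

/-- The entry `(i, j)` of the weak Hessian, `∂_j (∂_i v)`. -/
def weakHess {d : ℕ} (U : Set (Space d)) (i j : Fin d) (v : Space d → ℝ) : Space d → ℝ :=
  weakDeriv U j (weakDeriv U i v)

/-- `v ∈ H²(U)`: `v` and its weak derivatives of first and second order exist and are in `L²(U)`. -/
def MemH2 {d : ℕ} (U : Set (Space d)) (v : Space d → ℝ) : Prop :=
  MemLp v 2 (volume.restrict U) ∧
    ∀ i, ∃ g, IsWeakDeriv U i v g ∧ MemLp g 2 (volume.restrict U) ∧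
      ∀ j, ∃ h, IsWeakDeriv U j g h ∧ MemLp h 2 (volume.restrict U)

/-- `H¹₀(Ω)`, the closure of `C₀^∞(Ω)` in `H¹(Ω)`: the functions `v ∈ L²(Ω)` for which there are test
functions `φ n` with `φ n → v` and `∂_i (φ n) → g i` in `L²(Ω)` (and then `g i` is the weak
derivative `∂_i v`). -/
def H10 {d : ℕ} (Ω : Set (Space d)) : Submodule ℝ (L2 Ω) where
  carrier := {v | ∃ g : Fin d → L2 Ω, ∃ φ : ℕ → Space d → ℝ,
    (∀ n, IsTestFunction Ω (φ n)) ∧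
    Tendsto (fun n => eLpNorm (fun x => φ n x - v x) 2 (volume.restrict Ω)) atTop (𝓝 0) ∧
    ∀ i, Tendsto (fun n => eLpNorm (fun x => pderiv i (φ n) x - g i x) 2 (volume.restrict Ω))
      atTop (𝓝 0)}
  zero_mem' := by
    refine ⟨0, fun _ => 0, fun n => ⟨contDiff_const, HasCompactSupport.zero, by simp [tsupport]⟩, ?_, ?_⟩
    · have : ∀ n : ℕ, eLpNorm (fun x => (0 : Space d → ℝ) x - (0 : L2 Ω) x) 2
          (volume.restrict Ω) = 0 := by
        intro n
        rw [← eLpNorm_zero (p := 2) (μ := volume.restrict Ω) (ε := ℝ)]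
        apply eLpNorm_congr_ae
        filter_upwards [Lp.coeFn_zero ℝ 2 (volume.restrict Ω)] with x hx
        rw [hx]
        simp
      exact Tendsto.congr (fun n => (this n).symm) tendsto_const_nhds
    · intro i
      have : ∀ n : ℕ, eLpNorm (fun x => pderiv i (0 : Space d → ℝ) x - (0 : L2 Ω) x) 2
          (volume.restrict Ω) = 0 := by
        intro n
        rw [← eLpNorm_zero (p := 2) (μ := volume.restrict Ω) (ε := ℝ)]
        apply eLpNorm_congr_ae
        filter_upwards [Lp.coeFn_zero ℝ 2 (volume.restrict Ω)] with x hx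
        rw [hx]
        simp [pderiv]
      exact Tendsto.congr (fun n => (this n).symm) tendsto_const_nhds
  add_mem' := by
    rintro v w ⟨g, φ, hφ, hv, hg⟩ ⟨k, ψ, hψ, hw, hk⟩
    have meas : ∀ θ : Space d → ℝ, Continuous θ → ∀ u : L2 Ω,
        AEStronglyMeasurable (fun x => θ x - u x) (volume.restrict Ω) := fun θ hθ u =>
      hθ.aestronglyMeasurable.sub (Lp.aestronglyMeasurable u)
    have pc : ∀ i : Fin d, ∀ θ : Space d → ℝ, ContDiff ℝ ∞ θ → Continuous (pderiv i θ) :=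
      fun i θ hθ => (hθ.continuous_fderiv (by simp)).clm_apply continuous_const
    have key : ∀ (a b : ℕ → Space d → ℝ) (u z : L2 Ω), (∀ n, Continuous (a n)) →
        (∀ n, Continuous (b n)) →
        Tendsto (fun n => eLpNorm (fun x => a n x - u x) 2 (volume.restrict Ω)) atTop (𝓝 0) →
        Tendsto (fun n => eLpNorm (fun x => b n x - z x) 2 (volume.restrict Ω)) atTop (𝓝 0) →
        Tendsto (fun n => eLpNorm (fun x => (a n x + b n x) - (u + z : L2 Ω) x) 2
          (volume.restrict Ω)) atTop (𝓝 0) := by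
      intro a b u z ha hb h1 h2
      refine tendsto_of_tendsto_of_tendsto_of_le_of_le tendsto_const_nhds
        (by simpa using h1.add h2) (fun _ => bot_le) (fun n => ?_)
      refine le_trans (le_of_eq ?_) (eLpNorm_add_le (meas _ (ha n) u) (meas _ (hb n) z)
        (by norm_num))
      apply eLpNorm_congr_ae
      filter_upwards [Lp.coeFn_add u z] with x hx
      simp only [hx, Pi.add_apply]
      ring
    refine ⟨g + k, fun n x => φ n x + ψ n x, fun n => ⟨(hφ n).1.add (hψ n).1,
      (hφ n).2.1.add (hψ n).2.1, (tsupport_add _ _).trans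
        (Set.union_subset (hφ n).2.2 (hψ n).2.2)⟩,
      key _ _ _ _ (fun n => (hφ n).1.continuous) (fun n => (hψ n).1.continuous) hv hw, fun i => ?_⟩
    refine (key _ _ _ _ (fun n => pc i _ (hφ n).1) (fun n => pc i _ (hψ n).1)
      (hg i) (hk i)).congr (fun n => ?_)
    congr 1
    funext x
    have h1 := ((hφ n).1.differentiable (by simp)) x
    have h2 := ((hψ n).1.differentiable (by simp)) x
    simp only [pderiv, fderiv_fun_add h1 h2, Pi.add_apply, add_apply]
  smul_mem' := by
    rintro c v ⟨g, φ, hφ, hv, hg⟩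
    have key : ∀ (a : ℕ → Space d → ℝ) (u : L2 Ω),
        Tendsto (fun n => eLpNorm (fun x => a n x - u x) 2 (volume.restrict Ω)) atTop (𝓝 0) →
        Tendsto (fun n => eLpNorm (fun x => c * a n x - (c • u : L2 Ω) x) 2
          (volume.restrict Ω)) atTop (𝓝 0) := by
      intro a u h1
      have h2 := ENNReal.Tendsto.const_mul h1 (a := ‖c‖ₑ) (Or.inr enorm_ne_top)
      rw [mul_zero] at h2
      refine h2.congr (fun n => ?_)
      rw [← eLpNorm_const_smul]
      apply eLpNorm_congr_ae
      filter_upwards [Lp.coeFn_smul c u] with x hx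
      simp only [hx, Pi.smul_apply, smul_eq_mul]
      ring
    refine ⟨c • g, fun n x => c * φ n x, fun n => ⟨contDiff_const.mul (hφ n).1,
      (hφ n).2.1.mul_left, (closure_mono (Function.support_mul_subset_right _ _)).trans
        (hφ n).2.2⟩, key _ _ hv, fun i => ?_⟩
    refine (key _ _ (hg i)).congr (fun n => ?_)
    congr 1
    funext x
    have h1 := ((hφ n).1.differentiable (by simp)) x
    simp [pderiv, fderiv_const_mul h1]

/-! ### The Isaacs equation -/

/-- The data of the Isaacs equation: the coefficients `a`, `b`, `c` and the source `f`, as functions of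
`(x, α, β)`. -/
structure IsaacsData (d : ℕ) (𝒜 ℬ : Type*) where
  a : Space d → 𝒜 → ℬ → Matrix (Fin d) (Fin d) ℝ
  b : Space d → 𝒜 → ℬ → Space d
  c : Space d → 𝒜 → ℬ → ℝ
  f : Space d → 𝒜 → ℬ → ℝ

/-- The square of the Frobenius norm of a matrix. -/
def frobSq {d : ℕ} (A : Matrix (Fin d) (Fin d) ℝ) : ℝ := ∑ i, ∑ j, A i j ^ 2

namespace IsaacsData

variable {d : ℕ} {𝒜 ℬ : Type*}

/-- The lower-order coefficients `b` and `c` vanish identically on `Ω̄ × 𝒜 × ℬ`. -/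
def NoLowerOrder (P : IsaacsData d 𝒜 ℬ) (Ω : Set (Space d)) : Prop :=
  ∀ x ∈ closure Ω, ∀ α β, P.b x α β = 0 ∧ P.c x α β = 0

/-- The standing assumptions on the data: continuity on `Ω̄ × 𝒜 × ℬ`, symmetry of `a`, nonnegativity of
`c`, uniform ellipticity, and the Cordes condition with parameters `lam` and `ν`, where `lam = 0` if
`b` and `c` vanish identically. -/
structure Admissible [TopologicalSpace 𝒜] [TopologicalSpace ℬ] (P : IsaacsData d 𝒜 ℬ)
    (Ω : Set (Space d)) (lam ν : ℝ) : Prop where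
  continuous_a : ContinuousOn (fun z : Space d × 𝒜 × ℬ => P.a z.1 z.2.1 z.2.2)
    (closure Ω ×ˢ Set.univ)
  continuous_b : ContinuousOn (fun z : Space d × 𝒜 × ℬ => P.b z.1 z.2.1 z.2.2)
    (closure Ω ×ˢ Set.univ)
  continuous_c : ContinuousOn (fun z : Space d × 𝒜 × ℬ => P.c z.1 z.2.1 z.2.2)
    (closure Ω ×ˢ Set.univ)
  continuous_f : ContinuousOn (fun z : Space d × 𝒜 × ℬ => P.f z.1 z.2.1 z.2.2)
    (closure Ω ×ˢ Set.univ)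
  symm : ∀ x ∈ closure Ω, ∀ α β, (P.a x α β).IsSymm
  c_nonneg : ∀ x ∈ Ω, ∀ α β, 0 ≤ P.c x α β
  elliptic : ∃ lo hi : ℝ, 0 < lo ∧ 0 < hi ∧ ∀ x ∈ Ω, ∀ (ξ : Space d) (α : 𝒜) (β : ℬ),
    lo * ‖ξ‖ ^ 2 ≤ ∑ i, ∑ j, ξ i * P.a x α β i j * ξ j ∧
      ∑ i, ∑ j, ξ i * P.a x α β i j * ξ j ≤ hi * ‖ξ‖ ^ 2
  nu_pos : 0 < ν
  nu_le_one : ν ≤ 1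
  cordes :
    (P.NoLowerOrder Ω ∧ lam = 0 ∧ ∀ x ∈ Ω, ∀ α β,
      frobSq (P.a x α β) / (P.a x α β).trace ^ 2 ≤ 1 / ((d : ℝ) - 1 + ν)) ∨
    (¬ P.NoLowerOrder Ω ∧ 0 < lam ∧ ∀ x ∈ Ω, ∀ α β,
      (frobSq (P.a x α β) + ‖P.b x α β‖ ^ 2 / (2 * lam) + (P.c x α β / lam) ^ 2) /
        ((P.a x α β).trace + P.c x α β / lam) ^ 2 ≤ 1 / ((d : ℝ) + ν))

/-- The linear operator `L^{αβ} v = a^{αβ} : ∇²v + b^{αβ} · ∇v - c^{αβ} v`, where the derivatives are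
the weak ones on the open set `U`. -/
def linOp (P : IsaacsData d 𝒜 ℬ) (U : Set (Space d)) (α : 𝒜) (β : ℬ) (v : Space d → ℝ)
    (x : Space d) : ℝ :=
  (∑ i, ∑ j, P.a x α β i j * weakHess U i j v x) + (∑ i, P.b x α β i * weakDeriv U i v x)
    - P.c x α β * v x

/-- The Isaacs operator `F[v] = inf_α sup_β [L^{αβ} v - f^{αβ}]` on the open set `U`. -/
def op (P : IsaacsData d 𝒜 ℬ) (U : Set (Space d)) (v : Space d → ℝ) (x : Space d) : ℝ :=
  ⨅ α, ⨆ β, (P.linOp U α β v x - P.f x α β)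

/-- The renormalization function `γ^{αβ}`; the case `lam = 0` is that of vanishing `b` and `c`. -/
def gamma (P : IsaacsData d 𝒜 ℬ) (lam : ℝ) (x : Space d) (α : 𝒜) (β : ℬ) : ℝ :=
  if lam = 0 then (P.a x α β).trace / frobSq (P.a x α β)
  else ((P.a x α β).trace + P.c x α β / lam) /
    (frobSq (P.a x α β) + ‖P.b x α β‖ ^ 2 / (2 * lam) + P.c x α β ^ 2 / lam ^ 2)

/-- The renormalized operator `F_γ[v] = inf_α sup_β [γ^{αβ} (L^{αβ} v - f^{αβ})]` on `U`. -/
def opGamma (P : IsaacsData d 𝒜 ℬ) (lam : ℝ) (U : Set (Space d)) (v : Space d → ℝ)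
    (x : Space d) : ℝ :=
  ⨅ α, ⨆ β, P.gamma lam x α β * (P.linOp U α β v x - P.f x α β)

/-- `u ∈ H²(Ω) ∩ H¹₀(Ω)` is a strong solution: `F[u] = 0` a.e. in `Ω`. -/
def IsStrongSolution (P : IsaacsData d 𝒜 ℬ) (Ω : Set (Space d)) (u : L2 Ω) : Prop :=
  MemH2 Ω u ∧ u ∈ H10 Ω ∧ ∀ᵐ x ∂(volume.restrict Ω), P.op Ω u x = 0

end IsaacsData

/-! ### Traces -/

/-- `τ ∈ L²(∂U)` is the trace on `∂U` of the function `v ∈ H¹(U)`: the trace operator is the continuous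
extension of the restriction to `∂U` of smooth functions. So there are smooth `ψ n` on `ℝ^d` that
converge to `v` in `H¹(U)` and to `τ` in `L²(∂U)`; here `G i` is the weak derivative `∂_i v`.
The measure `μHE[d - 1]` is the `(d-1)`-dimensional Hausdorff measure, normalized as surface
measure. -/
def IsTrace {d : ℕ} (U : Set (Space d)) (v τ : Space d → ℝ) : Prop :=
  MemLp v 2 (volume.restrict U) ∧ MemLp τ 2 (μHE[d - 1].restrict (frontier U)) ∧
    ∃ G : Fin d → Space d → ℝ, (∀ i, MemLp (G i) 2 (volume.restrict U)) ∧
    (∀ i, IsWeakDeriv U i v (G i)) ∧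
    ∃ ψ : ℕ → Space d → ℝ, (∀ n, ContDiff ℝ ∞ (ψ n)) ∧
      Tendsto (fun n => eLpNorm (fun x => ψ n x - v x) 2 (volume.restrict U)) atTop (𝓝 0) ∧
      (∀ i, Tendsto (fun n => eLpNorm (fun x => pderiv i (ψ n) x - G i x) 2 (volume.restrict U))
        atTop (𝓝 0)) ∧
      Tendsto (fun n => eLpNorm (fun x => ψ n x - τ x) 2 (μHE[d - 1].restrict (frontier U)))
        atTop (𝓝 0)

open Classical in
/-- The trace of `v` on `∂U` (a representative of it; `0` if there is no trace). -/
def trace {d : ℕ} (U : Set (Space d)) (v : Space d → ℝ) : Space d → ℝ :=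
  if h : ∃ τ, IsTrace U v τ then h.choose else 0

/-! ### Meshes -/

/-- A finite conforming partition of (the closure of) `Ω` into closed `d`-simplices: a finite
simplicial complex with underlying space `Ω̄`, all of whose faces are faces of `d`-simplices of the
complex. Simplices are given by their sets of vertices. -/
structure Mesh {d : ℕ} (Ω : Set (Space d)) extends Geometry.SimplicialComplex ℝ (Space d) where
  finite_faces : faces.Finite
  pure : ∀ s ∈ faces, ∃ t ∈ faces, s ⊆ t ∧ t.card = d + 1
  space_eq : toSimplicialComplex.space = closure Ω

/-- The closed simplex with the given vertices. -/
def hull {d : ℕ} (s : Finset (Space d)) : Set (Space d) := convexHull ℝ (s : Set (Space d))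

/-- The diameter `ρ_K` of the largest ball inscribed in the set `K`. -/
def inscribedDiam {d : ℕ} (K : Set (Space d)) : ℝ :=
  sSup {δ : ℝ | ∃ x : Space d, ∃ r : ℝ, 0 ≤ r ∧ δ = 2 * r ∧ Metric.closedBall x r ⊆ K}

namespace Mesh

variable {d : ℕ} {Ω : Set (Space d)}

/-- The elements (the `d`-simplices) of the mesh. -/
def elements (M : Mesh Ω) : Finset (Finset (Space d)) :=
  M.finite_faces.toFinset.filter fun s => s.card = d + 1

/-- The set `𝓕` of `(d-1)`-dimensional faces of the mesh. -/
def facets (M : Mesh Ω) : Finset (Finset (Space d)) :=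
  M.finite_faces.toFinset.filter fun s => s.card = d

/-- `F` is the common face of the two different elements `Q.1` and `Q.2`. -/
def IsShared (M : Mesh Ω) (F : Finset (Space d)) (Q : Finset (Space d) × Finset (Space d)) : Prop :=
  Q.1 ∈ M.elements ∧ Q.2 ∈ M.elements ∧ Q.1 ≠ Q.2 ∧ F ⊆ Q.1 ∧ F ⊆ Q.2

open Classical in
/-- The set `𝓕^I` of interior faces: those shared by two elements. All other faces are boundary
faces. -/
def interiorFacets (M : Mesh Ω) : Finset (Finset (Space d)) :=
  M.facets.filter fun F => ∃ Q, M.IsShared F Q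

/-- `h_K = |K|^{1/d}`. -/
def elementSize (K : Finset (Space d)) : ℝ := (volume.real (hull K)) ^ (1 / (d : ℝ))

/-- `h_F = (𝓗^{d-1}(F))^{1/(d-1)}`. -/
def facetSize (F : Finset (Space d)) : ℝ :=
  ((μHE[d - 1] : Measure (Space d)).real (hull F)) ^ (1 / ((d : ℝ) - 1))

/-- The mesh-size `max_K h_K`. -/
def meshSize (M : Mesh Ω) : ℝ := sSup (elementSize '' (M.elements : Set (Finset (Space d))))

/-- The shape-regularity parameter `max_K (diam K / ρ_K)`. -/
def shapeRegularity (M : Mesh Ω) : ℝ :=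
  sSup ((fun K => Metric.diam (hull K) / inscribedDiam (hull K)) ''
    (M.elements : Set (Finset (Space d))))

/-- The union of the interiors of the elements, which is `Ω` up to a null set. Weak derivatives on
this open set are the elementwise ones. -/
def brokenDomain (M : Mesh Ω) : Set (Space d) := ⋃ K ∈ M.elements, interior (hull K)

open Classical in
/-- The jump of `v` on the face `F`: the difference of the traces from the two elements that share an
interior face (their order is that of a fixed choice of the unit normal of `F`), and the trace from
the only element that contains a boundary face. -/
def jump (M : Mesh Ω) (F : Finset (Space d)) (v : Space d → ℝ) (x : Space d) : ℝ :=
  if h : ∃ Q, M.IsShared F Q then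
    trace (interior (hull h.choose.1)) v x - trace (interior (hull h.choose.2)) v x
  else if h : ∃ K ∈ M.elements, F ⊆ K then trace (interior (hull h.choose)) v x
  else 0

/-- The square of the jump seminorm:
`∫_{𝓕^I} h⁻¹ |⟦∇v⟧|² + ∫_𝓕 h⁻³ |⟦v⟧|²`, with elementwise gradients. -/
def jumpSq (M : Mesh Ω) (v : L2 Ω) : ℝ :=
  (∑ F ∈ M.interiorFacets, ∫ x in hull F,
      (facetSize F)⁻¹ * ∑ i, M.jump F (weakDeriv M.brokenDomain i v) x ^ 2 ∂μHE[d - 1]) +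
  ∑ F ∈ M.facets, ∫ x in hull F, (facetSize F ^ 3)⁻¹ * M.jump F v x ^ 2 ∂μHE[d - 1]

/-- The jump seminorm `|v|_{J,𝓣}`. -/
def jumpSeminorm (M : Mesh Ω) (v : L2 Ω) : ℝ := Real.sqrt (M.jumpSq v)

/-- The mesh norm `‖v‖_𝓣`, defined on functions that are elementwise `H²`: the square root of
`∫_Ω [|∇²v|² + |∇v|² + |v|²] + |v|²_{J,𝓣}`, with elementwise derivatives. -/
def meshNorm (M : Mesh Ω) (v : L2 Ω) : ℝ :=
  Real.sqrt ((∫ x in Ω, ((∑ i, ∑ j, weakHess M.brokenDomain i j v x ^ 2) +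
    (∑ i, weakDeriv M.brokenDomain i v x ^ 2) + v x ^ 2)) + M.jumpSq v)

/-- The discontinuous finite element space `V⁰_𝓣`: functions in `L²(Ω)` that are a polynomial of total
degree at most `p` on each element. -/
def dgSpace (M : Mesh Ω) (p : ℕ) : Submodule ℝ (L2 Ω) where
  carrier := {v | ∀ K ∈ M.elements, ∃ q : MvPolynomial (Fin d) ℝ, q.totalDegree ≤ p ∧
    ∀ᵐ x ∂(volume.restrict Ω), x ∈ hull K → v x = MvPolynomial.eval (fun i => x i) q}
  zero_mem' := by
    intro K _
    refine ⟨0, by simp, ?_⟩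
    filter_upwards [Lp.coeFn_zero ℝ 2 (volume.restrict Ω)] with x hx _
    rw [hx]
    simp
  add_mem' := by
    intro v w hv hw K hK
    obtain ⟨q, hq, hvq⟩ := hv K hK
    obtain ⟨r, hr, hwr⟩ := hw K hK
    refine ⟨q + r, (MvPolynomial.totalDegree_add q r).trans (max_le hq hr), ?_⟩
    filter_upwards [Lp.coeFn_add v w, hvq, hwr] with x hx h1 h2 hxK
    rw [hx, Pi.add_apply, h1 hxK, h2 hxK, map_add]
  smul_mem' := by
    intro c v hv K hK
    obtain ⟨q, hq, hvq⟩ := hv K hK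
    refine ⟨c • q, (MvPolynomial.totalDegree_smul_le c q).trans hq, ?_⟩
    filter_upwards [Lp.coeFn_smul c v, hvq] with x hx h1 hxK
    rw [hx, Pi.smul_apply, h1 hxK, MvPolynomial.smul_eval, smul_eq_mul]

/-- The finite element spaces `V^s_𝓣`, `s ∈ {0, 1}`: `V⁰_𝓣` as above, `V¹_𝓣 = V⁰_𝓣 ∩ H¹₀(Ω)`. -/
def femSpace (M : Mesh Ω) (p : ℕ) (s : Fin 2) : Submodule ℝ (L2 Ω) :=
  if s = 0 then M.dgSpace p else M.dgSpace p ⊓ H10 Ω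

/-! ### Assumptions on the numerical method -/

/-- Lipschitz continuity of the nonlinear form `A` with constant `C`. -/
def LipschitzForm (M : Mesh Ω) (V : Submodule ℝ (L2 Ω)) (A : V → V → ℝ) (C : ℝ) : Prop :=
  ∀ w z v : V, |A w v - A z v| ≤ C * M.meshNorm ((w - z : V) : L2 Ω) * M.meshNorm (v : L2 Ω)

/-- Discrete consistency of the form `A` with constants `Ccons` and `CL`: there is a linear operator
`L : V → L²(Ω)` such that `A(w; v)` is `∫_Ω F_γ[w] L v` up to a term controlled by the jumps of `w`;
here `F_γ[w]` is formed with elementwise derivatives. -/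
def DiscretelyConsistent {𝒜 ℬ : Type*} (M : Mesh Ω) (P : IsaacsData d 𝒜 ℬ) (lam : ℝ)
    (V : Submodule ℝ (L2 Ω)) (A : V → V → ℝ) (Ccons CL : ℝ) : Prop :=
  ∃ L : V →ₗ[ℝ] L2 Ω,
    (∀ w v : V,
      |A w v - ∫ x in Ω, P.opGamma lam M.brokenDomain (w : L2 Ω) x * L v x| ≤
        Ccons * M.jumpSeminorm (w : L2 Ω) * M.meshNorm (v : L2 Ω)) ∧
    ∀ v : V, ‖L v‖ ≤ CL * M.meshNorm (v : L2 Ω)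

/-- Strong monotonicity of the form `A` with constant `C`. -/
def StronglyMonotone (M : Mesh Ω) (V : Submodule ℝ (L2 Ω)) (A : V → V → ℝ) (C : ℝ) : Prop :=
  ∀ w v : V, C⁻¹ * M.meshNorm ((w - v : V) : L2 Ω) ^ 2 ≤ A w (w - v) - A v (w - v)

end Mesh

end IsaacsFEM

end

open IsaacsFEM

/-! The proof is an abstract quasi-optimality estimate followed by a density argument.

Quasi-optimality. Let `v` be a discrete function and `e = uh - v`. Strong monotonicity together with
`A(uh; e) = 0` gives `C_mon⁻¹ ‖e‖² ≤ -A(v; e)`, and consistency replaces `A(v; e)` by `∫ F_γ[v] L e`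
up to a multiple of `|v|_J ‖e‖`. The weight `γ` is nonnegative and bounded, so `F[u] = 0` forces
`F_γ[u] = 0` almost everywhere (`iInf_iSup_mul_eq_zero`). An inf-sup changes by at most the sup norm
of the change of its entries, hence `|F_γ[v]| = |F_γ[u] - F_γ[v]|` is bounded pointwise by the
derivatives of `u - v` of order at most two (`exists_residual_bound`). Therefore `‖uh - v‖ ≤ C (‖u -
v‖ + |v|_J)`, and if moreover `|v|_J ≤ ‖u - v‖`, the error of the scheme is at most a constant times
`‖u - v‖` (`meshNorm_sub_le`).

Density. What remains is to find discrete `v k` with `‖u - v k‖ → 0` and with jumps controlled in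
this way, for `u` merely in `H² ∩ H¹₀` (`exists_tendsto_meshNorm`). In dimension at most three `u`
has a continuous representative that vanishes on the boundary (`exists_zeroLimit`), and `v k` is its
continuous piecewise quadratic Lagrange interpolant. This function is globally Lipschitz and
vanishes outside `Ω`, so it lies in `H¹₀` and serves `s = 0` and `s = 1` alike. The values of `u`
and `v k` and the gradient of `u` do not jump, so the only jumps left are those of the gradient of
`v k`, which are at the same time those of `u - v k`.

Quadratics are reproduced by the interpolation. So on each element `K` the error, measured with the
natural powers of the diameter, is bounded by the `L²(K)` distance of the Hessian of `u` to an
arbitrary constant symmetric matrix `A K` (`interp_error`); the gradient jumps follow by a scaled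
trace inequality. The sum over `K` of these distances tends to zero with the mesh size, since the
Hessian of `u` is an `L²` limit of uniformly continuous Hessians that can be frozen on each element
(`exists_oscSq_le`). This yields convergence without a rate and without further regularity.

All estimates are first shown for smooth functions and then passed to the limit; smooth functions
are dense in `H²(Ω)` by contracting the convex set `Ω` towards an interior point and mollifying. -/

noncomputable section

namespace IsaacsFEM

/-! ### Calculus preliminaries -/

/-- The squared Euclidean norm of the classical gradient. -/
def gradSq {d : ℕ} (ψ : Space d → ℝ) (x : Space d) : ℝ := ∑ i, pderiv i ψ x ^ 2

/-- The squared Frobenius norm of the classical Hessian. -/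
def hessSq {d : ℕ} (w : Space d → ℝ) (x : Space d) : ℝ :=
  ∑ i, ∑ j, pderiv j (pderiv i w) x ^ 2

section calculus
variable {d : ℕ} {ψ χ w : Space d → ℝ}

lemma gradSq_nonneg (ψ : Space d → ℝ) (x : Space d) : 0 ≤ gradSq ψ x :=
  Finset.sum_nonneg fun _ _ => sq_nonneg _

lemma hessSq_nonneg (ψ : Space d → ℝ) (x : Space d) : 0 ≤ hessSq ψ x :=
  Finset.sum_nonneg fun _ _ => Finset.sum_nonneg fun _ _ => sq_nonneg _

lemma hessSq_eq (w : Space d → ℝ) (x : Space d) : hessSq w x = ∑ i, gradSq (pderiv i w) x := rfl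

lemma contDiff_pderiv (hψ : ContDiff ℝ ∞ ψ) (i : Fin d) : ContDiff ℝ ∞ (pderiv i ψ) :=
  (hψ.fderiv_right (m := ∞) (by simp)).clm_apply contDiff_const

lemma continuous_pderiv (hψ : ContDiff ℝ ∞ ψ) (i : Fin d) : Continuous (pderiv i ψ) :=
  (contDiff_pderiv hψ i).continuous

lemma continuous_gradSq (hψ : ContDiff ℝ ∞ ψ) : Continuous (gradSq ψ) :=
  continuous_finsetSum _ fun i _ => (continuous_pderiv hψ i).pow 2

lemma continuous_hessSq (hψ : ContDiff ℝ ∞ ψ) : Continuous (hessSq ψ) :=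
  continuous_finsetSum _ fun i _ => continuous_gradSq (contDiff_pderiv hψ i)

lemma pderiv_add (hψ : ContDiff ℝ ∞ ψ) (hχ : ContDiff ℝ ∞ χ) (i : Fin d) :
    pderiv i (fun x => ψ x + χ x) = fun x => pderiv i ψ x + pderiv i χ x := by
  funext x
  simp only [pderiv]
  rw [fderiv_fun_add (hψ.differentiable (by simp) x) (hχ.differentiable (by simp) x)]
  rfl

lemma pderiv_sub (hψ : ContDiff ℝ ∞ ψ) (hχ : ContDiff ℝ ∞ χ) (i : Fin d) :
    pderiv i (fun x => ψ x - χ x) = fun x => pderiv i ψ x - pderiv i χ x := by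
  funext x
  simp only [pderiv]
  rw [fderiv_fun_sub (hψ.differentiable (by simp) x) (hχ.differentiable (by simp) x)]
  rfl

lemma pderiv_const_mul (hψ : ContDiff ℝ ∞ ψ) (c : ℝ) (i : Fin d) :
    pderiv i (fun x => c * ψ x) = fun x => c * pderiv i ψ x := by
  funext x
  simp only [pderiv]
  rw [fderiv_const_mul (hψ.differentiable (by simp) x)]
  rfl

lemma pderiv_mul (hψ : ContDiff ℝ ∞ ψ) (hχ : ContDiff ℝ ∞ χ) (i : Fin d) :
    pderiv i (fun x => ψ x * χ x) = fun x => ψ x * pderiv i χ x + χ x * pderiv i ψ x := by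
  funext x
  simp only [pderiv]
  rw [fderiv_fun_mul (hψ.differentiable (by simp) x) (hχ.differentiable (by simp) x)]
  rfl

lemma pderiv_const (c : ℝ) (i : Fin d) : pderiv i (fun _ : Space d => c) = fun _ => 0 := by
  funext x
  simp [pderiv]

lemma pderiv_sum {ι : Type*} (s : Finset ι) (f : ι → Space d → ℝ)
    (hf : ∀ k ∈ s, ContDiff ℝ ∞ (f k)) (i : Fin d) :
    pderiv i (fun x => ∑ k ∈ s, f k x) = fun x => ∑ k ∈ s, pderiv i (f k) x := by
  funext x
  simp only [pderiv]
  rw [fderiv_fun_sum (fun k hk => (hf k hk).differentiable (by simp) x)]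
  simp

lemma contDiff_coord (i : Fin d) : ContDiff ℝ ∞ (fun x : Space d => x i) := by
  fun_prop

lemma pderiv_coord (i k : Fin d) :
    pderiv i (fun x : Space d => x k) = fun _ => if k = i then 1 else 0 := by
  funext x
  have : HasFDerivAt (fun x : Space d => x k) (EuclideanSpace.proj (𝕜 := ℝ) k) x :=
    (EuclideanSpace.proj (𝕜 := ℝ) k).hasFDerivAt
  simp [pderiv, this.fderiv]

lemma fderiv_apply_eq (ψ : Space d → ℝ) (x v : Space d) :
    fderiv ℝ ψ x v = ∑ i, v i * pderiv i ψ x := by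
  conv_lhs => rw [← (EuclideanSpace.basisFun (Fin d) ℝ).sum_repr v]
  simp [pderiv]

lemma fderiv_sq_le (ψ : Space d → ℝ) (x v : Space d) :
    (fderiv ℝ ψ x v) ^ 2 ≤ ‖v‖ ^ 2 * gradSq ψ x := by
  rw [fderiv_apply_eq, EuclideanSpace.real_norm_sq_eq]
  exact Finset.sum_mul_sq_le_sq_mul_sq _ _ _

lemma hasDerivAt_line (hψ : ContDiff ℝ ∞ ψ) (x v : Space d) (t : ℝ) :
    HasDerivAt (fun s : ℝ => ψ (x + s • v)) (fderiv ℝ ψ (x + t • v) v) t := by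
  have h1 : HasDerivAt (fun s : ℝ => x + s • v) v t := by
    simpa using ((hasDerivAt_id t).smul_const v).const_add x
  exact ((hψ.differentiable (by simp) _).hasFDerivAt).comp_hasDerivAt t h1

/-- The second derivative in direction `v`. -/
def dderiv (w : Space d → ℝ) (v x : Space d) : ℝ :=
  ∑ i, v i * fderiv ℝ (pderiv i w) x v

lemma hasDerivAt_line_fderiv (hw : ContDiff ℝ ∞ w) (x v : Space d) (t : ℝ) :
    HasDerivAt (fun s : ℝ => fderiv ℝ w (x + s • v) v) (dderiv w v (x + t • v)) t := by
  simp only [fderiv_apply_eq w, dderiv]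
  apply HasDerivAt.fun_sum
  intro i _
  exact (hasDerivAt_line (contDiff_pderiv hw i) x v t).const_mul _

/-- Cauchy–Schwarz twice: once over the outer index, once for each inner directional derivative. -/
lemma dderiv_sq_le (w : Space d → ℝ) (v x : Space d) :
    dderiv w v x ^ 2 ≤ ‖v‖ ^ 4 * hessSq w x := by
  calc dderiv w v x ^ 2 ≤ (∑ i, v i ^ 2) * ∑ i, (fderiv ℝ (pderiv i w) x v) ^ 2 :=
        Finset.sum_mul_sq_le_sq_mul_sq _ _ _
    _ ≤ ‖v‖ ^ 2 * ∑ i, ‖v‖ ^ 2 * gradSq (pderiv i w) x := by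
        rw [EuclideanSpace.real_norm_sq_eq v]
        gcongr with i
        rw [← EuclideanSpace.real_norm_sq_eq v]
        exact fderiv_sq_le _ _ _
    _ = _ := by rw [← Finset.mul_sum, hessSq_eq]; ring

lemma continuous_dderiv (hw : ContDiff ℝ ∞ w) (v : Space d) : Continuous (dderiv w v) := by
  refine continuous_finsetSum _ fun i _ => continuous_const.mul ?_
  exact ((contDiff_pderiv hw i).continuous_fderiv (by simp)).clm_apply continuous_const

end calculus

/-! ### Integral inequalities -/

/-- Cauchy–Schwarz: the square of an average is at most the average of the square. -/
lemma sq_integral_le {X : Type*} [MeasurableSpace X] {μ : Measure X} [IsFiniteMeasure μ]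
    {f : X → ℝ} (hf : MemLp f 2 μ) : (∫ x, f x ∂μ) ^ 2 ≤ μ.real Set.univ * ∫ x, f x ^ 2 ∂μ := by
  have hint : Integrable f μ := hf.integrable (by norm_num)
  have hsq : Integrable (fun x => f x ^ 2) μ := hf.integrable_sq
  set I := ∫ x, f x ∂μ with hI
  set m := μ.real Set.univ with hm
  have hm0 : 0 ≤ m := measureReal_nonneg
  -- Expanding this square gives `m (m ∫ f² - I²) ≥ 0`. The factor `m` can be cancelled unless it is
  -- zero, in which case the measure vanishes.
  have h : 0 ≤ ∫ x, (m * f x - I) ^ 2 ∂μ := integral_nonneg fun _ => sq_nonneg _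
  have e : ∫ x, (m * f x - I) ^ 2 ∂μ = m ^ 2 * (∫ x, f x ^ 2 ∂μ) - 2 * m * I * I + m * I ^ 2 := by
    have : ∀ x, (m * f x - I) ^ 2 = (m ^ 2 * f x ^ 2 - 2 * m * I * f x) + I ^ 2 := fun x => by ring
    simp_rw [this]
    have hs : Integrable (fun x => m ^ 2 * f x ^ 2 - 2 * m * I * f x) μ :=
      (hsq.const_mul _).sub (hint.const_mul _)
    rw [integral_add hs (integrable_const _),
      integral_sub (hsq.const_mul _) (hint.const_mul _), integral_const_mul, integral_const_mul,
      integral_const, smul_eq_mul]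
  rcases hm0.eq_or_lt with h0 | h0
  · have : μ = 0 := by
      rw [← Measure.measure_univ_eq_zero]
      exact (measureReal_eq_zero_iff).1 h0.symm
    simp [hI, this]
  · rw [e] at h
    have : 0 ≤ m * (m * (∫ x, f x ^ 2 ∂μ) - I ^ 2) := by nlinarith
    have := nonneg_of_mul_nonneg_right this h0
    linarith

lemma sq_intervalIntegral_le {a b : ℝ} (hab : a ≤ b) {f : ℝ → ℝ} (hf : Continuous f) :
    (∫ t in a..b, f t) ^ 2 ≤ (b - a) * ∫ t in a..b, f t ^ 2 := by
  rw [intervalIntegral.integral_of_le hab, intervalIntegral.integral_of_le hab]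
  have hm : MemLp f 2 (volume.restrict (Set.Ioc a b)) := by
    refine (memLp_two_iff_integrable_sq hf.aestronglyMeasurable).2 ?_
    exact ((hf.pow 2).integrableOn_Icc).mono_set Set.Ioc_subset_Icc_self
  have := sq_integral_le hm
  simpa [measureReal_def, hab] using this

/-- The change of variables `y ↦ x + t (y - x)` in a convex set. -/
lemma lintegral_homothety_le {d : ℕ} {K : Set (Space d)} (hK : Convex ℝ K) (hm : MeasurableSet K)
    {x : Space d} (hx : x ∈ K) {t : ℝ} (ht0 : 0 < t) (ht1 : t ≤ 1) (g : Space d → ℝ≥0∞) :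
    ENNReal.ofReal (t ^ d) * ∫⁻ y in K, g (x + t • (y - x)) ≤ ∫⁻ y in K, g y := by
  have hf : ∀ y ∈ K, HasFDerivWithinAt (fun y : Space d => x + t • (y - x))
      (t • ContinuousLinearMap.id ℝ (Space d)) K y := fun y _ =>
    ((((hasFDerivAt_id y).sub_const x).const_smul t).const_add x).hasFDerivWithinAt
  have hinj : Set.InjOn (fun y : Space d => x + t • (y - x)) K := by
    intro a _ b _ h
    have h1 : t • (a - x) = t • (b - x) := by simpa using h
    have := smul_right_injective _ ht0.ne' h1
    simpa using this
  -- The homothety has Jacobian `t ^ d`. Its centre lies in `K`, so by convexity it maps `K` into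
  -- itself, and enlarging the image to `K` gives the inequality.
  have key := lintegral_image_eq_lintegral_abs_det_fderiv_mul volume hm hf hinj g
  have hdet : (t • ContinuousLinearMap.id ℝ (Space d)).det = t ^ d := by
    rw [ContinuousLinearMap.det]
    simp [LinearMap.det_smul]
  rw [hdet, abs_of_pos (pow_pos ht0 d), lintegral_const_mul' _ _ ENNReal.ofReal_ne_top] at key
  rw [← key]
  refine lintegral_mono_set ?_
  rintro _ ⟨y, hy, rfl⟩
  have := hK hx hy (sub_nonneg.2 ht1) ht0.le (by ring)
  convert this using 1
  module

/-! ### Approximation by affine functions on convex sets -/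

/-- Provides the integrability behind every exchange of integrals below: the function is bounded on
the compact product, which has finite measure. -/
lemma integrable_prod_of_continuous {X Y : Type*} [TopologicalSpace X] [TopologicalSpace Y]
    [MeasurableSpace X] [MeasurableSpace Y] [OpensMeasurableSpace X] [OpensMeasurableSpace Y]
    [SecondCountableTopology X] [T2Space X] [T2Space Y] [SecondCountableTopology Y]
    {μ : Measure X} {ν : Measure Y} [IsFiniteMeasureOnCompacts μ] [IsFiniteMeasureOnCompacts ν]
    [SFinite μ] [SFinite ν] {f : X × Y → ℝ} (hf : Continuous f) {K : Set X} {L : Set Y}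
    (hK : IsCompact K) (hL : IsCompact L) :
    Integrable f ((μ.restrict K).prod (ν.restrict L)) := by
  have : OpensMeasurableSpace (X × Y) := Prod.opensMeasurableSpace
  obtain ⟨C, hC⟩ := (hK.prod hL).exists_bound_of_continuousOn hf.continuousOn
  have : IsFiniteMeasure (μ.restrict K) := ⟨by simpa using hK.measure_lt_top⟩
  have : IsFiniteMeasure (ν.restrict L) := ⟨by simpa using hL.measure_lt_top⟩
  refine Integrable.of_bound hf.aestronglyMeasurable C ?_
  rw [Measure.prod_restrict]
  exact ae_restrict_of_forall_mem (hK.measurableSet.prod hL.measurableSet) hC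

section affine
variable {d : ℕ} {K : Set (Space d)} {w : Space d → ℝ}

lemma integral_homothety_le (hK : Convex ℝ K) (hc : IsCompact K) {x : Space d} (hx : x ∈ K)
    {t : ℝ} (ht0 : 0 < t) (ht1 : t ≤ 1) {g : Space d → ℝ} (hg : Continuous g)
    (hg0 : ∀ y, 0 ≤ g y) :
    t ^ d * ∫ y in K, g (x + t • (y - x)) ≤ ∫ y in K, g y := by
  have h := lintegral_homothety_le hK hc.measurableSet hx ht0 ht1 (fun y => ENNReal.ofReal (g y))
  have hg' : Continuous fun y => g (x + t • (y - x)) := by fun_prop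
  rw [← ofReal_integral_eq_lintegral_ofReal (hg'.continuousOn.integrableOn_compact hc)
      (Eventually.of_forall fun _ => hg0 _),
    ← ofReal_integral_eq_lintegral_ofReal (hg.continuousOn.integrableOn_compact hc)
      (Eventually.of_forall fun _ => hg0 _), ← ENNReal.ofReal_mul (by positivity)] at h
  exact (ENNReal.ofReal_le_ofReal_iff (integral_nonneg fun _ => hg0 _)).1 h

/-- Taylor's formula with integral remainder, after the substitution `t = s ^ 2`. -/
lemma taylor_remainder (hw : ContDiff ℝ ∞ w) (x y : Space d) :
    w x - w y - fderiv ℝ w y (x - y) =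
      ∫ s in (0:ℝ)..1, 2 * s ^ 3 * dderiv w (y - x) (x + s ^ 2 • (y - x)) := by
  set v := y - x with hv
  have hcont : Continuous fun s : ℝ => 2 * s ^ 3 * dderiv w v (x + s ^ 2 • v) := by
    have := continuous_dderiv hw v
    fun_prop
  -- The primitive of the remainder. The two terms with first derivatives cancel, and the
  -- substitution turns the weight `t dt` into `2 s³ ds`.
  have hd : ∀ s : ℝ, HasDerivAt
      (fun s : ℝ => s ^ 2 * fderiv ℝ w (x + s ^ 2 • v) v - w (x + s ^ 2 • v))
      (2 * s ^ 3 * dderiv w v (x + s ^ 2 • v)) s := by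
    intro s
    have hs : HasDerivAt (fun s : ℝ => s ^ 2) (2 * s) s := by simpa using hasDerivAt_pow 2 s
    have h1 := (hasDerivAt_line hw x v (s ^ 2)).comp s hs
    have h2 := (hasDerivAt_line_fderiv hw x v (s ^ 2)).comp s hs
    refine ((hs.mul h2).sub h1).congr_deriv ?_
    simp only [Function.comp]
    ring
  rw [intervalIntegral.integral_eq_sub_of_hasDerivAt (fun s _ => hd s)
    (hcont.intervalIntegrable _ _)]
  have e : fderiv ℝ w y (x - y) = - fderiv ℝ w y v := by rw [← map_neg, hv, neg_sub]
  have hxv : x + v = y := by simp [hv]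
  simp only [one_pow, one_smul, hxv, e]
  simp
  ring

/-- Squaring the remainder produces the weight `s⁶`, whereas the change of variables in `K` with
factor `s²` costs the Jacobian `s^(2d)`. The first is at most the second exactly when `d ≤ 3`, which
is where the dimension enters. Without the substitution `t = s²` the weight would be `t²` against
`t^d`, which is not enough for `d = 3`. -/
lemma remainder_sq_integral_le (hd : d ≤ 3) (hK : Convex ℝ K) (hc : IsCompact K) {x : Space d}
    (hx : x ∈ K) (hw : ContDiff ℝ ∞ w) :
    ∫ y in K, (w x - w y - fderiv ℝ w y (x - y)) ^ 2 ≤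
      4 * Metric.diam K ^ 4 * ∫ y in K, hessSq w y := by
  set D := Metric.diam K
  have hH := continuous_hessSq hw
  have hF : Continuous fun p : Space d × ℝ => p.2 ^ 6 * hessSq w (x + p.2 ^ 2 • (p.1 - x)) := by
    fun_prop
  have hpt : ∀ y ∈ K, (w x - w y - fderiv ℝ w y (x - y)) ^ 2 ≤
      4 * D ^ 4 * ∫ s in Set.Icc (0:ℝ) 1, s ^ 6 * hessSq w (x + s ^ 2 • (y - x)) := by
    intro y hy
    rw [taylor_remainder hw, integral_Icc_eq_integral_Ioc, ← intervalIntegral.integral_of_le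
      zero_le_one]
    have hcd := continuous_dderiv hw (y - x)
    refine (sq_intervalIntegral_le zero_le_one (by fun_prop)).trans ?_
    rw [sub_zero, one_mul, ← intervalIntegral.integral_const_mul]
    refine intervalIntegral.integral_mono_on zero_le_one
      (Continuous.intervalIntegrable (by fun_prop) _ _)
      (Continuous.intervalIntegrable (by fun_prop) _ _) fun s _ => ?_
    have h1 := dderiv_sq_le w (y - x) (x + s ^ 2 • (y - x))
    have h2 : ‖y - x‖ ≤ D := by
      rw [← dist_eq_norm]; exact Metric.dist_le_diam_of_mem hc.isBounded hy hx
    have h3 : ‖y - x‖ ^ 4 ≤ D ^ 4 := by gcongr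
    calc (2 * s ^ 3 * dderiv w (y - x) (x + s ^ 2 • (y - x))) ^ 2
        = 4 * s ^ 6 * dderiv w (y - x) (x + s ^ 2 • (y - x)) ^ 2 := by ring
      _ ≤ 4 * s ^ 6 * (‖y - x‖ ^ 4 * hessSq w (x + s ^ 2 • (y - x))) := by gcongr
      _ ≤ 4 * s ^ 6 * (D ^ 4 * hessSq w (x + s ^ 2 • (y - x))) := by
          have := hessSq_nonneg w (x + s ^ 2 • (y - x))
          gcongr
      _ = _ := by ring
  have hint := integrable_prod_of_continuous (μ := (volume : Measure (Space d)))
    (ν := (volume : Measure ℝ)) hF hc (isCompact_Icc (a := (0:ℝ)) (b := 1))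
  have hdw : Continuous fun y => fderiv ℝ w y := hw.continuous_fderiv (by simp)
  have hwc := hw.continuous
  have hR : Continuous fun y => (w x - w y - fderiv ℝ w y (x - y)) ^ 2 := by fun_prop
  calc ∫ y in K, (w x - w y - fderiv ℝ w y (x - y)) ^ 2
      ≤ ∫ y in K, 4 * D ^ 4 * ∫ s in Set.Icc (0:ℝ) 1, s ^ 6 * hessSq w (x + s ^ 2 • (y - x)) := by
        refine setIntegral_mono_on (hR.continuousOn.integrableOn_compact hc)
          ((hint.integral_prod_left).const_mul _) hc.measurableSet hpt
    _ = 4 * D ^ 4 * ∫ s in Set.Icc (0:ℝ) 1, ∫ y in K, s ^ 6 * hessSq w (x + s ^ 2 • (y - x)) := by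
        rw [integral_const_mul, integral_integral_swap hint]
    _ ≤ 4 * D ^ 4 * ∫ s in Set.Icc (0:ℝ) 1, ∫ y in K, hessSq w y := by
        have hI0 : 0 ≤ ∫ y in K, hessSq w y := integral_nonneg fun _ => hessSq_nonneg _ _
        gcongr 4 * D ^ 4 * ?_
        refine setIntegral_mono_on hint.integral_prod_right (by simp) measurableSet_Icc ?_
        intro s hs
        rw [integral_const_mul]
        rcases hs.1.eq_or_lt with h0 | h0
        · rw [← h0]; simpa using hI0
        have h1 := integral_homothety_le hK hc hx (t := s ^ 2) (by positivity)
          (pow_le_one₀ hs.1 hs.2) hH (hessSq_nonneg w)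
        refine le_trans ?_ h1
        have : 0 ≤ ∫ y in K, hessSq w (x + s ^ 2 • (y - x)) :=
          integral_nonneg fun _ => hessSq_nonneg _ _
        refine mul_le_mul_of_nonneg_right ?_ this
        rw [← pow_mul]
        exact pow_le_pow_of_le_one hs.1 hs.2 (by omega)
    _ = _ := by simp

/-- Stopping at the midpoint restricts the homothety factor to `[1/2, 1]`, so that its Jacobian is
at least `2^(-d)` and no singularity arises at `x`. In the constant, one factor `1/2` comes from
Cauchy–Schwarz on this interval and the other from integrating over it. -/
lemma sq_sub_midpoint_integral_le (hK : Convex ℝ K) (hc : IsCompact K) {x : Space d}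
    (hx : x ∈ K) (hw : ContDiff ℝ ∞ w) :
    ∫ y in K, (w y - w ((1 / 2 : ℝ) • (x + y))) ^ 2 ≤
      2 ^ d / 4 * Metric.diam K ^ 2 * ∫ y in K, gradSq w y := by
  set D := Metric.diam K
  have hH := continuous_gradSq hw
  have hF : Continuous fun p : Space d × ℝ => gradSq w (x + p.2 • (p.1 - x)) := by
    fun_prop
  have hpt : ∀ y ∈ K, (w y - w ((1 / 2 : ℝ) • (x + y))) ^ 2 ≤
      D ^ 2 / 2 * ∫ s in Set.Icc (1/2:ℝ) 1, gradSq w (x + s • (y - x)) := by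
    intro y hy
    have hdw : Continuous fun y => fderiv ℝ w y := hw.continuous_fderiv (by simp)
    have hcont : Continuous fun t : ℝ => fderiv ℝ w (x + t • (y - x)) (y - x) := by fun_prop
    have e : w y - w ((1 / 2 : ℝ) • (x + y)) =
        ∫ s in (1/2:ℝ)..1, fderiv ℝ w (x + s • (y - x)) (y - x) := by
      rw [intervalIntegral.integral_eq_sub_of_hasDerivAt
        (fun s _ => hasDerivAt_line hw x (y - x) s) (hcont.intervalIntegrable _ _)]
      congr 2
      · module
      · module
    rw [e, integral_Icc_eq_integral_Ioc, ← intervalIntegral.integral_of_le (by norm_num)]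
    refine (sq_intervalIntegral_le (by norm_num) hcont).trans ?_
    rw [← intervalIntegral.integral_const_mul, ← intervalIntegral.integral_const_mul]
    refine intervalIntegral.integral_mono_on (by norm_num)
      (Continuous.intervalIntegrable (by fun_prop) _ _)
      (Continuous.intervalIntegrable (by fun_prop) _ _) fun s _ => ?_
    have h1 := fderiv_sq_le w (x + s • (y - x)) (y - x)
    have h2 : ‖y - x‖ ≤ D := by
      rw [← dist_eq_norm]; exact Metric.dist_le_diam_of_mem hc.isBounded hy hx
    have h3 : ‖y - x‖ ^ 2 ≤ D ^ 2 := by gcongr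
    have h4 := gradSq_nonneg w (x + s • (y - x))
    nlinarith
  have hint := integrable_prod_of_continuous (μ := (volume : Measure (Space d)))
    (ν := (volume : Measure ℝ)) hF hc (isCompact_Icc (a := (1/2:ℝ)) (b := 1))
  have hwc := hw.continuous
  have hR : Continuous fun y => (w y - w ((1 / 2 : ℝ) • (x + y))) ^ 2 := by fun_prop
  have hI0 : 0 ≤ ∫ y in K, gradSq w y := integral_nonneg fun _ => gradSq_nonneg _ _
  calc ∫ y in K, (w y - w ((1 / 2 : ℝ) • (x + y))) ^ 2
      ≤ ∫ y in K, D ^ 2 / 2 * ∫ s in Set.Icc (1/2:ℝ) 1, gradSq w (x + s • (y - x)) := by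
        refine setIntegral_mono_on (hR.continuousOn.integrableOn_compact hc)
          ((hint.integral_prod_left).const_mul _) hc.measurableSet hpt
    _ = D ^ 2 / 2 * ∫ s in Set.Icc (1/2:ℝ) 1, ∫ y in K, gradSq w (x + s • (y - x)) := by
        rw [integral_const_mul, integral_integral_swap hint]
    _ ≤ D ^ 2 / 2 * ∫ s in Set.Icc (1/2:ℝ) 1, 2 ^ d * ∫ y in K, gradSq w y := by
        gcongr D ^ 2 / 2 * ?_
        refine setIntegral_mono_on hint.integral_prod_right
          (continuous_const.integrableOn_Icc) measurableSet_Icc ?_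
        intro s hs
        have hs0 : 0 < s := lt_of_lt_of_le (by norm_num) hs.1
        have h1 := integral_homothety_le hK hc hx hs0 hs.2 hH (gradSq_nonneg w)
        have h2 : 0 ≤ ∫ y in K, gradSq w (x + s • (y - x)) :=
          integral_nonneg fun _ => gradSq_nonneg _ _
        have h3 : 1 ≤ 2 ^ d * s ^ d := by
          rw [← mul_pow]; exact one_le_pow₀ (by linarith [hs.1])
        calc ∫ y in K, gradSq w (x + s • (y - x))
            ≤ (2 ^ d * s ^ d) * ∫ y in K, gradSq w (x + s • (y - x)) := le_mul_of_one_le_left h2 h3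
          _ = 2 ^ d * (s ^ d * ∫ y in K, gradSq w (x + s • (y - x))) := by ring
          _ ≤ _ := by gcongr
    _ = _ := by
        simp only [setIntegral_const, smul_eq_mul, measureReal_def, Real.volume_Icc]
        rw [ENNReal.toReal_ofReal (by norm_num)]
        ring

/-- The Poincaré inequality on compact convex sets. -/
lemma poincare (hK : Convex ℝ K) (hc : IsCompact K) (hv : 0 < volume.real K)
    (hw : ContDiff ℝ ∞ w) :
    ∫ x in K, (w x - (volume.real K)⁻¹ * ∫ y in K, w y) ^ 2 ≤
      2 ^ d * Metric.diam K ^ 2 * ∫ y in K, gradSq w y := by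
  set D := Metric.diam K
  set V := volume.real K with hV
  set I := ∫ y in K, gradSq w y
  have hwc := hw.continuous
  have : IsFiniteMeasure (volume.restrict K) := ⟨by simpa using hc.measure_lt_top⟩
  have ion : ∀ {g : Space d → ℝ}, Continuous g → Integrable g (volume.restrict K) :=
    fun hg => hg.continuousOn.integrableOn_compact hc
  let P : Space d × Space d → ℝ := fun p => (w p.2 - w ((1 / 2 : ℝ) • (p.1 + p.2))) ^ 2
  have hP : Continuous P := by fun_prop
  have hPint := integrable_prod_of_continuous (μ := (volume : Measure (Space d)))
    (ν := (volume : Measure (Space d))) hP hc hc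
  -- By Cauchy–Schwarz the deviation from the mean is bounded by the average of `(w x - w y)²`, and
  -- `w x - w y` is split at the midpoint of `x` and `y`. The two halves have the same double
  -- integral by symmetry, so the final constant is `4 * (2 ^ d / 4)`.
  have h1 : ∀ x, V * (w x - V⁻¹ * ∫ y in K, w y) ^ 2 ≤
      2 * (∫ y in K, P (x, y)) + 2 * ∫ y in K, P (y, x) := by
    intro x
    have hm : MemLp (fun y => w x - w y) 2 (volume.restrict K) :=
      (memLp_two_iff_integrable_sq (by fun_prop)).2 (ion (by fun_prop))
    have h := sq_integral_le hm
    have e : ∫ y in K, (w x - w y) = V * (w x - V⁻¹ * ∫ y in K, w y) := by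
      rw [integral_sub (integrable_const _) (ion hwc), mul_sub, ← mul_assoc,
        mul_inv_cancel₀ hv.ne']
      simp [hV]
    rw [e] at h
    have hu : (volume.restrict K).real Set.univ = V := by simp [hV, measureReal_def]
    rw [hu] at h
    have h' : V * (w x - V⁻¹ * ∫ y in K, w y) ^ 2 ≤ ∫ y in K, (w x - w y) ^ 2 := by
      have : V * (V * (w x - V⁻¹ * ∫ y in K, w y) ^ 2) ≤ V * ∫ y in K, (w x - w y) ^ 2 := by
        linarith [h]
      exact le_of_mul_le_mul_left this hv
    refine h'.trans ?_
    rw [← integral_const_mul, ← integral_const_mul, ← integral_add]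
    · refine integral_mono (ion (by fun_prop)) (ion (by fun_prop)) fun y => ?_
      simp only [P, add_comm y x]
      nlinarith [sq_nonneg ((w y - w ((1 / 2 : ℝ) • (x + y))) +
        (w x - w ((1 / 2 : ℝ) • (x + y))))]
    · exact ion (by fun_prop)
    · exact ion (by fun_prop)
  have h2 : ∫ x in K, ∫ y in K, P (x, y) ≤ V * (2 ^ d / 4 * D ^ 2 * I) := by
    have : ∫ x in K, ∫ y in K, P (x, y) ≤ ∫ x in K, 2 ^ d / 4 * D ^ 2 * I :=
      setIntegral_mono_on hPint.integral_prod_left (integrable_const _) hc.measurableSet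
        fun x hx => sq_sub_midpoint_integral_le hK hc hx hw
    simpa [hV] using this
  have h3 : ∫ x in K, ∫ y in K, P (y, x) = ∫ x in K, ∫ y in K, P (x, y) :=
    (integral_integral_swap (f := fun x y => P (x, y)) hPint).symm
  have h4 : ∫ x in K, V * (w x - V⁻¹ * ∫ y in K, w y) ^ 2 ≤
      ∫ x in K, (2 * (∫ y in K, P (x, y)) + 2 * ∫ y in K, P (y, x)) :=
    integral_mono (ion (by fun_prop))
      ((hPint.integral_prod_left.const_mul 2).add (hPint.integral_prod_right.const_mul 2)) h1
  rw [integral_const_mul, integral_add (hPint.integral_prod_left.const_mul 2)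
    (hPint.integral_prod_right.const_mul 2), integral_const_mul, integral_const_mul, h3] at h4
  have h5 : V * ∫ x in K, (w x - V⁻¹ * ∫ y in K, w y) ^ 2 ≤ V * (2 ^ d * D ^ 2 * I) := by
    linarith
  exact le_of_mul_le_mul_left h5 hv

/-- Bramble–Hilbert: approximation of a function by an affine one on a compact convex set. -/
theorem exists_affine_approx (hd : d ≤ 3) (hK : Convex ℝ K) (hc : IsCompact K)
    (hv : 0 < volume.real K) (hw : ContDiff ℝ ∞ w) :
    ∃ (c : ℝ) (g : Fin d → ℝ),
      (∀ x ∈ K, volume.real K * (w x - (c + ∑ i, g i * x i)) ^ 2 ≤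
        4 * Metric.diam K ^ 4 * ∫ y in K, hessSq w y) ∧
      ∫ x in K, ∑ i, (pderiv i w x - g i) ^ 2 ≤
        2 ^ d * Metric.diam K ^ 2 * ∫ y in K, hessSq w y := by
  set V := volume.real K with hV
  have hwc := hw.continuous
  have hdw : Continuous fun y => fderiv ℝ w y := hw.continuous_fderiv (by simp)
  have : IsFiniteMeasure (volume.restrict K) := ⟨by simpa using hc.measure_lt_top⟩
  have ion : ∀ {g : Space d → ℝ}, Continuous g → Integrable g (volume.restrict K) :=
    fun hg => hg.continuousOn.integrableOn_compact hc
  -- The affine function is the average over `y` of the first order Taylor polynomials `x ↦ w y +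
  -- Dw(y)(x - y)`. Its error at `x` is thus an average of Taylor remainders, and its gradient is
  -- the mean of the gradient of `w`, so that Poincaré applies to each partial derivative.
  refine ⟨V⁻¹ * ∫ y in K, (w y - fderiv ℝ w y y), fun i => V⁻¹ * ∫ y in K, pderiv i w y, ?_, ?_⟩
  · intro x hx
    refine le_trans ?_ (remainder_sq_integral_le hd hK hc hx hw)
    have hm : MemLp (fun y => w x - w y - fderiv ℝ w y (x - y)) 2 (volume.restrict K) :=
      (memLp_two_iff_integrable_sq (by fun_prop)).2 (ion (by fun_prop))
    have h := sq_integral_le hm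
    have e : ∫ y in K, (w x - w y - fderiv ℝ w y (x - y)) =
        V * (w x - (V⁻¹ * (∫ y in K, (w y - fderiv ℝ w y y)) +
          ∑ i, V⁻¹ * (∫ y in K, pderiv i w y) * x i)) := by
      have e1 : ∀ y, w x - w y - fderiv ℝ w y (x - y) =
          w x - ((w y - fderiv ℝ w y y) + ∑ i, x i * pderiv i w y) := by
        intro y
        rw [map_sub, fderiv_apply_eq w y x]
        ring
      simp_rw [e1]
      have i1 : Integrable (fun y => ∑ i, x i * pderiv i w y) (volume.restrict K) :=
        integrable_finsetSum _ fun i _ => (ion (continuous_pderiv hw i)).const_mul _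
      have i2 : Integrable (fun y => w y - fderiv ℝ w y y) (volume.restrict K) :=
        ion (by fun_prop)
      have i3 : Integrable (fun y => (w y - fderiv ℝ w y y) + ∑ i, x i * pderiv i w y)
        (volume.restrict K) := i2.add i1
      rw [integral_sub (integrable_const _) i3, integral_add i2 i1,
        integral_finsetSum _ fun i _ => (ion (continuous_pderiv hw i)).const_mul _]
      simp_rw [integral_const_mul]
      rw [mul_sub, mul_add, ← mul_assoc V V⁻¹, mul_inv_cancel₀ hv.ne', Finset.mul_sum]
      have : ∀ i, V * (V⁻¹ * (∫ y in K, pderiv i w y) * x i) = x i * ∫ y in K, pderiv i w y := by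
        intro i; field_simp
      simp_rw [this]
      simp [hV]
    rw [e] at h
    have hu : (volume.restrict K).real Set.univ = V := by simp [hV, measureReal_def]
    rw [hu] at h
    refine le_of_mul_le_mul_left ?_ hv
    refine le_trans (le_of_eq ?_) h
    ring
  · have : ∀ i, ∫ x in K, (pderiv i w x - V⁻¹ * ∫ y in K, pderiv i w y) ^ 2 ≤
        2 ^ d * Metric.diam K ^ 2 * ∫ y in K, gradSq (pderiv i w) y :=
      fun i => poincare hK hc hv (contDiff_pderiv hw i)
    have hc' := fun i => continuous_pderiv hw i
    have i1 : ∀ i ∈ Finset.univ, Integrable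
        (fun x => (pderiv i w x - V⁻¹ * ∫ y in K, pderiv i w y) ^ 2) (volume.restrict K) :=
      fun i _ => ion (((hc' i).sub continuous_const).pow 2)
    rw [integral_finsetSum _ i1]
    simp_rw [hessSq_eq]
    rw [integral_finsetSum _ fun i _ => ion (continuous_gradSq (contDiff_pderiv hw i)),
      Finset.mul_sum]
    exact Finset.sum_le_sum fun i _ => this i

/-- The Sobolev embedding of `H²` into the continuous functions in dimension at most three. -/
theorem sobolev_sup (hd : d ≤ 3) (hK : Convex ℝ K) (hc : IsCompact K)
    (hw : ContDiff ℝ ∞ w) {x : Space d} (hx : x ∈ K) :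
    volume.real K * w x ^ 2 ≤ 3 * (∫ y in K, w y ^ 2) +
      3 * Metric.diam K ^ 2 * (∫ y in K, gradSq w y) +
      12 * Metric.diam K ^ 4 * ∫ y in K, hessSq w y := by
  have h := remainder_sq_integral_le hd hK hc hx hw
  have hwc := hw.continuous
  have hg := continuous_gradSq hw
  have hdw : Continuous fun y => fderiv ℝ w y := hw.continuous_fderiv (by simp)
  have : IsFiniteMeasure (volume.restrict K) := ⟨by simpa using hc.measure_lt_top⟩
  have ion : ∀ {g : Space d → ℝ}, Continuous g → Integrable g (volume.restrict K) :=
    fun hg => hg.continuousOn.integrableOn_compact hc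
  -- The value `w x` is the sum of `w y`, the linear term and the Taylor remainder. The square of a
  -- sum of three terms costs the factor `3`, and the remainder estimate contributes the `4` in
  -- `12`.
  have key : ∫ y in K, w x ^ 2 ≤ ∫ y in K, ((3 * w y ^ 2 + 3 * Metric.diam K ^ 2 * gradSq w y) +
      3 * (w x - w y - fderiv ℝ w y (x - y)) ^ 2) := by
    refine setIntegral_mono_on (integrable_const _) (ion (by fun_prop)) hc.measurableSet ?_
    intro y hy
    have h1 := fderiv_sq_le w y (x - y)
    have h2 : ‖x - y‖ ≤ Metric.diam K := by
      rw [← dist_eq_norm]; exact Metric.dist_le_diam_of_mem hc.isBounded hx hy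
    have h3 : ‖x - y‖ ^ 2 ≤ Metric.diam K ^ 2 := by gcongr
    have h4 : fderiv ℝ w y (x - y) ^ 2 ≤ Metric.diam K ^ 2 * gradSq w y :=
      h1.trans (mul_le_mul_of_nonneg_right h3 (gradSq_nonneg w y))
    set p := w x; set q := w y; set r := fderiv ℝ w y (x - y)
    nlinarith [sq_nonneg (q - r), sq_nonneg (q - (p - q - r)), sq_nonneg (r - (p - q - r))]
  rw [integral_add (ion (by fun_prop)) (ion (by fun_prop)),
    integral_add (ion (by fun_prop)) (ion (by fun_prop)), integral_const_mul, integral_const_mul,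
    integral_const_mul] at key
  have e : ∫ y in K, w x ^ 2 = volume.real K * w x ^ 2 := by simp
  rw [e] at key
  linarith

end affine

/-! ### Convergence in the mean square -/

/-- Convergence in `L²(μ)`, for functions that are not necessarily in `L²(μ)` themselves. -/
def TendstoL2 {X : Type*} [MeasurableSpace X] (μ : Measure X) (f : ℕ → X → ℝ) (g : X → ℝ) : Prop :=
  Tendsto (fun n => eLpNorm (fun x => f n x - g x) 2 μ) atTop (𝓝 0)

section L2
variable {X : Type*} [MeasurableSpace X] {μ ν : Measure X} {f f' : ℕ → X → ℝ} {g g' h : X → ℝ}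

lemma eLpNorm_two_toReal_sq (hg : MemLp g 2 μ) : (eLpNorm g 2 μ).toReal ^ 2 = ∫ x, g x ^ 2 ∂μ := by
  rw [hg.eLpNorm_eq_integral_rpow_norm (by norm_num) (by norm_num)]
  have h0 : 0 ≤ ∫ x, ‖g x‖ ^ ((2 : ℝ≥0∞).toReal) ∂μ := integral_nonneg fun _ => by positivity
  rw [ENNReal.toReal_ofReal (by positivity), ← Real.rpow_natCast, ← Real.rpow_mul h0]
  simp

lemma tendsto_of_le_of_tendsto_zero {a b : ℕ → ℝ≥0∞} (hb : Tendsto b atTop (𝓝 0))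
    (h : ∀ n, a n ≤ b n) : Tendsto a atTop (𝓝 0) :=
  tendsto_of_tendsto_of_tendsto_of_le_of_le tendsto_const_nhds hb (fun _ => bot_le) h

namespace TendstoL2

lemma mono_measure (hf : TendstoL2 μ f g) (hν : ν ≤ μ) : TendstoL2 ν f g :=
  tendsto_of_le_of_tendsto_zero hf fun _ => eLpNorm_mono_measure _ hν

lemma congr (hf : TendstoL2 μ f g) (h1 : ∀ n, f n =ᵐ[μ] f' n) (h2 : g =ᵐ[μ] g') :
    TendstoL2 μ f' g' := by
  refine Tendsto.congr (fun n => ?_) hf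
  apply eLpNorm_congr_ae
  filter_upwards [h1 n, h2] with x a b
  rw [a, b]

lemma add (hf : TendstoL2 μ f g) (hf' : TendstoL2 μ f' g')
    (m1 : ∀ n, AEStronglyMeasurable (f n) μ) (m2 : AEStronglyMeasurable g μ)
    (m3 : ∀ n, AEStronglyMeasurable (f' n) μ) (m4 : AEStronglyMeasurable g' μ) :
    TendstoL2 μ (fun n x => f n x + f' n x) (fun x => g x + g' x) := by
  have hs : Tendsto (fun n => eLpNorm (fun x => f n x - g x) 2 μ +
      eLpNorm (fun x => f' n x - g' x) 2 μ) atTop (𝓝 0) := by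
    simpa using Tendsto.add hf hf'
  refine tendsto_of_le_of_tendsto_zero hs fun n => ?_
  refine le_trans (le_of_eq ?_) (eLpNorm_add_le ((m1 n).sub m2) ((m3 n).sub m4) (by norm_num))
  congr 1
  funext x
  simp only [Pi.add_apply]
  ring

lemma const_mul (hf : TendstoL2 μ f g) (c : ℝ) :
    TendstoL2 μ (fun n x => c * f n x) (fun x => c * g x) := by
  have h2 := ENNReal.Tendsto.const_mul hf (a := ‖c‖ₑ) (Or.inr enorm_ne_top)
  rw [mul_zero] at h2
  refine h2.congr (fun n => ?_)
  rw [← eLpNorm_const_smul]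
  congr 1
  funext x
  simp only [Pi.smul_apply, smul_eq_mul]
  ring

lemma sub (hf : TendstoL2 μ f g) (hf' : TendstoL2 μ f' g')
    (m1 : ∀ n, AEStronglyMeasurable (f n) μ) (m2 : AEStronglyMeasurable g μ)
    (m3 : ∀ n, AEStronglyMeasurable (f' n) μ) (m4 : AEStronglyMeasurable g' μ) :
    TendstoL2 μ (fun n x => f n x - f' n x) (fun x => g x - g' x) := by
  have := hf.add (hf'.const_mul (-1)) m1 m2 (fun n => (m3 n).const_mul _) (m4.const_mul _)
  simpa [sub_eq_add_neg] using this

lemma const (g : X → ℝ) : TendstoL2 μ (fun _ => g) g := by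
  simp [TendstoL2]

lemma of_tendstoUniformly_bound [IsFiniteMeasure μ] {ε : ℕ → ℝ} (hε : Tendsto ε atTop (𝓝 0))
    (h : ∀ n, ∀ᵐ x ∂μ, |f n x - g x| ≤ ε n) : TendstoL2 μ f g := by
  have h1 : Tendsto (fun n => μ Set.univ ^ ((2 : ℝ≥0∞).toReal⁻¹) * ENNReal.ofReal (ε n)) atTop
      (𝓝 0) := by
    have := ENNReal.Tendsto.const_mul (ENNReal.tendsto_ofReal hε)
      (a := μ Set.univ ^ ((2 : ℝ≥0∞).toReal⁻¹))
      (Or.inr (ENNReal.rpow_ne_top_of_nonneg (by positivity) (measure_ne_top _ _)))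
    simpa using this
  refine tendsto_of_le_of_tendsto_zero h1 fun n => ?_
  exact eLpNorm_le_of_ae_bound (h n)

lemma unique (hf : TendstoL2 μ f g) (hf' : TendstoL2 μ f g')
    (m1 : ∀ n, AEStronglyMeasurable (f n) μ) (m2 : AEStronglyMeasurable g μ)
    (m4 : AEStronglyMeasurable g' μ) : g =ᵐ[μ] g' := by
  have h1 := hf.sub hf' m1 m2 m1 m4
  have h2 : eLpNorm (fun x => g x - g' x) 2 μ = 0 := by
    have h3 : ∀ n : ℕ, eLpNorm (fun x => (f n x - f n x) - (g x - g' x)) 2 μ =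
        eLpNorm (fun x => g x - g' x) 2 μ := by
      intro n
      rw [← eLpNorm_neg]
      congr 1
      funext x
      simp
    exact tendsto_nhds_unique (tendsto_const_nhds.congr fun n => (h3 n).symm) h1
  filter_upwards [(eLpNorm_eq_zero_iff (m2.sub m4) (by norm_num)).1 h2] with x hx
  simpa [sub_eq_zero] using hx

lemma tendsto_eLpNorm (hf : TendstoL2 μ f g)
    (m1 : ∀ n, AEStronglyMeasurable (f n) μ) (m2 : AEStronglyMeasurable g μ) :
    Tendsto (fun n => eLpNorm (f n) 2 μ) atTop (𝓝 (eLpNorm g 2 μ)) := by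
  have u1 : ∀ n, eLpNorm (f n) 2 μ ≤ eLpNorm g 2 μ + eLpNorm (fun x => f n x - g x) 2 μ := by
    intro n
    refine le_trans (le_of_eq ?_) (eLpNorm_add_le m2 ((m1 n).sub m2) (by norm_num))
    congr 1; funext x; simp
  have u2 : ∀ n, eLpNorm g 2 μ - eLpNorm (fun x => f n x - g x) 2 μ ≤ eLpNorm (f n) 2 μ := by
    intro n
    rw [tsub_le_iff_right]
    refine le_trans (le_of_eq ?_) (eLpNorm_sub_le (m1 n) ((m1 n).sub m2) (by norm_num))
    congr 1; funext x; simp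
  refine tendsto_of_tendsto_of_tendsto_of_le_of_le ?_ ?_ u2 u1
  · have := ENNReal.Tendsto.sub (tendsto_const_nhds (x := eLpNorm g 2 μ)) hf (Or.inr (by simp))
    simpa using this
  · have := (tendsto_const_nhds (x := eLpNorm g 2 μ)).add hf
    simpa using this

lemma tendsto_integral_sq (hf : TendstoL2 μ f g) (h1 : ∀ n, MemLp (f n) 2 μ) (h2 : MemLp g 2 μ) :
    Tendsto (fun n => ∫ x, f n x ^ 2 ∂μ) atTop (𝓝 (∫ x, g x ^ 2 ∂μ)) := by
  have := hf.tendsto_eLpNorm (fun n => (h1 n).1) h2.1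
  have h3 := ((ENNReal.tendsto_toReal h2.2.ne).comp this).pow 2
  rw [eLpNorm_two_toReal_sq h2] at h3
  exact h3.congr fun n => eLpNorm_two_toReal_sq (h1 n)

lemma tendsto_integral_mul (hf : TendstoL2 μ f g) (h1 : ∀ n, MemLp (f n) 2 μ) (h2 : MemLp g 2 μ)
    (hh : MemLp h 2 μ) : Tendsto (fun n => ∫ x, f n x * h x ∂μ) atTop (𝓝 (∫ x, g x * h x ∂μ)) := by
  refine tendsto_integral_of_L1' _ (MemLp.integrable_mul h2 hh).1
    (Eventually.of_forall fun n => MemLp.integrable_mul (h1 n) hh) ?_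
  have h3 := ENNReal.Tendsto.mul_const hf (b := eLpNorm h 2 μ) (Or.inr hh.2.ne)
  rw [zero_mul] at h3
  refine tendsto_of_le_of_tendsto_zero h3 fun n => ?_
  refine le_trans (le_of_eq ?_) (eLpNorm_smul_le_mul_eLpNorm (p := 2) (q := 2) (r := 1)
    hh.1 ((h1 n).sub h2).1)
  congr 1
  funext x
  simp [sub_mul]

lemma exists_of_cauchy (h1 : ∀ n, MemLp (f n) 2 μ)
    (hc : ∀ ε : ℝ≥0∞, 0 < ε → ∃ N, ∀ n, N ≤ n → ∀ m, N ≤ m →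
      eLpNorm (fun x => f n x - f m x) 2 μ < ε) :
    ∃ g, MemLp g 2 μ ∧ TendstoL2 μ f g := by
  have hC : CauchySeq fun n => (h1 n).toLp (f n) := by
    rw [EMetric.cauchySeq_iff]
    intro ε hε
    obtain ⟨N, hN⟩ := hc ε hε
    refine ⟨N, fun n hn m hm => ?_⟩
    rw [Lp.edist_toLp_toLp]
    exact hN n hn m hm
  obtain ⟨G, hG⟩ := cauchySeq_tendsto_of_complete hC
  refine ⟨G, Lp.memLp G, ?_⟩
  rw [tendsto_iff_edist_tendsto_0] at hG
  refine hG.congr fun n => ?_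
  rw [Lp.edist_def]
  apply eLpNorm_congr_ae
  filter_upwards [(h1 n).coeFn_toLp] with x hx
  simp [hx]

end TendstoL2
end L2

/-! ### Weak derivatives -/

section weak
variable {d : ℕ} {U V : Set (Space d)} {i : Fin d} {v w g h φ : Space d → ℝ}

lemma IsTestFunction.pderiv (hφ : IsTestFunction U φ) (i : Fin d) :
    IsTestFunction U (pderiv i φ) :=
  ⟨contDiff_pderiv hφ.1 i, hφ.2.1.fderiv_apply ℝ _,
    (tsupport_fderiv_apply_subset ℝ _).trans hφ.2.2⟩

lemma IsTestFunction.mono (hφ : IsTestFunction U φ) (h : U ⊆ V) : IsTestFunction V φ :=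
  ⟨hφ.1, hφ.2.1, hφ.2.2.trans h⟩

lemma IsTestFunction.eq_zero (hφ : IsTestFunction U φ) {x : Space d} (hx : x ∉ U) : φ x = 0 :=
  image_eq_zero_of_notMem_tsupport fun h => hx (hφ.2.2 h)

lemma IsTestFunction.memLp (hφ : IsTestFunction U φ) (μ : Measure (Space d))
    [IsFiniteMeasureOnCompacts μ] : MemLp φ 2 μ :=
  hφ.1.continuous.memLp_of_hasCompactSupport hφ.2.1

lemma IsTestFunction.setIntegral_mul (hφ : IsTestFunction U φ) (v : Space d → ℝ) :
    ∫ x in U, v x * φ x = ∫ x, v x * φ x :=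
  setIntegral_eq_integral_of_forall_compl_eq_zero fun x hx => by simp [hφ.eq_zero hx]

lemma IsTestFunction.integrable_mul (hφ : IsTestFunction U φ) (hv : LocallyIntegrableOn v U) :
    Integrable fun x => v x * φ x := by
  have h1 : IntegrableOn v (tsupport φ) := hv.integrableOn_compact_subset hφ.2.2 hφ.2.1
  have h2 : IntegrableOn (fun x => v x * φ x) (tsupport φ) :=
    h1.mul_continuousOn hφ.1.continuous.continuousOn hφ.2.1
  refine (integrableOn_iff_integrable_of_support_subset ?_).1 h2
  exact (Function.support_mul_subset_right _ _).trans subset_closure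

lemma locallyIntegrableOn_of_memLp (hv : MemLp v 2 (volume.restrict U)) :
    LocallyIntegrableOn v U :=
  locallyIntegrableOn_of_locallyIntegrable_restrict (hv.locallyIntegrable (by norm_num))

namespace IsWeakDeriv

lemma integral_eq (hv : IsWeakDeriv U i v g) (hφ : IsTestFunction U φ) :
    ∫ x, v x * IsaacsFEM.pderiv i φ x = - ∫ x, g x * φ x := by
  rw [← (hφ.pderiv i).setIntegral_mul, ← hφ.setIntegral_mul]
  exact hv.2.2 φ hφ

/-- The fundamental lemma of the calculus of variations, applied to `g - h`. -/
lemma ae_eq (hU : IsOpen U) (hg : IsWeakDeriv U i v g) (hh : IsWeakDeriv U i v h) :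
    g =ᵐ[volume.restrict U] h := by
  have key := hU.ae_eq_zero_of_integral_contDiff_smul_eq_zero (hg.2.1.sub hh.2.1) (by
    intro φ h1 h2 h3
    have hφ : IsTestFunction U φ := ⟨h1, h2, h3⟩
    have e : ∀ x, φ x • (g - h) x = g x * φ x - h x * φ x := fun x => by
      simp only [Pi.sub_apply, smul_eq_mul]; ring
    simp_rw [e]
    rw [integral_sub (hφ.integrable_mul hg.2.1) (hφ.integrable_mul hh.2.1)]
    have := hg.integral_eq hφ
    have := hh.integral_eq hφ
    linarith)
  rw [Filter.EventuallyEq, ae_restrict_iff' hU.measurableSet]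
  filter_upwards [key] with x hx hxU
  have := hx hxU
  simpa [sub_eq_zero] using this

lemma mono (hg : IsWeakDeriv U i v g) (h : V ⊆ U) : IsWeakDeriv V i v g := by
  refine ⟨hg.1.mono_set h, hg.2.1.mono_set h, fun φ hφ => ?_⟩
  rw [(hφ.pderiv i).setIntegral_mul, hφ.setIntegral_mul]
  exact hg.integral_eq (hφ.mono h)

lemma congr (hg : IsWeakDeriv U i v g) (h1 : v =ᵐ[volume.restrict U] w)
    (h2 : g =ᵐ[volume.restrict U] h) : IsWeakDeriv U i w h := by
  refine ⟨hg.1.congr h1, hg.2.1.congr h2, fun φ hφ => ?_⟩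
  have e1 : ∫ x in U, w x * IsaacsFEM.pderiv i φ x = ∫ x in U, v x * IsaacsFEM.pderiv i φ x := by
    apply integral_congr_ae
    filter_upwards [h1] with x hx
    rw [hx]
  have e2 : ∫ x in U, h x * φ x = ∫ x in U, g x * φ x := by
    apply integral_congr_ae
    filter_upwards [h2] with x hx
    rw [hx]
  rw [e1, e2]
  exact hg.2.2 φ hφ

lemma sub (hg : IsWeakDeriv U i v g) (hh : IsWeakDeriv U i w h) :
    IsWeakDeriv U i (fun x => v x - w x) (fun x => g x - h x) := by
  refine ⟨hg.1.sub hh.1, hg.2.1.sub hh.2.1, fun φ hφ => ?_⟩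
  rw [(hφ.pderiv i).setIntegral_mul, hφ.setIntegral_mul]
  simp_rw [sub_mul]
  rw [integral_sub ((hφ.pderiv i).integrable_mul hg.1) ((hφ.pderiv i).integrable_mul hh.1),
    integral_sub (hφ.integrable_mul hg.2.1) (hφ.integrable_mul hh.2.1), hg.integral_eq hφ,
    hh.integral_eq hφ]
  ring

lemma of_contDiff (hψ : ContDiff ℝ ∞ v) (i : Fin d) : IsWeakDeriv U i v (IsaacsFEM.pderiv i v) := by
  have hl : ∀ {u : Space d → ℝ}, Continuous u → LocallyIntegrableOn u U := fun hu =>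
    hu.locallyIntegrable.locallyIntegrableOn U
  refine ⟨hl hψ.continuous, hl (continuous_pderiv hψ i), fun φ hφ => ?_⟩
  rw [(hφ.pderiv i).setIntegral_mul, hφ.setIntegral_mul]
  refine integral_mul_fderiv_eq_neg_fderiv_mul_of_integrable ?_ ?_ ?_ ?_ ?_
  · exact hφ.integrable_mul (hl (continuous_pderiv hψ i))
  · exact (hφ.pderiv i).integrable_mul (hl hψ.continuous)
  · exact hφ.integrable_mul (hl hψ.continuous)
  · exact fun x _ => hψ.differentiable (by simp) x
  · exact fun x _ => hφ.1.differentiable (by simp) x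

lemma of_tendsto {vn gn : ℕ → Space d → ℝ} (hn : ∀ n, IsWeakDeriv U i (vn n) (gn n))
    (hv : TendstoL2 (volume.restrict U) vn v) (hg : TendstoL2 (volume.restrict U) gn g)
    (m1 : ∀ n, MemLp (vn n) 2 (volume.restrict U)) (m2 : ∀ n, MemLp (gn n) 2 (volume.restrict U))
    (m3 : MemLp v 2 (volume.restrict U)) (m4 : MemLp g 2 (volume.restrict U)) :
    IsWeakDeriv U i v g := by
  refine ⟨locallyIntegrableOn_of_memLp m3, locallyIntegrableOn_of_memLp m4, fun φ hφ => ?_⟩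
  have t1 := hv.tendsto_integral_mul m1 m3 ((hφ.pderiv i).memLp _)
  have t2 := (hg.tendsto_integral_mul m2 m4 (hφ.memLp _)).neg
  exact tendsto_nhds_unique t1 (t2.congr fun n => ((hn n).2.2 φ hφ).symm)

end IsWeakDeriv

lemma weakDeriv_spec (h : ∃ g, IsWeakDeriv U i v g) : IsWeakDeriv U i v (weakDeriv U i v) := by
  rw [weakDeriv, dif_pos h]
  exact h.choose_spec

lemma weakDeriv_ae_eq (hU : IsOpen U) (hg : IsWeakDeriv U i v g) :
    weakDeriv U i v =ᵐ[volume.restrict U] g :=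
  (weakDeriv_spec ⟨g, hg⟩).ae_eq hU hg

/-- The restriction of a test function to one of finitely many disjoint open sets. -/
lemma IsTestFunction.indicator {ι : Type*} {s : Finset ι} {W : ι → Set (Space d)}
    (hW : ∀ k ∈ s, IsOpen (W k)) (hdis : (s : Set ι).PairwiseDisjoint W)
    (hφ : IsTestFunction (⋃ k ∈ s, W k) φ) {k : ι} (hk : k ∈ s) :
    IsTestFunction (W k) ((W k).indicator φ) := by
  classical
  -- By disjointness, intersecting the support with `W k` is the same as removing the other open
  -- sets. So the intersection is closed, hence compact, although `W k` is open.
  have hcl : tsupport φ ∩ W k = tsupport φ \ ⋃ l ∈ s.erase k, W l := by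
    ext x
    simp only [Set.mem_inter_iff, Set.mem_sdiff, Set.mem_iUnion, Finset.mem_erase, not_exists]
    refine and_congr_right fun hx => ⟨fun hxk l hl hxl => ?_, fun hall => ?_⟩
    · exact Set.disjoint_left.1 (hdis (Finset.mem_coe.2 hl.2) (Finset.mem_coe.2 hk) hl.1) hxl hxk
    · obtain ⟨l, hl, hxl⟩ := Set.mem_iUnion₂.1 (hφ.2.2 hx)
      by_cases h : l = k
      · rwa [← h]
      · exact absurd hxl (hall l ⟨h, hl⟩)
  have hop : IsOpen (⋃ l ∈ s.erase k, W l) :=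
    isOpen_biUnion fun l hl => hW l (Finset.mem_of_mem_erase hl)
  have hcomp : IsCompact (tsupport φ ∩ W k) := by
    rw [hcl]; exact IsCompact.diff hφ.2.1 hop
  have hsub : tsupport ((W k).indicator φ) ⊆ tsupport φ ∩ W k := by
    refine closure_minimal ?_ hcomp.isClosed
    intro x hx
    rw [Function.mem_support, Set.indicator_apply_ne_zero] at hx
    exact ⟨subset_closure hx.2, hx.1⟩
  refine ⟨?_, hcomp.of_isClosed_subset (isClosed_tsupport _) hsub,
    hsub.trans Set.inter_subset_right⟩
  rw [contDiff_iff_contDiffAt]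
  intro x
  by_cases hx : x ∈ tsupport φ ∩ W k
  · refine (hφ.1.contDiffAt (x := x)).congr_of_eventuallyEq ?_
    filter_upwards [(hW k hk).mem_nhds hx.2] with y hy
    exact Set.indicator_of_mem hy φ
  · refine (contDiffAt_const (c := (0 : ℝ))).congr_of_eventuallyEq ?_
    filter_upwards [hcomp.isClosed.isOpen_compl.mem_nhds hx] with y hy
    by_contra hne
    exact hy (hsub (subset_closure hne))

/-- Weak derivatives on finitely many disjoint open sets are a weak derivative on the union. -/
lemma exists_isWeakDeriv_biUnion {ι : Type*} {s : Finset ι} {W : ι → Set (Space d)}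
    (hW : ∀ k ∈ s, IsOpen (W k)) (hdis : (s : Set ι).PairwiseDisjoint W)
    (hv : ∀ k ∈ s, ∃ g, IsWeakDeriv (W k) i v g) : ∃ g, IsWeakDeriv (⋃ k ∈ s, W k) i v g := by
  classical
  choose! G hG using hv
  let g : Space d → ℝ := fun x => ∑ k ∈ s, (W k).indicator (G k) x
  have hgk : ∀ k ∈ s, ∀ x ∈ W k, g x = G k x := by
    intro k hk x hx
    simp only [g]
    rw [Finset.sum_eq_single_of_mem k hk, Set.indicator_of_mem hx]
    intro l hl hlk
    refine Set.indicator_of_notMem (fun hxl => ?_) _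
    exact Set.disjoint_left.1 (hdis (Finset.mem_coe.2 hl) (Finset.mem_coe.2 hk) hlk) hxl hx
  have hloc : ∀ u : Space d → ℝ, (∀ k ∈ s, LocallyIntegrableOn u (W k)) →
      LocallyIntegrableOn u (⋃ k ∈ s, W k) := by
    intro u hu x hx
    obtain ⟨k, hk, hxk⟩ := Set.mem_iUnion₂.1 hx
    have h1 := hu k hk x hxk
    rw [(hW k hk).nhdsWithin_eq hxk] at h1
    exact h1.filter_mono nhdsWithin_le_nhds
  have hvl := hloc v fun k hk => (hG k hk).1
  have hgl := hloc g fun k hk => (hG k hk).2.1.congr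
    (ae_restrict_of_forall_mem (hW k hk).measurableSet fun x hx => (hgk k hk x hx).symm)
  refine ⟨g, hvl, hgl, fun φ hφ => ?_⟩
  rw [integral_biUnion_finset s (fun k hk => (hW k hk).measurableSet) hdis
      fun k _ => ((hφ.pderiv i).integrable_mul hvl).integrableOn,
    integral_biUnion_finset s (fun k hk => (hW k hk).measurableSet) hdis
      fun k _ => (hφ.integrable_mul hgl).integrableOn, ← Finset.sum_neg_distrib]
  refine Finset.sum_congr rfl fun k hk => ?_
  -- The piece of the test function that lives on `W k` is again a test function there, and agrees
  -- with `φ` to all orders on `W k`.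
  have hφk := hφ.indicator hW hdis hk
  have e := (hG k hk).2.2 _ hφk
  have e1 : ∫ x in W k, v x * pderiv i ((W k).indicator φ) x = ∫ x in W k, v x * pderiv i φ x := by
    refine setIntegral_congr_fun (hW k hk).measurableSet fun x hx => ?_
    have : (W k).indicator φ =ᶠ[𝓝 x] φ := by
      filter_upwards [(hW k hk).mem_nhds hx] with y hy
      exact Set.indicator_of_mem hy φ
    simp only [pderiv, this.fderiv_eq]
  have e2 : ∫ x in W k, G k x * (W k).indicator φ x = ∫ x in W k, g x * φ x := by
    refine setIntegral_congr_fun (hW k hk).measurableSet fun x hx => ?_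
    simp only [Set.indicator_of_mem hx, hgk k hk x hx]
  rw [← e1, e, e2]

end weak

/-! ### Mollification and dilation -/

section mollify
variable {d : ℕ} {φ : ContDiffBump (0 : Space d)} {g h v : Space d → ℝ}

/-- The convolution of `g` with a normalized bump function. -/
def moll (φ : ContDiffBump (0 : Space d)) (g : Space d → ℝ) (x : Space d) : ℝ :=
  ∫ t, g t * φ.normed volume (x - t)

lemma moll_eq (φ : ContDiffBump (0 : Space d)) (g : Space d → ℝ) :
    moll φ g = convolution g (φ.normed volume) (ContinuousLinearMap.mul ℝ ℝ) volume := rfl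

lemma contDiff_moll (hg : LocallyIntegrable g) : ContDiff ℝ ∞ (moll φ g) := by
  rw [moll_eq]
  exact HasCompactSupport.contDiff_convolution_right _ φ.hasCompactSupport_normed hg
    φ.contDiff_normed

lemma contDiff_kernel (φ : ContDiffBump (0 : Space d)) (x : Space d) :
    ContDiff ℝ ∞ (fun t => φ.normed volume (x - t)) :=
  φ.contDiff_normed.comp (contDiff_const.sub contDiff_id)

lemma tsupport_kernel (φ : ContDiffBump (0 : Space d)) (x : Space d) :
    tsupport (fun t => φ.normed volume (x - t)) ⊆ Metric.closedBall x φ.rOut := by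
  refine closure_minimal (fun t ht => ?_) Metric.isClosed_closedBall
  have : x - t ∈ Function.support (φ.normed (volume : Measure (Space d))) := ht
  rw [φ.support_normed_eq] at this
  rw [Metric.mem_closedBall, dist_comm, dist_eq_norm]
  simpa using (mem_ball_zero_iff.1 this).le

lemma kernel_eq_zero (φ : ContDiffBump (0 : Space d)) {x t : Space d} (h : φ.rOut < dist t x) :
    φ.normed volume (x - t) = 0 :=
  image_eq_zero_of_notMem_tsupport (f := fun t => φ.normed volume (x - t))
    fun hm => h.not_ge (tsupport_kernel φ x hm)

lemma isTestFunction_kernel (φ : ContDiffBump (0 : Space d)) {x : Space d} {U : Set (Space d)}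
    (hU : Metric.closedBall x φ.rOut ⊆ U) :
    IsTestFunction U (fun t => φ.normed volume (x - t)) :=
  ⟨contDiff_kernel φ x, (isCompact_closedBall x φ.rOut).of_isClosed_subset (isClosed_tsupport _)
    (tsupport_kernel φ x), (tsupport_kernel φ x).trans hU⟩

lemma integral_kernel (φ : ContDiffBump (0 : Space d)) (x : Space d) :
    ∫ t, φ.normed volume (x - t) = 1 := by
  rw [integral_sub_left_eq_self (fun t => φ.normed volume t) volume x]
  exact φ.integral_normed

lemma integrable_mul_kernel (hg : LocallyIntegrable g) (x : Space d) :
    Integrable fun t => g t * φ.normed volume (x - t) :=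
  (isTestFunction_kernel φ (Set.subset_univ _)).integrable_mul
    (locallyIntegrableOn_univ.2 hg)

lemma moll_sub (hg : LocallyIntegrable g) (hh : LocallyIntegrable h) (x : Space d) :
    moll φ (fun t => g t - h t) x = moll φ g x - moll φ h x := by
  simp only [moll, sub_mul]
  exact integral_sub (integrable_mul_kernel hg x) (integrable_mul_kernel hh x)

/-- Jensen's inequality for the probability density `t ↦ φ(x - t)`, obtained from the nonnegativity
of the variance about the mean `c`. -/
lemma moll_sq_le (hg : MemLp g 2 (volume : Measure (Space d))) (x : Space d) :
    moll φ g x ^ 2 ≤ ∫ t, g t ^ 2 * φ.normed volume (x - t) := by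
  have hgl : LocallyIntegrable g := hg.locallyIntegrable (by norm_num)
  have hg2 : LocallyIntegrable (fun t => g t ^ 2) := hg.integrable_sq.locallyIntegrable
  set c := moll φ g x with hc
  have h0 : 0 ≤ ∫ t, (g t - c) ^ 2 * φ.normed volume (x - t) :=
    integral_nonneg fun t => mul_nonneg (sq_nonneg _) (φ.nonneg_normed _)
  have i1 := integrable_mul_kernel (φ := φ) hg2 x
  have i2 := (integrable_mul_kernel (φ := φ) hgl x).const_mul (2 * c)
  have i3 : Integrable fun t => c ^ 2 * φ.normed volume (x - t) :=
    integrable_mul_kernel (g := fun _ => c ^ 2) (locallyIntegrable_const _) x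
  have e : ∀ t, (g t - c) ^ 2 * φ.normed volume (x - t) = (g t ^ 2 * φ.normed volume (x - t) -
      2 * c * (g t * φ.normed volume (x - t))) + c ^ 2 * φ.normed volume (x - t) := fun t => by ring
  have i12 : Integrable fun t => g t ^ 2 * φ.normed volume (x - t) -
      2 * c * (g t * φ.normed volume (x - t)) := i1.sub i2
  simp_rw [e] at h0
  rw [integral_add i12 i3, integral_sub i1 i2, integral_const_mul, integral_const_mul,
    integral_kernel] at h0
  have : ∫ t, g t * φ.normed volume (x - t) = c := rfl
  rw [this] at h0
  linarith

/-- Integrating the pointwise Jensen inequality in `x` and using that the kernel has mass one shows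
that mollification is a contraction of `L²`. -/
lemma moll_memLp (hg : MemLp g 2 (volume : Measure (Space d))) :
    MemLp (moll φ g) 2 volume ∧ eLpNorm (moll φ g) 2 volume ≤ eLpNorm g 2 volume := by
  have hgl : LocallyIntegrable g := hg.locallyIntegrable (by norm_num)
  have hκ : Integrable (φ.normed (volume : Measure (Space d))) :=
    φ.continuous_normed.integrable_of_hasCompactSupport φ.hasCompactSupport_normed
  have hc : Integrable (fun x => ∫ t, g t ^ 2 * φ.normed volume (x - t)) :=
    Integrable.integrable_convolution (ContinuousLinearMap.mul ℝ ℝ) hg.integrable_sq hκ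
  have hce : ∫ x, ∫ t, g t ^ 2 * φ.normed volume (x - t) = ∫ t, g t ^ 2 := by
    have := integral_convolution (ContinuousLinearMap.mul ℝ ℝ) (μ := (volume : Measure (Space d)))
      (ν := (volume : Measure (Space d))) hg.integrable_sq hκ
    rw [φ.integral_normed] at this
    simpa [convolution_def] using this
  have hcont := (contDiff_moll (φ := φ) hgl).continuous
  have hm : MemLp (moll φ g) 2 volume := by
    refine (memLp_two_iff_integrable_sq hcont.aestronglyMeasurable).2 ?_
    refine hc.mono' (hcont.pow 2).aestronglyMeasurable (Eventually.of_forall fun x => ?_)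
    rw [Real.norm_of_nonneg (sq_nonneg _)]
    exact moll_sq_le hg x
  refine ⟨hm, ?_⟩
  rw [← ENNReal.toReal_le_toReal hm.2.ne hg.2.ne]
  refine le_of_sq_le_sq ?_ ENNReal.toReal_nonneg
  rw [eLpNorm_two_toReal_sq hm, eLpNorm_two_toReal_sq hg, ← hce]
  exact integral_mono hm.integrable_sq hc fun x => moll_sq_le hg x

lemma abs_moll_sub_le (hg : Continuous g) {x : Space d} {ε : ℝ}
    (hε : ∀ t, dist t x ≤ φ.rOut → |g t - g x| ≤ ε) : |moll φ g x - g x| ≤ ε := by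
  have hgl : LocallyIntegrable g := hg.locallyIntegrable
  have e : moll φ g x - g x = ∫ t, (g t - g x) * φ.normed volume (x - t) := by
    have := moll_sub (φ := φ) hgl (locallyIntegrable_const (g x)) x
    have h2 : moll φ (fun _ => g x) x = g x := by
      simp only [moll]; rw [integral_const_mul, integral_kernel, mul_one]
    rw [h2] at this
    exact this.symm
  have i3 : Integrable fun t => ε * φ.normed volume (x - t) :=
    integrable_mul_kernel (g := fun _ => ε) (locallyIntegrable_const _) x
  rw [e, ← Real.norm_eq_abs]
  refine (norm_integral_le_of_norm_le i3 (Eventually.of_forall fun t => ?_)).trans ?_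
  · rw [norm_mul, Real.norm_of_nonneg (φ.nonneg_normed _), Real.norm_eq_abs]
    by_cases ht : dist t x ≤ φ.rOut
    · exact mul_le_mul_of_nonneg_right (hε t ht) (φ.nonneg_normed _)
    · rw [kernel_eq_zero φ (not_le.1 ht)]; simp
  · rw [integral_const_mul, integral_kernel, mul_one]

/-- When the ball around `x` is contained in `U`, the kernel centred at `x` is itself a test
function on `U`. The derivative can then be moved from the kernel to the function by the definition
of the weak derivative, and the extension by zero outside `U` plays no role. -/
lemma pderiv_moll {U : Set (Space d)} {i : Fin d} (hU : IsOpen U)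
    (hv : IsWeakDeriv U i v g) (hvU : MemLp v 2 (volume.restrict U)) {x : Space d}
    (hx : Metric.closedBall x φ.rOut ⊆ U) :
    pderiv i (moll φ (U.indicator v)) x = moll φ (U.indicator g) x := by
  have hvm : MemLp (U.indicator v) 2 volume := (memLp_indicator_iff_restrict hU.measurableSet).2 hvU
  have hvl : LocallyIntegrable (U.indicator v) := hvm.locallyIntegrable (by norm_num)
  have h1 := HasCompactSupport.hasFDerivAt_convolution_right (ContinuousLinearMap.mul ℝ ℝ)
    (μ := (volume : Measure (Space d))) φ.hasCompactSupport_normed hvl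
    (φ.contDiff_normed (n := 1) (μ := volume)) x
  have h2 := convolution_precompR_apply (𝕜 := ℝ) (ContinuousLinearMap.mul ℝ ℝ) hvl
    ((φ.hasCompactSupport_normed (μ := volume)).fderiv ℝ)
    ((φ.contDiff_normed (n := 1) (μ := volume)).continuous_fderiv (by simp)) x
    (EuclideanSpace.single i (1 : ℝ))
  rw [pderiv, moll_eq, h1.fderiv, h2]
  have hθ := isTestFunction_kernel φ hx
  have hd : ∀ t, pderiv i (fun t => φ.normed volume (x - t)) t =
      - fderiv ℝ (φ.normed (volume : Measure (Space d))) (x - t) (EuclideanSpace.single i 1) := by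
    intro t
    have a1 : HasFDerivAt (fun t : Space d => x - t) (-ContinuousLinearMap.id ℝ (Space d)) t :=
      (hasFDerivAt_id t).const_sub x
    have a2 : DifferentiableAt ℝ (φ.normed (volume : Measure (Space d))) (x - t) :=
      (φ.contDiff_normed (n := 1)).differentiable (by simp) _
    have a3 := a2.hasFDerivAt.comp t a1
    have a4 : fderiv ℝ (fun t => φ.normed (volume : Measure (Space d)) (x - t)) t = _ := a3.fderiv
    rw [pderiv, a4]
    simp
  have h3 := hv.integral_eq hθ
  have e1 : ∀ t, U.indicator v t * fderiv ℝ (φ.normed (volume : Measure (Space d))) (x - t)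
      (EuclideanSpace.single i 1) = - (v t * pderiv i (fun t => φ.normed volume (x - t)) t) := by
    intro t
    by_cases ht : t ∈ U
    · rw [Set.indicator_of_mem ht, hd]; ring
    · rw [Set.indicator_of_notMem ht, (hθ.pderiv i).eq_zero ht]; simp
  have e2 : ∀ t, U.indicator g t * φ.normed volume (x - t) = g t * φ.normed volume (x - t) := by
    intro t
    by_cases ht : t ∈ U
    · rw [Set.indicator_of_mem ht]
    · rw [Set.indicator_of_notMem ht, hθ.eq_zero ht]; simp
  simp only [convolution_def, moll, ContinuousLinearMap.mul_apply']
  simp_rw [e1, e2]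
  rw [integral_neg, h3, neg_neg]

/-- The dilation with centre `x₀` and factor `t`. -/
def dil (x₀ : Space d) (t : ℝ) (x : Space d) : Space d := x₀ + t • (x - x₀)

lemma contDiff_dil (x₀ : Space d) (t : ℝ) : ContDiff ℝ ∞ (dil x₀ t) := by
  unfold dil; fun_prop

lemma map_dil (x₀ : Space d) {t : ℝ} (ht : t ≠ 0) :
    (volume : Measure (Space d)).map (dil x₀ t) = ENNReal.ofReal |(t ^ d)⁻¹| • volume := by
  have e : dil x₀ t = (fun x => x₀ + x) ∘ (fun x => t • x) ∘ fun x => x - x₀ := rfl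
  rw [e, ← Measure.map_map (by fun_prop) (by fun_prop), ← Measure.map_map (by fun_prop)
    (by fun_prop), (measurePreserving_sub_right volume x₀).map_eq, Measure.map_addHaar_smul _ ht,
    Measure.map_smul, (measurePreserving_add_left volume x₀).map_eq]
  simp

/-- The point is that the bound is uniform in `t ≥ 1/2`, as needed for a density argument. The
Jacobian factor `t^(-d) ≤ 2^d` appears with a square root because of the exponent `2`. -/
lemma eLpNorm_comp_dil_le (x₀ : Space d) {t : ℝ} (ht : 1 / 2 ≤ t)
    (hg : AEStronglyMeasurable g volume) :
    AEStronglyMeasurable (g ∘ dil x₀ t) volume ∧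
    eLpNorm (g ∘ dil x₀ t) 2 volume ≤ ENNReal.ofReal (2 ^ d) ^ (1 / 2 : ℝ) * eLpNorm g 2 volume := by
  have ht0 : 0 < t := by linarith
  have hm := map_dil x₀ ht0.ne'
  have hD : Measurable (dil x₀ t) := (contDiff_dil x₀ t).continuous.measurable
  have hg' : AEStronglyMeasurable g (volume.map (dil x₀ t)) := by
    rw [hm]; exact hg.mono_ac (Measure.AbsolutelyContinuous.smul_left (by rfl) _)
  refine ⟨hg'.comp_measurable hD, ?_⟩
  rw [← eLpNorm_map_measure hg' hD.aemeasurable, hm,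
    eLpNorm_smul_measure_of_ne_top (by norm_num), smul_eq_mul]
  have h2 : ((1 : ℝ≥0∞) / 2).toReal = 1 / 2 := by simp
  rw [h2]
  gcongr
  rw [abs_of_pos (by positivity), ← inv_pow]
  gcongr
  rw [inv_le_comm₀ ht0 (by norm_num)]
  linarith

/-- The operators are bounded on `L²` uniformly in `n`, so it suffices to treat the dense class of
continuous functions with compact support. For these the convergence is uniform and takes place in a
fixed ball. -/
theorem tendstoL2_moll_dil (x₀ : Space d) {φ : ℕ → ContDiffBump (0 : Space d)} {t : ℕ → ℝ}
    (hφ : Tendsto (fun n => (φ n).rOut) atTop (𝓝 0)) (ht : Tendsto t atTop (𝓝 1))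
    (ht2 : ∀ n, 1 / 2 ≤ t n) (hg : MemLp g 2 (volume : Measure (Space d))) :
    TendstoL2 volume (fun n x => moll (φ n) g (dil x₀ (t n) x)) g := by
  set C : ℝ≥0∞ := ENNReal.ofReal (2 ^ d) ^ (1 / 2 : ℝ) with hC
  have hCtop : C ≠ ⊤ := ENNReal.rpow_ne_top_of_nonneg (by positivity) ENNReal.ofReal_ne_top
  have hgl : LocallyIntegrable g := hg.locallyIntegrable (by norm_num)
  -- the case of continuous functions with compact support
  have key : ∀ h : Space d → ℝ, Continuous h → HasCompactSupport h →
      TendstoL2 volume (fun n x => moll (φ n) h (dil x₀ (t n) x)) h := by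
    intro h hh hs
    obtain ⟨R, hR⟩ := hs.isBounded.subset_closedBall x₀
    -- The dilation factor is at least `1/2`, so points outside of this ball are mapped to distance
    -- more than `|R| + 1` from `x₀`. A kernel of radius less than `1` centred there does not meet
    -- the support of `h`.
    set B := Metric.closedBall x₀ (2 * (|R| + 1)) with hB
    have hRn : R ≤ |R| := le_abs_self R
    have hzero : ∀ y, R < dist y x₀ → h y = 0 := fun y hy =>
      image_eq_zero_of_notMem_tsupport fun hm => hy.not_ge (hR hm)
    have hfin : IsFiniteMeasure (volume.restrict B) :=
      ⟨by simpa using (isCompact_closedBall x₀ _).measure_lt_top⟩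
    have huc : UniformContinuous h := hh.uniformContinuous_of_tendsto_cocompact
      (hs.is_zero_at_infty)
    rw [Metric.uniformContinuous_iff] at huc
    rw [TendstoL2, ENNReal.tendsto_nhds_zero]
    intro ε hε
    set M : ℝ≥0∞ := (volume.restrict B) Set.univ ^ ((2 : ℝ≥0∞).toReal⁻¹) with hM
    have hMtop : M ≠ ⊤ := ENNReal.rpow_ne_top_of_nonneg (by positivity) (measure_ne_top _ _)
    obtain ⟨δ, hδ, hδε⟩ : ∃ δ : ℝ, 0 < δ ∧ M * ENNReal.ofReal δ ≤ ε := by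
      have h1 : Tendsto (fun δ : ℝ => M * ENNReal.ofReal δ) (𝓝[>] 0) (𝓝 0) := by
        have := ENNReal.Tendsto.const_mul (ENNReal.tendsto_ofReal
          (tendsto_id (α := ℝ) (x := 𝓝 0))) (a := M) (Or.inr hMtop)
        simp only [ENNReal.ofReal_zero, mul_zero] at this
        exact this.mono_left nhdsWithin_le_nhds
      obtain ⟨δ, h2, h3⟩ := ((h1.eventually (ge_mem_nhds hε)).and self_mem_nhdsWithin).exists
      exact ⟨δ, h3, h2⟩
    obtain ⟨η, hη, hηδ⟩ := huc (δ / 2) (by positivity)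
    have h1 : ∀ᶠ n in atTop, (φ n).rOut < min η 1 :=
      hφ.eventually_lt_const (by positivity)
    have h2 : ∀ᶠ n in atTop, |t n - 1| * (2 * (|R| + 1)) < η := by
      have : Tendsto (fun n => |t n - 1| * (2 * (|R| + 1))) atTop (𝓝 0) := by
        have := ((ht.sub_const 1).abs).mul_const (2 * (|R| + 1))
        simpa using this
      exact this.eventually_lt_const hη
    filter_upwards [h1, h2] with n hn1 hn2
    have hsupp : Function.support (fun x => moll (φ n) h (dil x₀ (t n) x) - h x) ⊆ B := by
      intro x hx
      by_contra hxB
      have hxd : 2 * (|R| + 1) < dist x x₀ := by simpa [hB] using hxB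
      apply hx
      have e1 : h x = 0 := hzero x (by linarith [abs_nonneg R])
      have e2 : moll (φ n) h (dil x₀ (t n) x) = 0 := by
        refine (integral_congr_ae (Eventually.of_forall fun y => ?_)).trans
          (integral_zero' _ _)
        simp only [Pi.zero_apply, mul_eq_zero]
        by_cases hy : R < dist y x₀
        · exact Or.inl (hzero y hy)
        · right
          apply kernel_eq_zero
          have d1 : dist (dil x₀ (t n) x) x₀ = t n * dist x x₀ := by
            rw [dil, dist_eq_norm, add_sub_cancel_left, norm_smul, ← dist_eq_norm,
              Real.norm_of_nonneg (by linarith [ht2 n])]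
          have d2 := dist_triangle_left (dil x₀ (t n) x) x₀ y
          have d3 : |R| + 1 < t n * dist x x₀ := by nlinarith [ht2 n, abs_nonneg R]
          have d4 := lt_of_lt_of_le hn1 (min_le_right _ _)
          linarith [not_lt.1 hy]
      simp [e1, e2]
    rw [← eLpNorm_restrict_eq_of_support_subset hsupp]
    refine le_trans (eLpNorm_le_of_ae_bound (C := δ) ?_) hδε
    refine ae_restrict_of_forall_mem Metric.isClosed_closedBall.measurableSet fun x hx => ?_
    have hx' : dist x x₀ ≤ 2 * (|R| + 1) := hx
    have e1 : |moll (φ n) h (dil x₀ (t n) x) - h (dil x₀ (t n) x)| ≤ δ / 2 := by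
      refine abs_moll_sub_le hh fun y hy => ?_
      have := hηδ (lt_of_le_of_lt hy (lt_of_lt_of_le hn1 (min_le_left _ _)))
      rw [Real.dist_eq] at this
      exact this.le
    have e2 : |h (dil x₀ (t n) x) - h x| ≤ δ / 2 := by
      have : dist (dil x₀ (t n) x) x < η := by
        have e : dil x₀ (t n) x - x = (t n - 1) • (x - x₀) := by rw [dil]; module
        rw [dist_eq_norm, e, norm_smul, Real.norm_eq_abs, ← dist_eq_norm]
        refine lt_of_le_of_lt ?_ hn2
        gcongr
      have := hηδ this
      rw [Real.dist_eq] at this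
      exact this.le
    rw [Real.norm_eq_abs]
    calc |moll (φ n) h (dil x₀ (t n) x) - h x| ≤ |moll (φ n) h (dil x₀ (t n) x) -
        h (dil x₀ (t n) x)| + |h (dil x₀ (t n) x) - h x| := abs_sub_le _ _ _
      _ ≤ δ := by linarith
  rw [TendstoL2, ENNReal.tendsto_nhds_zero]
  intro ε hε
  obtain ⟨η, hη0, hη⟩ : ∃ η : ℝ≥0∞, 0 < η ∧ C * η + η + η ≤ ε := by
    have h1 : Tendsto (fun η : ℝ≥0∞ => C * η + η + η) (𝓝[>] 0) (𝓝 0) := by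
      have := ((ENNReal.Tendsto.const_mul (tendsto_id (α := ℝ≥0∞) (x := 𝓝 0)) (a := C)
        (Or.inr hCtop)).add tendsto_id).add tendsto_id
      simp only [mul_zero, add_zero] at this
      exact this.mono_left nhdsWithin_le_nhds
    obtain ⟨η, h2, h3⟩ := ((h1.eventually (ge_mem_nhds hε)).and self_mem_nhdsWithin).exists
    exact ⟨η, h3, h2⟩
  obtain ⟨h, hs, hgh, hh, hhm⟩ := hg.exists_hasCompactSupport_eLpNorm_sub_le (by norm_num) hη0.ne'
  have hhl : LocallyIntegrable h := hh.locallyIntegrable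
  have h1 := (ENNReal.tendsto_nhds_zero.1 (key h hh hs)) η hη0
  filter_upwards [h1] with n hn
  have hgh' : MemLp (fun x => g x - h x) 2 volume := hg.sub hhm
  have b1 := eLpNorm_comp_dil_le x₀ (ht2 n) (moll_memLp (φ := φ n) hgh').1.1
  have b2 : eLpNorm (moll (φ n) (fun x => g x - h x) ∘ dil x₀ (t n)) 2 volume ≤ C * η :=
    b1.2.trans (mul_le_mul_right ((moll_memLp hgh').2.trans hgh) C)
  have cD := (contDiff_dil x₀ (t n)).continuous
  have m1 : AEStronglyMeasurable (fun x => moll (φ n) h (dil x₀ (t n) x) - h x) volume :=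
    (((contDiff_moll hhl).continuous.comp cD).sub hh).aestronglyMeasurable
  have m2 : AEStronglyMeasurable (fun x => h x - g x) volume := (hhm.sub hg).1
  have e : (fun x => moll (φ n) g (dil x₀ (t n) x) - g x) =
      (moll (φ n) (fun x => g x - h x) ∘ dil x₀ (t n)) +
      (fun x => moll (φ n) h (dil x₀ (t n) x) - h x) + fun x => h x - g x := by
    funext x
    simp only [Pi.add_apply, Function.comp, moll_sub hgl hhl]
    ring
  rw [e]
  refine (eLpNorm_add_le (b1.1.add m1) m2 (by norm_num)).trans ?_
  refine le_trans (add_le_add (eLpNorm_add_le b1.1 m1 (by norm_num)) le_rfl) ?_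
  refine le_trans (add_le_add (add_le_add b2 hn) ?_) hη
  rw [← eLpNorm_neg]
  refine le_trans (le_of_eq ?_) hgh
  congr 1
  funext x
  simp

lemma pderiv_comp_dil {ψ : Space d → ℝ} (hψ : ContDiff ℝ ∞ ψ) (x₀ : Space d) (t : ℝ) (i : Fin d) :
    pderiv i (fun x => ψ (dil x₀ t x)) = fun x => t * pderiv i ψ (dil x₀ t x) := by
  funext x
  have h1 : HasFDerivAt (dil x₀ t) (t • ContinuousLinearMap.id ℝ (Space d)) x :=
    (((hasFDerivAt_id x).sub_const x₀).const_smul t).const_add x₀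
  have h2 := ((hψ.differentiable (by simp) (dil x₀ t x)).hasFDerivAt).comp x h1
  have h3 : fderiv ℝ (fun x => ψ (dil x₀ t x)) x = _ := h2.fderiv
  rw [pderiv, h3]
  simp [pderiv]

/-- A bump function with outer radius `r`. -/
def bumpOf (d : ℕ) (r : ℝ) (hr : 0 < r) : ContDiffBump (0 : Space d) :=
  ⟨r / 2, r, half_pos hr, half_lt_self hr⟩

/-- Smooth functions on `ℝ^d` are dense in `H²(Ω)`, for convex open sets `Ω`. -/
theorem exists_smooth_approx {Ω : Set (Space d)} (hΩ : IsOpen Ω) (hc : Convex ℝ Ω)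
    (hne : Ω.Nonempty) {u : Space d → ℝ} {G : Fin d → Space d → ℝ}
    {H : Fin d → Fin d → Space d → ℝ} (hu : MemLp u 2 (volume.restrict Ω))
    (hG : ∀ i, MemLp (G i) 2 (volume.restrict Ω)) (hH : ∀ i j, MemLp (H i j) 2 (volume.restrict Ω))
    (huG : ∀ i, IsWeakDeriv Ω i u (G i)) (hGH : ∀ i j, IsWeakDeriv Ω j (G i) (H i j)) :
    ∃ w : ℕ → Space d → ℝ, (∀ n, ContDiff ℝ ∞ (w n)) ∧ TendstoL2 (volume.restrict Ω) w u ∧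
      (∀ i, TendstoL2 (volume.restrict Ω) (fun n => pderiv i (w n)) (G i)) ∧
      ∀ i j, TendstoL2 (volume.restrict Ω) (fun n => pderiv j (pderiv i (w n))) (H i j) := by
  obtain ⟨x₀, hx₀⟩ := hne
  obtain ⟨ρ, hρ, hball⟩ := Metric.isOpen_iff.1 hΩ x₀ hx₀
  -- The point `x` is contracted towards `x₀` by the factor `1 - s n`. This leaves a distance of at
  -- least `s n * ρ` to the complement of `Ω`, so that mollification with radius `s n * (ρ / 2)`
  -- only sees values inside `Ω` and no extension operator is needed. The shift by `2` gives `s n ≤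
  -- 1/2`.
  let s : ℕ → ℝ := fun n => 1 / ((n : ℝ) + 2)
  have hs0 : ∀ n, 0 < s n := fun n => by positivity
  have hs1 : ∀ n, s n ≤ 1 / 2 := fun n => by
    simp only [s]; gcongr; linarith [(Nat.cast_nonneg n : (0:ℝ) ≤ n)]
  have hst : Tendsto s atTop (𝓝 0) := by
    have := (tendsto_add_atTop_iff_nat (f := fun n : ℕ => 1 / (n : ℝ)) 2).2
      tendsto_one_div_atTop_nhds_zero_nat
    simpa [s] using this
  let φ : ℕ → ContDiffBump (0 : Space d) := fun n =>
    bumpOf d (s n * (ρ / 2)) (mul_pos (hs0 n) (by positivity))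
  let t : ℕ → ℝ := fun n => 1 - s n
  have hφ : Tendsto (fun n => (φ n).rOut) atTop (𝓝 0) := by
    simpa [φ, bumpOf] using hst.mul_const (ρ / 2)
  have ht : Tendsto t atTop (𝓝 1) := by simpa [t] using tendsto_const_nhds.sub hst
  have ht2 : ∀ n, 1 / 2 ≤ t n := fun n => by simp only [t]; linarith [hs1 n]
  have hsub : ∀ n, ∀ x ∈ Ω, Metric.closedBall (dil x₀ (t n) x) (φ n).rOut ⊆ Ω := by
    intro n x hx y hy
    have h1 : ‖y - dil x₀ (t n) x‖ ≤ s n * (ρ / 2) := by rw [← dist_eq_norm]; exact hy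
    -- The point `y` is the convex combination of this point and of `x` with weights `s n` and `t
    -- n`.
    have h2 : x₀ + (s n)⁻¹ • (y - dil x₀ (t n) x) ∈ Ω := by
      apply hball
      rw [Metric.mem_ball, dist_eq_norm, add_sub_cancel_left, norm_smul, norm_inv,
        Real.norm_of_nonneg (hs0 n).le, inv_mul_lt_iff₀ (hs0 n)]
      have := hs0 n
      nlinarith
    have h3 := hc h2 hx (hs0 n).le (by linarith [ht2 n] : 0 ≤ t n) (by simp [t])
    convert h3 using 1
    rw [smul_add, smul_smul, mul_inv_cancel₀ (hs0 n).ne', one_smul]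
    simp only [dil, t]
    module
  have hind : ∀ {g : Space d → ℝ}, MemLp g 2 (volume.restrict Ω) →
      MemLp (Ω.indicator g) 2 volume := fun h =>
    (memLp_indicator_iff_restrict hΩ.measurableSet).2 h
  have hli : ∀ {g : Space d → ℝ}, MemLp g 2 (volume.restrict Ω) →
      LocallyIntegrable (Ω.indicator g) := fun h => (hind h).locallyIntegrable (by norm_num)
  have hS : ∀ {g : Space d → ℝ}, MemLp g 2 (volume.restrict Ω) →
      TendstoL2 (volume.restrict Ω) (fun n x => moll (φ n) (Ω.indicator g) (dil x₀ (t n) x)) g := by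
    intro g hg
    have h1 := (tendstoL2_moll_dil x₀ hφ ht ht2 (hind hg)).mono_measure
      (Measure.restrict_le_self (s := Ω))
    exact h1.congr (fun n => ae_eq_rfl) (indicator_ae_eq_restrict hΩ.measurableSet)
  -- By the chain rule each derivative of the contracted function carries a factor `t n`. It
  -- disappears in the limit because `t n - 1 = -s n → 0` and the norms stay bounded.
  have hscale : ∀ {f : ℕ → Space d → ℝ} {g : Space d → ℝ}, (∀ n, Continuous (f n)) →
      MemLp g 2 (volume.restrict Ω) → TendstoL2 (volume.restrict Ω) f g →
      TendstoL2 (volume.restrict Ω) (fun n x => t n * f n x) g := by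
    intro f g hf hg hfg
    have hb := hfg.tendsto_eLpNorm (fun n => (hf n).aestronglyMeasurable) hg.1
    have hb2 : Tendsto (fun n => ENNReal.ofReal (s n) * eLpNorm (f n) 2 (volume.restrict Ω) +
        eLpNorm (fun x => f n x - g x) 2 (volume.restrict Ω)) atTop (𝓝 0) := by
      have h1 := ENNReal.tendsto_ofReal hst
      have h2 := ENNReal.Tendsto.mul h1 (Or.inr hg.2.ne) hb (Or.inr (by simp))
      simpa using h2.add hfg
    refine tendsto_of_le_of_tendsto_zero hb2 fun n => ?_
    have e : (fun x => t n * f n x - g x) = (-(s n)) • (f n) + fun x => f n x - g x := by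
      funext x; simp [t]; ring
    rw [e]
    refine (eLpNorm_add_le ((hf n).aestronglyMeasurable.const_smul _)
      ((hf n).aestronglyMeasurable.sub hg.1) (by norm_num)).trans ?_
    rw [eLpNorm_const_smul, enorm_neg, Real.enorm_of_nonneg (hs0 n).le]
    exact le_rfl
  have cD : ∀ n, ContDiff ℝ ∞ (dil x₀ (t n)) := fun n => contDiff_dil _ _
  have cont : ∀ {g : Space d → ℝ}, MemLp g 2 (volume.restrict Ω) → ∀ n,
      ContDiff ℝ ∞ (fun x => moll (φ n) (Ω.indicator g) (dil x₀ (t n) x)) := fun hg n =>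
    (contDiff_moll (hli hg)).comp (cD n)
  have hder : ∀ {g g' : Space d → ℝ} {i : Fin d}, MemLp g 2 (volume.restrict Ω) →
      IsWeakDeriv Ω i g g' → ∀ n, ∀ x ∈ Ω,
      pderiv i (fun x => moll (φ n) (Ω.indicator g) (dil x₀ (t n) x)) x =
        t n * moll (φ n) (Ω.indicator g') (dil x₀ (t n) x) := by
    intro g g' i hg hgg' n x hx
    rw [pderiv_comp_dil (contDiff_moll (hli hg))]
    simp only
    rw [pderiv_moll hΩ hgg' hg (hsub n x hx)]
  refine ⟨fun n x => moll (φ n) (Ω.indicator u) (dil x₀ (t n) x), cont hu, hS hu, fun i => ?_,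
    fun i j => ?_⟩
  · refine (hscale (fun n => (cont (hG i) n).continuous) (hG i) (hS (hG i))).congr (fun n => ?_)
      ae_eq_rfl
    exact ae_restrict_of_forall_mem hΩ.measurableSet fun x hx => (hder hu (huG i) n x hx).symm
  · have h1 := hscale (fun n => (cont (hH i j) n).continuous) (hH i j) (hS (hH i j))
    have h2 := hscale (fun n => continuous_const.mul (cont (hH i j) n).continuous) (hH i j) h1
    refine h2.congr (fun n => ?_) ae_eq_rfl
    refine ae_restrict_of_forall_mem hΩ.measurableSet fun x hx => ?_
    have e : pderiv i (fun x => moll (φ n) (Ω.indicator u) (dil x₀ (t n) x)) =ᶠ[𝓝 x]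
        fun x => t n * moll (φ n) (Ω.indicator (G i)) (dil x₀ (t n) x) := by
      filter_upwards [hΩ.mem_nhds hx] with y hy
      exact hder hu (huG i) n y hy
    have e2 : pderiv j (pderiv i (fun x => moll (φ n) (Ω.indicator u) (dil x₀ (t n) x))) x =
        pderiv j (fun x => t n * moll (φ n) (Ω.indicator (G i)) (dil x₀ (t n) x)) x := by
      rw [pderiv, e.fderiv_eq]; rfl
    rw [e2, pderiv_const_mul (cont (hG i) n)]
    simp only
    rw [hder (hG i) (hGH i j) n x hx]
    rfl

end mollify

/-! ### The trace inequality on simplices -/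

lemma isCompact_hull {d : ℕ} (s : Finset (Space d)) : IsCompact (hull s) :=
  s.finite_toSet.isCompact_convexHull ℝ

lemma convex_hull {d : ℕ} (s : Finset (Space d)) : Convex ℝ (hull s) := convex_convexHull ℝ _

lemma subset_hull {d : ℕ} (s : Finset (Space d)) : (s : Set (Space d)) ⊆ hull s :=
  subset_convexHull ℝ _

lemma measurableSet_hull {d : ℕ} (s : Finset (Space d)) : MeasurableSet (hull s) :=
  (isCompact_hull s).measurableSet

section facet
variable {n : ℕ} {F : Finset (Space (n + 1))}

/-- An isometric parametrization of the affine span of a facet. -/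
lemma exists_facet_param (hF : AffineIndependent ℝ ((↑) : F → Space (n + 1)))
    (hc : F.card = n + 1) : ∃ y₀ ∈ F, ∃ L : Space n →ₗᵢ[ℝ] Space (n + 1),
      hull F ⊆ Set.range fun η => y₀ + L η := by
  have hne : F.Nonempty := Finset.card_pos.1 (by omega)
  obtain ⟨y₀, hy₀⟩ := hne
  have hr : Module.finrank ℝ (vectorSpan ℝ (F : Set (Space (n + 1)))) = n := by
    have := hF.finrank_vectorSpan (n := n) (by simpa using hc)
    rwa [show Set.range ((↑) : F → Space (n + 1)) = (F : Set (Space (n + 1))) by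
      ext; simp] at this
  let e := ((stdOrthonormalBasis ℝ (vectorSpan ℝ (F : Set (Space (n + 1))))).reindex
    (finCongr hr)).repr
  refine ⟨y₀, hy₀, (vectorSpan ℝ (F : Set (Space (n + 1)))).subtypeₗᵢ.comp
    e.symm.toLinearIsometry, fun x hx => ?_⟩
  have h1 : x ∈ affineSpan ℝ (F : Set (Space (n + 1))) := convexHull_subset_affineSpan _ hx
  have h2 : x - y₀ ∈ vectorSpan ℝ (F : Set (Space (n + 1))) := by
    have := AffineSubspace.vsub_mem_direction h1 (subset_affineSpan ℝ _ hy₀)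
    rwa [direction_affineSpan] at this
  exact ⟨e ⟨x - y₀, h2⟩, by simp⟩

variable {y₀ : Space (n + 1)} {L : Space n →ₗᵢ[ℝ] Space (n + 1)}

lemma isometry_param : Isometry fun η => y₀ + L η :=
  (isometry_add_left y₀).comp L.isometry

/-- Isometries preserve the normalized Hausdorff measure, so surface integrals over a facet are
Lebesgue integrals over its parameter domain. -/
lemma restrict_facet (hL : hull F ⊆ Set.range fun η => y₀ + L η) :
    (μHE[n] : Measure (Space (n + 1))).restrict (hull F) =
      (volume.restrict ((fun η => y₀ + L η) ⁻¹' hull F)).map (fun η => y₀ + L η) := by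
  have hi : Isometry fun η => y₀ + L η := isometry_param
  have h1 := hi.map_euclideanHausdorffMeasure (d := n)
  rw [EuclideanSpace.euclideanHausdorffMeasure_eq_volume] at h1
  rw [← Measure.restrict_map hi.continuous.measurable (measurableSet_hull F), h1,
    Measure.restrict_restrict (measurableSet_hull F), Set.inter_eq_left.2 hL]

lemma measure_facet (hL : hull F ⊆ Set.range fun η => y₀ + L η) :
    (μHE[n] : Measure (Space (n + 1))) (hull F) = volume ((fun η => y₀ + L η) ⁻¹' hull F) := by
  have h := congrArg (fun μ => μ Set.univ) (restrict_facet hL)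
  have hi : Isometry fun η => y₀ + L η := isometry_param
  simp only at h
  rwa [Measure.restrict_apply_univ, Measure.map_apply hi.continuous.measurable MeasurableSet.univ,
    Set.preimage_univ, Measure.restrict_apply_univ] at h

/-- In the parametrization the facet is contained in the ball around the parameter of a vertex with
radius the diameter. -/
lemma measure_facet_le (hF : AffineIndependent ℝ ((↑) : F → Space (n + 1)))
    (hc : F.card = n + 1) : (μHE[n] : Measure (Space (n + 1))) (hull F) ≤
      ENNReal.ofReal (Metric.diam (hull F) ^ n) * volume (Metric.ball (0 : Space n) 1) := by
  obtain ⟨y₀, hy₀, L, hL⟩ := exists_facet_param hF hc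
  rw [measure_facet hL]
  have hi : Isometry fun η => y₀ + L η := isometry_param
  have h1 : (fun η => y₀ + L η) ⁻¹' hull F ⊆ Metric.closedBall 0 (Metric.diam (hull F)) := by
    intro η hη
    have := Metric.dist_le_diam_of_mem (isCompact_hull F).isBounded hη (subset_hull F hy₀)
    rw [Metric.mem_closedBall]
    calc dist η 0 = dist (y₀ + L η) (y₀ + L 0) := (hi.dist_eq _ _).symm
      _ ≤ _ := by simpa using this
  refine (measure_mono h1).trans ?_
  rw [Measure.addHaar_closedBall _ _ Metric.diam_nonneg]
  simp

lemma measure_facet_lt_top (hF : AffineIndependent ℝ ((↑) : F → Space (n + 1)))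
    (hc : F.card = n + 1) : (μHE[n] : Measure (Space (n + 1))) (hull F) < ⊤ :=
  lt_of_le_of_lt (measure_facet_le hF hc)
    (ENNReal.mul_lt_top ENNReal.ofReal_lt_top measure_ball_lt_top)

/-- Integration over the part of a simplex that is close to a facet, in conical coordinates. -/
theorem lintegral_cone_le (hF : AffineIndependent ℝ ((↑) : F → Space (n + 1)))
    (hc : F.card = n + 1) (z : Space (n + 1))
    (hK : 0 < volume (convexHull ℝ (insert z (F : Set (Space (n + 1))))))
    {g : Space (n + 1) → ℝ≥0∞} (hg : Measurable g) :
    volume (convexHull ℝ (insert z (F : Set (Space (n + 1))))) *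
      (∫⁻ t in Set.Icc (1 / 2 : ℝ) 1, ∫⁻ y in hull F, g (z + t • (y - z)) ∂μHE[n]) ≤
    2 ^ n * μHE[n] (hull F) * ∫⁻ x in convexHull ℝ (insert z (F : Set (Space (n + 1)))), g x := by
  classical
  obtain ⟨y₀, hy₀, L, hL⟩ := exists_facet_param hF hc
  set K := convexHull ℝ (insert z (F : Set (Space (n + 1)))) with hKdef
  have hKm : MeasurableSet K := by
    have : IsCompact K := (F.finite_toSet.insert z).isCompact_convexHull ℝ
    exact this.measurableSet
  set S := (fun η => y₀ + L η) ⁻¹' hull F with hS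
  have hi : Isometry fun η => y₀ + L η := isometry_param
  have hSm : MeasurableSet S := hi.continuous.measurable (measurableSet_hull F)
  -- A point `z + t (y - z)` with `y = y₀ + L η` is `z + M (t η, t)`. In the linear coordinates
  -- given by `M`, the slice of the simplex at height `t` is the scaled parameter domain `t • S`.
  let a := y₀ - z
  let M : (Space n × ℝ) →ₗ[ℝ] Space (n + 1) :=
    L.toLinearMap.comp (LinearMap.fst ℝ _ _) + (LinearMap.toSpanSingleton ℝ _ a).comp
      (LinearMap.snd ℝ _ _)
  have hM : ∀ η t, M (η, t) = L η + t • a := fun η t => by simp [M]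
  -- points of the simplex in conical coordinates
  have hcone : ∀ x ∈ K, ∃ t : ℝ, 0 ≤ t ∧ t ≤ 1 ∧ ∃ η ∈ S, x = z + M (t • η, t) := by
    intro x hx
    have hne : (F : Set (Space (n + 1))).Nonempty := ⟨y₀, hy₀⟩
    rw [hKdef, convexHull_insert hne, mem_convexJoin] at hx
    obtain ⟨z', hz', y, hy, hxy⟩ := hx
    rw [Set.mem_singleton_iff] at hz'
    subst hz'
    obtain ⟨t, ⟨ht0, ht1⟩, rfl⟩ := segment_eq_image' ℝ z' y ▸ hxy
    obtain ⟨η, rfl⟩ := hL hy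
    refine ⟨t, ht0, ht1, η, hy, ?_⟩
    simp only [hM, map_smul, a]
    module
  have hmem : ∀ η ∈ S, ∀ t : ℝ, 0 ≤ t → t ≤ 1 → z + M (t • η, t) ∈ K := by
    intro η hη t ht0 ht1
    have h1 : z ∈ K := subset_convexHull ℝ _ (Set.mem_insert _ _)
    have h2 : y₀ + L η ∈ K := convexHull_mono (Set.subset_insert _ _) hη
    have := (convex_convexHull ℝ (insert z (F : Set (Space (n + 1))))) h1 h2
      (sub_nonneg.2 ht1) ht0 (by ring)
    convert this using 1
    simp only [hM, map_smul, a]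
    module
  -- The translate `K - z` lies in the range of `M`. A proper subspace is a null set, which would
  -- contradict the positive volume of `K`.
  have hsurj : Function.Surjective M := by
    rw [← LinearMap.range_eq_top]
    by_contra hne
    have h0 := Measure.addHaar_submodule (volume : Measure (Space (n + 1))) _ hne
    have h1 : (fun x => x + z) ⁻¹' K ⊆ (LinearMap.range M : Set (Space (n + 1))) := by
      intro x hx
      obtain ⟨t, -, -, η, -, h⟩ := hcone _ hx
      have h' : x + z = z + M (t • η, t) := h
      rw [add_comm x z] at h'
      replace h := h'
      exact ⟨_, (add_left_cancel h).symm⟩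
    have h2 := measure_mono (μ := volume) h1
    rw [measure_preimage_add_right, h0] at h2
    exact hK.not_ge h2
  have hinj : Function.Injective M := by
    refine (LinearMap.injective_iff_surjective_of_finrank_eq_finrank ?_).2 hsurj
    simp
  let e : (Space n × ℝ) ≃L[ℝ] Space (n + 1) :=
    (LinearEquiv.ofBijective M ⟨hinj, hsurj⟩).toContinuousLinearEquiv
  have he : ∀ p, e p = M p := fun p => rfl
  -- By uniqueness of Haar measure, volume is a constant `c` times the image of the product measure.
  -- The constant, a height, is never computed: it cancels between the bounds `hKle` and `hlow`.
  let ν : Measure (Space (n + 1)) := ((volume : Measure (Space n)).prod (volume : Measure ℝ)).map e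
  have hν : ν.IsAddHaarMeasure := e.isAddHaarMeasure_map _
  have hvol := Measure.isAddLeftInvariant_eq_smul (volume : Measure (Space (n + 1))) ν
  set c := Measure.addHaarScalarFactor (volume : Measure (Space (n + 1))) ν
  have heM : Measurable e := e.continuous.measurable
  -- integrals over the simplex
  have hint : ∀ f : Space (n + 1) → ℝ≥0∞, Measurable f → ∫⁻ x in K, f x =
      c * ∫⁻ t : ℝ, ∫⁻ η : Space n, K.indicator f (z + M (η, t)) := by
    intro f hf
    have hfK : Measurable (K.indicator f) := hf.indicator hKm
    rw [← lintegral_indicator hKm, ← lintegral_add_left_eq_self _ z]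
    conv_lhs => rw [hvol]
    have hf2 : Measurable fun x => K.indicator f (z + x) := hfK.comp (measurable_const_add z)
    rw [lintegral_smul_measure, lintegral_map hf2 heM, lintegral_prod_symm]
    · rfl
    · exact (hf2.comp heM).aemeasurable
  have hslice : ∀ t : ℝ, 0 < t → ∀ f : Space n → ℝ≥0∞,
      ∫⁻ η in (fun η : Space n => t • η) '' S, f η =
        ENNReal.ofReal (t ^ n) * ∫⁻ η in S, f (t • η) := by
    intro t ht f
    have h1 := lintegral_image_eq_lintegral_abs_det_fderiv_mul (volume : Measure (Space n)) hSm
      (f := fun η : Space n => t • η) (f' := fun _ => t • ContinuousLinearMap.id ℝ (Space n))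
      (fun η _ => ((hasFDerivAt_id η).const_smul t).hasFDerivWithinAt)
      (smul_right_injective _ ht.ne').injOn f
    have hdet : (t • ContinuousLinearMap.id ℝ (Space n)).det = t ^ n := by
      rw [ContinuousLinearMap.det]
      simp [LinearMap.det_smul]
    rw [h1, hdet, abs_of_pos (pow_pos ht n), lintegral_const_mul' _ _ ENNReal.ofReal_ne_top]
  -- The slices at heights `t ∈ [0, 1]` are contained in `t • S`, whose measure is at most that of
  -- `S`; all other slices are empty.
  have hKle : volume K ≤ c * volume S := by
    have h1 := hint (fun _ => 1) measurable_const
    rw [setLIntegral_one] at h1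
    rw [h1]
    gcongr
    have h2 : ∀ t : ℝ, ∫⁻ η : Space n, K.indicator (fun _ => 1) (z + M (η, t)) ≤
        (Set.Icc (0:ℝ) 1).indicator (fun _ => volume S) t := by
      intro t
      by_cases ht : t ∈ Set.Icc (0:ℝ) 1
      · rw [Set.indicator_of_mem ht]
        have h3 : ∀ η, K.indicator (fun _ => (1 : ℝ≥0∞)) (z + M (η, t)) ≤
            ((fun η : Space n => t • η) '' S).indicator (fun _ => 1) η := by
          intro η
          by_cases hx : z + M (η, t) ∈ K
          · obtain ⟨t', -, -, η', hη', h⟩ := hcone _ hx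
            have h4 := hinj (add_left_cancel h)
            rw [Prod.mk.injEq] at h4
            obtain ⟨h5, rfl⟩ := h4
            have h6 : η ∈ (fun η : Space n => t • η) '' S := ⟨η', hη', h5.symm⟩
            rw [Set.indicator_of_mem hx, Set.indicator_of_mem h6]
          · rw [Set.indicator_of_notMem hx]; exact zero_le
        refine (lintegral_mono h3).trans ?_
        refine (lintegral_indicator_const_le _ _).trans ?_
        rw [one_mul, Set.image_smul, Measure.addHaar_smul]
        refine (mul_le_mul_left (ENNReal.ofReal_le_one.2 ?_) _).trans (one_mul _).le
        rw [abs_of_nonneg (pow_nonneg ht.1 _)]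
        exact pow_le_one₀ ht.1 ht.2
      · rw [Set.indicator_of_notMem ht]
        have h3 : ∀ η, K.indicator (fun _ => (1 : ℝ≥0∞)) (z + M (η, t)) = 0 := by
          intro η
          refine Set.indicator_of_notMem (fun hx => ?_) _
          obtain ⟨t', h0, h1, η', hη', h⟩ := hcone _ hx
          have h4 := hinj (add_left_cancel h)
          rw [Prod.mk.injEq] at h4
          exact ht (h4.2 ▸ ⟨h0, h1⟩)
        simp [h3]
    refine (lintegral_mono h2).trans ?_
    rw [lintegral_indicator measurableSet_Icc]
    simp
  -- For `t ≥ 1/2` the slice at height `t` has Jacobian `t ^ n ≥ 2^(-n)` relative to the facet. This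
  -- is the source of the factor `2 ^ n`.
  have hlow : c * ∫⁻ t in Set.Icc (1 / 2 : ℝ) 1, ∫⁻ y in hull F, g (z + t • (y - z)) ∂μHE[n] ≤
      2 ^ n * ∫⁻ x in K, g x := by
    rw [hint g hg, mul_left_comm]
    gcongr
    rw [← lintegral_const_mul' _ _ (by simp), ← lintegral_indicator measurableSet_Icc]
    refine lintegral_mono fun t => ?_
    by_cases ht : t ∈ Set.Icc (1 / 2 : ℝ) 1
    swap
    · rw [Set.indicator_of_notMem ht]; exact zero_le
    rw [Set.indicator_of_mem ht]
    have ht0 : 0 < t := lt_of_lt_of_le (by norm_num) ht.1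
    have hgt : Measurable fun y => g (z + t • (y - z)) := by fun_prop
    rw [restrict_facet hL, lintegral_map hgt hi.continuous.measurable]
    have h1 : (∫⁻ η in S, g (z + M (t • η, t))) ≤
        2 ^ n * (ENNReal.ofReal (t ^ n) * ∫⁻ η in S, g (z + M (t • η, t))) := by
      rw [← mul_assoc]
      refine le_mul_of_one_le_left zero_le ?_
      rw [show (2 : ℝ≥0∞) ^ n = ENNReal.ofReal (2 ^ n) by
        rw [ENNReal.ofReal_pow (by norm_num)]; simp, ← ENNReal.ofReal_mul (by positivity),
        ENNReal.one_le_ofReal, ← mul_pow]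
      exact one_le_pow₀ (by linarith [ht.1])
    rw [← hslice t ht0 (fun η => g (z + M (η, t)))] at h1
    refine le_trans (le_of_eq ?_) (h1.trans ?_)
    · refine lintegral_congr fun η => ?_
      congr 1
      simp only [hM, map_smul, a]
      module
    · gcongr 2 ^ n * ?_
      have hme : MeasurableSet ((fun η : Space n => t • η) '' S) := by
        rw [Set.image_smul]; exact hSm.const_smul₀ t
      rw [← lintegral_indicator hme]
      refine lintegral_mono fun η => ?_
      by_cases hη : η ∈ (fun η : Space n => t • η) '' S
      · rw [Set.indicator_of_mem hη]
        obtain ⟨η', hη', rfl⟩ := hη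
        rw [Set.indicator_of_mem (hmem η' hη' t ht0.le ht.2)]
      · rw [Set.indicator_of_notMem hη]; exact zero_le
  rw [measure_facet hL]
  generalize (∫⁻ t in Set.Icc (1 / 2 : ℝ) 1, ∫⁻ y in hull F, g (z + t • (y - z)) ∂μHE[n]) = I
    at hlow ⊢
  calc volume K * I ≤ (c * volume S) * I := by gcongr
    _ = volume S * (c * I) := by ring
    _ ≤ volume S * (2 ^ n * ∫⁻ x in K, g x) := by gcongr
    _ = _ := by ring

/-- The scaled trace inequality on a facet of a simplex. -/
theorem trace_inequality (hF : AffineIndependent ℝ ((↑) : F → Space (n + 1)))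
    (hc : F.card = n + 1) (z : Space (n + 1))
    (hK : 0 < volume (convexHull ℝ (insert z (F : Set (Space (n + 1))))))
    {ψ : Space (n + 1) → ℝ} (hψ : ContDiff ℝ ∞ ψ) :
    volume.real (convexHull ℝ (insert z (F : Set (Space (n + 1))))) *
      (∫ y in hull F, ψ y ^ 2 ∂μHE[n]) ≤
    4 * 2 ^ n * (μHE[n] : Measure (Space (n + 1))).real (hull F) *
      ∫ x in convexHull ℝ (insert z (F : Set (Space (n + 1)))), (ψ x ^ 2 +
        Metric.diam (convexHull ℝ (insert z (F : Set (Space (n + 1))))) ^ 2 * gradSq ψ x) := by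
  set K := convexHull ℝ (insert z (F : Set (Space (n + 1)))) with hKdef
  have hKc : IsCompact K := (F.finite_toSet.insert z).isCompact_convexHull ℝ
  have hKconv : Convex ℝ K := convex_convexHull ℝ _
  set D := Metric.diam K
  have hψc := hψ.continuous
  have hgc := continuous_gradSq hψ
  let q : Space (n + 1) → ℝ := fun x => ψ x ^ 2 + D ^ 2 * gradSq ψ x
  have hq : Continuous q := by fun_prop
  have hq0 : ∀ x, 0 ≤ q x := fun x =>
    add_nonneg (sq_nonneg _) (mul_nonneg (sq_nonneg _) (gradSq_nonneg _ _))
  have hFfin : IsFiniteMeasure ((μHE[n] : Measure (Space (n + 1))).restrict (hull F)) :=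
    ⟨by simpa using measure_facet_lt_top hF hc⟩
  -- Along the segment from the opposite vertex `z` to `y`, the fundamental theorem of calculus
  -- compares `ψ y` with the values at the parameters `t ∈ [1/2, 1]`, and the result is averaged
  -- over this interval. Staying away from `z` keeps the conical coordinates nondegenerate.
  have hpt : ∀ y ∈ hull F, ψ y ^ 2 ≤ 4 * ∫ t in Set.Icc (1 / 2 : ℝ) 1, q (z + t • (y - z)) := by
    intro y hy
    have hzy : ‖y - z‖ ≤ D := by
      rw [← dist_eq_norm]
      exact Metric.dist_le_diam_of_mem hKc.isBounded (convexHull_mono (Set.subset_insert _ _) hy)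
        (subset_convexHull ℝ _ (Set.mem_insert _ _))
    set I := ∫ t in Set.Icc (1 / 2 : ℝ) 1, gradSq ψ (z + t • (y - z)) with hI
    have hdψ : Continuous fun y => fderiv ℝ ψ y := hψ.continuous_fderiv (by simp)
    have hcont : Continuous fun t : ℝ => fderiv ℝ ψ (z + t • (y - z)) (y - z) := by fun_prop
    have h1 : ∀ t ∈ Set.Icc (1 / 2 : ℝ) 1, (ψ y - ψ (z + t • (y - z))) ^ 2 ≤
        1 / 2 * (D ^ 2 * I) := by
      intro t ht
      have e : ψ y - ψ (z + t • (y - z)) =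
          ∫ s in t..1, fderiv ℝ ψ (z + s • (y - z)) (y - z) := by
        rw [intervalIntegral.integral_eq_sub_of_hasDerivAt
          (fun s _ => hasDerivAt_line hψ z (y - z) s) (hcont.intervalIntegrable _ _)]
        congr 2
        module
      rw [e]
      refine (sq_intervalIntegral_le ht.2 hcont).trans ?_
      have h2 : ∫ s in t..1, fderiv ℝ ψ (z + s • (y - z)) (y - z) ^ 2 ≤ D ^ 2 * I := by
        rw [intervalIntegral.integral_of_le ht.2, ← integral_Icc_eq_integral_Ioc]
        have h3 : ∫ s in Set.Icc t 1, fderiv ℝ ψ (z + s • (y - z)) (y - z) ^ 2 ≤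
            ∫ s in Set.Icc (1 / 2 : ℝ) 1, fderiv ℝ ψ (z + s • (y - z)) (y - z) ^ 2 :=
          setIntegral_mono_set (hcont.pow 2).integrableOn_Icc
            (Eventually.of_forall fun _ => sq_nonneg _) (Set.Icc_subset_Icc_left ht.1).eventuallyLE
        refine h3.trans ?_
        rw [hI, ← integral_const_mul]
        refine integral_mono (Continuous.integrableOn_Icc (by fun_prop))
          (Continuous.integrableOn_Icc (by fun_prop)) fun s => ?_
        have h4 := fderiv_sq_le ψ (z + s • (y - z)) (y - z)
        have h5 : ‖y - z‖ ^ 2 ≤ D ^ 2 := by gcongr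
        exact h4.trans (mul_le_mul_of_nonneg_right h5 (gradSq_nonneg _ _))
      have h6 : 0 ≤ ∫ s in t..1, fderiv ℝ ψ (z + s • (y - z)) (y - z) ^ 2 :=
        intervalIntegral.integral_nonneg ht.2 fun _ _ => sq_nonneg _
      have h7 : 1 - t ≤ 1 / 2 := by linarith [ht.1]
      have h8 : 0 ≤ D ^ 2 * I := h6.trans h2
      calc (1 - t) * _ ≤ 1 / 2 * ∫ s in t..1, fderiv ℝ ψ (z + s • (y - z)) (y - z) ^ 2 := by gcongr
        _ ≤ _ := by gcongr
    have h2 : ∫ t in Set.Icc (1 / 2 : ℝ) 1, ψ y ^ 2 ≤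
        ∫ t in Set.Icc (1 / 2 : ℝ) 1, (2 * ψ (z + t • (y - z)) ^ 2 + D ^ 2 * I) := by
      refine setIntegral_mono_on (continuous_const.integrableOn_Icc)
        (Continuous.integrableOn_Icc (by fun_prop)) measurableSet_Icc fun t ht => ?_
      have := h1 t ht
      nlinarith [sq_nonneg (ψ y - ψ (z + t • (y - z)) - ψ (z + t • (y - z)))]
    have hψi : IntegrableOn (fun t : ℝ => ψ (z + t • (y - z)) ^ 2) (Set.Icc (1 / 2 : ℝ) 1) :=
      Continuous.integrableOn_Icc (by fun_prop)
    have hgi : IntegrableOn (fun t : ℝ => gradSq ψ (z + t • (y - z))) (Set.Icc (1 / 2 : ℝ) 1) :=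
      Continuous.integrableOn_Icc (by fun_prop)
    have hv : volume.real (Set.Icc (1 / 2 : ℝ) 1) = 1 / 2 := by
      rw [measureReal_def, Real.volume_Icc, ENNReal.toReal_ofReal (by norm_num)]; norm_num
    rw [integral_add (hψi.const_mul 2) (continuous_const.integrableOn_Icc), integral_const_mul,
      setIntegral_const, setIntegral_const, hv, smul_eq_mul, smul_eq_mul] at h2
    simp only [q]
    rw [integral_add hψi (hgi.const_mul _), integral_const_mul, ← hI]
    have h9 : 0 ≤ I := integral_nonneg fun _ => gradSq_nonneg _ _
    have h10 : 0 ≤ D ^ 2 * I := by positivity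
    linarith
  -- integrate over the facet
  have hqm : Measurable fun x => ENNReal.ofReal (q x) := by fun_prop
  have h1 := lintegral_cone_le hF hc z hK hqm
  have h2 : ∫⁻ y in hull F, ENNReal.ofReal (ψ y ^ 2) ∂μHE[n] ≤
      4 * ∫⁻ t in Set.Icc (1 / 2 : ℝ) 1, ∫⁻ y in hull F, ENNReal.ofReal (q (z + t • (y - z)))
        ∂μHE[n] := by
    have hsw : ∫⁻ t in Set.Icc (1 / 2 : ℝ) 1, ∫⁻ y in hull F, ENNReal.ofReal (q (z + t • (y - z)))
        ∂μHE[n] = ∫⁻ y in hull F, (∫⁻ t in Set.Icc (1 / 2 : ℝ) 1,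
          ENNReal.ofReal (q (z + t • (y - z)))) ∂μHE[n] := by
      refine lintegral_lintegral_swap ?_
      refine Measurable.aemeasurable ?_
      have : Continuous fun p : ℝ × Space (n + 1) => q (z + p.1 • (p.2 - z)) := by fun_prop
      exact this.measurable.ennreal_ofReal
    rw [hsw, ← lintegral_const_mul' _ _ (by simp)]
    refine setLIntegral_mono' (measurableSet_hull F) fun y hy => ?_
    have hqi : IntegrableOn (fun t : ℝ => q (z + t • (y - z))) (Set.Icc (1 / 2 : ℝ) 1) :=
      Continuous.integrableOn_Icc (by fun_prop)
    rw [← ofReal_integral_eq_lintegral_ofReal hqi (Eventually.of_forall fun _ => hq0 _),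
      show (4 : ℝ≥0∞) = ENNReal.ofReal 4 by simp, ← ENNReal.ofReal_mul (by norm_num)]
    exact ENNReal.ofReal_le_ofReal (hpt y hy)
  have hψF : Integrable (fun y => ψ y ^ 2)
      ((μHE[n] : Measure (Space (n + 1))).restrict (hull F)) := by
    obtain ⟨C, hC⟩ := (isCompact_hull F).exists_bound_of_continuousOn (hψc.pow 2).continuousOn
    refine Integrable.of_bound (hψc.pow 2).aestronglyMeasurable C ?_
    exact ae_restrict_of_forall_mem (measurableSet_hull F) hC
  have hqK : IntegrableOn q K := hq.continuousOn.integrableOn_compact hKc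
  rw [← ofReal_integral_eq_lintegral_ofReal hψF (Eventually.of_forall fun _ => sq_nonneg _)] at h2
  rw [← ofReal_integral_eq_lintegral_ofReal hqK (Eventually.of_forall fun _ => hq0 _)] at h1
  have h3 : volume K * ENNReal.ofReal (∫ y in hull F, ψ y ^ 2 ∂μHE[n]) ≤
      4 * (2 ^ n * μHE[n] (hull F) * ENNReal.ofReal (∫ x in K, q x)) := by
    refine (mul_le_mul_right h2 _).trans ?_
    rw [mul_left_comm]
    gcongr
  have h4 := ENNReal.toReal_mono (by
    refine ENNReal.mul_ne_top (by simp) (ENNReal.mul_ne_top (ENNReal.mul_ne_top (by simp)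
      (measure_facet_lt_top hF hc).ne) ENNReal.ofReal_ne_top)) h3
  simp only [ENNReal.toReal_mul, ENNReal.toReal_pow, ENNReal.toReal_ofNat] at h4
  rw [ENNReal.toReal_ofReal (integral_nonneg fun _ => sq_nonneg _),
    ENNReal.toReal_ofReal (integral_nonneg hq0)] at h4
  refine h4.trans (le_of_eq ?_)
  simp only [measureReal_def, q]
  ring

end facet

/-! ### Simplices and barycentric coordinates -/

/-- The vertices of a nondegenerate `d`-simplex in `ℝ^d`. -/
structure IsSimplex {d : ℕ} (K : Finset (Space d)) : Prop where
  indep : AffineIndependent ℝ ((↑) : K → Space d)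
  card : K.card = d + 1

section simplex
variable {d : ℕ} {K : Finset (Space d)} {x z : Space d}

/-- The vertices of a simplex as an affine basis. -/
def IsSimplex.basis (hK : IsSimplex K) : AffineBasis K ℝ (Space d) :=
  ⟨(↑), hK.indep, hK.indep.affineSpan_eq_top_iff_card_eq_finrank_add_one.2 (by simp [hK.card])⟩

open Classical in
/-- The barycentric coordinate with respect to the vertex `z` of `K`, extended by `0` to other `z`. -/
def bary (K : Finset (Space d)) (z x : Space d) : ℝ :=
  if h : IsSimplex K ∧ z ∈ K then h.1.basis.coord ⟨z, h.2⟩ x else 0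

/-- The (constant) partial derivatives of the barycentric coordinates. -/
def baryGrad (K : Finset (Space d)) (z : Space d) (i : Fin d) : ℝ := pderiv i (bary K z) 0

namespace IsSimplex

lemma bary_eq (hK : IsSimplex K) (hz : z ∈ K) (x : Space d) :
    bary K z x = hK.basis.coord ⟨z, hz⟩ x := by
  rw [bary, dif_pos ⟨hK, hz⟩]

lemma basis_apply (hK : IsSimplex K) (k : K) : hK.basis k = k := rfl

lemma sum_bary (hK : IsSimplex K) (x : Space d) : ∑ z ∈ K, bary K z x = 1 := by
  rw [← Finset.sum_coe_sort, ← hK.basis.sum_coord_apply_eq_one x]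
  exact Finset.sum_congr rfl fun k _ => hK.bary_eq k.2 x

lemma sum_bary_smul (hK : IsSimplex K) (x : Space d) : ∑ z ∈ K, bary K z x • z = x := by
  conv_rhs => rw [← hK.basis.linear_combination_coord_eq_self x]
  rw [← Finset.sum_coe_sort]
  exact Finset.sum_congr rfl fun k _ => by rw [hK.bary_eq k.2 x]; rfl

lemma bary_unique (hK : IsSimplex K) {w : Space d → ℝ} (h1 : ∑ y ∈ K, w y = 1)
    (h2 : ∑ y ∈ K, w y • y = x) (hz : z ∈ K) : bary K z x = w z := by
  have h3 : ∑ k : K, w k = 1 := by rw [← h1, ← Finset.sum_coe_sort K w]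
  have h4 := hK.basis.coord_apply_combination_of_mem (s := Finset.univ) (Finset.mem_univ ⟨z, hz⟩)
    (w := fun k : K => w k) h3
  rw [Finset.univ.affineCombination_eq_linear_combination _ _ h3] at h4
  have h5 : ∑ k : K, w k • hK.basis k = x := by
    rw [← h2, ← Finset.sum_coe_sort K (fun y => w y • y)]
    rfl
  rw [h5] at h4
  rw [hK.bary_eq hz, h4]

lemma bary_vertex [DecidableEq (Space d)] (hK : IsSimplex K) (hz : z ∈ K) (hx : x ∈ K) :
    bary K z x = if z = x then 1 else 0 := by
  refine hK.bary_unique (w := fun y => if y = x then 1 else 0) ?_ ?_ hz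
  · simp [hx]
  · simp [hx]

end IsSimplex

lemma bary_eq_affine (K : Finset (Space d)) (z x : Space d) :
    bary K z x = bary K z 0 + ∑ i, baryGrad K z i * x i := by
  by_cases h : IsSimplex K ∧ z ∈ K
  · have e : ∀ x, bary K z x = (h.1.basis.coord ⟨z, h.2⟩).linear.toContinuousLinearMap x
        + bary K z 0 := by
      intro x
      rw [h.1.bary_eq h.2, h.1.bary_eq h.2]
      exact congrFun (AffineMap.decomp (h.1.basis.coord ⟨z, h.2⟩)) x
    have h1 : ∀ y, fderiv ℝ (bary K z) y =
        (h.1.basis.coord ⟨z, h.2⟩).linear.toContinuousLinearMap := by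
      intro y
      rw [show bary K z = fun x => (h.1.basis.coord ⟨z, h.2⟩).linear.toContinuousLinearMap x
        + bary K z 0 from funext e, fderiv_add_const, ContinuousLinearMap.fderiv]
    rw [e x, add_comm, ← h1 0, fderiv_apply_eq]
    congr 1
    exact Finset.sum_congr rfl fun i _ => mul_comm _ _
  · have e : bary K z = fun _ => 0 := by
      funext x; rw [bary, dif_neg h]
    simp [e, baryGrad, pderiv]

lemma contDiff_bary (K : Finset (Space d)) (z : Space d) : ContDiff ℝ ∞ (bary K z) := by
  rw [show bary K z = fun x => bary K z 0 + ∑ i, baryGrad K z i * x i from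
    funext (bary_eq_affine K z)]
  exact contDiff_const.add (ContDiff.sum fun i _ => contDiff_const.mul (contDiff_coord i))

lemma pderiv_bary (K : Finset (Space d)) (z : Space d) (i : Fin d) :
    pderiv i (bary K z) = fun _ => baryGrad K z i := by
  have h : ∀ k ∈ Finset.univ, ContDiff ℝ ∞ fun x : Space d => baryGrad K z k * x k :=
    fun k _ => contDiff_const.mul (contDiff_coord k)
  rw [show bary K z = fun x => bary K z 0 + ∑ i, baryGrad K z i * x i from
    funext (bary_eq_affine K z), pderiv_add contDiff_const (ContDiff.sum h), pderiv_sum _ _ h]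
  funext x
  simp [pderiv_const, pderiv_const_mul (contDiff_coord _), pderiv_coord]

lemma bary_combo (K : Finset (Space d)) (z x y : Space d) {a b : ℝ} (hab : a + b = 1) :
    bary K z (a • x + b • y) = a * bary K z x + b * bary K z y := by
  rw [bary_eq_affine K z (a • x + b • y), bary_eq_affine K z x, bary_eq_affine K z y]
  have : ∑ i, baryGrad K z i * (a • x + b • y) i =
      a * ∑ i, baryGrad K z i * x i + b * ∑ i, baryGrad K z i * y i := by
    rw [Finset.mul_sum, Finset.mul_sum, ← Finset.sum_add_distrib]
    refine Finset.sum_congr rfl fun i _ => ?_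
    simp only [PiLp.add_apply, PiLp.smul_apply, smul_eq_mul]
    ring
  rw [this]
  linear_combination (-bary K z 0) * hab

namespace IsSimplex

lemma mem_hull_iff (hK : IsSimplex K) : x ∈ hull K ↔ ∀ z ∈ K, 0 ≤ bary K z x := by
  constructor
  · intro hx z hz
    rw [hull, Finset.mem_convexHull'] at hx
    obtain ⟨w, h0, h1, h2⟩ := hx
    rw [hK.bary_unique h1 h2 hz]
    exact h0 z hz
  · intro h
    rw [hull, Finset.mem_convexHull']
    exact ⟨fun z => bary K z x, h, hK.sum_bary x, hK.sum_bary_smul x⟩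

lemma mem_interior_hull_iff (hK : IsSimplex K) :
    x ∈ interior (hull K) ↔ ∀ z ∈ K, 0 < bary K z x := by
  have h := hK.basis.interior_convexHull
  have e : Set.range hK.basis = (K : Set (Space d)) := by
    ext y; simp [basis_apply]
  rw [e] at h
  rw [hull, h]
  constructor
  · intro hx z hz
    rw [hK.bary_eq hz]; exact hx _
  · intro hx k
    rw [← hK.bary_eq k.2]; exact hx k k.2

lemma interior_nonempty (hK : IsSimplex K) : (interior (hull K)).Nonempty := by
  refine ⟨∑ z ∈ K, ((d : ℝ) + 1)⁻¹ • z, hK.mem_interior_hull_iff.2 fun z hz => ?_⟩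
  have hd : ((d : ℝ) + 1) ≠ 0 := by positivity
  rw [hK.bary_unique (w := fun _ => ((d : ℝ) + 1)⁻¹) _ rfl hz]
  · positivity
  · rw [Finset.sum_const, hK.card, nsmul_eq_mul]
    push_cast
    exact mul_inv_cancel₀ hd

lemma closure_interior (hK : IsSimplex K) : closure (interior (hull K)) = hull K := by
  rw [(convex_hull K).closure_interior_eq_closure_of_nonempty_interior hK.interior_nonempty,
    (isCompact_hull K).isClosed.closure_eq]

lemma volume_pos (hK : IsSimplex K) : 0 < volume (hull K) :=
  Measure.measure_pos_of_nonempty_interior _ hK.interior_nonempty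

lemma volume_real_pos (hK : IsSimplex K) : 0 < volume.real (hull K) :=
  ENNReal.toReal_pos hK.volume_pos.ne' (isCompact_hull K).measure_lt_top.ne

end IsSimplex

/-- The frontier of a convex set is a null set. -/
lemma restrict_interior_hull (K : Finset (Space d)) :
    (volume : Measure (Space d)).restrict (interior (hull K)) = volume.restrict (hull K) := by
  refine Measure.restrict_congr_set ?_
  exact interior_ae_eq_of_null_frontier ((convex_hull K).addHaar_frontier _)

lemma hull_mono {s t : Finset (Space d)} (h : s ⊆ t) : hull s ⊆ hull t :=
  convexHull_mono (by exact_mod_cast h)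

variable [DecidableEq (Space d)]

namespace IsSimplex

lemma mem_hull_erase_iff (hK : IsSimplex K) (hz : z ∈ K) :
    x ∈ hull (K.erase z) ↔ x ∈ hull K ∧ bary K z x = 0 := by
  constructor
  · intro hx
    refine ⟨hull_mono (Finset.erase_subset _ _) hx, ?_⟩
    rw [hull, Finset.mem_convexHull'] at hx
    obtain ⟨w, h0, h1, h2⟩ := hx
    rw [hK.bary_unique (w := fun y => if y = z then 0 else w y) _ _ hz, if_pos rfl]
    · rw [← Finset.add_sum_erase K _ hz, if_pos rfl, zero_add, ← h1]
      exact Finset.sum_congr rfl fun y hy => if_neg (Finset.ne_of_mem_erase hy)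
    · rw [← Finset.add_sum_erase K _ hz, if_pos rfl, zero_smul, zero_add, ← h2]
      exact Finset.sum_congr rfl fun y hy => by rw [if_neg (Finset.ne_of_mem_erase hy)]
  · rintro ⟨hx, h0⟩
    rw [hK.mem_hull_iff] at hx
    rw [hull, Finset.mem_convexHull']
    refine ⟨fun y => bary K y x, fun y hy => hx y (Finset.mem_of_mem_erase hy), ?_, ?_⟩
    · have := hK.sum_bary x
      rwa [← Finset.add_sum_erase K _ hz, h0, zero_add] at this
    · have := hK.sum_bary_smul x
      rwa [← Finset.add_sum_erase K _ hz, h0, zero_smul, zero_add] at this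

lemma frontier_subset (hK : IsSimplex K) :
    frontier (interior (hull K)) ⊆ ⋃ z ∈ K, hull (K.erase z) := by
  intro x hx
  rw [frontier, hK.closure_interior, interior_interior] at hx
  have h := hx.2
  rw [hK.mem_interior_hull_iff] at h
  push Not at h
  obtain ⟨z, hz, h1⟩ := h
  refine Set.mem_biUnion (Finset.mem_coe.2 hz) ((hK.mem_hull_erase_iff hz).2 ⟨hx.1, ?_⟩)
  exact le_antisymm h1 (hK.mem_hull_iff.1 hx.1 z hz)

lemma facet_subset_frontier (hK : IsSimplex K) (hz : z ∈ K) :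
    hull (K.erase z) ⊆ frontier (interior (hull K)) := by
  intro x hx
  rw [hK.mem_hull_erase_iff hz] at hx
  rw [frontier, hK.closure_interior, interior_interior]
  refine ⟨hx.1, fun h => ?_⟩
  exact (hK.mem_interior_hull_iff.1 h z hz).ne' hx.2

lemma facet_indep (hK : IsSimplex K) (z : Space d) :
    AffineIndependent ℝ (fun y : ↥(K.erase z) => (y : Space d)) :=
  hK.indep.comp_embedding
    ⟨fun y : ↥(K.erase z) => (⟨y, Finset.mem_of_mem_erase y.2⟩ : K), fun _ _ h =>
      Subtype.ext (congrArg (fun k : K => (k : Space d)) h)⟩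

lemma facet_card (hK : IsSimplex K) (hz : z ∈ K) : (K.erase z).card = d := by
  rw [Finset.card_erase_of_mem hz, hK.card]; simp

lemma convexHull_insert_erase (hz : z ∈ K) :
    convexHull ℝ (insert z ((K.erase z : Finset (Space d)) : Set (Space d))) = hull K := by
  rw [hull, ← Finset.coe_insert, Finset.insert_erase hz]

/-- The trace inequality for the facets of a simplex. -/
lemma trace_inequality (hd : 1 ≤ d) (hK : IsSimplex K) (hz : z ∈ K) {ψ : Space d → ℝ}
    (hψ : ContDiff ℝ ∞ ψ) :
    volume.real (hull K) * (∫ y in hull (K.erase z), ψ y ^ 2 ∂μHE[d - 1]) ≤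
    4 * 2 ^ (d - 1) * (μHE[d - 1] : Measure (Space d)).real (hull (K.erase z)) *
      ∫ x in interior (hull K), (ψ x ^ 2 + Metric.diam (hull K) ^ 2 * gradSq ψ x) := by
  obtain ⟨n, rfl⟩ : ∃ n, d = n + 1 := ⟨d - 1, by omega⟩
  have h := IsaacsFEM.trace_inequality (hK.facet_indep z) (hK.facet_card hz) z
    (by rw [convexHull_insert_erase hz]; exact hK.volume_pos) hψ
  rw [convexHull_insert_erase hz] at h
  rw [restrict_interior_hull]
  exact h

lemma measure_facet_le (hd : 1 ≤ d) (hK : IsSimplex K) (hz : z ∈ K) :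
    (μHE[d - 1] : Measure (Space d)) (hull (K.erase z)) ≤
      ENNReal.ofReal (Metric.diam (hull (K.erase z)) ^ (d - 1)) *
        volume (Metric.ball (0 : Space (d - 1)) 1) := by
  obtain ⟨n, rfl⟩ : ∃ n, d = n + 1 := ⟨d - 1, by omega⟩
  exact IsaacsFEM.measure_facet_le (hK.facet_indep z) (hK.facet_card hz)

lemma measure_facet_lt_top (hd : 1 ≤ d) (hK : IsSimplex K) (hz : z ∈ K) :
    (μHE[d - 1] : Measure (Space d)) (hull (K.erase z)) < ⊤ :=
  lt_of_le_of_lt (hK.measure_facet_le hd hz)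
    (ENNReal.mul_lt_top ENNReal.ofReal_lt_top measure_ball_lt_top)

lemma frontier_measure_lt_top (hd : 1 ≤ d) (hK : IsSimplex K) :
    (μHE[d - 1] : Measure (Space d)) (frontier (interior (hull K))) < ⊤ := by
  refine lt_of_le_of_lt ((measure_mono hK.frontier_subset).trans (measure_biUnion_finset_le _ _)) ?_
  exact ENNReal.sum_lt_top.2 fun z hz => hK.measure_facet_lt_top hd hz

/-- The boundary is covered by the facets, so its surface measure is at most the sum of their
measures, and the facetwise trace inequality applies. The size of the constant does not matter: this
bound serves existence and uniqueness of traces, while scaled estimates are derived facet by facet.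
-/
lemma frontier_integral_le (hd : 1 ≤ d) (hK : IsSimplex K) : ∃ C : ℝ, 0 ≤ C ∧
    ∀ ψ : Space d → ℝ, ContDiff ℝ ∞ ψ → ∫ y in frontier (interior (hull K)), ψ y ^ 2 ∂μHE[d - 1] ≤
      C * ∫ x in interior (hull K), (ψ x ^ 2 + Metric.diam (hull K) ^ 2 * gradSq ψ x) := by
  set μ : Measure (Space d) := μHE[d - 1]
  refine ⟨∑ z ∈ K, (volume.real (hull K))⁻¹ * (4 * 2 ^ (d - 1) * μ.real (hull (K.erase z))),
    Finset.sum_nonneg fun z _ => by positivity, fun ψ hψ => ?_⟩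
  have hcont : Continuous fun y => ψ y ^ 2 := hψ.continuous.pow 2
  have hfin : ∀ z ∈ K, IsFiniteMeasure (μ.restrict (hull (K.erase z))) := fun z hz =>
    ⟨by simpa using hK.measure_facet_lt_top hd hz⟩
  have hint : ∀ z ∈ K, IntegrableOn (fun y => ψ y ^ 2) (hull (K.erase z)) μ := by
    intro z hz
    have := hfin z hz
    obtain ⟨C, hC⟩ := (isCompact_hull (K.erase z)).exists_bound_of_continuousOn hcont.continuousOn
    exact Integrable.of_bound hcont.aestronglyMeasurable C
      (ae_restrict_of_forall_mem (measurableSet_hull _) hC)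
  have hle : μ.restrict (frontier (interior (hull K))) ≤ ∑ z ∈ K, μ.restrict (hull (K.erase z)) := by
    refine Measure.le_iff.2 fun s hs => ?_
    rw [Measure.restrict_apply hs, Measure.finsetSum_apply]
    have h1 : s ∩ frontier (interior (hull K)) ⊆ ⋃ z ∈ K, s ∩ hull (K.erase z) := by
      rw [← Set.inter_iUnion₂]
      exact Set.inter_subset_inter_right _ hK.frontier_subset
    refine (measure_mono h1).trans ((measure_biUnion_finset_le _ _).trans (le_of_eq ?_))
    exact Finset.sum_congr rfl fun z _ => (Measure.restrict_apply hs).symm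
  refine (integral_mono_measure hle (Eventually.of_forall fun _ => sq_nonneg _)
    (integrable_finsetSum_measure.2 hint)).trans ?_
  rw [integral_finsetSum_measure hint, Finset.sum_mul]
  refine Finset.sum_le_sum fun z hz => ?_
  have h := hK.trace_inequality hd hz hψ
  rw [mul_assoc, ← div_eq_inv_mul, le_div_iff₀' hK.volume_real_pos]
  exact h

end IsSimplex
end simplex

/-! ### Traces on the boundary of a simplex -/

lemma memLp_restrict_of_continuous {X : Type*} [TopologicalSpace X] [MeasurableSpace X]
    [BorelSpace X] [SecondCountableTopology X] {μ : Measure X} {s C : Set X} {f : X → ℝ}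
    (hf : Continuous f) (hC : IsCompact C) (hs : MeasurableSet s) (hsC : s ⊆ C) (hμ : μ s < ⊤) :
    MemLp f 2 (μ.restrict s) := by
  have : IsFiniteMeasure (μ.restrict s) := ⟨by simpa using hμ⟩
  obtain ⟨B, hB⟩ := hC.exists_bound_of_continuousOn hf.continuousOn
  exact MemLp.of_bound hf.aestronglyMeasurable B
    (ae_restrict_of_forall_mem hs fun x hx => hB x (hsC hx))

/-- `v` has the weak gradient `G` in `L²(U)`, and is the limit in `H¹(U)` of smooth functions on
`ℝ^d`. -/
structure H1Approx {d : ℕ} (U : Set (Space d)) (v : Space d → ℝ) (G : Fin d → Space d → ℝ) :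
    Prop where
  weak : ∀ i, IsWeakDeriv U i v (G i)
  memLp : MemLp v 2 (volume.restrict U)
  memLp_grad : ∀ i, MemLp (G i) 2 (volume.restrict U)
  approx : ∃ ψ : ℕ → Space d → ℝ, (∀ n, ContDiff ℝ ∞ (ψ n)) ∧ TendstoL2 (volume.restrict U) ψ v ∧
    ∀ i, TendstoL2 (volume.restrict U) (fun n => pderiv i (ψ n)) (G i)

section trace
variable {d : ℕ} {K : Finset (Space d)} {v w : Space d → ℝ} {G H : Fin d → Space d → ℝ}

/-- The distance of `ψ` to `v` in `H¹`. -/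
def h1Dist (U : Set (Space d)) (v : Space d → ℝ) (G : Fin d → Space d → ℝ) (ψ : Space d → ℝ) :
    ℝ≥0∞ :=
  eLpNorm (fun x => ψ x - v x) 2 (volume.restrict U) +
    ∑ i, eLpNorm (fun x => pderiv i ψ x - G i x) 2 (volume.restrict U)

lemma tendsto_h1Dist {U : Set (Space d)} {ψ : ℕ → Space d → ℝ}
    (h1 : TendstoL2 (volume.restrict U) ψ v)
    (h2 : ∀ i, TendstoL2 (volume.restrict U) (fun n => pderiv i (ψ n)) (G i)) :
    Tendsto (fun n => h1Dist U v G (ψ n)) atTop (𝓝 0) := by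
  have h3 : Tendsto (fun n => ∑ i, eLpNorm (fun x => pderiv i (ψ n) x - G i x) 2
      (volume.restrict U)) atTop (𝓝 (∑ i : Fin d, 0)) := tendsto_finsetSum _ fun i _ => h2 i
  simpa [h1Dist] using Tendsto.add h1 h3

lemma memLp_interior_hull {f : Space d → ℝ} (hf : Continuous f) (K : Finset (Space d)) :
    MemLp f 2 (volume.restrict (interior (hull K))) :=
  memLp_restrict_of_continuous hf (isCompact_hull K) isOpen_interior.measurableSet interior_subset
    ((measure_mono interior_subset).trans_lt (isCompact_hull K).measure_lt_top)

namespace IsSimplex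

lemma frontier_subset_hull (K : Finset (Space d)) : frontier (interior (hull K)) ⊆ hull K :=
  frontier_subset_closure.trans
    (closure_minimal interior_subset (isCompact_hull K).isClosed)

lemma memLp_frontier (hd : 1 ≤ d) (hK : IsSimplex K) {f : Space d → ℝ} (hf : Continuous f) :
    MemLp f 2 ((μHE[d - 1] : Measure (Space d)).restrict (frontier (interior (hull K)))) := by
  classical
  exact memLp_restrict_of_continuous hf (isCompact_hull K) isClosed_frontier.measurableSet
    (frontier_subset_hull K) (hK.frontier_measure_lt_top hd)

/-- The trace inequality for differences of smooth functions. -/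
lemma eLpNorm_frontier_sub_le (hd : 1 ≤ d) (hK : IsSimplex K) : ∃ C : ℝ≥0∞, C ≠ ⊤ ∧
    ∀ (v : Space d → ℝ) (G : Fin d → Space d → ℝ) (ψ χ : Space d → ℝ),
      AEStronglyMeasurable v (volume.restrict (interior (hull K))) →
      (∀ i, AEStronglyMeasurable (G i) (volume.restrict (interior (hull K)))) →
      ContDiff ℝ ∞ ψ → ContDiff ℝ ∞ χ →
      eLpNorm (fun x => ψ x - χ x) 2 (μHE[d - 1].restrict (frontier (interior (hull K)))) ≤
        C * (h1Dist (interior (hull K)) v G ψ + h1Dist (interior (hull K)) v G χ) := by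
  classical
  obtain ⟨C, hC0, hC⟩ := hK.frontier_integral_le hd
  set U := interior (hull K)
  set D := Metric.diam (hull K)
  set B := Real.sqrt (C * (1 + D ^ 2)) with hB
  refine ⟨ENNReal.ofReal B, ENNReal.ofReal_ne_top, fun v G ψ χ hv hG hψ hχ => ?_⟩
  set ζ : Space d → ℝ := fun x => ψ x - χ x with hζd
  have hζ : ContDiff ℝ ∞ ζ := hψ.sub hχ
  have hp : ∀ i, pderiv i ζ = fun x => pderiv i ψ x - pderiv i χ x := pderiv_sub hψ hχ
  -- Two smooth functions are compared through a common target. Taken with the target `v` and its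
  -- gradient, this makes approximating sequences Cauchy on the boundary and forces two such
  -- sequences to have the same boundary limit.
  have tri : ∀ f g h : Space d → ℝ, AEStronglyMeasurable f (volume.restrict U) →
      AEStronglyMeasurable g (volume.restrict U) → AEStronglyMeasurable h (volume.restrict U) →
      eLpNorm (fun x => f x - g x) 2 (volume.restrict U) ≤
        eLpNorm (fun x => f x - h x) 2 (volume.restrict U) +
        eLpNorm (fun x => g x - h x) 2 (volume.restrict U) := by
    intro f g h hf hg hh
    refine le_trans (le_of_eq ?_) (eLpNorm_sub_le (hf.sub hh) (hg.sub hh) (by norm_num))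
    congr 1
    funext x
    simp
  have hm : ∀ {f : Space d → ℝ}, Continuous f → AEStronglyMeasurable f (volume.restrict U) :=
    fun hf => hf.aestronglyMeasurable
  have m0 : MemLp ζ 2 (volume.restrict U) := memLp_interior_hull hζ.continuous K
  have m1 : ∀ i, MemLp (pderiv i ζ) 2 (volume.restrict U) :=
    fun i => memLp_interior_hull (continuous_pderiv hζ i) K
  have m2 := hK.memLp_frontier hd hζ.continuous
  have key : eLpNorm ζ 2 (μHE[d - 1].restrict (frontier U)) ≤ ENNReal.ofReal B *
      (eLpNorm ζ 2 (volume.restrict U) + ∑ i, eLpNorm (pderiv i ζ) 2 (volume.restrict U)) := by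
    have hr : (eLpNorm ζ 2 (μHE[d - 1].restrict (frontier U))).toReal ≤
        B * ((eLpNorm ζ 2 (volume.restrict U)).toReal +
          ∑ i, (eLpNorm (pderiv i ζ) 2 (volume.restrict U)).toReal) := by
      set a := (eLpNorm ζ 2 (volume.restrict U)).toReal with ha
      set g := fun i => (eLpNorm (pderiv i ζ) 2 (volume.restrict U)).toReal with hg
      have ha0 : 0 ≤ a := ENNReal.toReal_nonneg
      have hg0 : ∀ i, 0 ≤ g i := fun i => ENNReal.toReal_nonneg
      have hs0 : 0 ≤ ∑ i, g i := Finset.sum_nonneg fun i _ => hg0 i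
      refine abs_le_of_sq_le_sq' ?_ (mul_nonneg (Real.sqrt_nonneg _) (add_nonneg ha0 hs0)) |>.2
      have h1 := hC ζ hζ
      have h2 : ∫ x in U, (ζ x ^ 2 + D ^ 2 * gradSq ζ x) = a ^ 2 + D ^ 2 * ∑ i, g i ^ 2 := by
        simp only [gradSq]
        rw [integral_add m0.integrable_sq ((integrable_finsetSum _ fun i _ =>
          (m1 i).integrable_sq).const_mul _), integral_const_mul,
          integral_finsetSum _ fun i _ => (m1 i).integrable_sq, ha, eLpNorm_two_toReal_sq m0]
        simp only [hg, eLpNorm_two_toReal_sq (m1 _)]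
      have h3 : ∑ i, g i ^ 2 ≤ (∑ i, g i) ^ 2 :=
        Finset.sum_sq_le_sq_sum_of_nonneg fun i _ => hg0 i
      rw [eLpNorm_two_toReal_sq m2, mul_pow, Real.sq_sqrt (by positivity)]
      refine h1.trans ?_
      rw [h2, mul_assoc]
      refine mul_le_mul_of_nonneg_left ?_ hC0
      nlinarith [sq_nonneg D, mul_nonneg ha0 hs0, mul_nonneg (sq_nonneg D) (mul_nonneg ha0 hs0),
        mul_nonneg (sq_nonneg D) (sq_nonneg a), mul_le_mul_of_nonneg_left h3 (sq_nonneg D),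
        sq_nonneg (∑ i, g i)]
    have hfin : (eLpNorm ζ 2 (volume.restrict U) + ∑ i, eLpNorm (pderiv i ζ) 2 (volume.restrict U))
        ≠ ⊤ := ENNReal.add_ne_top.2 ⟨m0.2.ne, (ENNReal.sum_lt_top.2 fun i _ => (m1 i).2).ne⟩
    rw [← ENNReal.toReal_le_toReal m2.2.ne (ENNReal.mul_ne_top ENNReal.ofReal_ne_top hfin),
      ENNReal.toReal_mul, ENNReal.toReal_ofReal (Real.sqrt_nonneg _),
      ENNReal.toReal_add m0.2.ne (ENNReal.sum_lt_top.2 fun i _ => (m1 i).2).ne,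
      ENNReal.toReal_sum fun i _ => (m1 i).2.ne]
    exact hr
  refine key.trans ?_
  refine mul_le_mul_right ?_ _
  refine (add_le_add (tri _ _ v (hm hψ.continuous) (hm hχ.continuous) hv)
    (Finset.sum_le_sum (g := fun i => eLpNorm (fun x => pderiv i ψ x - G i x) 2 (volume.restrict U) +
      eLpNorm (fun x => pderiv i χ x - G i x) 2 (volume.restrict U)) fun i _ => ?_)).trans
    (le_of_eq ?_)
  · rw [hp i]
    exact tri _ _ _ (hm (continuous_pderiv hψ i)) (hm (continuous_pderiv hχ i)) (hG i)
  · rw [Finset.sum_add_distrib, h1Dist, h1Dist]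
    ring

end IsSimplex

variable (hd : 1 ≤ d) (hK : IsSimplex K)
include hd hK

/-- By the trace inequality, smooth functions that converge in `H¹` form a Cauchy sequence in `L²`
of the boundary, which is complete. -/
lemma H1Approx.exists_isTrace (hv : H1Approx (interior (hull K)) v G) :
    ∃ τ, IsTrace (interior (hull K)) v τ := by
  obtain ⟨ψ, hψ, h1, h2⟩ := hv.approx
  obtain ⟨C, hC, hle⟩ := hK.eLpNorm_frontier_sub_le hd
  have h3 := ENNReal.Tendsto.const_mul (tendsto_h1Dist h1 h2) (a := C) (Or.inr hC)
  rw [mul_zero] at h3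
  obtain ⟨τ, hτ, h4⟩ := TendstoL2.exists_of_cauchy
    (fun n => hK.memLp_frontier hd (hψ n).continuous) (f := ψ) (fun ε hε => by
      obtain ⟨N, hN⟩ := eventually_atTop.1 (h3.eventually_lt_const (ENNReal.half_pos hε.ne'))
      refine ⟨N, fun n hn m hm => ?_⟩
      refine (hle v G _ _ hv.memLp.1 (fun i => (hv.memLp_grad i).1) (hψ n) (hψ m)).trans_lt ?_
      rw [mul_add, ← ENNReal.add_halves ε]
      exact ENNReal.add_lt_add (hN n hn) (hN m hm))
  exact ⟨τ, hv.memLp, hτ, G, hv.memLp_grad, hv.weak, ψ, hψ, h1, h2, h4⟩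

/-- All smooth approximations converge to the trace. -/
lemma IsTrace.tendsto {τ : Space d → ℝ} (hτ : IsTrace (interior (hull K)) v τ)
    (hG : ∀ i, IsWeakDeriv (interior (hull K)) i v (G i)) {ψ : ℕ → Space d → ℝ}
    (hψ : ∀ n, ContDiff ℝ ∞ (ψ n)) (h1 : TendstoL2 (volume.restrict (interior (hull K))) ψ v)
    (h2 : ∀ i, TendstoL2 (volume.restrict (interior (hull K))) (fun n => pderiv i (ψ n)) (G i)) :
    TendstoL2 (μHE[d - 1].restrict (frontier (interior (hull K)))) ψ τ := by
  obtain ⟨hv, hτm, G', hG'm, hG', χ, hχ, h3, h4, h5⟩ := hτ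
  obtain ⟨C, hC, hle⟩ := hK.eLpNorm_frontier_sub_le hd
  -- The gradient that occurs in the definition of the trace may differ from `G`, but only on a null
  -- set, by uniqueness of weak derivatives.
  have h2' : ∀ i, TendstoL2 (volume.restrict (interior (hull K)))
      (fun n => pderiv i (ψ n)) (G' i) := fun i =>
    (h2 i).congr (fun n => EventuallyEq.rfl) ((hG i).ae_eq isOpen_interior (hG' i))
  have h6 := ENNReal.Tendsto.const_mul ((tendsto_h1Dist h1 h2').add
    (tendsto_h1Dist (G := G') h3 h4)) (a := C) (Or.inr hC)
  rw [add_zero, mul_zero] at h6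
  have h7 := h6.add h5
  rw [add_zero] at h7
  refine tendsto_of_le_of_tendsto_zero h7 fun n => ?_
  refine le_trans ?_ (add_le_add_left (hle v G' _ _ hv.1 (fun i => (hG'm i).1) (hψ n) (hχ n)) _)
  refine le_trans (le_of_eq ?_) (eLpNorm_add_le
    ((hψ n).continuous.aestronglyMeasurable.sub (hχ n).continuous.aestronglyMeasurable)
    ((hχ n).continuous.aestronglyMeasurable.sub hτm.1) (by norm_num))
  congr 1
  funext x
  simp

lemma H1Approx.isTrace_trace (hv : H1Approx (interior (hull K)) v G) :
    IsTrace (interior (hull K)) v (trace (interior (hull K)) v) := by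
  have h := hv.exists_isTrace hd hK
  rw [trace, dif_pos h]
  exact h.choose_spec

lemma H1Approx.memLp_trace (hv : H1Approx (interior (hull K)) v G) :
    MemLp (trace (interior (hull K)) v) 2 (μHE[d - 1].restrict (frontier (interior (hull K)))) :=
  (hv.isTrace_trace hd hK).2.1

lemma H1Approx.tendsto_trace (hv : H1Approx (interior (hull K)) v G) {ψ : ℕ → Space d → ℝ}
    (hψ : ∀ n, ContDiff ℝ ∞ (ψ n)) (h1 : TendstoL2 (volume.restrict (interior (hull K))) ψ v)
    (h2 : ∀ i, TendstoL2 (volume.restrict (interior (hull K))) (fun n => pderiv i (ψ n)) (G i)) :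
    TendstoL2 (μHE[d - 1].restrict (frontier (interior (hull K)))) ψ
      (trace (interior (hull K)) v) :=
  (hv.isTrace_trace hd hK).tendsto hd hK hv.weak hψ h1 h2

/-- If smooth approximations converge on the boundary, then the limit is the trace. -/
lemma H1Approx.trace_ae_eq (hv : H1Approx (interior (hull K)) v G) {ψ : ℕ → Space d → ℝ}
    {τ : Space d → ℝ}
    (hψ : ∀ n, ContDiff ℝ ∞ (ψ n)) (h1 : TendstoL2 (volume.restrict (interior (hull K))) ψ v)
    (h2 : ∀ i, TendstoL2 (volume.restrict (interior (hull K))) (fun n => pderiv i (ψ n)) (G i))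
    {s : Set (Space d)} (hs : s ⊆ frontier (interior (hull K)))
    (hτ : AEStronglyMeasurable τ (μHE[d - 1].restrict s))
    (h3 : TendstoL2 (μHE[d - 1].restrict s) ψ τ) :
    trace (interior (hull K)) v =ᵐ[μHE[d - 1].restrict s] τ := by
  have hle : (μHE[d - 1] : Measure (Space d)).restrict s ≤
      μHE[d - 1].restrict (frontier (interior (hull K))) := Measure.restrict_mono hs le_rfl
  exact ((hv.tendsto_trace hd hK hψ h1 h2).mono_measure hle).unique h3
    (fun n => (hψ n).continuous.aestronglyMeasurable)
    ((hv.memLp_trace hd hK).1.mono_measure hle) hτ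

omit hd hK in
lemma H1Approx.sub {U : Set (Space d)} (hv : H1Approx U v G) (hw : H1Approx U w H) :
    H1Approx U (fun x => v x - w x) (fun i x => G i x - H i x) := by
  obtain ⟨ψ, hψ, h1, h2⟩ := hv.approx
  obtain ⟨χ, hχ, h3, h4⟩ := hw.approx
  refine ⟨fun i => (hv.weak i).sub (hw.weak i), hv.memLp.sub hw.memLp,
    fun i => (hv.memLp_grad i).sub (hw.memLp_grad i), fun n x => ψ n x - χ n x,
    fun n => (hψ n).sub (hχ n), ?_, fun i => ?_⟩
  · exact h1.sub h3 (fun n => (hψ n).continuous.aestronglyMeasurable) hv.memLp.1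
      (fun n => (hχ n).continuous.aestronglyMeasurable) hw.memLp.1
  · have := (h2 i).sub (h4 i) (fun n => (continuous_pderiv (hψ n) i).aestronglyMeasurable)
      (hv.memLp_grad i).1 (fun n => (continuous_pderiv (hχ n) i).aestronglyMeasurable)
      (hw.memLp_grad i).1
    refine this.congr (fun n => ?_) EventuallyEq.rfl
    rw [pderiv_sub (hψ n) (hχ n)]

lemma H1Approx.trace_sub (hv : H1Approx (interior (hull K)) v G)
    (hw : H1Approx (interior (hull K)) w H) :
    trace (interior (hull K)) (fun x => v x - w x)
      =ᵐ[μHE[d - 1].restrict (frontier (interior (hull K)))]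
      fun x => trace (interior (hull K)) v x - trace (interior (hull K)) w x := by
  obtain ⟨ψ, hψ, h1, h2⟩ := hv.approx
  obtain ⟨χ, hχ, h3, h4⟩ := hw.approx
  have m1 := fun n => (hψ n).continuous.aestronglyMeasurable (μ := volume.restrict (interior (hull K)))
  have m2 := fun n => (hχ n).continuous.aestronglyMeasurable (μ := volume.restrict (interior (hull K)))
  refine (hv.sub hw).trace_ae_eq hd hK (ψ := fun n x => ψ n x - χ n x)
    (fun n => (hψ n).sub (hχ n)) (h1.sub h3 m1 hv.memLp.1 m2 hw.memLp.1) (fun i => ?_) le_rfl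
    ((hv.memLp_trace hd hK).1.sub (hw.memLp_trace hd hK).1)
    ((hv.tendsto_trace hd hK hψ h1 h2).sub (hw.tendsto_trace hd hK hχ h3 h4)
      (fun n => (hψ n).continuous.aestronglyMeasurable) (hv.memLp_trace hd hK).1
      (fun n => (hχ n).continuous.aestronglyMeasurable) (hw.memLp_trace hd hK).1)
  have := (h2 i).sub (h4 i) (fun n => (continuous_pderiv (hψ n) i).aestronglyMeasurable)
      (hv.memLp_grad i).1 (fun n => (continuous_pderiv (hχ n) i).aestronglyMeasurable)
      (hw.memLp_grad i).1
  refine this.congr (fun n => ?_) EventuallyEq.rfl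
  rw [pderiv_sub (hψ n) (hχ n)]

/-- The quantitative trace inequality. -/
lemma H1Approx.integral_trace_sq_le [DecidableEq (Space d)]
    (hv : H1Approx (interior (hull K)) v G) {z : Space d} (hz : z ∈ K) :
    volume.real (hull K) *
      (∫ y in hull (K.erase z), trace (interior (hull K)) v y ^ 2 ∂μHE[d - 1]) ≤
    4 * 2 ^ (d - 1) * (μHE[d - 1] : Measure (Space d)).real (hull (K.erase z)) *
      ((∫ x in interior (hull K), v x ^ 2) +
        Metric.diam (hull K) ^ 2 * ∑ i, ∫ x in interior (hull K), G i x ^ 2) := by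
  obtain ⟨ψ, hψ, h1, h2⟩ := hv.approx
  have hle : (μHE[d - 1] : Measure (Space d)).restrict (hull (K.erase z)) ≤
      μHE[d - 1].restrict (frontier (interior (hull K))) :=
    Measure.restrict_mono (hK.facet_subset_frontier hz) le_rfl
  have m0 : ∀ n, MemLp (ψ n) 2 (volume.restrict (interior (hull K))) :=
    fun n => memLp_interior_hull (hψ n).continuous K
  have m1 : ∀ n i, MemLp (pderiv i (ψ n)) 2 (volume.restrict (interior (hull K))) :=
    fun n i => memLp_interior_hull (continuous_pderiv (hψ n) i) K
  have t1 := ((hv.tendsto_trace hd hK hψ h1 h2).mono_measure hle).tendsto_integral_sq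
    (fun n => (hK.memLp_frontier hd (hψ n).continuous).mono_measure hle)
    ((hv.memLp_trace hd hK).mono_measure hle)
  have t2 := h1.tendsto_integral_sq m0 hv.memLp
  have t3 := tendsto_finsetSum Finset.univ fun i _ =>
    (h2 i).tendsto_integral_sq (fun n => m1 n i) (hv.memLp_grad i)
  refine le_of_tendsto_of_tendsto' (t1.const_mul _) ((t2.add (t3.const_mul _)).const_mul _)
    fun n => ?_
  have := hK.trace_inequality hd hz (hψ n)
  simp only [gradSq] at this
  rwa [integral_add (m0 n).integrable_sq ((integrable_finsetSum _ fun i _ =>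
    (m1 n i).integrable_sq).const_mul _), integral_const_mul,
    integral_finsetSum _ fun i _ => (m1 n i).integrable_sq] at this

end trace

/-! ### Quadratic Lagrange interpolation on a simplex -/

/-- The quadratic Lagrange interpolant, with the vertices and midpoints of edges as nodes. -/
def interp {d : ℕ} (K : Finset (Space d)) (v : Space d → ℝ) (x : Space d) : ℝ :=
  -- The double sum runs over ordered pairs including the diagonal, where the midpoint is a vertex.
  -- Collecting terms yields the usual basis: `4 λ_z λ_y` for the midpoint of the edge between `z`
  -- and `y`, and `λ_z (2 λ_z - 1)` for the vertex `z`.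
  2 * (∑ z ∈ K, ∑ y ∈ K, v ((1 / 2 : ℝ) • z + (1 / 2 : ℝ) • y) * (bary K z x * bary K y x)) -
    ∑ z ∈ K, v z * bary K z x

section interp
variable {d : ℕ} {K : Finset (Space d)} {v w : Space d → ℝ} {x : Space d}

lemma interp_sub (K : Finset (Space d)) (v w : Space d → ℝ) (x : Space d) :
    interp K (fun y => v y - w y) x = interp K v x - interp K w x := by
  simp only [interp, sub_mul, Finset.sum_sub_distrib]
  ring

lemma contDiff_interp (K : Finset (Space d)) (v : Space d → ℝ) : ContDiff ℝ ∞ (interp K v) := by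
  have h := contDiff_bary K
  unfold interp
  refine (contDiff_const.mul (ContDiff.sum fun z _ => ContDiff.sum fun y _ =>
    contDiff_const.mul ((h z).mul (h y)))).sub (ContDiff.sum fun z _ => contDiff_const.mul (h z))

lemma pderiv_interp (K : Finset (Space d)) (v : Space d → ℝ) (i : Fin d) :
    pderiv i (interp K v) = fun x =>
      2 * (∑ z ∈ K, ∑ y ∈ K, v ((1 / 2 : ℝ) • z + (1 / 2 : ℝ) • y) *
        (bary K z x * baryGrad K y i + bary K y x * baryGrad K z i)) -
        ∑ z ∈ K, v z * baryGrad K z i := by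
  have h := contDiff_bary K
  have h1 : ∀ z y : Space d, ContDiff ℝ ∞ fun x =>
      v ((1 / 2 : ℝ) • z + (1 / 2 : ℝ) • y) * (bary K z x * bary K y x) := fun z y =>
    contDiff_const.mul ((h z).mul (h y))
  have h2 : ∀ z : Space d, ContDiff ℝ ∞ fun x => ∑ y ∈ K,
      v ((1 / 2 : ℝ) • z + (1 / 2 : ℝ) • y) * (bary K z x * bary K y x) := fun z =>
    ContDiff.sum fun y _ => h1 z y
  have h3 : ∀ z : Space d, ContDiff ℝ ∞ fun x => v z * bary K z x := fun z =>
    contDiff_const.mul (h z)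
  rw [show interp K v = fun x => 2 * (∑ z ∈ K, ∑ y ∈ K, v ((1 / 2 : ℝ) • z + (1 / 2 : ℝ) • y) *
    (bary K z x * bary K y x)) - ∑ z ∈ K, v z * bary K z x from rfl,
    pderiv_sub (contDiff_const.mul (ContDiff.sum fun z _ => h2 z)) (ContDiff.sum fun z _ => h3 z),
    pderiv_const_mul (ContDiff.sum fun z _ => h2 z), pderiv_sum _ _ fun z _ => h2 z,
    pderiv_sum _ _ fun z _ => h3 z]
  simp only [pderiv_sum _ _ fun y _ => h1 _ y, pderiv_const_mul ((h _).mul (h _)),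
    pderiv_const_mul (h _), pderiv_mul (h _) (h _), pderiv_bary]

lemma pderiv_pderiv_interp (K : Finset (Space d)) (v : Space d → ℝ) (i j : Fin d) :
    pderiv j (pderiv i (interp K v)) = fun _ =>
      2 * (∑ z ∈ K, ∑ y ∈ K, v ((1 / 2 : ℝ) • z + (1 / 2 : ℝ) • y) *
        (baryGrad K y i * baryGrad K z j + baryGrad K z i * baryGrad K y j)) := by
  have h := contDiff_bary K
  have h0 : ∀ z y : Space d, ContDiff ℝ ∞ fun x =>
      bary K z x * baryGrad K y i + bary K y x * baryGrad K z i := fun z y =>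
    ((h z).mul contDiff_const).add ((h y).mul contDiff_const)
  have h1 : ∀ z y : Space d, ContDiff ℝ ∞ fun x => v ((1 / 2 : ℝ) • z + (1 / 2 : ℝ) • y) *
      (bary K z x * baryGrad K y i + bary K y x * baryGrad K z i) := fun z y =>
    contDiff_const.mul (h0 z y)
  have h2 : ∀ z : Space d, ContDiff ℝ ∞ fun x => ∑ y ∈ K,
      v ((1 / 2 : ℝ) • z + (1 / 2 : ℝ) • y) *
      (bary K z x * baryGrad K y i + bary K y x * baryGrad K z i) := fun z =>
    ContDiff.sum fun y _ => h1 z y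
  rw [pderiv_interp, pderiv_sub (contDiff_const.mul (ContDiff.sum fun z _ => h2 z))
    contDiff_const, pderiv_const_mul (ContDiff.sum fun z _ => h2 z), pderiv_sum _ _ fun z _ => h2 z]
  simp only [pderiv_sum _ _ fun y _ => h1 _ y, pderiv_const_mul (h0 _ _),
    pderiv_add ((h _).mul contDiff_const) ((h _).mul contDiff_const),
    pderiv_mul (h _) contDiff_const, pderiv_bary, pderiv_const, mul_zero, zero_add, sub_zero]

namespace IsSimplex

/-- On the simplex the barycentric coordinates are nonnegative with sum one, so the double sum and
the single sum are both at most `M`; the constant is `2 + 1`. -/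
lemma abs_interp_le (hK : IsSimplex K) {M : ℝ} (hM : ∀ y ∈ hull K, |v y| ≤ M)
    (hx : x ∈ hull K) : |interp K v x| ≤ 3 * M := by
  have h0 := hK.mem_hull_iff.1 hx
  have h1 := hK.sum_bary x
  have hv : ∀ z ∈ K, |v z| ≤ M := fun z hz => hM z (subset_hull K hz)
  have hm : ∀ z ∈ K, ∀ y ∈ K, |v ((1 / 2 : ℝ) • z + (1 / 2 : ℝ) • y)| ≤ M := fun z hz y hy =>
    hM _ (convex_hull K (subset_hull K hz) (subset_hull K hy) (by norm_num) (by norm_num)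
      (by norm_num))
  have e1 : |∑ z ∈ K, ∑ y ∈ K, v ((1 / 2 : ℝ) • z + (1 / 2 : ℝ) • y) * (bary K z x * bary K y x)|
      ≤ M := by
    calc _ ≤ ∑ z ∈ K, ∑ y ∈ K, M * (bary K z x * bary K y x) := by
          refine (Finset.abs_sum_le_sum_abs _ _).trans (Finset.sum_le_sum fun z hz => ?_)
          refine (Finset.abs_sum_le_sum_abs _ _).trans (Finset.sum_le_sum fun y hy => ?_)
          have h2 := mul_nonneg (h0 z hz) (h0 y hy)
          rw [abs_mul, abs_of_nonneg h2]
          exact mul_le_mul_of_nonneg_right (hm z hz y hy) h2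
      _ = M := by
          simp only [← Finset.mul_sum, h1, mul_one]
  have e2 : |∑ z ∈ K, v z * bary K z x| ≤ M := by
    calc _ ≤ ∑ z ∈ K, M * bary K z x := by
          refine (Finset.abs_sum_le_sum_abs _ _).trans (Finset.sum_le_sum fun z hz => ?_)
          rw [abs_mul, abs_of_nonneg (h0 z hz)]
          exact mul_le_mul_of_nonneg_right (hv z hz) (h0 z hz)
      _ = M := by rw [← Finset.mul_sum, h1, mul_one]
  rw [abs_le] at e1 e2 ⊢
  constructor <;> simp only [interp] <;> linarith [e1.1, e1.2, e2.1, e2.2]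

/-- In each term one factor is a coordinate, which sums to one, and the other is a gradient entry,
summed over `d + 1` vertices. The product rule makes the constant `2 * 2 + 1`. -/
lemma abs_pderiv_interp_le (hK : IsSimplex K) {M β : ℝ} (hM : ∀ y ∈ hull K, |v y| ≤ M)
    {i : Fin d} (hβ : ∀ z ∈ K, |baryGrad K z i| ≤ β) (hx : x ∈ hull K) :
    |pderiv i (interp K v) x| ≤ 5 * (d + 1) * β * M := by
  have h0 := hK.mem_hull_iff.1 hx
  have h1 := hK.sum_bary x
  have hc : (K.card : ℝ) = d + 1 := by rw [hK.card]; push_cast; rfl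
  have hv : ∀ z ∈ K, |v z| ≤ M := fun z hz => hM z (subset_hull K hz)
  have hM0 : 0 ≤ M := (abs_nonneg _).trans (hM x hx)
  have hm : ∀ z ∈ K, ∀ y ∈ K, |v ((1 / 2 : ℝ) • z + (1 / 2 : ℝ) • y)| ≤ M := fun z hz y hy =>
    hM _ (convex_hull K (subset_hull K hz) (subset_hull K hy) (by norm_num) (by norm_num)
      (by norm_num))
  have e1 : |∑ z ∈ K, ∑ y ∈ K, v ((1 / 2 : ℝ) • z + (1 / 2 : ℝ) • y) *
      (bary K z x * baryGrad K y i + bary K y x * baryGrad K z i)| ≤ 2 * (d + 1) * β * M := by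
    calc _ ≤ ∑ z ∈ K, ∑ y ∈ K, M * (bary K z x * β + bary K y x * β) := by
          refine (Finset.abs_sum_le_sum_abs _ _).trans (Finset.sum_le_sum fun z hz => ?_)
          refine (Finset.abs_sum_le_sum_abs _ _).trans (Finset.sum_le_sum fun y hy => ?_)
          rw [abs_mul]
          refine mul_le_mul (hm z hz y hy) ((abs_add_le _ _).trans ?_) (abs_nonneg _) hM0
          rw [abs_mul, abs_mul, abs_of_nonneg (h0 z hz), abs_of_nonneg (h0 y hy)]
          exact add_le_add (mul_le_mul_of_nonneg_left (hβ y hy) (h0 z hz))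
            (mul_le_mul_of_nonneg_left (hβ z hz) (h0 y hy))
      _ = _ := by
          simp only [← Finset.mul_sum, Finset.sum_add_distrib, ← Finset.sum_mul, h1,
            Finset.sum_const, nsmul_eq_mul, hc]
          ring
  have e2 : |∑ z ∈ K, v z * baryGrad K z i| ≤ (d + 1) * β * M := by
    calc _ ≤ ∑ z ∈ K, M * β := by
          refine (Finset.abs_sum_le_sum_abs _ _).trans (Finset.sum_le_sum fun z hz => ?_)
          rw [abs_mul]
          exact mul_le_mul (hv z hz) (hβ z hz) (abs_nonneg _) hM0
      _ = _ := by rw [Finset.sum_const, nsmul_eq_mul, hc]; ring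
  rw [pderiv_interp]
  rw [abs_le] at e1 e2 ⊢
  constructor <;> linarith [e1.1, e1.2, e2.1, e2.2]

/-- The second derivatives are constant and only involve products of two gradient entries, over `(d
+ 1)²` pairs of vertices; hence `x` is arbitrary. -/
lemma abs_pderiv_pderiv_interp_le (hK : IsSimplex K) {M β : ℝ} (hM : ∀ y ∈ hull K, |v y| ≤ M)
    (hβ : ∀ z ∈ K, ∀ i, |baryGrad K z i| ≤ β) (i j : Fin d) (x : Space d) :
    |pderiv j (pderiv i (interp K v)) x| ≤ 4 * (d + 1) ^ 2 * β ^ 2 * M := by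
  have hc : (K.card : ℝ) = d + 1 := by rw [hK.card]; push_cast; rfl
  obtain ⟨z₀, hz₀⟩ : K.Nonempty := Finset.card_pos.1 (by rw [hK.card]; omega)
  have hM0 : 0 ≤ M := (abs_nonneg _).trans (hM z₀ (subset_hull K hz₀))
  have hβ0 : 0 ≤ β := (abs_nonneg _).trans (hβ z₀ hz₀ i)
  have hm : ∀ z ∈ K, ∀ y ∈ K, |v ((1 / 2 : ℝ) • z + (1 / 2 : ℝ) • y)| ≤ M := fun z hz y hy =>
    hM _ (convex_hull K (subset_hull K hz) (subset_hull K hy) (by norm_num) (by norm_num)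
      (by norm_num))
  rw [pderiv_pderiv_interp]
  have e1 : |∑ z ∈ K, ∑ y ∈ K, v ((1 / 2 : ℝ) • z + (1 / 2 : ℝ) • y) *
      (baryGrad K y i * baryGrad K z j + baryGrad K z i * baryGrad K y j)| ≤
      2 * (d + 1) ^ 2 * β ^ 2 * M := by
    calc _ ≤ ∑ z ∈ K, ∑ y ∈ K, M * (β * β + β * β) := by
          refine (Finset.abs_sum_le_sum_abs _ _).trans (Finset.sum_le_sum fun z hz => ?_)
          refine (Finset.abs_sum_le_sum_abs _ _).trans (Finset.sum_le_sum fun y hy => ?_)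
          rw [abs_mul]
          refine mul_le_mul (hm z hz y hy) ((abs_add_le _ _).trans ?_) (abs_nonneg _) hM0
          rw [abs_mul, abs_mul]
          exact add_le_add (mul_le_mul (hβ y hy i) (hβ z hz j) (abs_nonneg _) hβ0)
            (mul_le_mul (hβ z hz i) (hβ y hy j) (abs_nonneg _) hβ0)
      _ = _ := by
          simp only [Finset.sum_const, nsmul_eq_mul, hc]
          ring
  rw [abs_mul, abs_two]
  linarith

/-- Quadratic polynomials are reproduced. -/
lemma interp_quadratic (hK : IsSimplex K) (c : ℝ) (g : Fin d → ℝ) (B : Fin d → Fin d → ℝ)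
    (x : Space d) :
    interp K (fun x => c + ∑ i, g i * x i + ∑ i, ∑ j, B i j * (x i * x j)) x =
      c + ∑ i, g i * x i + ∑ i, ∑ j, B i j * (x i * x j) := by
  set a := fun z => bary K z x with ha
  have h1 : ∑ z ∈ K, a z = 1 := hK.sum_bary x
  have hx : ∀ i, ∑ z ∈ K, a z * z i = x i := fun i => by
    conv_rhs => rw [← hK.sum_bary_smul x]
    simp [ha]
  let l : Space d → ℝ := fun y => c + ∑ i, g i * y i
  let β : Space d → Space d → ℝ := fun y z => ∑ i, ∑ j, B i j * (y i * z j)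
  have hl : ∑ z ∈ K, l z * a z = l x := by
    simp only [l, add_mul, Finset.sum_add_distrib, ← Finset.mul_sum, h1, Finset.sum_mul]
    rw [mul_one, Finset.sum_comm]
    congr 1
    refine Finset.sum_congr rfl fun i _ => ?_
    rw [← hx i, Finset.mul_sum]
    exact Finset.sum_congr rfl fun z _ => by ring
  have hβ1 : ∀ y, ∑ z ∈ K, β y z * a z = β y x := fun y => by
    simp only [β, Finset.sum_mul]
    rw [Finset.sum_comm]
    refine Finset.sum_congr rfl fun i _ => ?_
    rw [Finset.sum_comm]
    refine Finset.sum_congr rfl fun j _ => ?_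
    rw [← hx j, Finset.mul_sum, Finset.mul_sum]
    exact Finset.sum_congr rfl fun z _ => by ring
  have hβ2 : ∀ z, ∑ y ∈ K, β y z * a y = β x z := fun z => by
    simp only [β, Finset.sum_mul]
    rw [Finset.sum_comm]
    refine Finset.sum_congr rfl fun i _ => ?_
    rw [Finset.sum_comm]
    refine Finset.sum_congr rfl fun j _ => ?_
    rw [← hx i, Finset.sum_mul, Finset.mul_sum]
    exact Finset.sum_congr rfl fun z _ => by ring
  -- With `l` affine and `β` bilinear, the value at a midpoint separates into vertex terms and mixed
  -- terms. Since `x` is the barycentre of the vertices with weights `a`, the weighted mixed sums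
  -- become `β x x`, and the diagonal sums of `β y y` cancel against the correction term of the
  -- interpolant.
  have hmid : ∀ z y : Space d, l ((1 / 2 : ℝ) • z + (1 / 2 : ℝ) • y) +
      β ((1 / 2 : ℝ) • z + (1 / 2 : ℝ) • y) ((1 / 2 : ℝ) • z + (1 / 2 : ℝ) • y) =
      (1 / 2 * l z + 1 / 4 * β z z) + (1 / 2 * l y + 1 / 4 * β y y) + 1 / 4 * β z y
        + 1 / 4 * β y z := by
    intro z y
    have e1 : l ((1 / 2 : ℝ) • z + (1 / 2 : ℝ) • y) = 1 / 2 * l z + 1 / 2 * l y := by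
      have : ∑ i, g i * ((1 / 2 : ℝ) • z + (1 / 2 : ℝ) • y) i =
          1 / 2 * ∑ i, g i * z i + 1 / 2 * ∑ i, g i * y i := by
        rw [Finset.mul_sum, Finset.mul_sum, ← Finset.sum_add_distrib]
        refine Finset.sum_congr rfl fun i _ => ?_
        simp only [PiLp.add_apply, PiLp.smul_apply, smul_eq_mul]
        ring
      simp only [l, this]
      ring
    have e2 : β ((1 / 2 : ℝ) • z + (1 / 2 : ℝ) • y) ((1 / 2 : ℝ) • z + (1 / 2 : ℝ) • y) =
        1 / 4 * β z z + 1 / 4 * β y y + 1 / 4 * β z y + 1 / 4 * β y z := by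
      simp only [β, Finset.mul_sum, ← Finset.sum_add_distrib]
      refine Finset.sum_congr rfl fun i _ => Finset.sum_congr rfl fun j _ => ?_
      simp only [PiLp.add_apply, PiLp.smul_apply, smul_eq_mul]
      ring
    rw [e1, e2]
    ring
  have hin : ∀ z, ∑ y ∈ K, (l ((1 / 2 : ℝ) • z + (1 / 2 : ℝ) • y) +
      β ((1 / 2 : ℝ) • z + (1 / 2 : ℝ) • y) ((1 / 2 : ℝ) • z + (1 / 2 : ℝ) • y)) * (a z * a y) =
      a z * ((1 / 2 * l z + 1 / 4 * β z z) + (1 / 2 * l x + 1 / 4 * ∑ y ∈ K, β y y * a y) +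
        1 / 4 * β z x + 1 / 4 * β x z) := by
    intro z
    have e : ∀ y, (l ((1 / 2 : ℝ) • z + (1 / 2 : ℝ) • y) +
        β ((1 / 2 : ℝ) • z + (1 / 2 : ℝ) • y) ((1 / 2 : ℝ) • z + (1 / 2 : ℝ) • y)) * (a z * a y) =
        a z * ((1 / 2 * l z + 1 / 4 * β z z) * a y + 1 / 2 * (l y * a y) + 1 / 4 * (β y y * a y) +
        1 / 4 * (β z y * a y) + 1 / 4 * (β y z * a y)) := fun y => by rw [hmid]; ring
    simp only [e, Finset.sum_add_distrib, ← Finset.mul_sum, hl, h1, hβ1, hβ2]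
    ring
  have hout : ∑ z ∈ K, a z * ((1 / 2 * l z + 1 / 4 * β z z) +
      (1 / 2 * l x + 1 / 4 * ∑ y ∈ K, β y y * a y) + 1 / 4 * β z x + 1 / 4 * β x z) =
      l x + 1 / 2 * (∑ y ∈ K, β y y * a y) + 1 / 2 * β x x := by
    have e : ∀ z, a z * ((1 / 2 * l z + 1 / 4 * β z z) +
        (1 / 2 * l x + 1 / 4 * ∑ y ∈ K, β y y * a y) + 1 / 4 * β z x + 1 / 4 * β x z) =
        1 / 2 * (l z * a z) + 1 / 4 * (β z z * a z) +
        (1 / 2 * l x + 1 / 4 * ∑ y ∈ K, β y y * a y) * a z + 1 / 4 * (β z x * a z) +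
        1 / 4 * (β x z * a z) := fun z => by ring
    simp only [e, Finset.sum_add_distrib, ← Finset.mul_sum, hl, h1, hβ1, hβ2]
    ring
  change 2 * (∑ z ∈ K, ∑ y ∈ K, (l ((1 / 2 : ℝ) • z + (1 / 2 : ℝ) • y) +
      β ((1 / 2 : ℝ) • z + (1 / 2 : ℝ) • y) ((1 / 2 : ℝ) • z + (1 / 2 : ℝ) • y)) * (a z * a y)) -
    ∑ z ∈ K, (l z + β z z) * a z = l x + β x x
  rw [Finset.sum_congr rfl fun z _ => hin z, hout]
  simp only [add_mul, Finset.sum_add_distrib, hl]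
  ring

/-- A barycentric coordinate is affine with values in `[0, 1]` on the inscribed ball, so it changes
by at most `1` over a diameter of length `2 r` in direction `i`. -/
lemma abs_baryGrad_le (hK : IsSimplex K) {r : ℝ} (hr : 0 < r) {x₀ : Space d}
    (hball : Metric.closedBall x₀ r ⊆ hull K) {z : Space d} (hz : z ∈ K) (i : Fin d) :
    |baryGrad K z i| ≤ 1 / (2 * r) := by
  have h01 : ∀ y ∈ hull K, 0 ≤ bary K z y ∧ bary K z y ≤ 1 := by
    intro y hy
    have h0 := hK.mem_hull_iff.1 hy
    refine ⟨h0 z hz, ?_⟩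
    rw [← hK.sum_bary y]
    exact Finset.single_le_sum h0 hz
  have hmem : ∀ s : ℝ, |s| ≤ r → x₀ + EuclideanSpace.single i s ∈ hull K := fun s hs => by
    apply hball
    simpa [dist_eq_norm] using hs
  have hval : ∀ s : ℝ, bary K z (x₀ + EuclideanSpace.single i s) =
      bary K z x₀ + baryGrad K z i * s := by
    intro s
    rw [bary_eq_affine K z (x₀ + _), bary_eq_affine K z x₀]
    simp [mul_add, Finset.sum_add_distrib, add_assoc]
  have h1 := h01 _ (hmem r (abs_of_pos hr).le)
  have h2 := h01 _ (hmem (-r) (by rw [abs_neg, abs_of_pos hr]))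
  rw [hval] at h1 h2
  rw [le_div_iff₀ (by positivity)]
  have : |baryGrad K z i| * (2 * r) = |baryGrad K z i * (2 * r)| := by
    rw [abs_mul, abs_of_pos (by positivity : 0 < 2 * r)]
  rw [this, abs_le]
  constructor <;> linarith [h1.1, h1.2, h2.1, h2.2]

end IsSimplex

lemma pderiv_comm (hw : ContDiff ℝ ∞ w) (i j : Fin d) (x : Space d) :
    pderiv j (pderiv i w) x = pderiv i (pderiv j w) x := by
  have hs : IsSymmSndFDerivAt ℝ w x := hw.contDiffAt.isSymmSndFDerivAt (by
    simp only [minSmoothness_of_isRCLikeNormedField]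
    exact WithTop.coe_le_coe.2 (le_top : (2 : ℕ∞) ≤ ⊤))
  have hd : ∀ y : Space d, DifferentiableAt ℝ (fderiv ℝ w) y := fun y =>
    (hw.fderiv_right (m := ∞) (by simp)).differentiable (by simp) y
  have e : ∀ a b : Fin d, pderiv b (pderiv a w) x =
      fderiv ℝ (fderiv ℝ w) x (EuclideanSpace.single b 1) (EuclideanSpace.single a 1) := by
    intro a b
    have := (hd x).hasFDerivAt.clm_apply (hasFDerivAt_const (EuclideanSpace.single a (1 : ℝ)) x)
    rw [pderiv, show pderiv a w = fun y => fderiv ℝ w y (EuclideanSpace.single a 1) from rfl,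
      this.fderiv]
    simp
  rw [e, e]
  exact hs _ _

end interp

/-! ### The interpolation error -/

section error
variable {d : ℕ} {K : Finset (Space d)} {v w : Space d → ℝ} {x : Space d}

/-- A quadratic polynomial. -/
def quad (c : ℝ) (g : Fin d → ℝ) (A : Fin d → Fin d → ℝ) (x : Space d) : ℝ :=
  c + ∑ i, g i * x i + ∑ i, ∑ j, A i j / 2 * (x i * x j)

lemma contDiff_quad (c : ℝ) (g : Fin d → ℝ) (A : Fin d → Fin d → ℝ) :
    ContDiff ℝ ∞ (quad c g A) := by
  unfold quad
  fun_prop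

lemma pderiv_affine (c : ℝ) (g : Fin d → ℝ) (k : Fin d) :
    pderiv k (fun x : Space d => c + ∑ i, g i * x i) = fun _ => g k := by
  have h : ∀ i ∈ Finset.univ, ContDiff ℝ ∞ fun x : Space d => g i * x i :=
    fun i _ => contDiff_const.mul (contDiff_coord i)
  rw [pderiv_add contDiff_const (ContDiff.sum h), pderiv_sum _ _ h]
  funext x
  simp [pderiv_const, pderiv_const_mul (contDiff_coord _), pderiv_coord]

lemma pderiv_quad {A : Fin d → Fin d → ℝ} (hA : ∀ i j, A i j = A j i) (c : ℝ) (g : Fin d → ℝ)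
    (k : Fin d) : pderiv k (quad c g A) = fun x => g k + ∑ j, A k j * x j := by
  have h0 : ∀ i j, ContDiff ℝ ∞ fun x : Space d => x i * x j := fun i j =>
    (contDiff_coord i).mul (contDiff_coord j)
  have h1 : ∀ i j, ContDiff ℝ ∞ fun x : Space d => A i j / 2 * (x i * x j) := fun i j =>
    contDiff_const.mul (h0 i j)
  have h2 : ∀ i, ContDiff ℝ ∞ fun x : Space d => ∑ j, A i j / 2 * (x i * x j) := fun i =>
    ContDiff.sum fun j _ => h1 i j
  rw [show quad c g A = fun x => (c + ∑ i, g i * x i) + ∑ i, ∑ j, A i j / 2 * (x i * x j) from rfl,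
    pderiv_add (contDiff_const.add (ContDiff.sum fun i _ => contDiff_const.mul (contDiff_coord i)))
      (ContDiff.sum fun i _ => h2 i), pderiv_affine, pderiv_sum _ _ fun i _ => h2 i]
  funext x
  simp only [pderiv_sum _ _ fun j _ => h1 _ j, pderiv_const_mul (h0 _ _),
    pderiv_mul (contDiff_coord _) (contDiff_coord _), pderiv_coord]
  simp only [mul_add, Finset.sum_add_distrib, mul_ite, mul_one, mul_zero, Finset.sum_ite_eq',
    Finset.mem_univ, if_true]
  rw [Finset.sum_comm]
  simp only [Finset.sum_ite_eq', Finset.mem_univ, if_true]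
  rw [← Finset.sum_add_distrib]
  congr 1
  refine Finset.sum_congr rfl fun j _ => ?_
  rw [hA j k]
  ring

/-- The constant of the interpolation estimate on a simplex with diameter at most `s` times the
inradius. -/
def interpConst (d : ℕ) (s : ℝ) : ℝ :=
  80 + 2 * 2 ^ d + 50 * d * (d + 1) ^ 2 * s ^ 2 + 8 * d ^ 2 * (d + 1) ^ 4 * s ^ 4

lemma interpConst_pos (d : ℕ) (s : ℝ) : 0 < interpConst d s := by
  unfold interpConst; positivity

/-- Interpolation reproduces quadratics, so `w` can be replaced by `w` minus a quadratic polynomial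
with Hessian `A` and with affine part taken from the Bramble–Hilbert lemma. The difference is small
in the sup norm on `K`, and the interpolant of a function is controlled in all derivatives by its
sup norm and the inradius. The matrix `A` is left free: the error is measured by the distance of the
Hessian to constants rather than by third derivatives, and thus makes sense for `H²` functions. -/
theorem interp_error (hd : d ≤ 3) (hK : IsSimplex K) {r s : ℝ} (hr : 0 < r) {x₀ : Space d}
    (hball : Metric.closedBall x₀ r ⊆ hull K) (hs : Metric.diam (hull K) ≤ s * r)
    (hw : ContDiff ℝ ∞ w) {A : Fin d → Fin d → ℝ} (hA : ∀ i j, A i j = A j i) {N : ℝ}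
    (hN : N = ∫ y in hull K, ∑ i, ∑ j, (pderiv j (pderiv i w) y - A i j) ^ 2) :
    (∫ y in hull K, (w y - interp K w y) ^ 2) ≤ interpConst d s * Metric.diam (hull K) ^ 4 * N ∧
    (∫ y in hull K, gradSq (fun y => w y - interp K w y) y) ≤
      interpConst d s * Metric.diam (hull K) ^ 2 * N ∧
    (∫ y in hull K, hessSq (fun y => w y - interp K w y) y) ≤ interpConst d s * N := by
  set D := Metric.diam (hull K) with hD
  set V := volume.real (hull K) with hV
  have hV0 : 0 < V := hK.volume_real_pos
  have hD0 : 0 ≤ D := Metric.diam_nonneg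
  have hN0 : 0 ≤ N := hN ▸ integral_nonneg fun _ =>
    Finset.sum_nonneg fun _ _ => Finset.sum_nonneg fun _ _ => sq_nonneg _
  -- Subtracting the pure quadratic part shifts the Hessian by `A`. The symmetry of `A` enters here,
  -- because the Hessian of the quadratic form is the symmetric part of its matrix.
  set w1 : Space d → ℝ := fun x => w x - quad 0 (fun _ => 0) A x with hw1
  have hw1s : ContDiff ℝ ∞ w1 := hw.sub (contDiff_quad _ _ _)
  have hess1 : ∀ y, hessSq w1 y = ∑ i, ∑ j, (pderiv j (pderiv i w) y - A i j) ^ 2 := by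
    intro y
    refine Finset.sum_congr rfl fun i _ => Finset.sum_congr rfl fun j _ => ?_
    rw [hw1, pderiv_sub hw (contDiff_quad _ _ _), pderiv_quad hA, pderiv_sub (contDiff_pderiv hw i)
      (contDiff_const.add (ContDiff.sum fun i _ => contDiff_const.mul (contDiff_coord i))),
      pderiv_affine]
  have hNw : N = ∫ y in hull K, hessSq w1 y := by rw [hN]; simp only [hess1]
  obtain ⟨c, g, hsup, hgrad⟩ := exists_affine_approx hd (convex_hull K) (isCompact_hull K)
    (by exact hV0) hw1s
  rw [← hNw] at hsup hgrad
  let v : Space d → ℝ := fun x => w x - quad c g A x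
  have hv : ContDiff ℝ ∞ v := hw.sub (contDiff_quad _ _ _)
  have hve : ∀ x, v x = w1 x - (c + ∑ i, g i * x i) := fun x => by
    simp only [v, hw1, quad]; simp; ring
  have hvi : ∀ i, pderiv i v = fun x => pderiv i w1 x - g i := fun i => by
    rw [show v = fun x => w1 x - (c + ∑ i, g i * x i) from funext hve, pderiv_sub hw1s
      (contDiff_const.add (ContDiff.sum fun i _ => contDiff_const.mul (contDiff_coord i))),
      pderiv_affine]
  have hvij : ∀ i j, pderiv j (pderiv i v) = pderiv j (pderiv i w1) := fun i j => by
    rw [hvi, pderiv_sub (contDiff_pderiv hw1s i) contDiff_const, pderiv_const]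
    simp
  have hI : ContDiff ℝ ∞ (interp K v) := contDiff_interp K v
  have he : (fun y => w y - interp K w y) = fun y => v y - interp K v y := by
    funext y
    have h1 := interp_sub K w (quad c g A) y
    have h2 : interp K (quad c g A) y = quad c g A y :=
      hK.interp_quadratic c g (fun i j => A i j / 2) y
    simp only [v, h1, h2]
    ring
  -- The sup bound given by the affine approximation. It is used through `V * M² = 4 D⁴ N`, which
  -- trades sup norms on `K` for integrals.
  set M := Real.sqrt (4 * D ^ 4 * N / V) with hMdef
  have hM2 : M ^ 2 = 4 * D ^ 4 * N / V := Real.sq_sqrt (by positivity)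
  have hVM : V * M ^ 2 = 4 * D ^ 4 * N := by rw [hM2]; field_simp
  have hM : ∀ y ∈ hull K, |v y| ≤ M := by
    intro y hy
    refine Real.abs_le_sqrt ?_
    rw [le_div_iff₀' hV0, hve]
    exact hsup y hy
  -- The bound for the gradients of the barycentric coordinates. Each derivative of the interpolant
  -- costs a factor `β`, and `D * β ≤ s / 2` by shape regularity, so it costs one power of `1 / D`.
  set β := 1 / (2 * r) with hβdef
  have hβ : ∀ z ∈ K, ∀ i, |baryGrad K z i| ≤ β := fun z hz i => hK.abs_baryGrad_le hr hball hz i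
  have hβ0 : 0 < β := by positivity
  have hDβ : D * β ≤ s / 2 := by
    rw [hβdef, mul_one_div, div_le_iff₀ (by positivity)]; linarith
  have hDβ0 : 0 ≤ D * β := by positivity
  have hsq : (D * β) ^ 2 ≤ s ^ 2 / 4 := by
    have := pow_le_pow_left₀ hDβ0 hDβ 2; linarith [this, show (s / 2) ^ 2 = s ^ 2 / 4 by ring]
  have hqu : (D * β) ^ 4 ≤ s ^ 4 / 16 := by
    have := pow_le_pow_left₀ hDβ0 hDβ 4; linarith [this, show (s / 2) ^ 4 = s ^ 4 / 16 by ring]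
  have ion : ∀ {f : Space d → ℝ}, Continuous f → IntegrableOn f (hull K) := fun hf =>
    hf.continuousOn.integrableOn_compact (isCompact_hull K)
  have two : ∀ a b : ℝ, (a - b) ^ 2 ≤ 2 * a ^ 2 + 2 * b ^ 2 := fun a b => by
    nlinarith [sq_nonneg (a + b)]
  have hes : ContDiff ℝ ∞ fun y => v y - interp K v y := hv.sub hI
  have hconst : ∀ c : ℝ, ∫ _ in hull K, c = V * c := fun c => by
    rw [setIntegral_const, smul_eq_mul]
  have he' : ∀ y, w y - interp K w y = v y - interp K v y := congrFun he
  simp only [he']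
  refine ⟨?_, ?_, ?_⟩
  · have h1 : ∫ y in hull K, (v y - interp K v y) ^ 2 ≤ ∫ _ in hull K, 20 * M ^ 2 := by
      refine setIntegral_mono_on (ion (hes.continuous.pow 2)) (ion continuous_const)
        (measurableSet_hull K) fun y hy => ?_
      have a1 := hM y hy
      have a2 := hK.abs_interp_le hM hy
      have a3 : v y ^ 2 ≤ M ^ 2 := sq_le_sq' (abs_le.1 a1).1 (abs_le.1 a1).2
      have a4 : interp K v y ^ 2 ≤ (3 * M) ^ 2 := sq_le_sq' (abs_le.1 a2).1 (abs_le.1 a2).2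
      have := two (v y) (interp K v y)
      nlinarith
    rw [hconst] at h1
    have h2 : V * (20 * M ^ 2) = 80 * (D ^ 4 * N) := by linear_combination 20 * hVM
    have h3 : (80 : ℝ) ≤ interpConst d s := by
      unfold interpConst
      have : 0 ≤ 2 * 2 ^ d + 50 * d * (d + 1) ^ 2 * s ^ 2 + 8 * d ^ 2 * (d + 1) ^ 4 * s ^ 4 := by
        positivity
      linarith
    rw [mul_assoc]
    exact h1.trans (h2.le.trans (mul_le_mul_of_nonneg_right h3 (by positivity)))
  · set b := 5 * (d + 1) * β * M with hb
    have h1 : ∫ y in hull K, gradSq (fun y => v y - interp K v y) y ≤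
        ∫ y in hull K, (2 * (∑ i, (pderiv i w1 y - g i) ^ 2) + 2 * (d * b ^ 2)) := by
      refine setIntegral_mono_on (ion (continuous_gradSq hes)) (ion ?_)
        (measurableSet_hull K) fun y hy => ?_
      · have := fun i => continuous_pderiv hw1s i
        fun_prop
      have hcard : (d : ℝ) * b ^ 2 = ∑ _i : Fin d, b ^ 2 := by simp
      rw [hcard, Finset.mul_sum, Finset.mul_sum, ← Finset.sum_add_distrib, gradSq]
      refine Finset.sum_le_sum fun i _ => ?_
      rw [pderiv_sub hv hI, hvi]
      have a2 := hK.abs_pderiv_interp_le hM (fun z hz => hβ z hz i) hy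
      have a4 : pderiv i (interp K v) y ^ 2 ≤ b ^ 2 := sq_le_sq' (abs_le.1 a2).1 (abs_le.1 a2).2
      have := two (pderiv i w1 y - g i) (pderiv i (interp K v) y)
      linarith
    have hc1 : Continuous fun y => ∑ i, (pderiv i w1 y - g i) ^ 2 := by
      have := fun i => continuous_pderiv hw1s i
      fun_prop
    rw [integral_add ((ion hc1).const_mul 2) (ion continuous_const), hconst,
      integral_const_mul] at h1
    -- Here `200 = 2 * 25 * 4`, and `(D β)² ≤ s² / 4` reduces it to the coefficient `50` in
    -- `interpConst`. In the same way `128 / 16 = 8` for the second derivatives.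
    have h2 : V * (2 * (d * b ^ 2)) = 200 * d * (d + 1) ^ 2 * (D * β) ^ 2 * (D ^ 2 * N) := by
      rw [hb]; linear_combination 50 * d * (d + 1) ^ 2 * β ^ 2 * hVM
    have h3 : 200 * d * (d + 1) ^ 2 * (D * β) ^ 2 * (D ^ 2 * N) ≤
        200 * d * (d + 1) ^ 2 * (s ^ 2 / 4) * (D ^ 2 * N) := by gcongr
    have h4 : 0 ≤ (80 + 8 * d ^ 2 * (d + 1) ^ 4 * s ^ 4) * (D ^ 2 * N) := by positivity
    have h5 : interpConst d s * D ^ 2 * N = 2 * (2 ^ d * D ^ 2 * N) +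
        200 * d * (d + 1) ^ 2 * (s ^ 2 / 4) * (D ^ 2 * N) +
        (80 + 8 * d ^ 2 * (d + 1) ^ 4 * s ^ 4) * (D ^ 2 * N) := by unfold interpConst; ring
    linarith
  · set b := 4 * (d + 1) ^ 2 * β ^ 2 * M with hb
    have h1 : ∫ y in hull K, hessSq (fun y => v y - interp K v y) y ≤
        ∫ y in hull K, (2 * hessSq w1 y + 2 * (d ^ 2 * b ^ 2)) := by
      refine setIntegral_mono_on (ion (continuous_hessSq hes)) (ion ?_)
        (measurableSet_hull K) fun y hy => ?_
      · exact (continuous_const.mul (continuous_hessSq hw1s)).add continuous_const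
      have hcard : (d : ℝ) ^ 2 * b ^ 2 = ∑ _i : Fin d, ∑ _j : Fin d, b ^ 2 := by
        simp; ring
      rw [hcard, hessSq, hessSq, Finset.mul_sum, Finset.mul_sum, ← Finset.sum_add_distrib]
      refine Finset.sum_le_sum fun i _ => ?_
      rw [Finset.mul_sum, Finset.mul_sum, ← Finset.sum_add_distrib]
      refine Finset.sum_le_sum fun j _ => ?_
      rw [pderiv_sub hv hI, pderiv_sub (contDiff_pderiv hv i) (contDiff_pderiv hI i), hvij]
      have a2 := hK.abs_pderiv_pderiv_interp_le hM hβ i j y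
      have a4 : pderiv j (pderiv i (interp K v)) y ^ 2 ≤ b ^ 2 :=
        sq_le_sq' (abs_le.1 a2).1 (abs_le.1 a2).2
      have := two (pderiv j (pderiv i w1) y) (pderiv j (pderiv i (interp K v)) y)
      linarith
    rw [integral_add ((ion (continuous_hessSq hw1s)).const_mul 2) (ion continuous_const), hconst,
      integral_const_mul, ← hNw] at h1
    have h2 : V * (2 * (d ^ 2 * b ^ 2)) = 128 * d ^ 2 * (d + 1) ^ 4 * (D * β) ^ 4 * N := by
      rw [hb]; linear_combination 32 * d ^ 2 * (d + 1) ^ 4 * β ^ 4 * hVM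
    have h3 : 128 * d ^ 2 * (d + 1) ^ 4 * (D * β) ^ 4 * N ≤
        128 * d ^ 2 * (d + 1) ^ 4 * (s ^ 4 / 16) * N := by gcongr
    have h4 : 0 ≤ (78 + 2 * 2 ^ d + 50 * d * (d + 1) ^ 2 * s ^ 2) * N := by positivity
    have h5 : interpConst d s * N = 2 * N + 128 * d ^ 2 * (d + 1) ^ 4 * (s ^ 4 / 16) * N +
        (78 + 2 * 2 ^ d + 50 * d * (d + 1) ^ 2 * s ^ 2) * N := by unfold interpConst; ring
    linarith

end error

/-! ### Limits of smooth functions in `H²` -/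

/-- The smooth functions `ψ n` converge in `H²(U)` to `v`, with gradient `G` and Hessian `H`. -/
structure H2Limit {d : ℕ} (U : Set (Space d)) (ψ : ℕ → Space d → ℝ) (v : Space d → ℝ)
    (G : Fin d → Space d → ℝ) (H : Fin d → Fin d → Space d → ℝ) : Prop where
  smooth : ∀ n, ContDiff ℝ ∞ (ψ n)
  memLp : MemLp v 2 (volume.restrict U)
  memLp_grad : ∀ i, MemLp (G i) 2 (volume.restrict U)
  memLp_hess : ∀ i j, MemLp (H i j) 2 (volume.restrict U)
  lim : TendstoL2 (volume.restrict U) ψ v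
  lim_grad : ∀ i, TendstoL2 (volume.restrict U) (fun n => pderiv i (ψ n)) (G i)
  lim_hess : ∀ i j, TendstoL2 (volume.restrict U) (fun n => pderiv j (pderiv i (ψ n))) (H i j)

section H2
variable {d : ℕ} {U V : Set (Space d)} {ψ χ : ℕ → Space d → ℝ} {v w : Space d → ℝ}
  {G G' : Fin d → Space d → ℝ} {H H' : Fin d → Fin d → Space d → ℝ} {K : Finset (Space d)}

namespace H2Limit

lemma mono (h : H2Limit U ψ v G H) (hV : V ⊆ U) : H2Limit V ψ v G H := by
  have hle : (volume : Measure (Space d)).restrict V ≤ volume.restrict U :=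
    Measure.restrict_mono hV le_rfl
  exact ⟨h.smooth, h.memLp.mono_measure hle, fun i => (h.memLp_grad i).mono_measure hle,
    fun i j => (h.memLp_hess i j).mono_measure hle, h.lim.mono_measure hle,
    fun i => (h.lim_grad i).mono_measure hle, fun i j => (h.lim_hess i j).mono_measure hle⟩

lemma sub (h : H2Limit U ψ v G H) (h' : H2Limit U χ w G' H') :
    H2Limit U (fun n x => ψ n x - χ n x) (fun x => v x - w x) (fun i x => G i x - G' i x)
      (fun i j x => H i j x - H' i j x) := by
  have c1 := fun n => (h.smooth n).continuous.aestronglyMeasurable (μ := volume.restrict U)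
  have c2 := fun n => (h'.smooth n).continuous.aestronglyMeasurable (μ := volume.restrict U)
  have d1 := fun n i => (continuous_pderiv (h.smooth n) i).aestronglyMeasurable
    (μ := volume.restrict U)
  have d2 := fun n i => (continuous_pderiv (h'.smooth n) i).aestronglyMeasurable
    (μ := volume.restrict U)
  have e1 := fun n i j => (continuous_pderiv (contDiff_pderiv (h.smooth n) i) j).aestronglyMeasurable
    (μ := volume.restrict U)
  have e2 := fun n i j => (continuous_pderiv (contDiff_pderiv (h'.smooth n) i) j).aestronglyMeasurable
    (μ := volume.restrict U)
  refine ⟨fun n => (h.smooth n).sub (h'.smooth n), h.memLp.sub h'.memLp,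
    fun i => (h.memLp_grad i).sub (h'.memLp_grad i),
    fun i j => (h.memLp_hess i j).sub (h'.memLp_hess i j),
    h.lim.sub h'.lim c1 h.memLp.1 c2 h'.memLp.1, fun i => ?_, fun i j => ?_⟩
  · simp only [fun n => pderiv_sub (h.smooth n) (h'.smooth n)]
    exact (h.lim_grad i).sub (h'.lim_grad i) (fun n => d1 n i) (h.memLp_grad i).1
      (fun n => d2 n i) (h'.memLp_grad i).1
  · simp only [fun n => pderiv_sub (h.smooth n) (h'.smooth n),
      fun n => pderiv_sub (contDiff_pderiv (h.smooth n) i) (contDiff_pderiv (h'.smooth n) i)]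
    exact (h.lim_hess i j).sub (h'.lim_hess i j) (fun n => e1 n i j) (h.memLp_hess i j).1
      (fun n => e2 n i j) (h'.memLp_hess i j).1

lemma h1Approx (h : H2Limit (interior (hull K)) ψ v G H) : H1Approx (interior (hull K)) v G :=
  ⟨fun i => IsWeakDeriv.of_tendsto (fun n => IsWeakDeriv.of_contDiff (h.smooth n) i) h.lim
    (h.lim_grad i) (fun n => memLp_interior_hull (h.smooth n).continuous K)
    (fun n => memLp_interior_hull (continuous_pderiv (h.smooth n) i) K) h.memLp (h.memLp_grad i),
    h.memLp, h.memLp_grad, ψ, h.smooth, h.lim, h.lim_grad⟩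

lemma h1Approx_grad (h : H2Limit (interior (hull K)) ψ v G H) (i : Fin d) :
    H1Approx (interior (hull K)) (G i) (H i) :=
  ⟨fun j => IsWeakDeriv.of_tendsto
    (fun n => IsWeakDeriv.of_contDiff (contDiff_pderiv (h.smooth n) i) j) (h.lim_grad i)
    (h.lim_hess i j) (fun n => memLp_interior_hull (continuous_pderiv (h.smooth n) i) K)
    (fun n => memLp_interior_hull (continuous_pderiv (contDiff_pderiv (h.smooth n) i) j) K)
    (h.memLp_grad i) (h.memLp_hess i j),
    h.memLp_grad i, h.memLp_hess i, fun n => pderiv i (ψ n),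
    fun n => contDiff_pderiv (h.smooth n) i, h.lim_grad i, h.lim_hess i⟩

/-- The interpolants converge if the functions converge uniformly. -/
lemma interpolants (hK : IsSimplex K) {ε : ℕ → ℝ}
    (hε : Tendsto ε atTop (𝓝 0)) (h : ∀ n, ∀ x ∈ hull K, |ψ n x - v x| ≤ ε n) :
    H2Limit (interior (hull K)) (fun n => interp K (ψ n)) (interp K v)
      (fun i => pderiv i (interp K v))
      (fun i j => pderiv j (pderiv i (interp K v))) := by
  have cI := contDiff_interp K
  obtain ⟨x₀, hx₀⟩ := hK.interior_nonempty
  obtain ⟨r, hr, hball⟩ := Metric.nhds_basis_closedBall.mem_iff.1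
    (mem_interior_iff_mem_nhds.1 hx₀)
  have hβ : ∀ z ∈ K, ∀ i, |baryGrad K z i| ≤ 1 / (2 * r) := fun z hz i =>
    hK.abs_baryGrad_le hr hball hz i
  have hfin : IsFiniteMeasure ((volume : Measure (Space d)).restrict (interior (hull K))) :=
    ⟨by simpa using (measure_mono interior_subset).trans_lt (isCompact_hull K).measure_lt_top⟩
  -- All derivatives of the interpolant depend linearly on the nodal values, so uniform convergence
  -- on the fixed element carries over to each of them. The constant may depend on the element.
  have key : ∀ (f : ℕ → Space d → ℝ) (g : Space d → ℝ) (C : ℝ),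
      (∀ n, ∀ x ∈ hull K, |f n x - g x| ≤ C * ε n) →
      TendstoL2 (volume.restrict (interior (hull K))) f g := by
    intro f g C hC
    have hε' : Tendsto (fun n => C * ε n) atTop (𝓝 0) := by simpa using hε.const_mul C
    exact TendstoL2.of_tendstoUniformly_bound hε' fun n =>
      ae_restrict_of_forall_mem isOpen_interior.measurableSet fun x hx =>
        hC n x (interior_subset hx)
  have e0 : ∀ n, (fun x => interp K (ψ n) x - interp K v x) =
      interp K fun y => ψ n y - v y := fun n =>
    funext fun x => (interp_sub K (ψ n) v x).symm
  have e1 : ∀ n i x, pderiv i (interp K (ψ n)) x - pderiv i (interp K v) x =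
      pderiv i (interp K fun y => ψ n y - v y) x := fun n i x => by
    rw [← e0, pderiv_sub (cI _) (cI _)]
  have e2 : ∀ n i j x, pderiv j (pderiv i (interp K (ψ n))) x -
      pderiv j (pderiv i (interp K v)) x =
      pderiv j (pderiv i (interp K fun y => ψ n y - v y)) x := fun n i j x => by
    rw [← e0, pderiv_sub (cI _) (cI _), pderiv_sub (contDiff_pderiv (cI _) i)
      (contDiff_pderiv (cI _) i)]
  refine ⟨fun n => cI _, memLp_interior_hull (cI v).continuous K,
    fun i => memLp_interior_hull (continuous_pderiv (cI v) i) K,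
    fun i j => memLp_interior_hull (continuous_pderiv (contDiff_pderiv (cI v) i) j) K,
    key _ _ 3 fun n x hx => ?_, fun i => key _ _ (5 * (d + 1) * (1 / (2 * r))) fun n x hx => ?_,
    fun i j => key _ _ (4 * (d + 1) ^ 2 * (1 / (2 * r)) ^ 2) fun n x hx => ?_⟩
  · rw [← interp_sub]
    exact hK.abs_interp_le (h n) hx
  · rw [e1]
    exact hK.abs_pderiv_interp_le (h n) (fun z hz => hβ z hz i) hx
  · rw [e2]
    exact hK.abs_pderiv_pderiv_interp_le (h n) hβ i j x

end H2Limit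

/-- The interpolation error for functions in `H²`. -/
theorem H2Limit.interp_error (hd : d ≤ 3) (hK : IsSimplex K) {r s : ℝ} (hr : 0 < r) {x₀ : Space d}
    (hball : Metric.closedBall x₀ r ⊆ hull K) (hs : Metric.diam (hull K) ≤ s * r)
    (h : H2Limit (interior (hull K)) ψ v G H) {vc : Space d → ℝ} {ε : ℕ → ℝ}
    (hε : Tendsto ε atTop (𝓝 0)) (hu : ∀ n, ∀ x ∈ hull K, |ψ n x - vc x| ≤ ε n)
    {A : Fin d → Fin d → ℝ} (hA : ∀ i j, A i j = A j i) {N : ℝ}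
    (hN : N = ∑ i, ∑ j, ∫ y in interior (hull K), (H i j y - A i j) ^ 2) :
    (∫ y in interior (hull K), (v y - interp K vc y) ^ 2) ≤
      interpConst d s * Metric.diam (hull K) ^ 4 * N ∧
    (∑ i, ∫ y in interior (hull K), (G i y - pderiv i (interp K vc) y) ^ 2) ≤
      interpConst d s * Metric.diam (hull K) ^ 2 * N ∧
    (∑ i, ∑ j, ∫ y in interior (hull K), (H i j y - pderiv j (pderiv i (interp K vc)) y) ^ 2) ≤
      interpConst d s * N := by
  have hI := H2Limit.interpolants hK hε hu
  have hE := h.sub hI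
  set μ := (volume : Measure (Space d)).restrict (interior (hull K)) with hμ
  have hmem : ∀ {f : Space d → ℝ}, Continuous f → MemLp f 2 μ := fun hf => memLp_interior_hull hf K
  have hc1 := fun n i => contDiff_pderiv (h.smooth n) i
  have hc2 := fun n i j => continuous_pderiv (hc1 n i) j
  have k1 := fun n i => contDiff_pderiv (hE.smooth n) i
  have k2 := fun n i j => continuous_pderiv (k1 n i) j
  -- Both sides of the estimate for smooth functions are continuous under convergence in `H²`,
  -- combined on the left with the uniform convergence that governs the interpolants.
  have tN : Tendsto (fun n => ∫ y in hull K, ∑ i, ∑ j, (pderiv j (pderiv i (ψ n)) y - A i j) ^ 2)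
      atTop (𝓝 N) := by
    have t1 := fun i j => ((h.lim_hess i j).sub (TendstoL2.const fun _ => A i j)
      (fun n => (hc2 n i j).aestronglyMeasurable) (h.memLp_hess i j).1
      (fun _ => aestronglyMeasurable_const) aestronglyMeasurable_const).tendsto_integral_sq
      (fun n => (hmem (hc2 n i j)).sub (hmem continuous_const))
      ((h.memLp_hess i j).sub (hmem continuous_const))
    have t2 := tendsto_finsetSum Finset.univ fun i _ => tendsto_finsetSum Finset.univ fun j _ =>
      t1 i j
    rw [hN]
    refine t2.congr fun n => ?_
    rw [← restrict_interior_hull, integral_finsetSum]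
    · refine Finset.sum_congr rfl fun i _ => ?_
      rw [integral_finsetSum]
      exact fun j _ => ((hmem (hc2 n i j)).sub (hmem continuous_const)).integrable_sq
    · exact fun i _ => integrable_finsetSum _ fun j _ =>
        ((hmem (hc2 n i j)).sub (hmem continuous_const)).integrable_sq
  have hest := fun n => IsaacsFEM.interp_error hd hK hr hball hs (h.smooth n) hA rfl
  refine ⟨?_, ?_, ?_⟩
  · have t1 := hE.lim.tendsto_integral_sq (fun n => hmem (hE.smooth n).continuous) hE.memLp
    refine le_of_tendsto_of_tendsto' t1 (tN.const_mul _) fun n => ?_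
    rw [restrict_interior_hull]
    exact (hest n).1
  · have t1 := tendsto_finsetSum Finset.univ fun i _ => (hE.lim_grad i).tendsto_integral_sq
      (fun n => hmem (k1 n i).continuous) (hE.memLp_grad i)
    refine le_of_tendsto_of_tendsto' t1 (tN.const_mul _) fun n => ?_
    rw [← integral_finsetSum _ fun i _ => (hmem (k1 n i).continuous).integrable_sq, hμ,
      restrict_interior_hull]
    exact (hest n).2.1
  · have t1 := tendsto_finsetSum Finset.univ fun i _ => tendsto_finsetSum Finset.univ fun j _ =>
      (hE.lim_hess i j).tendsto_integral_sq (fun n => hmem (k2 n i j)) (hE.memLp_hess i j)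
    refine le_of_tendsto_of_tendsto' t1 (tN.const_mul _) fun n => ?_
    have e : ∀ i, ∑ j, ∫ x in interior (hull K),
        pderiv j (pderiv i fun x => ψ n x - interp K (ψ n) x) x ^ 2 =
        ∫ x in interior (hull K),
          ∑ j, pderiv j (pderiv i fun x => ψ n x - interp K (ψ n) x) x ^ 2 := fun i =>
      (integral_finsetSum _ fun j _ => (hmem (k2 n i j)).integrable_sq).symm
    simp only [e]
    rw [← integral_finsetSum _ fun i _ => integrable_finsetSum _ fun j _ =>
      (hmem (k2 n i j)).integrable_sq, hμ, restrict_interior_hull]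
    exact (hest n).2.2

lemma integral_sub_sq_le {μ : Measure (Space d)} {f g h : Space d → ℝ} (hf : MemLp f 2 μ)
    (hg : MemLp g 2 μ) (hh : MemLp h 2 μ) : ∫ x, (f x - g x) ^ 2 ∂μ ≤
      ((eLpNorm (fun x => f x - h x) 2 μ).toReal + (eLpNorm (fun x => g x - h x) 2 μ).toReal) ^ 2 := by
  have h1 := eLpNorm_two_toReal_sq (hf.sub hg)
  simp only [Pi.sub_apply] at h1
  have n1 : eLpNorm (fun x => f x - h x) 2 μ ≠ ⊤ := (hf.sub hh).2.ne
  have n2 : eLpNorm (fun x => g x - h x) 2 μ ≠ ⊤ := (hg.sub hh).2.ne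
  rw [← h1, ← ENNReal.toReal_add n1 n2]
  gcongr
  · exact ENNReal.add_ne_top.2 ⟨n1, n2⟩
  · refine le_trans (le_of_eq ?_) (eLpNorm_sub_le (hf.sub hh).1 (hg.sub hh).1 (by norm_num))
    congr 1
    funext x
    simp

/-- Functions in `H²(Ω)` have continuous representatives, in dimension at most three. -/
theorem H2Limit.exists_continuous (hd : d ≤ 3) {Ω : Set (Space d)} (hΩ : IsOpen Ω)
    (hne : Ω.Nonempty) (hb : Bornology.IsBounded Ω) (hc : Convex ℝ Ω) (h : H2Limit Ω ψ v G H) :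
    ∃ (vc : Space d → ℝ) (ε : ℕ → ℝ), Tendsto ε atTop (𝓝 0) ∧
      ∀ n, ∀ x ∈ closure Ω, |ψ n x - vc x| ≤ ε n := by
  have hKc : IsCompact (closure Ω) := hb.isCompact_closure
  have hKconv : Convex ℝ (closure Ω) := hc.closure
  set μ := (volume : Measure (Space d)).restrict Ω with hμ
  have hcl : (volume : Measure (Space d)).restrict (closure Ω) = μ := by
    refine Measure.restrict_congr_set ?_
    exact (closure_ae_eq_of_null_frontier (hc.addHaar_frontier _))
  set D := Metric.diam (closure Ω)
  set V := volume.real (closure Ω) with hV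
  have hV0 : 0 < V := by
    refine ENNReal.toReal_pos ?_ hKc.measure_lt_top.ne
    exact (Measure.measure_pos_of_nonempty_interior _
      (hne.mono (interior_maximal subset_closure hΩ))).ne'
  have hmem : ∀ {f : Space d → ℝ}, Continuous f → MemLp f 2 μ := fun hf =>
    memLp_restrict_of_continuous hf hKc hΩ.measurableSet subset_closure
      ((measure_mono subset_closure).trans_lt hKc.measure_lt_top)
  have hc1 := fun n i => contDiff_pderiv (h.smooth n) i
  have hc2 := fun n i j => continuous_pderiv (hc1 n i) j
  let a : ℕ → ℝ := fun n => (eLpNorm (fun x => ψ n x - v x) 2 μ).toReal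
  let b : Fin d → ℕ → ℝ := fun i n => (eLpNorm (fun x => pderiv i (ψ n) x - G i x) 2 μ).toReal
  let c : Fin d → Fin d → ℕ → ℝ := fun i j n =>
    (eLpNorm (fun x => pderiv j (pderiv i (ψ n)) x - H i j x) 2 μ).toReal
  let e : ℕ → ℝ := fun n => a n + ∑ i, b i n + ∑ i, ∑ j, c i j n
  have toR : ∀ {f : ℕ → Space d → ℝ} {g : Space d → ℝ}, TendstoL2 μ f g →
      Tendsto (fun n => (eLpNorm (fun x => f n x - g x) 2 μ).toReal) atTop (𝓝 0) := by
    intro f g hfg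
    have := (ENNReal.tendsto_toReal ENNReal.zero_ne_top).comp hfg
    rwa [ENNReal.toReal_zero] at this
  have he : Tendsto e atTop (𝓝 0) := by
    have h1 := toR h.lim
    have h2 := tendsto_finsetSum Finset.univ fun i _ => toR (h.lim_grad i)
    have h3 := tendsto_finsetSum Finset.univ fun i _ => tendsto_finsetSum Finset.univ fun j _ =>
      toR (h.lim_hess i j)
    simpa using (h1.add h2).add h3
  have hb0 : ∀ i n, 0 ≤ b i n := fun i n => ENNReal.toReal_nonneg
  have hc0 : ∀ i j n, 0 ≤ c i j n := fun i j n => ENNReal.toReal_nonneg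
  have ha0 : ∀ n, 0 ≤ a n := fun n => ENNReal.toReal_nonneg
  have hB0 : ∀ n, 0 ≤ ∑ i, b i n := fun n => Finset.sum_nonneg fun i _ => hb0 i n
  have hC0 : ∀ n, 0 ≤ ∑ i, ∑ j, c i j n := fun n =>
    Finset.sum_nonneg fun i _ => Finset.sum_nonneg fun j _ => hc0 i j n
  have hae : ∀ n, a n ≤ e n := fun n => by simp only [e]; linarith [hB0 n, hC0 n]
  have hbe : ∀ i n, b i n ≤ e n := fun i n => by
    have := Finset.single_le_sum (f := fun i => b i n) (fun i _ => hb0 i n) (Finset.mem_univ i)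
    simp only [e]; linarith [ha0 n, hC0 n]
  have hce : ∀ i j n, c i j n ≤ e n := fun i j n => by
    have h1 := Finset.single_le_sum (f := fun j => c i j n) (fun j _ => hc0 i j n)
      (Finset.mem_univ j)
    have h2 := Finset.single_le_sum (f := fun i => ∑ j, c i j n)
      (fun i _ => Finset.sum_nonneg fun j _ => hc0 i j n) (Finset.mem_univ i)
    simp only [e]; linarith [ha0 n, hB0 n]
  have he0 : ∀ n, 0 ≤ e n := fun n => (ha0 n).trans (hae n)
  set C := (3 + 3 * D ^ 2 * d + 12 * D ^ 4 * d ^ 2) / V with hC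
  have hC0' : 0 ≤ C := by positivity
  -- The Sobolev inequality on the compact convex set `closure Ω`, applied to `ψ n - ψ m`. The
  -- quantity `e n` collects the `L²` distances of `ψ n` to its limit up to second order, so the
  -- sequence is uniformly Cauchy with an explicit modulus.
  have hdiff : ∀ n m, ∀ x ∈ closure Ω, |ψ n x - ψ m x| ≤ Real.sqrt C * (e n + e m) := by
    intro n m x hx
    have hs : ContDiff ℝ ∞ fun x => ψ n x - ψ m x := (h.smooth n).sub (h.smooth m)
    have h1 := sobolev_sup hd hKconv hKc hs hx
    rw [hcl] at h1
    have hi : ∀ i, pderiv i (fun x => ψ n x - ψ m x) = fun x => pderiv i (ψ n) x - pderiv i (ψ m) x :=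
      pderiv_sub (h.smooth n) (h.smooth m)
    have i0 : ∫ y, (ψ n y - ψ m y) ^ 2 ∂μ ≤ (e n + e m) ^ 2 := by
      refine (integral_sub_sq_le (hmem (h.smooth n).continuous) (hmem (h.smooth m).continuous)
        h.memLp).trans ?_
      exact pow_le_pow_left₀ (add_nonneg (ha0 n) (ha0 m)) (add_le_add (hae n) (hae m)) 2
    have i1 : ∫ y, gradSq (fun x => ψ n x - ψ m x) y ∂μ ≤ d * (e n + e m) ^ 2 := by
      have hcard : (d : ℝ) * (e n + e m) ^ 2 = ∑ _i : Fin d, (e n + e m) ^ 2 := by simp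
      rw [hcard]
      simp only [gradSq]
      rw [integral_finsetSum _ fun i _ =>
        (hmem (continuous_pderiv hs i)).integrable_sq]
      refine Finset.sum_le_sum fun i _ => ?_
      simp only [hi]
      refine (integral_sub_sq_le (hmem (hc1 n i).continuous) (hmem (hc1 m i).continuous)
        (h.memLp_grad i)).trans ?_
      exact pow_le_pow_left₀ (add_nonneg (hb0 i n) (hb0 i m)) (add_le_add (hbe i n) (hbe i m)) 2
    have i2 : ∫ y, hessSq (fun x => ψ n x - ψ m x) y ∂μ ≤ d ^ 2 * (e n + e m) ^ 2 := by
      have hcard : (d : ℝ) ^ 2 * (e n + e m) ^ 2 =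
          ∑ _i : Fin d, ∑ _j : Fin d, (e n + e m) ^ 2 := by simp; ring
      rw [hcard]
      simp only [hessSq]
      rw [integral_finsetSum _ fun i _ => integrable_finsetSum _ fun j _ =>
        (hmem (continuous_pderiv (contDiff_pderiv hs i) j)).integrable_sq]
      refine Finset.sum_le_sum fun i _ => ?_
      rw [integral_finsetSum _ fun j _ =>
        (hmem (continuous_pderiv (contDiff_pderiv hs i) j)).integrable_sq]
      refine Finset.sum_le_sum fun j _ => ?_
      simp only [hi, pderiv_sub (hc1 n i) (hc1 m i)]
      refine (integral_sub_sq_le (hmem (hc2 n i j)) (hmem (hc2 m i j)) (h.memLp_hess i j)).trans ?_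
      exact pow_le_pow_left₀ (add_nonneg (hc0 i j n) (hc0 i j m))
        (add_le_add (hce i j n) (hce i j m)) 2
    have h2 : V * (ψ n x - ψ m x) ^ 2 ≤
        (3 + 3 * D ^ 2 * d + 12 * D ^ 4 * d ^ 2) * (e n + e m) ^ 2 := by
      refine h1.trans ?_
      have j1 := mul_le_mul_of_nonneg_left i1 (by positivity : 0 ≤ 3 * D ^ 2)
      have j2 := mul_le_mul_of_nonneg_left i2 (by positivity : 0 ≤ 12 * D ^ 4)
      linarith
    have h3 : (ψ n x - ψ m x) ^ 2 ≤ (Real.sqrt C * (e n + e m)) ^ 2 := by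
      rw [mul_pow, Real.sq_sqrt hC0', hC, div_mul_eq_mul_div, le_div_iff₀' hV0]
      exact h2
    exact abs_le_of_sq_le_sq h3 (mul_nonneg (Real.sqrt_nonneg _) (add_nonneg (he0 n) (he0 m)))
  have hε : Tendsto (fun n => Real.sqrt C * e n) atTop (𝓝 0) := by
    simpa using he.const_mul (Real.sqrt C)
  have hlim : ∀ x ∈ closure Ω, ∃ l, Tendsto (fun n => ψ n x) atTop (𝓝 l) := by
    intro x hx
    refine cauchySeq_tendsto_of_complete (Metric.cauchySeq_iff.2 fun δ hδ => ?_)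
    obtain ⟨N, hN⟩ := eventually_atTop.1 (hε.eventually_lt_const (half_pos hδ))
    refine ⟨N, fun m hm n hn => ?_⟩
    rw [Real.dist_eq]
    refine (hdiff m n x hx).trans_lt ?_
    linarith [hN m hm, hN n hn]
  choose! vc hvc using hlim
  refine ⟨vc, fun n => Real.sqrt C * e n, hε, fun n x hx => ?_⟩
  have t1 : Tendsto (fun m => |ψ n x - ψ m x|) atTop (𝓝 |ψ n x - vc x|) :=
    (tendsto_const_nhds.sub (hvc x hx)).abs
  have t2 : Tendsto (fun m => Real.sqrt C * (e n + e m)) atTop (𝓝 (Real.sqrt C * (e n + 0))) :=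
    (tendsto_const_nhds.add he).const_mul _
  rw [add_zero] at t2
  exact le_of_tendsto_of_tendsto' t1 t2 fun m => hdiff n m x hx

end H2

/-! ### Geometry of meshes -/

namespace Mesh
variable {d : ℕ} {Ω : Set (Space d)} {M : Mesh Ω} {K K' F : Finset (Space d)} {x : Space d}

lemma mem_elements : K ∈ M.elements ↔ K ∈ M.faces ∧ K.card = d + 1 := by
  simp [elements]

lemma mem_facets : F ∈ M.facets ↔ F ∈ M.faces ∧ F.card = d := by
  simp [facets]

lemma isSimplex (hK : K ∈ M.elements) : IsSimplex K :=
  ⟨M.indep (mem_elements.1 hK).1, (mem_elements.1 hK).2⟩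

lemma closure_eq (M : Mesh Ω) : closure Ω = ⋃ K ∈ M.elements, hull K := by
  rw [← M.space_eq]
  ext x
  simp only [Geometry.SimplicialComplex.mem_space_iff, Set.mem_iUnion, exists_prop]
  constructor
  · rintro ⟨s, hs, hx⟩
    obtain ⟨t, ht, hst, hc⟩ := M.pure s hs
    exact ⟨t, mem_elements.2 ⟨ht, hc⟩, hull_mono hst hx⟩
  · rintro ⟨K, hK, hx⟩
    exact ⟨K, (mem_elements.1 hK).1, hx⟩

lemma hull_subset_closure (hK : K ∈ M.elements) : hull K ⊆ closure Ω := by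
  rw [M.closure_eq]
  exact Set.subset_biUnion_of_mem (u := fun K => hull K) (Finset.mem_coe.2 hK)

lemma exists_mem_hull (M : Mesh Ω) (hx : x ∈ closure Ω) : ∃ K ∈ M.elements, x ∈ hull K := by
  rw [M.closure_eq] at hx
  simpa using hx

lemma interior_closure_eq (hΩ : IsOpen Ω) (hc : Convex ℝ Ω) (hne : Ω.Nonempty) :
    interior (closure Ω) = Ω := by
  rw [hc.interior_closure_eq_interior_of_nonempty_interior (by rwa [hΩ.interior_eq]),
    hΩ.interior_eq]

lemma interior_hull_subset (hΩ : IsConvexPolytopalDomain Ω) (hK : K ∈ M.elements) :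
    interior (hull K) ⊆ Ω := by
  rw [← interior_closure_eq hΩ.isOpen hΩ.convex hΩ.nonempty]
  exact interior_mono (hull_subset_closure hK)

lemma inter_hull_subset [DecidableEq (Space d)] (hK : K ∈ M.faces) (hK' : K' ∈ M.faces) :
    hull K ∩ hull K' ⊆ hull (K ∩ K') := by
  have := M.inter_subset_convexHull hK hK'
  rw [hull, hull, hull, Finset.coe_inter]
  exact this

lemma exists_notMem (hK : K ∈ M.elements) (hK' : K' ∈ M.elements) (h : K ≠ K') :
    ∃ z ∈ K, z ∉ K' := by
  by_contra! hsub
  exact h (Finset.eq_of_subset_of_card_le hsub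
    (by rw [(mem_elements.1 hK).2, (mem_elements.1 hK').2]))

/-- Two elements meet in the hull of their common vertices, which lies in a facet of `K` opposite to
a vertex outside of `K'`. There a barycentric coordinate vanishes, whereas all of them are positive
in the interior. -/
lemma pairwiseDisjoint (M : Mesh Ω) :
    (M.elements : Set (Finset (Space d))).PairwiseDisjoint fun K => interior (hull K) := by
  classical
  intro K hK K' hK' hne
  refine Set.disjoint_left.2 fun x hx hx' => ?_
  obtain ⟨z, hz, hz'⟩ := exists_notMem (Finset.mem_coe.1 hK) (Finset.mem_coe.1 hK') hne
  have h1 := inter_hull_subset (mem_elements.1 hK).1 (mem_elements.1 hK').1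
    ⟨interior_subset hx, interior_subset hx'⟩
  have h2 : x ∈ hull (K.erase z) := hull_mono (fun y hy => by
    rw [Finset.mem_inter] at hy
    exact Finset.mem_erase.2 ⟨fun h => hz' (h ▸ hy.2), hy.1⟩) h1
  have h3 := (((isSimplex hK).mem_hull_erase_iff hz).1 h2).2
  exact ((isSimplex hK).mem_interior_hull_iff.1 hx z hz).ne' h3

lemma brokenDomain_subset (hΩ : IsConvexPolytopalDomain Ω) : M.brokenDomain ⊆ Ω :=
  Set.iUnion₂_subset fun _ hK => interior_hull_subset hΩ hK

lemma interior_hull_subset_brokenDomain (hK : K ∈ M.elements) :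
    interior (hull K) ⊆ M.brokenDomain :=
  Set.subset_biUnion_of_mem (u := fun K => interior (hull K)) (Finset.mem_coe.2 hK)

/-- The points of `Ω` missed by the open elements lie in the finitely many frontiers of convex sets,
which are null sets. Elementwise integrals therefore add up to integrals over `Ω`. -/
lemma restrict_brokenDomain (hΩ : IsConvexPolytopalDomain Ω) :
    (volume : Measure (Space d)).restrict M.brokenDomain = volume.restrict Ω := by
  refine Measure.restrict_congr_set (Filter.EventuallyLE.antisymm
    (brokenDomain_subset hΩ).eventuallyLE ?_)
  rw [ae_le_set]
  refine measure_mono_null (t := ⋃ K ∈ M.elements, frontier (hull K)) ?_ ?_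
  · rintro x ⟨hx, hx'⟩
    obtain ⟨K, hK, hxK⟩ := M.exists_mem_hull (subset_closure hx)
    refine Set.mem_biUnion (Finset.mem_coe.2 hK) ⟨subset_closure hxK, fun h => hx' ?_⟩
    exact interior_hull_subset_brokenDomain hK h
  · exact (measure_biUnion_null_iff M.elements.countable_toSet).2 fun K _ =>
      (convex_hull K).addHaar_frontier _

lemma setIntegral_eq_sum (hΩ : IsConvexPolytopalDomain Ω) {f : Space d → ℝ}
    (hf : ∀ K ∈ M.elements, IntegrableOn f (interior (hull K))) :
    ∫ x in Ω, f x = ∑ K ∈ M.elements, ∫ x in interior (hull K), f x := by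
  rw [← restrict_brokenDomain (M := M) hΩ, brokenDomain]
  exact integral_biUnion_finset _ (fun _ _ => isOpen_interior.measurableSet) M.pairwiseDisjoint hf

lemma memLp_of_elements (hΩ : IsConvexPolytopalDomain Ω) {f : Space d → ℝ}
    (hf : ∀ K ∈ M.elements, MemLp f 2 (volume.restrict (interior (hull K)))) :
    MemLp f 2 (volume.restrict Ω) := by
  have hm : AEStronglyMeasurable f (volume.restrict Ω) := by
    rw [← restrict_brokenDomain (M := M) hΩ, brokenDomain,
      Measure.restrict_biUnion_finset M.pairwiseDisjoint
        (fun _ => isOpen_interior.measurableSet)]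
    exact aestronglyMeasurable_sum_measure_iff.2 fun K => (hf K K.2).1
  refine (memLp_two_iff_integrable_sq hm).2 ?_
  rw [← restrict_brokenDomain (M := M) hΩ, brokenDomain]
  exact (integrableOn_finset_iUnion (s := M.elements)).2 fun K hK => (hf K hK).integrable_sq

lemma exists_element_of_facet (hF : F ∈ M.facets) : ∃ K ∈ M.elements, F ⊆ K := by
  obtain ⟨K, hK, h, hc⟩ := M.pure F (mem_facets.1 hF).1
  exact ⟨K, mem_elements.2 ⟨hK, hc⟩, h⟩

variable [DecidableEq (Space d)]

lemma exists_erase_eq (hF : F ∈ M.facets) (hK : K ∈ M.elements) (h : F ⊆ K) :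
    ∃ z ∈ K, F = K.erase z := by
  have h1 : (K \ F).card = 1 := by
    rw [Finset.card_sdiff_of_subset h, (mem_elements.1 hK).2, (mem_facets.1 hF).2]; omega
  obtain ⟨z, hz⟩ := Finset.card_eq_one.1 h1
  have hzK : z ∈ K \ F := by rw [hz]; exact Finset.mem_singleton_self z
  refine ⟨z, (Finset.mem_sdiff.1 hzK).1, ?_⟩
  rw [← Finset.sdiff_singleton_eq_erase, ← hz, Finset.sdiff_sdiff_eq_self h]

/-- Facets that belong to one element only are contained in the boundary. -/
lemma hull_subset_frontier (hd : 1 ≤ d) (hΩ : IsConvexPolytopalDomain Ω) (hF : F ∈ M.facets)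
    (hns : ¬ ∃ Q, M.IsShared F Q) : hull F ⊆ frontier Ω := by
  obtain ⟨K, hK, hFK⟩ := exists_element_of_facet hF
  obtain ⟨z, hz, hFz⟩ := exists_erase_eq hF hK hFK
  have hKs := isSimplex hK
  intro x hx
  have hxc : x ∈ closure Ω := hull_subset_closure hK (hull_mono hFK hx)
  rw [frontier, hΩ.isOpen.interior_eq]
  refine ⟨hxc, fun hxΩ => hns ?_⟩
  -- a point of `Ω` in the relative interior of the facet
  set c : Space d := ∑ y ∈ F, (d : ℝ)⁻¹ • y with hc
  have hd0 : (0 : ℝ) < d := by exact_mod_cast hd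
  have hcb : ∀ y ∈ K, bary K y c = if y = z then 0 else (d : ℝ)⁻¹ := by
    intro y hy
    refine hKs.bary_unique (w := fun y => if y = z then 0 else (d : ℝ)⁻¹) ?_ ?_ hy
    · rw [← Finset.add_sum_erase K _ hz, if_pos rfl, zero_add, ← hFz,
        Finset.sum_congr rfl (g := fun _ => (d : ℝ)⁻¹) fun y hy => if_neg fun h => by
          rw [h, hFz] at hy; exact Finset.notMem_erase _ _ hy,
        Finset.sum_const, (mem_facets.1 hF).2, nsmul_eq_mul, mul_inv_cancel₀ hd0.ne']
    · rw [← Finset.add_sum_erase K _ hz, if_pos rfl, zero_smul, zero_add, ← hFz]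
      refine Finset.sum_congr rfl fun y hy => ?_
      rw [if_neg fun h => by rw [h, hFz] at hy; exact Finset.notMem_erase _ _ hy]
  have hx' := hx
  rw [hFz, hKs.mem_hull_erase_iff hz] at hx'
  obtain ⟨hxK, hxz⟩ := hx'
  have ht : ∀ᶠ t : ℝ in 𝓝[>] 0, (1 - t) • x + t • c ∈ Ω ∧ t < 1 := by
    have hcont : Continuous fun t : ℝ => (1 - t) • x + t • c := by fun_prop
    have h1 : ∀ᶠ t : ℝ in 𝓝 0, (1 - t) • x + t • c ∈ Ω :=
      hcont.continuousAt.eventually (hΩ.isOpen.mem_nhds (by simpa using hxΩ))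
    exact (h1.and (eventually_lt_nhds one_pos)).filter_mono nhdsWithin_le_nhds
  obtain ⟨t, ⟨htΩ, ht1⟩, ht0⟩ := (ht.and self_mem_nhdsWithin).exists
  set x' := (1 - t) • x + t • c with hx'def
  have hbx' : ∀ y, bary K y x' = (1 - t) * bary K y x + t * bary K y c := fun y =>
    bary_combo K y x c (by ring)
  have hz0 : bary K z x' = 0 := by rw [hbx', hxz, hcb z hz, if_pos rfl]; ring
  have hpos : ∀ y ∈ F, 0 < bary K y x' := by
    intro y hy
    have hyz : y ≠ z := fun h => by rw [h, hFz] at hy; exact Finset.notMem_erase _ _ hy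
    rw [hbx', hcb y (hFK hy), if_neg hyz]
    have h1 := hKs.mem_hull_iff.1 hxK y (hFK hy)
    have h2 : 0 < t * (d : ℝ)⁻¹ := by positivity
    have h3 : 0 ≤ (1 - t) * bary K y x := mul_nonneg (by linarith) h1
    linarith
  -- it belongs to the closure of the union of the other elements
  have hcl : IsClosed (⋃ K' ∈ M.elements.erase K, hull K') :=
    isClosed_biUnion_finset fun K' _ => (isCompact_hull K').isClosed
  have hmem : x' ∈ ⋃ K' ∈ M.elements.erase K, hull K' := by
    rw [← hcl.closure_eq]
    -- Moving `x'` across the facet away from `z` makes the coordinate of `z` equal to `-s`. These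
    -- points leave `K` but stay in `Ω` for small `s`, so other elements must contain them.
    have hcont : Continuous fun s : ℝ => (1 + s) • x' + (-s) • z := by fun_prop
    have htend : Tendsto (fun s : ℝ => (1 + s) • x' + (-s) • z) (𝓝[>] 0) (𝓝 x') := by
      have := hcont.tendsto 0
      simp only [add_zero, one_smul, neg_zero, zero_smul] at this
      exact this.mono_left nhdsWithin_le_nhds
    refine mem_closure_of_tendsto htend ?_
    filter_upwards [htend.eventually (hΩ.isOpen.mem_nhds htΩ), self_mem_nhdsWithin] with s hs hs0
    obtain ⟨K', hK', hmem⟩ := M.exists_mem_hull (subset_closure hs)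
    refine Set.mem_biUnion (x := K') (Finset.mem_coe.2 (Finset.mem_erase.2 ⟨?_, hK'⟩)) hmem
    rintro rfl
    have h1 := hKs.mem_hull_iff.1 hmem z hz
    rw [bary_combo K' z x' z (by ring), hz0, hKs.bary_vertex hz hz, if_pos rfl] at h1
    rw [Set.mem_Ioi] at hs0
    linarith
  simp only [Set.mem_iUnion, exists_prop] at hmem
  obtain ⟨K', hK', hxK'⟩ := hmem
  rw [Finset.mem_erase] at hK'
  have hxK2 : x' ∈ hull K := by
    refine hKs.mem_hull_iff.2 fun y hy => ?_
    by_cases hyz : y = z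
    · rw [hyz, hz0]
    · exact (hpos y (by rw [hFz]; exact Finset.mem_erase.2 ⟨hyz, hy⟩)).le
  refine ⟨(K, K'), hK, hK'.2, hK'.1.symm, hFK, fun y hy => ?_⟩
  by_contra hyK'
  have h1 := inter_hull_subset (mem_elements.1 hK).1 (mem_elements.1 hK'.2).1 ⟨hxK2, hxK'⟩
  have h2 : x' ∈ hull (K.erase y) := hull_mono (fun a ha => by
    rw [Finset.mem_inter] at ha
    exact Finset.mem_erase.2 ⟨fun h => hyK' (h ▸ ha.2), ha.1⟩) h1
  exact (hpos y hy).ne' ((hKs.mem_hull_erase_iff (hFK hy)).1 h2).2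

end Mesh

/-! ### The global interpolant -/

/-- On a common face, the barycentric coordinates of two simplices agree. -/
lemma bary_eq_of_mem_hull {d : ℕ} {K K' S : Finset (Space d)} {x : Space d} (hK : IsSimplex K)
    (hK' : IsSimplex K') (hS : S ⊆ K) (hS' : S ⊆ K') (hx : x ∈ hull S) :
    (∀ z ∈ S, bary K z x = bary K' z x) ∧ ∀ z ∈ K, z ∉ S → bary K z x = 0 := by
  classical
  rw [hull, Finset.mem_convexHull'] at hx
  obtain ⟨w, -, h1, h2⟩ := hx
  have key : ∀ {L : Finset (Space d)}, IsSimplex L → S ⊆ L → ∀ z ∈ L,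
      bary L z x = if z ∈ S then w z else 0 := by
    intro L hL hSL z hz
    refine hL.bary_unique (w := fun z => if z ∈ S then w z else 0) ?_ ?_ hz
    · rw [← h1, ← Finset.sum_subset hSL fun y _ hy => if_neg hy]
      exact Finset.sum_congr rfl fun y hy => if_pos hy
    · rw [← h2, ← Finset.sum_subset hSL fun y _ hy => by rw [if_neg hy, zero_smul]]
      exact Finset.sum_congr rfl fun y hy => by rw [if_pos hy]
  refine ⟨fun z hz => ?_, fun z hz hzS => by rw [key hK hS z hz, if_neg hzS]⟩
  rw [key hK hS z (hS hz), key hK' hS' z (hS' hz)]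

/-- On a face only the nodes of that face contribute to the interpolant. This is why interpolants of
neighbouring elements match. -/
lemma interp_eq_sum_of_mem_hull {d : ℕ} {K S : Finset (Space d)} {v : Space d → ℝ} {x : Space d}
    (hS : S ⊆ K) (h : ∀ z ∈ K, z ∉ S → bary K z x = 0) :
    interp K v x = 2 * (∑ z ∈ S, ∑ y ∈ S, v ((1 / 2 : ℝ) • z + (1 / 2 : ℝ) • y) *
      (bary K z x * bary K y x)) - ∑ z ∈ S, v z * bary K z x := by
  have h1 : ∀ z, ∑ y ∈ S, v ((1 / 2 : ℝ) • z + (1 / 2 : ℝ) • y) * (bary K z x * bary K y x) =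
      ∑ y ∈ K, v ((1 / 2 : ℝ) • z + (1 / 2 : ℝ) • y) * (bary K z x * bary K y x) := fun z =>
    Finset.sum_subset hS fun y hy hyS => by rw [h y hy hyS]; ring
  rw [interp]
  simp only [h1]
  rw [Finset.sum_subset hS (f := fun z => v z * bary K z x) fun y hy hyS => by rw [h y hy hyS]; ring,
    Finset.sum_subset hS fun z hz hzS => ?_]
  exact Finset.sum_eq_zero fun y _ => by rw [h z hz hzS]; ring

namespace Mesh
variable {d : ℕ} {Ω : Set (Space d)} {M : Mesh Ω} {K K' F : Finset (Space d)} {x : Space d}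
  {v : Space d → ℝ}

/-- Conformity of the mesh: the point lies on the common face, where both interpolants reduce to the
same expression in the shared nodes and coordinates. -/
lemma interp_eq_interp (hK : K ∈ M.elements) (hK' : K' ∈ M.elements) (hx : x ∈ hull K)
    (hx' : x ∈ hull K') : interp K v x = interp K' v x := by
  classical
  have hxi := inter_hull_subset (mem_elements.1 hK).1 (mem_elements.1 hK').1 ⟨hx, hx'⟩
  obtain ⟨h1, h2⟩ := bary_eq_of_mem_hull (isSimplex hK) (isSimplex hK') Finset.inter_subset_left
    Finset.inter_subset_right hxi
  obtain ⟨-, h3⟩ := bary_eq_of_mem_hull (isSimplex hK') (isSimplex hK) Finset.inter_subset_right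
    Finset.inter_subset_left hxi
  rw [interp_eq_sum_of_mem_hull Finset.inter_subset_left h2,
    interp_eq_sum_of_mem_hull Finset.inter_subset_right h3]
  congr 1
  · congr 1
    exact Finset.sum_congr rfl fun z hz => Finset.sum_congr rfl fun y hy => by rw [h1 z hz, h1 y hy]
  · exact Finset.sum_congr rfl fun z hz => by rw [h1 z hz]

open Classical in
/-- The continuous piecewise quadratic interpolant, extended by zero. -/
def feInterp (M : Mesh Ω) (v : Space d → ℝ) (x : Space d) : ℝ :=
  if h : ∃ K ∈ M.elements, x ∈ hull K then interp h.choose v x else 0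

lemma feInterp_eq (hK : K ∈ M.elements) (hx : x ∈ hull K) : M.feInterp v x = interp K v x := by
  have h : ∃ K ∈ M.elements, x ∈ hull K := ⟨K, hK, hx⟩
  rw [feInterp, dif_pos h]
  exact interp_eq_interp h.choose_spec.1 hK h.choose_spec.2 hx

/-- The interpolant of a function that vanishes on the boundary vanishes outside of `Ω`. -/
lemma feInterp_eq_zero (hΩ : IsConvexPolytopalDomain Ω) (hv : ∀ y ∈ frontier Ω, v y = 0)
    (hx : x ∉ Ω) : M.feInterp v x = 0 := by
  by_cases h : ∃ K ∈ M.elements, x ∈ hull K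
  swap
  · rw [feInterp, dif_neg h]
  obtain ⟨K, hK, hxK⟩ := h
  rw [feInterp_eq hK hxK]
  have hKs := isSimplex hK
  have h0 := hKs.mem_hull_iff.1 hxK
  -- A hyperplane through `x` supporting `Ω`. Since `x` is a convex combination of vertices in the
  -- closure, every vertex of positive weight lies on this hyperplane, and so do the midpoints
  -- between them. These nodes are in the closure but not in `Ω`, hence on the boundary, where `v`
  -- vanishes.
  obtain ⟨f, hf⟩ := geometric_hahn_banach_open_point hΩ.convex hΩ.isOpen hx
  have hf' : ∀ y ∈ closure Ω, f y ≤ f x := fun y hy =>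
    closure_minimal (fun a ha => (hf a ha).le) (isClosed_le f.continuous continuous_const) hy
  have hfz : ∀ z ∈ K, bary K z x ≠ 0 → f z = f x := by
    intro z hz hne
    have h1 : ∑ y ∈ K, bary K y x * (f x - f y) = 0 := by
      simp only [mul_sub, Finset.sum_sub_distrib, ← Finset.sum_mul, hKs.sum_bary, one_mul]
      conv_lhs => lhs; rw [← hKs.sum_bary_smul x]
      simp [map_sum]
    have h2 := (Finset.sum_eq_zero_iff_of_nonneg fun y hy => mul_nonneg (h0 y hy)
      (sub_nonneg.2 (hf' y (hull_subset_closure hK (subset_hull K hy))))).1 h1 z hz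
    rcases mul_eq_zero.1 h2 with h3 | h3
    · exact absurd h3 hne
    · linarith
  have hbd : ∀ y ∈ closure Ω, f y = f x → v y = 0 := by
    intro y hy hfy
    refine hv y ?_
    rw [frontier, hΩ.isOpen.interior_eq]
    exact ⟨hy, fun h => (hf y h).ne hfy⟩
  rw [interp, Finset.sum_eq_zero, Finset.sum_eq_zero]
  · simp
  · intro z hz
    by_cases h1 : bary K z x = 0
    · rw [h1, mul_zero]
    · rw [hbd z (hull_subset_closure hK (subset_hull K hz)) (hfz z hz h1), zero_mul]
  · intro z hz
    refine Finset.sum_eq_zero fun y hy => ?_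
    by_cases h1 : bary K z x = 0
    · rw [h1]; ring
    by_cases h2 : bary K y x = 0
    · rw [h2]; ring
    rw [hbd, zero_mul]
    · exact hull_subset_closure hK (convex_hull K (subset_hull K hz) (subset_hull K hy)
        (by norm_num) (by norm_num) (by norm_num))
    · simp only [map_add, map_smul, hfz z hz h1, hfz y hy h2, smul_eq_mul]
      ring

end Mesh

/-! ### Lipschitz functions and `H¹₀` -/

section lipschitz
variable {d : ℕ}

/-- A continuous function that is Lipschitz on each set of a finite closed cover is Lipschitz. -/
lemma lipschitzWith_of_closed_cover {ι : Type*} [Finite ι] {C : ι → Set (Space d)}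
    (hC : ∀ i, IsClosed (C i)) (hcov : ⋃ i, C i = Set.univ) {f : Space d → ℝ}
    (hf : Continuous f) {L : NNReal} (hL : ∀ i, LipschitzOnWith L f (C i)) : LipschitzWith L f := by
  refine LipschitzWith.of_dist_le_mul fun x y => ?_
  set ℓ := dist x y with hℓ
  let γ : ℝ → Space d := fun t => x + t • (y - x)
  have hγ : Continuous γ := by fun_prop
  have hγd : ∀ s t, s ≤ t → dist (γ t) (γ s) = (t - s) * ℓ := fun s t hst => by
    rw [dist_eq_norm, show γ t - γ s = (t - s) • (y - x) by simp only [γ]; module, norm_smul,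
      Real.norm_of_nonneg (sub_nonneg.2 hst), hℓ, dist_comm, dist_eq_norm]
  let s : Set ℝ := {t | dist (f (γ t)) (f (γ 0)) ≤ L * (t * ℓ)}
  have hs : IsClosed s := isClosed_le (by fun_prop) (by fun_prop)
  have key : Set.Icc (0:ℝ) 1 ⊆ s := by
    refine (hs.inter isClosed_Icc).Icc_subset_of_forall_exists_gt ?_ ?_
    · simp [s]
    · rintro t ⟨hts, ht0, ht1⟩ b (hb : t < b)
      -- Continuous induction along the segment. Parameters decreasing to `t` visit one of the
      -- finitely many pieces infinitely often; that closed piece also contains `γ t`, and its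
      -- Lipschitz bound extends the estimate beyond `t`.
      let u : ℕ → ℝ := fun n => t + (b - t) / (n + 1)
      have hu : ∀ n, t < u n ∧ u n ≤ b := fun n => by
        have h1 : 0 < (b - t) / ((n : ℝ) + 1) := div_pos (by linarith) (by positivity)
        have h2 : (b - t) / ((n : ℝ) + 1) ≤ b - t :=
          div_le_self (by linarith) (by linarith [(Nat.cast_nonneg n : (0:ℝ) ≤ n)])
        constructor <;> simp only [u] <;> linarith
      have hut : Tendsto u atTop (𝓝 t) := by
        have := (tendsto_one_div_add_atTop_nhds_zero_nat (𝕜 := ℝ)).const_mul (b - t)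
        simpa [u, div_eq_mul_inv] using tendsto_const_nhds.add this
      have hch : ∀ n, ∃ i, γ (u n) ∈ C i := fun n => by
        have : γ (u n) ∈ ⋃ i, C i := hcov ▸ Set.mem_univ _
        simpa using this
      choose i hi using hch
      obtain ⟨k, hk⟩ := Finite.exists_infinite_fiber i
      rw [Set.infinite_coe_iff] at hk
      have hfreq : ∃ᶠ n in atTop, γ (u n) ∈ C k := by
        refine (Nat.frequently_atTop_iff_infinite.2 hk).mono fun n hn => ?_
        have : i n = k := hn
        exact this ▸ hi n
      have htk : γ t ∈ C k := by
        by_contra hne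
        have h1 := ((hγ.tendsto t).comp hut).eventually ((hC k).isOpen_compl.mem_nhds hne)
        obtain ⟨n, hn1, hn2⟩ := (hfreq.and_eventually h1).exists
        exact hn2 hn1
      obtain ⟨n, hn⟩ := hfreq.exists
      refine ⟨u n, ?_, (hu n)⟩
      have h1 := (hL k).dist_le_mul _ hn _ htk
      rw [hγd _ _ (hu n).1.le] at h1
      have h2 : dist (f (γ t)) (f (γ 0)) ≤ L * (t * ℓ) := hts
      have h3 := dist_triangle (f (γ (u n))) (f (γ t)) (f (γ 0))
      change dist (f (γ (u n))) (f (γ 0)) ≤ L * (u n * ℓ)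
      linarith
  have h1 : dist (f (γ 1)) (f (γ 0)) ≤ L * (1 * ℓ) := key ⟨zero_le_one, le_rfl⟩
  simp only [γ, one_smul, zero_smul, add_zero, one_mul, add_sub_cancel] at h1
  rwa [dist_comm]

lemma TendstoL2.mul_of_tendsto_one {μ : Measure (Space d)} {f : ℕ → Space d → ℝ}
    {g : Space d → ℝ} (h : TendstoL2 μ f g) (hf : ∀ n, AEStronglyMeasurable (f n) μ)
    (hg : MemLp g 2 μ) {t : ℕ → ℝ} (ht : Tendsto t atTop (𝓝 1)) :
    TendstoL2 μ (fun n x => t n * f n x) g := by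
  have hb := h.tendsto_eLpNorm hf hg.1
  have ht' : Tendsto (fun n => ‖t n - 1‖ₑ) atTop (𝓝 0) := by
    have := (ht.sub_const 1).enorm
    simpa using this
  have hb2 : Tendsto (fun n => ‖t n - 1‖ₑ * eLpNorm (f n) 2 μ +
      eLpNorm (fun x => f n x - g x) 2 μ) atTop (𝓝 0) := by
    have h2 := ENNReal.Tendsto.mul ht' (Or.inr hg.2.ne) hb (Or.inr (by simp))
    simpa using h2.add h
  refine tendsto_of_le_of_tendsto_zero hb2 fun n => ?_
  have e : (fun x => t n * f n x - g x) = (t n - 1) • (f n) + fun x => f n x - g x := by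
    funext x; simp; ring
  rw [e, ← eLpNorm_const_smul]
  exact eLpNorm_add_le ((hf n).const_smul _) ((hf n).sub hg.1) (by norm_num)

lemma isWeakDeriv_lineDeriv {L : NNReal} {v : Space d → ℝ} (hv : LipschitzWith L v) (i : Fin d) :
    IsWeakDeriv Set.univ i v fun x => lineDeriv ℝ v x (EuclideanSpace.single i 1) := by
  refine ⟨hv.continuous.locallyIntegrable.locallyIntegrableOn _,
    (hv.locallyIntegrable_lineDeriv _).locallyIntegrableOn _, fun φ hφ => ?_⟩
  obtain ⟨D, hD⟩ : ∃ D, LipschitzWith D φ :=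
    ContDiff.lipschitzWith_of_hasCompactSupport hφ.2.1 hφ.1 (by simp)
  rw [setIntegral_univ, setIntegral_univ, hv.integral_lineDeriv_mul_eq hD hφ.2.1,
    ← integral_neg]
  refine integral_congr_ae (Eventually.of_forall fun x => ?_)
  simp only
  rw [((hφ.1.differentiable (by simp)) x).lineDeriv_eq_fderiv, map_neg, pderiv]
  ring

/-- Lipschitz functions that vanish outside of a bounded convex open set `Ω` are in `H¹₀(Ω)`. -/
theorem mem_H10_of_lipschitz {Ω : Set (Space d)} (hΩ : IsConvexPolytopalDomain Ω) {L : NNReal}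
    {v : Space d → ℝ} (hv : LipschitzWith L v) (h0 : ∀ x ∉ Ω, v x = 0) (w : L2 Ω)
    (hw : w =ᵐ[volume.restrict Ω] v) : w ∈ H10 Ω := by
  obtain ⟨x₀, hx₀⟩ := hΩ.nonempty
  obtain ⟨ρ, hρ, hball⟩ := Metric.isOpen_iff.1 hΩ.isOpen x₀ hx₀
  have hcl : IsCompact (closure Ω) := hΩ.isBounded.isCompact_closure
  let G : Fin d → Space d → ℝ := fun i x => lineDeriv ℝ v x (EuclideanSpace.single i 1)
  have hvs : HasCompactSupport v := HasCompactSupport.intro hcl fun x hx =>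
    h0 x fun h => hx (subset_closure h)
  have hvm : MemLp v 2 volume := hv.continuous.memLp_of_hasCompactSupport hvs
  have hG0 : ∀ i, ∀ x ∉ closure Ω, G i x = 0 := by
    intro i x hx
    have h1 : v =ᶠ[𝓝 x] fun _ => 0 := by
      filter_upwards [isClosed_closure.isOpen_compl.mem_nhds hx] with y hy
      exact h0 y fun h => hy (subset_closure h)
    have : G i x = lineDeriv ℝ (fun _ : Space d => (0 : ℝ)) x (EuclideanSpace.single i 1) :=
      h1.lineDeriv_eq
    rw [this]
    simp [lineDeriv]
  have hGm : ∀ i, MemLp (G i) 2 volume := by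
    intro i
    have h1 : (closure Ω).indicator (G i) = G i := by
      rw [Set.indicator_eq_self]
      intro x hx
      by_contra h
      exact hx (hG0 i x h)
    rw [← h1, memLp_indicator_iff_restrict isClosed_closure.measurableSet]
    have : IsFiniteMeasure ((volume : Measure (Space d)).restrict (closure Ω)) :=
      ⟨by simpa using hcl.measure_lt_top⟩
    exact (hv.memLp_lineDeriv (μ := volume.restrict (closure Ω)) _).mono_exponent le_top
  have hGw : ∀ i, IsWeakDeriv Set.univ i v (G i) := fun i => isWeakDeriv_lineDeriv hv i
  let s : ℕ → ℝ := fun n => 1 / ((n : ℝ) + 1)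
  have hs0 : ∀ n, 0 < s n := fun n => by positivity
  have hst : Tendsto s atTop (𝓝 0) := tendsto_one_div_add_atTop_nhds_zero_nat
  let φ : ℕ → ContDiffBump (0 : Space d) := fun n =>
    bumpOf d (s n * (ρ / 2)) (mul_pos (hs0 n) (by positivity))
  -- Now the factor exceeds one: composition with this dilation shrinks the support of `v` into the
  -- interior of `Ω`, with enough room for mollification with radius `s n * (ρ / 2)`. The
  -- approximations are thus test functions on `Ω`.
  let t : ℕ → ℝ := fun n => 1 + s n
  have hφ : Tendsto (fun n => (φ n).rOut) atTop (𝓝 0) := by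
    simpa [φ, bumpOf] using hst.mul_const (ρ / 2)
  have ht : Tendsto t atTop (𝓝 1) := by simpa [t] using tendsto_const_nhds.add hst
  have ht2 : ∀ n, 1 / 2 ≤ t n := fun n => by simp only [t]; linarith [hs0 n]
  let ψ : ℕ → Space d → ℝ := fun n x => moll (φ n) v (dil x₀ (t n) x)
  have hvl : LocallyIntegrable v := hv.continuous.locallyIntegrable
  have hψs : ∀ n, ContDiff ℝ ∞ (ψ n) := fun n => (contDiff_moll hvl).comp (contDiff_dil _ _)
  have hcomb : ∀ n x, ∀ y ∈ closure Ω, dist (dil x₀ (t n) x) y ≤ s n * (ρ / 2) → x ∈ Ω := by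
    intro n x y hy hxy
    have ht0 : 0 < t n := by linarith [ht2 n]
    rw [dist_eq_norm] at hxy
    -- The point `x` is the convex combination of this interior point and of `y` with weights `s n /
    -- t n` and `1 / t n`.
    have h2 : x₀ + (s n)⁻¹ • (dil x₀ (t n) x - y) ∈ Ω := by
      apply hball
      rw [Metric.mem_ball, dist_eq_norm, add_sub_cancel_left, norm_smul, norm_inv,
        Real.norm_of_nonneg (hs0 n).le, inv_mul_lt_iff₀ (hs0 n)]
      have := hs0 n
      nlinarith
    rw [← hΩ.isOpen.interior_eq] at h2
    have h3 := hΩ.convex.combo_interior_closure_mem_interior h2 hy (a := s n / t n) (b := 1 / t n)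
      (div_pos (hs0 n) ht0) (by positivity) (by rw [← add_div, div_eq_one_iff_eq ht0.ne']; simp only [t]; ring)
    rw [hΩ.isOpen.interior_eq] at h3
    convert h3 using 1
    have e1 : s n / t n * (s n)⁻¹ = 1 / t n := by have := (hs0 n).ne'; field_simp
    have e2 : s n / t n + 1 / t n = 1 := by
      rw [← add_div, div_eq_one_iff_eq ht0.ne']; simp only [t]; ring
    have e3 : 1 / t n * t n = 1 := by field_simp
    rw [smul_add, smul_smul, e1, dil]
    have : x = (s n / t n + 1 / t n) • x₀ + (1 / t n * t n) • (x - x₀) := by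
      rw [e2, e3]; module
    conv_lhs => rw [this]
    module
  have hψt : ∀ n, IsTestFunction Ω (ψ n) := by
    intro n
    have hC : IsCompact (Metric.cthickening (s n * (ρ / 2)) (closure Ω)) := hcl.cthickening
    set S := dil x₀ (t n) ⁻¹' Metric.cthickening (s n * (ρ / 2)) (closure Ω) with hS
    have hSΩ : S ⊆ Ω := by
      intro x hx
      rw [hS, Set.mem_preimage, hcl.cthickening_eq_biUnion_closedBall
        (mul_pos (hs0 n) (by positivity)).le] at hx
      simp only [Set.mem_iUnion, exists_prop] at hx
      obtain ⟨y, hy, hxy⟩ := hx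
      exact hcomb n x y hy hxy
    have hSc : IsClosed S := hC.isClosed.preimage (contDiff_dil x₀ (t n)).continuous
    have hsupp : Function.support (ψ n) ⊆ S := by
      intro x hx
      by_contra hxS
      refine hx ?_
      have : ∀ y, v y * (φ n).normed volume (dil x₀ (t n) x - y) = 0 := by
        intro y
        by_cases hy : y ∈ Ω
        · rw [kernel_eq_zero, mul_zero]
          by_contra hle
          push Not at hle
          refine hxS ?_
          rw [hS, Set.mem_preimage]
          refine Metric.mem_cthickening_of_dist_le _ y _ _ (subset_closure hy) ?_
          rw [dist_comm]
          exact hle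
        · rw [h0 y hy, zero_mul]
      simp only [ψ, moll, this, integral_zero]
    have hts : tsupport (ψ n) ⊆ S := closure_minimal hsupp hSc
    refine ⟨hψs n, ?_, hts.trans hSΩ⟩
    exact hcl.of_isClosed_subset (isClosed_tsupport _) ((hts.trans hSΩ).trans subset_closure)
  have hpd : ∀ n i, pderiv i (ψ n) = fun x => t n * moll (φ n) (G i) (dil x₀ (t n) x) := by
    intro n i
    simp only [ψ]
    rw [pderiv_comp_dil (contDiff_moll hvl)]
    funext x
    have := pderiv_moll (φ := φ n) isOpen_univ (hGw i) (by rwa [Measure.restrict_univ])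
      (Set.subset_univ (Metric.closedBall (dil x₀ (t n) x) (φ n).rOut))
    simp only [Set.indicator_univ] at this
    rw [this]
  have hlim := tendstoL2_moll_dil x₀ hφ ht ht2 hvm
  have hle : (volume : Measure (Space d)).restrict Ω ≤ volume := Measure.restrict_le_self
  have hmeas : ∀ i n, AEStronglyMeasurable (fun x => moll (φ n) (G i) (dil x₀ (t n) x)) volume :=
    fun i n => ((contDiff_moll ((hGm i).locallyIntegrable (by norm_num))).comp
      (contDiff_dil x₀ (t n))).continuous.aestronglyMeasurable
  refine ⟨fun i => ((hGm i).mono_measure hle).toLp (G i), ψ, hψt,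
    (hlim.mono_measure hle).congr (fun _ => EventuallyEq.rfl) hw.symm, fun i => ?_⟩
  have h1 := (tendstoL2_moll_dil x₀ hφ ht ht2 (hGm i)).mul_of_tendsto_one (hmeas i) (hGm i) ht
  refine (h1.mono_measure hle).congr (fun n => ?_) (MemLp.coeFn_toLp _).symm
  rw [hpd]

end lipschitz

/-! ### Membership of the interpolant in the finite element spaces -/

namespace Mesh
variable {d : ℕ} {Ω : Set (Space d)} {M : Mesh Ω} {K : Finset (Space d)} {v : Space d → ℝ}

/-- The elements together with the complement of `Ω` form a finite closed cover. On each element the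
interpolant is a polynomial with bounded gradient, and on the complement it is zero because of the
boundary condition, so continuity gives a global Lipschitz constant. -/
lemma exists_lipschitzWith_feInterp (hΩ : IsConvexPolytopalDomain Ω)
    (hv : ∀ y ∈ frontier Ω, v y = 0) : ∃ L, LipschitzWith L (M.feInterp v) := by
  have hloc : ∀ K : Finset (Space d), ∃ L, LipschitzOnWith L (interp K v) (hull K) := by
    intro K
    have hI := contDiff_interp K v
    have hc : Continuous fun x => ‖fderiv ℝ (interp K v) x‖₊ :=
      (hI.continuous_fderiv (by simp)).nnnorm
    obtain ⟨L, hL⟩ := (isCompact_hull K).bddAbove_image hc.continuousOn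
    refine ⟨L, (convex_hull K).lipschitzOnWith_of_nnnorm_fderiv_le (𝕜 := ℝ)
      (fun x _ => hI.differentiable (by simp) x) fun x hx => hL ⟨x, hx, rfl⟩⟩
  choose L hL using hloc
  let C : Option M.elements → Set (Space d) := fun o => o.elim Ωᶜ fun K => hull (K : Finset (Space d))
  have hC : ∀ o, IsClosed (C o) := by
    rintro (_ | K)
    · exact hΩ.isOpen.isClosed_compl
    · exact (isCompact_hull _).isClosed
  have hcov : ⋃ o, C o = Set.univ := by
    refine Set.eq_univ_of_forall fun x => ?_
    by_cases hx : x ∈ Ω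
    · obtain ⟨K, hK, hxK⟩ := M.exists_mem_hull (subset_closure hx)
      exact Set.mem_iUnion.2 ⟨some ⟨K, hK⟩, hxK⟩
    · exact Set.mem_iUnion.2 ⟨none, hx⟩
  set B := M.elements.sup L
  have hlip : ∀ o, LipschitzOnWith B (M.feInterp v) (C o) := by
    rintro (_ | ⟨K, hK⟩)
    · intro x hx y hy
      rw [feInterp_eq_zero hΩ hv hx, feInterp_eq_zero hΩ hv hy]
      simp
    · intro x hx y hy
      rw [feInterp_eq hK hx, feInterp_eq hK hy]
      exact (hL K).weaken (Finset.le_sup hK) hx hy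
  refine ⟨B, lipschitzWith_of_closed_cover hC hcov ?_ hlip⟩
  exact (locallyFinite_of_finite C).continuous hcov hC fun o => (hlip o).continuousOn

lemma exists_polynomial_bary (K : Finset (Space d)) (z : Space d) :
    ∃ q : MvPolynomial (Fin d) ℝ, q.totalDegree ≤ 1 ∧
      ∀ x : Space d, MvPolynomial.eval (fun i => x i) q = bary K z x := by
  refine ⟨MvPolynomial.C (bary K z 0) + ∑ i, MvPolynomial.C (baryGrad K z i) * MvPolynomial.X i,
    ?_, fun x => ?_⟩
  · refine (MvPolynomial.totalDegree_add _ _).trans (max_le (by simp) ?_)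
    refine MvPolynomial.totalDegree_finsetSum_le fun i _ => ?_
    refine (MvPolynomial.totalDegree_mul _ _).trans ?_
    simp
  · rw [bary_eq_affine K z x]
    simp [map_sum]

lemma exists_polynomial_interp (K : Finset (Space d)) (v : Space d → ℝ) :
    ∃ q : MvPolynomial (Fin d) ℝ, q.totalDegree ≤ 2 ∧
      ∀ x : Space d, interp K v x = MvPolynomial.eval (fun i => x i) q := by
  choose b hb1 hb2 using exists_polynomial_bary K
  refine ⟨MvPolynomial.C 2 * (∑ z ∈ K, ∑ y ∈ K,
    MvPolynomial.C (v ((1 / 2 : ℝ) • z + (1 / 2 : ℝ) • y)) * (b z * b y)) -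
    ∑ z ∈ K, MvPolynomial.C (v z) * b z, ?_, fun x => ?_⟩
  · refine (MvPolynomial.totalDegree_sub _ _).trans (max_le ?_ ?_)
    · refine (MvPolynomial.totalDegree_mul _ _).trans ?_
      rw [MvPolynomial.totalDegree_C, zero_add]
      refine MvPolynomial.totalDegree_finsetSum_le fun z _ =>
        MvPolynomial.totalDegree_finsetSum_le fun y _ => ?_
      refine (MvPolynomial.totalDegree_mul _ _).trans ?_
      rw [MvPolynomial.totalDegree_C, zero_add]
      exact (MvPolynomial.totalDegree_mul _ _).trans (add_le_add (hb1 z) (hb1 y))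
    · refine MvPolynomial.totalDegree_finsetSum_le fun z _ => ?_
      refine (MvPolynomial.totalDegree_mul _ _).trans ?_
      rw [MvPolynomial.totalDegree_C, zero_add]
      exact (hb1 z).trans (by norm_num)
  · simp [map_sum, hb2, interp]

lemma mem_dgSpace_of_ae_eq {p : ℕ} (hp : 2 ≤ p) (w : L2 Ω)
    (hw : w =ᵐ[volume.restrict Ω] M.feInterp v) : w ∈ M.dgSpace p := by
  intro K hK
  obtain ⟨q, hq, h⟩ := exists_polynomial_interp K v
  refine ⟨q, hq.trans hp, ?_⟩
  filter_upwards [hw] with x hx hxK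
  rw [hx, feInterp_eq hK hxK, h]

/-- The interpolant is conforming, so the same function is admissible for the discontinuous space
and for the subspace of `H¹₀`. -/
lemma mem_femSpace_of_ae_eq (hΩ : IsConvexPolytopalDomain Ω) (hv : ∀ y ∈ frontier Ω, v y = 0)
    {p : ℕ} (hp : 2 ≤ p) (s : Fin 2) (w : L2 Ω) (hw : w =ᵐ[volume.restrict Ω] M.feInterp v) :
    w ∈ M.femSpace p s := by
  obtain ⟨L, hL⟩ := exists_lipschitzWith_feInterp (M := M) hΩ hv
  have h1 := mem_dgSpace_of_ae_eq hp w hw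
  have h2 := mem_H10_of_lipschitz hΩ hL (fun x hx => feInterp_eq_zero hΩ hv hx) w hw
  unfold femSpace
  split_ifs
  exacts [h1, ⟨h1, h2⟩]

end Mesh

/-! ### Boundary values of functions in `H¹₀` -/

section boundary
variable {d : ℕ} {Ω : Set (Space d)}

lemma continuousOn_of_uniform {s : Set (Space d)} {ψ : ℕ → Space d → ℝ} {v : Space d → ℝ} {ε : ℕ → ℝ}
    (hψ : ∀ n, Continuous (ψ n)) (hε : Tendsto ε atTop (𝓝 0))
    (h : ∀ n, ∀ x ∈ s, |ψ n x - v x| ≤ ε n) : ContinuousOn v s := by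
  refine TendstoUniformlyOn.continuousOn (F := ψ) (p := atTop) ?_
    (Eventually.of_forall fun n => (hψ n).continuousOn).frequently
  rw [Metric.tendstoUniformlyOn_iff]
  intro δ hδ
  filter_upwards [hε.eventually_lt_const hδ] with n hn x hx
  rw [dist_comm, Real.dist_eq]
  exact (h n x hx).trans_lt hn

/-- Points near a boundary point leave `Ω` soon, when they are moved outwards. -/
lemma exists_exit (hΩ : IsConvexPolytopalDomain Ω) {x₀ x : Space d} (hx₀ : x₀ ∈ Ω)
    (hx : x ∈ frontier Ω) {η : ℝ} (hη : 0 < η) : ∀ᶠ y in 𝓝 x, y ∈ Ω →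
      ∃ τ, 0 ≤ τ ∧ τ ≤ η ∧ y + τ • (x - x₀) ∈ frontier Ω ∧
        ∀ s, 0 ≤ s → s < τ → y + s • (x - x₀) ∈ Ω := by
  have hxΩ : x ∉ Ω := by
    have := hx.2
    rwa [hΩ.isOpen.interior_eq] at this
  -- Otherwise `x` would lie strictly between the interior point `x₀` and a point of the closure,
  -- hence in `Ω`.
  have h1 : x + η • (x - x₀) ∉ closure Ω := by
    intro hcl
    refine hxΩ ?_
    have h2 := hΩ.convex.combo_interior_closure_mem_interior (hΩ.isOpen.interior_eq.symm ▸ hx₀) hcl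
      (a := η / (1 + η)) (b := 1 / (1 + η)) (by positivity) (by positivity)
      (by rw [← add_div, add_comm, div_self (by positivity)])
    rw [hΩ.isOpen.interior_eq] at h2
    convert h2 using 1
    have e1 : η / (1 + η) + 1 / (1 + η) = 1 := by
      rw [← add_div, add_comm, div_self (by positivity)]
    have e2 : 1 / (1 + η) * (1 + η) = 1 := by field_simp
    have : x = (η / (1 + η) + 1 / (1 + η)) • x₀ + (1 / (1 + η) * (1 + η)) • (x - x₀) := by
      rw [e1, e2]; module
    conv_lhs => rw [this]
    module
  have hcont : Continuous fun y : Space d => y + η • (x - x₀) := by fun_prop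
  filter_upwards [hcont.continuousAt.eventually (isClosed_closure.isOpen_compl.mem_nhds h1)]
    with y hy hyΩ
  let γ : ℝ → Space d := fun s => y + s • (x - x₀)
  have hγ : Continuous γ := by fun_prop
  -- The segment starts in `Ω` and ends outside of the closure, so by connectedness it meets the
  -- frontier. Points before the crossing belong to `Ω` by convexity.
  obtain ⟨b, hb, hbf⟩ : (γ '' Set.Icc 0 η ∩ frontier Ω).Nonempty := by
    by_contra hemp
    rw [Set.not_nonempty_iff_eq_empty] at hemp
    have hp : IsPreconnected (γ '' Set.Icc 0 η) := isPreconnected_Icc.image _ hγ.continuousOn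
    obtain ⟨z, -, hz1, hz2⟩ := hp Ω (closure Ω)ᶜ hΩ.isOpen isClosed_closure.isOpen_compl
      (fun z hz => by
        by_contra hno
        rw [Set.mem_union, not_or, Set.notMem_compl_iff] at hno
        have : z ∈ γ '' Set.Icc 0 η ∩ frontier Ω :=
          ⟨hz, hno.2, by rw [hΩ.isOpen.interior_eq]; exact hno.1⟩
        rw [hemp] at this
        exact this)
      ⟨γ 0, ⟨0, ⟨le_rfl, hη.le⟩, rfl⟩, by simpa [γ] using hyΩ⟩
      ⟨γ η, ⟨η, ⟨hη.le, le_rfl⟩, rfl⟩, hy⟩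
    exact hz2 (subset_closure hz1)
  obtain ⟨τ, ⟨h0, h2⟩, rfl⟩ := hb
  refine ⟨τ, h0, h2, hbf, fun s hs hsτ => ?_⟩
  have hτ : 0 < τ := hs.trans_lt hsτ
  have h3 := hΩ.convex.combo_interior_closure_mem_interior (hΩ.isOpen.interior_eq.symm ▸ hyΩ)
    (frontier_subset_closure hbf) (a := 1 - s / τ) (b := s / τ)
    (by rw [sub_pos, div_lt_one hτ]; exact hsτ) (by positivity) (by ring)
  rw [hΩ.isOpen.interior_eq] at h3
  convert h3 using 1
  have e : s / τ * τ = s := by field_simp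
  simp only [γ]
  conv_lhs => rw [← e]
  module

/-- Fubini and translation invariance: for each `s` the integral over `y` is at most the integral
over `Ω`. The indicator makes the bound involve the derivative inside `Ω` only. -/
lemma lintegral_line_le (hΩ : IsOpen Ω) {χ : Space d → ℝ} (hχ : ContDiff ℝ ∞ χ) (e : Space d)
    {η : ℝ} (A : Set (Space d)) :
    ∫⁻ y in A, (∫⁻ s in Set.Ioo 0 η, Ω.indicator (fun z => ‖fderiv ℝ χ z e‖ₑ) (y + s • e)) ≤
      ENNReal.ofReal η * ∫⁻ z in Ω, ‖fderiv ℝ χ z e‖ₑ := by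
  have hc : Continuous fun z => fderiv ℝ χ z e :=
    (hχ.continuous_fderiv (by simp)).clm_apply continuous_const
  have hm : Measurable (Ω.indicator fun z => ‖fderiv ℝ χ z e‖ₑ) :=
    hc.enorm.measurable.indicator hΩ.measurableSet
  have hj : Measurable fun p : Space d × ℝ => p.1 + p.2 • e :=
    (by fun_prop : Continuous fun p : Space d × ℝ => p.1 + p.2 • e).measurable
  rw [lintegral_lintegral_swap
    (f := fun y s => Ω.indicator (fun z => ‖fderiv ℝ χ z e‖ₑ) (y + s • e)) (hm.comp hj).aemeasurable]
  calc _ ≤ ∫⁻ s in Set.Ioo 0 η, ∫⁻ z in Ω, ‖fderiv ℝ χ z e‖ₑ := by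
        refine lintegral_mono fun s => ?_
        refine (setLIntegral_le_lintegral _ _).trans ?_
        rw [lintegral_add_right_eq_self (Ω.indicator fun z => ‖fderiv ℝ χ z e‖ₑ) (s • e),
          lintegral_indicator hΩ.measurableSet]
    _ = _ := by simp [mul_comm]

/-- The differences `χ n = ψ n - φ n` of smooth approximations and test functions tend to zero in
`H¹(Ω)`, while on the boundary they equal `ψ n`, since the test functions vanish there. If `vc` were
nonzero at a boundary point, then `|χ n|` would be bounded below on the boundary nearby. Following
parallel segments from a small open set `A` to the boundary bounds this lower bound by `|χ n|` on
`A` plus a line integral of the derivative, and integrating over `A` gives a contradiction. No trace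
operator on `Ω` is needed. -/
theorem eq_zero_of_mem_H10 (hΩ : IsConvexPolytopalDomain Ω) {u : L2 Ω} {ψ : ℕ → Space d → ℝ}
    {G : Fin d → Space d → ℝ} {H : Fin d → Fin d → Space d → ℝ} (h : H2Limit Ω ψ u G H)
    (hG : ∀ i, IsWeakDeriv Ω i u (G i)) {vc : Space d → ℝ} {ε : ℕ → ℝ}
    (hε : Tendsto ε atTop (𝓝 0)) (hvc : ∀ n, ∀ x ∈ closure Ω, |ψ n x - vc x| ≤ ε n)
    (hu : u ∈ H10 Ω) : ∀ x ∈ frontier Ω, vc x = 0 := by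
  obtain ⟨g, φ, hφ, hφu, hφg⟩ := hu
  have hfin : IsFiniteMeasure ((volume : Measure (Space d)).restrict Ω) :=
    ⟨by simpa using hΩ.isBounded.measure_lt_top⟩
  set μ := (volume : Measure (Space d)).restrict Ω with hμ
  have hgG : ∀ i, (g i : Space d → ℝ) =ᵐ[μ] G i := fun i =>
    (IsWeakDeriv.of_tendsto (fun n => IsWeakDeriv.of_contDiff (hφ n).1 i) hφu (hφg i)
      (fun n => (hφ n).memLp _) (fun n => ((hφ n).pderiv i).memLp _) (Lp.memLp u)
      (Lp.memLp (g i))).ae_eq hΩ.isOpen (hG i)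
  let χ : ℕ → Space d → ℝ := fun n x => ψ n x - φ n x
  have hχ : ∀ n, ContDiff ℝ ∞ (χ n) := fun n => (h.smooth n).sub (hφ n).1
  have hχ0 : TendstoL2 μ χ fun _ => 0 := by
    refine (h.lim.sub hφu (fun n => (h.smooth n).continuous.aestronglyMeasurable) h.memLp.1
      (fun n => (hφ n).1.continuous.aestronglyMeasurable) h.memLp.1).congr
      (fun n => EventuallyEq.rfl) (Eventually.of_forall fun x => sub_self _)
  have hχi : ∀ i, TendstoL2 μ (fun n => pderiv i (χ n)) fun _ => 0 := by
    intro i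
    have h2 : TendstoL2 μ (fun n => pderiv i (φ n)) (G i) :=
      TendstoL2.congr (hφg i) (fun n => EventuallyEq.rfl) (hgG i)
    refine ((h.lim_grad i).sub h2
      (fun n => (continuous_pderiv (h.smooth n) i).aestronglyMeasurable) (h.memLp_grad i).1
      (fun n => (continuous_pderiv (hφ n).1 i).aestronglyMeasurable) (h.memLp_grad i).1).congr
      (fun n => ?_) (Eventually.of_forall fun x => sub_self _)
    rw [show χ n = fun x => ψ n x - φ n x from rfl, pderiv_sub (h.smooth n) (hφ n).1]
  have toL1 : ∀ {f : ℕ → Space d → ℝ}, (∀ n, Continuous (f n)) → TendstoL2 μ f (fun _ => 0) →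
      Tendsto (fun n => ∫⁻ x, ‖f n x‖ₑ ∂μ) atTop (𝓝 0) := by
    intro f hf hf0
    have h1 : Tendsto (fun n => eLpNorm (fun x => f n x - 0) 2 μ *
        μ Set.univ ^ (1 / (1 : ℝ≥0∞).toReal - 1 / (2 : ℝ≥0∞).toReal)) atTop (𝓝 0) := by
      have := ENNReal.Tendsto.mul_const hf0 (b := μ Set.univ ^ (1 / (1 : ℝ≥0∞).toReal -
        1 / (2 : ℝ≥0∞).toReal)) (Or.inr (ENNReal.rpow_ne_top_of_nonneg (by norm_num)
          (measure_ne_top _ _)))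
      rwa [zero_mul] at this
    refine tendsto_of_le_of_tendsto_zero h1 fun n => ?_
    have := eLpNorm_le_eLpNorm_mul_rpow_measure_univ (p := 1) (q := 2) (μ := μ) (f := f n)
      (by norm_num) (hf n).aestronglyMeasurable
    rw [eLpNorm_one_eq_lintegral_enorm] at this
    simpa using this
  intro x hx
  by_contra hne
  set δ := |vc x| with hδ
  have hδ0 : 0 < δ := abs_pos.2 hne
  have hcont := continuousOn_of_uniform (fun n => (h.smooth n).continuous) hε hvc
  have hxc : x ∈ closure Ω := frontier_subset_closure hx
  obtain ⟨x₀, hx₀⟩ := hΩ.nonempty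
  set e := x - x₀ with he
  obtain ⟨r, hr, hball⟩ : ∃ r > 0, ∀ b ∈ closure Ω, dist b x < r → δ / 2 < |vc b| := by
    have h1 : ∀ᶠ b in 𝓝[closure Ω] x, δ / 2 < |vc b| :=
      (hcont x hxc).abs.eventually (lt_mem_nhds (show δ / 2 < |vc x| by linarith))
    rw [eventually_nhdsWithin_iff, Metric.eventually_nhds_iff] at h1
    obtain ⟨r, hr, h2⟩ := h1
    exact ⟨r, hr, fun b hb hbx => h2 hbx hb⟩
  -- Points within `r / 2` of `x` that are moved by at most `η` in direction `e` stay within `r` of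
  -- `x`, where `|vc|` exceeds `δ / 2` on the closure.
  set η := r / (2 * (‖e‖ + 1)) with hηd
  have hη : 0 < η := by positivity
  have hηe : η * ‖e‖ ≤ r / 2 := by
    rw [hηd, div_mul_eq_mul_div, div_le_div_iff₀ (by positivity) (by positivity)]
    nlinarith [norm_nonneg e]
  obtain ⟨r', hr', hexit⟩ := Metric.eventually_nhds_iff_ball.1 (exists_exit hΩ hx₀ hx hη)
  set A := Ω ∩ Metric.ball x (min r' (r / 2)) with hA
  have hAo : IsOpen A := hΩ.isOpen.inter Metric.isOpen_ball
  have hAne : A.Nonempty := by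
    obtain ⟨y, hy, hyΩ⟩ := mem_closure_iff.1 hxc _ Metric.isOpen_ball
      (Metric.mem_ball_self (lt_min hr' (half_pos hr)))
    exact ⟨y, hyΩ, hy⟩
  -- At the exit point `b` the uniform error below `δ / 4` leaves `|ψ n b| ≥ δ / 4`, and `φ n b =
  -- 0`. The fundamental theorem of calculus transports this lower bound back to `y`.
  have hpt : ∀ n, ε n < δ / 4 → ∀ y ∈ A, ENNReal.ofReal (δ / 4) ≤ ‖χ n y‖ₑ +
      ∫⁻ s in Set.Ioo 0 η, Ω.indicator (fun z => ‖fderiv ℝ (χ n) z e‖ₑ) (y + s • e) := by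
    rintro n hn y ⟨hyΩ, hyx⟩
    rw [Metric.mem_ball, lt_min_iff] at hyx
    obtain ⟨τ, h0, hτη, hbf, hin⟩ := hexit y hyx.1 hyΩ
    set b := y + τ • e with hb
    have hbc : b ∈ closure Ω := frontier_subset_closure hbf
    have hbx : dist b x < r := by
      have h1 : dist b y ≤ r / 2 := by
        rw [dist_eq_norm, hb, add_sub_cancel_left, norm_smul, Real.norm_of_nonneg h0]
        exact (mul_le_mul_of_nonneg_right hτη (norm_nonneg _)).trans hηe
      linarith [dist_triangle b y x, hyx.2]
    have hbΩ : b ∉ Ω := by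
      have := hbf.2
      rwa [hΩ.isOpen.interior_eq] at this
    have hχb : δ / 4 ≤ |χ n b| := by
      have h1 := hvc n b hbc
      have h2 := hball b hbc hbx
      have h3 := abs_sub_abs_le_abs_sub (vc b) (ψ n b)
      rw [abs_sub_comm] at h3
      simp only [χ, (hφ n).eq_zero hbΩ, sub_zero]
      linarith
    have hc : Continuous fun s : ℝ => fderiv ℝ (χ n) (y + s • e) e :=
      (((hχ n).continuous_fderiv (by simp)).comp (by fun_prop)).clm_apply continuous_const
    have hint : χ n b = χ n y + ∫ s in Set.Ioo 0 τ, fderiv ℝ (χ n) (y + s • e) e := by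
      rw [← integral_Ioc_eq_integral_Ioo, ← intervalIntegral.integral_of_le h0,
        intervalIntegral.integral_eq_sub_of_hasDerivAt
          (fun s _ => hasDerivAt_line (hχ n) y e s) (hc.intervalIntegrable _ _)]
      simp [hb]
    have h4 : ENNReal.ofReal (δ / 4) ≤ ‖χ n b‖ₑ := by
      rw [Real.enorm_eq_ofReal_abs]
      exact ENNReal.ofReal_le_ofReal hχb
    refine h4.trans ?_
    rw [hint]
    refine (enorm_add_le _ _).trans (add_le_add_right ?_ _)
    refine (enorm_integral_le_lintegral_enorm _).trans ?_
    refine le_trans ?_ (lintegral_mono_set (Set.Ioo_subset_Ioo_right hτη))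
    refine setLIntegral_mono' measurableSet_Ioo fun s hs => ?_
    rw [Set.indicator_of_mem (hin s hs.1.le hs.2)]
  have hlim : Tendsto (fun n => (∫⁻ z, ‖χ n z‖ₑ ∂μ) + ENNReal.ofReal η *
      ∑ i, ENNReal.ofReal ‖e‖ * ∫⁻ z, ‖pderiv i (χ n) z‖ₑ ∂μ) atTop (𝓝 0) := by
    have h1 := toL1 (fun n => (hχ n).continuous) hχ0
    have h2 := fun i => ENNReal.Tendsto.const_mul (a := ENNReal.ofReal ‖e‖)
      (toL1 (fun n => continuous_pderiv (hχ n) i) (hχi i)) (Or.inr ENNReal.ofReal_ne_top)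
    have h3 := tendsto_finsetSum Finset.univ fun i _ => h2 i
    have h4 := h1.add (ENNReal.Tendsto.const_mul (a := ENNReal.ofReal η) h3
      (Or.inr ENNReal.ofReal_ne_top))
    simpa using h4
  have hbound : ∀ᶠ n in atTop, ENNReal.ofReal (δ / 4) * volume A ≤ (∫⁻ z, ‖χ n z‖ₑ ∂μ) +
      ENNReal.ofReal η * ∑ i, ENNReal.ofReal ‖e‖ * ∫⁻ z, ‖pderiv i (χ n) z‖ₑ ∂μ := by
    filter_upwards [hε.eventually_lt_const (by linarith : (0:ℝ) < δ / 4)] with n hn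
    have hAle : ENNReal.ofReal (δ / 4) * volume A ≤ ∫⁻ y in A, (‖χ n y‖ₑ +
        ∫⁻ s in Set.Ioo 0 η, Ω.indicator (fun z => ‖fderiv ℝ (χ n) z e‖ₑ) (y + s • e)) := by
      rw [← setLIntegral_const]
      exact setLIntegral_mono' hAo.measurableSet (hpt n hn)
    refine hAle.trans ?_
    rw [lintegral_add_left (hχ n).continuous.enorm.measurable]
    refine add_le_add (lintegral_mono_set Set.inter_subset_left) ?_
    refine (lintegral_line_le hΩ.isOpen (hχ n) e A).trans ?_
    gcongr
    rw [← Finset.sum_congr rfl fun i _ => lintegral_const_mul' _ _ ENNReal.ofReal_ne_top,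
      ← lintegral_finsetSum _ fun i _ =>
        (continuous_pderiv (hχ n) i).enorm.measurable.const_mul _]
    refine lintegral_mono fun z => ?_
    rw [fderiv_apply_eq]
    refine (enorm_sum_le _ _).trans (Finset.sum_le_sum fun i _ => ?_)
    rw [enorm_mul]
    gcongr
    rw [Real.enorm_eq_ofReal_abs]
    exact ENNReal.ofReal_le_ofReal (PiLp.norm_apply_le e i)
  have h5 := ge_of_tendsto hlim hbound
  have h6 : 0 < ENNReal.ofReal (δ / 4) * volume A :=
    ENNReal.mul_pos (ENNReal.ofReal_pos.2 (by positivity)).ne' (hAo.measure_pos _ hAne).ne'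
  exact h6.not_ge h5

end boundary

/-! ### Elementwise Sobolev functions, jumps and the mesh norm -/

section congr
variable {d : ℕ} {K : Finset (Space d)} {v w k : Space d → ℝ} {G G' H : Fin d → Space d → ℝ}
  {U : Set (Space d)}

lemma H1Approx.congr (h : H1Approx U v G) (h1 : v =ᵐ[volume.restrict U] w)
    (h2 : ∀ i, G i =ᵐ[volume.restrict U] G' i) : H1Approx U w G' := by
  obtain ⟨ψ, hψ, h3, h4⟩ := h.approx
  exact ⟨fun i => (h.weak i).congr h1 (h2 i), h.memLp.ae_eq h1,
    fun i => (h.memLp_grad i).ae_eq (h2 i), ψ, hψ, h3.congr (fun _ => EventuallyEq.rfl) h1,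
    fun i => (h4 i).congr (fun _ => EventuallyEq.rfl) (h2 i)⟩

lemma H1Approx.trace_congr (hd : 1 ≤ d) (hK : IsSimplex K) (h : H1Approx (interior (hull K)) v G)
    (h1 : v =ᵐ[volume.restrict (interior (hull K))] w) :
    trace (interior (hull K)) w
      =ᵐ[μHE[d - 1].restrict (frontier (interior (hull K)))] trace (interior (hull K)) v := by
  obtain ⟨ψ, hψ, h3, h4⟩ := h.approx
  exact (h.congr h1 fun _ => EventuallyEq.rfl).trace_ae_eq hd hK hψ
    (h3.congr (fun _ => EventuallyEq.rfl) h1) h4 le_rfl (h.memLp_trace hd hK).1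
    (h.tendsto_trace hd hK hψ h3 h4)

lemma H1Approx.trace_sub_congr (hd : 1 ≤ d) (hK : IsSimplex K)
    (hv : H1Approx (interior (hull K)) v G) (hw : H1Approx (interior (hull K)) w H)
    (hk : k =ᵐ[volume.restrict (interior (hull K))] fun x => v x - w x) :
    trace (interior (hull K)) k =ᵐ[μHE[d - 1].restrict (frontier (interior (hull K)))]
      fun x => trace (interior (hull K)) v x - trace (interior (hull K)) w x :=
  ((hv.sub hw).trace_congr hd hK hk.symm).trans (hv.trace_sub hd hK hw)

end congr

namespace Mesh
variable {d : ℕ} {Ω : Set (Space d)} {M : Mesh Ω} {K F : Finset (Space d)} {f g k : Space d → ℝ}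

/-- Elementwise `H¹` functions. -/
def BrokenH1 (M : Mesh Ω) (f : Space d → ℝ) : Prop :=
  ∀ K ∈ M.elements, ∃ G, H1Approx (interior (hull K)) f G

/-- Elementwise `H²` functions. -/
def BrokenH2 (M : Mesh Ω) (f : Space d → ℝ) : Prop :=
  ∀ K ∈ M.elements, ∃ (G : Fin d → Space d → ℝ) (H : Fin d → Fin d → Space d → ℝ), H1Approx (interior (hull K)) f G ∧
    ∀ i, H1Approx (interior (hull K)) (G i) (H i)

lemma BrokenH2.brokenH1 (h : M.BrokenH2 f) : M.BrokenH1 f := fun K hK =>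
  let ⟨G, _, h1, _⟩ := h K hK
  ⟨G, h1⟩

lemma ae_element_of_ae (hΩ : IsConvexPolytopalDomain Ω) (hK : K ∈ M.elements)
    (h : f =ᵐ[volume.restrict Ω] g) : f =ᵐ[volume.restrict (interior (hull K))] g :=
  ae_mono (Measure.restrict_mono (interior_hull_subset hΩ hK) le_rfl) h

lemma exists_isWeakDeriv_brokenDomain {i : Fin d}
    (h : ∀ K ∈ M.elements, ∃ g, IsWeakDeriv (interior (hull K)) i f g) :
    ∃ g, IsWeakDeriv M.brokenDomain i f g :=
  exists_isWeakDeriv_biUnion (fun _ _ => isOpen_interior) M.pairwiseDisjoint h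

/-- The chosen derivative on the broken domain is meaningful only if one exists there; gluing the
elementwise derivatives provides it. Restriction to an element and uniqueness then identify it. -/
lemma weakDeriv_ae_eq_element {i : Fin d}
    (h : ∀ K ∈ M.elements, ∃ g, IsWeakDeriv (interior (hull K)) i f g) (hK : K ∈ M.elements)
    {g : Space d → ℝ} (hg : IsWeakDeriv (interior (hull K)) i f g) :
    weakDeriv M.brokenDomain i f =ᵐ[volume.restrict (interior (hull K))] g :=
  ((weakDeriv_spec (exists_isWeakDeriv_brokenDomain h)).mono
    (interior_hull_subset_brokenDomain hK)).ae_eq isOpen_interior hg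

lemma BrokenH1.exists_weakDeriv (h : M.BrokenH1 f) (i : Fin d) :
    ∀ K ∈ M.elements, ∃ g, IsWeakDeriv (interior (hull K)) i f g := fun K hK =>
  let ⟨G, hG⟩ := h K hK
  ⟨G i, hG.weak i⟩

lemma BrokenH1.weakDeriv_ae_eq (h : M.BrokenH1 f) (hK : K ∈ M.elements) {i : Fin d}
    (hg : IsWeakDeriv (interior (hull K)) i f g) :
    weakDeriv M.brokenDomain i f =ᵐ[volume.restrict (interior (hull K))] g :=
  weakDeriv_ae_eq_element (h.exists_weakDeriv i) hK hg

lemma BrokenH1.h1Approx (h : M.BrokenH1 f) (hK : K ∈ M.elements) :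
    H1Approx (interior (hull K)) f fun i => weakDeriv M.brokenDomain i f := by
  obtain ⟨G, hG⟩ := h K hK
  exact hG.congr EventuallyEq.rfl fun i => (h.weakDeriv_ae_eq hK (hG.weak i)).symm

lemma BrokenH2.brokenH1_weakDeriv (h : M.BrokenH2 f) (i : Fin d) :
    M.BrokenH1 (weakDeriv M.brokenDomain i f) := by
  intro K hK
  obtain ⟨G, H, hG, hH⟩ := h K hK
  exact ⟨H i, (hH i).congr (h.brokenH1.weakDeriv_ae_eq hK (hG.weak i)).symm
    fun _ => EventuallyEq.rfl⟩

lemma BrokenH2.h1Approx_weakDeriv (h : M.BrokenH2 f) (hK : K ∈ M.elements) (i : Fin d) :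
    H1Approx (interior (hull K)) (weakDeriv M.brokenDomain i f)
      fun j => weakHess M.brokenDomain i j f :=
  (h.brokenH1_weakDeriv i).h1Approx hK

lemma BrokenH2.weakHess_ae_eq (h : M.BrokenH2 f) (hK : K ∈ M.elements) {i j : Fin d}
    (hg : IsWeakDeriv (interior (hull K)) i f g) (hk : IsWeakDeriv (interior (hull K)) j g k) :
    weakHess M.brokenDomain i j f =ᵐ[volume.restrict (interior (hull K))] k :=
  (h.brokenH1_weakDeriv i).weakDeriv_ae_eq hK
    (hk.congr (h.brokenH1.weakDeriv_ae_eq hK hg).symm EventuallyEq.rfl)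

lemma BrokenH2.congr (hΩ : IsConvexPolytopalDomain Ω) (h : M.BrokenH2 f)
    (hfg : f =ᵐ[volume.restrict Ω] g) : M.BrokenH2 g := fun K hK =>
  let ⟨G, H, hG, hH⟩ := h K hK
  ⟨G, H, hG.congr (ae_element_of_ae hΩ hK hfg) fun _ => EventuallyEq.rfl, hH⟩

lemma BrokenH2.sub (h : M.BrokenH2 f) (h' : M.BrokenH2 g) : M.BrokenH2 fun x => f x - g x :=
  fun K hK =>
  let ⟨_, _, hG, hH⟩ := h K hK
  let ⟨_, _, hG', hH'⟩ := h' K hK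
  ⟨_, _, hG.sub hG', fun i => (hH i).sub (hH' i)⟩

/-- Elementwise smooth functions are elementwise `H²`. -/
lemma brokenH2_of_piecewise {q : Finset (Space d) → Space d → ℝ} (hq : ∀ K, ContDiff ℝ ∞ (q K))
    (h : ∀ K ∈ M.elements, q K =ᵐ[volume.restrict (interior (hull K))] f) : M.BrokenH2 f := by
  intro K hK
  have hm : ∀ {ψ : Space d → ℝ}, ContDiff ℝ ∞ ψ →
      H1Approx (interior (hull K)) ψ fun i => pderiv i ψ := fun {ψ} hψ =>
    ⟨fun i => IsWeakDeriv.of_contDiff hψ i, memLp_interior_hull hψ.continuous K,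
      fun i => memLp_interior_hull (continuous_pderiv hψ i) K, fun _ => ψ, fun _ => hψ,
      TendstoL2.const _, fun i => TendstoL2.const _⟩
  exact ⟨_, _, (hm (hq K)).congr (h K hK) fun _ => EventuallyEq.rfl,
    fun i => hm (contDiff_pderiv (hq K) i)⟩

/-! ### Jumps -/

/-- Isolates the arbitrary choice of adjacent elements in the definition of `jump`: the same pair
serves for all functions, so jumps are differences of traces in a uniform way. -/
lemma jump_cases (hF : F ∈ M.facets) :
    (F ∈ M.interiorFacets ∧ ∃ K ∈ M.elements, ∃ K' ∈ M.elements, K ≠ K' ∧ F ⊆ K ∧ F ⊆ K' ∧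
      ∀ v x, M.jump F v x = trace (interior (hull K)) v x - trace (interior (hull K')) v x) ∨
    ((¬ ∃ Q, M.IsShared F Q) ∧ ∃ K ∈ M.elements, F ⊆ K ∧
      ∀ v x, M.jump F v x = trace (interior (hull K)) v x) := by
  by_cases h : ∃ Q, M.IsShared F Q
  · left
    have h1 := h.choose_spec
    refine ⟨?_, h.choose.1, h1.1, h.choose.2, h1.2.1, h1.2.2.1, h1.2.2.2.1, h1.2.2.2.2,
      fun v x => ?_⟩
    · simp only [interiorFacets, Finset.mem_filter]
      exact ⟨hF, h⟩
    · rw [jump, dif_pos h]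
  · right
    have h' := exists_element_of_facet hF
    exact ⟨h, h'.choose, h'.choose_spec.1, h'.choose_spec.2, fun v x => by
      rw [jump, dif_neg h, dif_pos h']⟩

lemma facet_subset_frontier (hF : F ∈ M.facets) (hK : K ∈ M.elements) (h : F ⊆ K) :
    hull F ⊆ frontier (interior (hull K)) := by
  classical
  obtain ⟨z, hz, rfl⟩ := exists_erase_eq hF hK h
  exact (isSimplex hK).facet_subset_frontier hz

lemma restrict_facet_le (hF : F ∈ M.facets) (hK : K ∈ M.elements) (h : F ⊆ K) :
    (μHE[d - 1] : Measure (Space d)).restrict (hull F) ≤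
      μHE[d - 1].restrict (frontier (interior (hull K))) :=
  Measure.restrict_mono (facet_subset_frontier hF hK h) le_rfl

lemma mem_facets_of_interior (hF : F ∈ M.interiorFacets) : F ∈ M.facets := by
  simp only [interiorFacets, Finset.mem_filter] at hF
  exact hF.1

variable (hd : 1 ≤ d)
include hd

lemma BrokenH1.memLp_trace (h : M.BrokenH1 f) (hF : F ∈ M.facets) (hK : K ∈ M.elements)
    (hFK : F ⊆ K) : MemLp (trace (interior (hull K)) f) 2 (μHE[d - 1].restrict (hull F)) :=
  ((h.h1Approx hK).memLp_trace hd (isSimplex hK)).mono_measure (restrict_facet_le hF hK hFK)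

lemma BrokenH1.memLp_jump (h : M.BrokenH1 f) (hF : F ∈ M.facets) :
    MemLp (M.jump F f) 2 (μHE[d - 1].restrict (hull F)) := by
  rcases jump_cases hF with ⟨-, K, hK, K', hK', -, hFK, hFK', hj⟩ | ⟨-, K, hK, hFK, hj⟩
  · rw [show M.jump F f = fun x => _ from funext (hj f)]
    exact (h.memLp_trace hd hF hK hFK).sub (h.memLp_trace hd hF hK' hFK')
  · rw [show M.jump F f = fun x => _ from funext (hj f)]
    exact h.memLp_trace hd hF hK hFK

lemma jump_sub (hf : M.BrokenH1 f) (hg : M.BrokenH1 g)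
    (hk : ∀ K ∈ M.elements, k =ᵐ[volume.restrict (interior (hull K))] fun x => f x - g x)
    (hF : F ∈ M.facets) :
    M.jump F k =ᵐ[μHE[d - 1].restrict (hull F)] fun x => M.jump F f x - M.jump F g x := by
  have key : ∀ K ∈ M.elements, F ⊆ K → trace (interior (hull K)) k
      =ᵐ[μHE[d - 1].restrict (hull F)]
      fun x => trace (interior (hull K)) f x - trace (interior (hull K)) g x := fun K hK hFK =>
    ae_mono (restrict_facet_le hF hK hFK)
      ((hf.h1Approx hK).trace_sub_congr hd (isSimplex hK) (hg.h1Approx hK) (hk K hK))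
  rcases jump_cases hF with ⟨-, K, hK, K', hK', -, hFK, hFK', hj⟩ | ⟨-, K, hK, hFK, hj⟩
  · filter_upwards [key K hK hFK, key K' hK' hFK'] with x h1 h2
    rw [hj, hj, hj, h1, h2]
    ring
  · filter_upwards [key K hK hFK] with x h1
    rw [hj, hj, hj, h1]

/-- The jumps of `H¹₀` functions with continuous representatives vanish. -/
lemma jump_eq_zero (hΩ : IsConvexPolytopalDomain Ω) {c : Space d → ℝ}
    (hc : ∀ y ∈ frontier Ω, c y = 0)
    (h : ∀ K ∈ M.elements, ∃ (G : Fin d → Space d → ℝ) (ψ : ℕ → Space d → ℝ) (ε : ℕ → ℝ),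
      H1Approx (interior (hull K)) f G ∧ (∀ n, ContDiff ℝ ∞ (ψ n)) ∧
      TendstoL2 (volume.restrict (interior (hull K))) ψ f ∧
      (∀ i, TendstoL2 (volume.restrict (interior (hull K))) (fun n => pderiv i (ψ n)) (G i)) ∧
      Tendsto ε atTop (𝓝 0) ∧ ∀ n, ∀ x ∈ hull K, |ψ n x - c x| ≤ ε n) (hF : F ∈ M.facets) :
    M.jump F f =ᵐ[μHE[d - 1].restrict (hull F)] fun _ => 0 := by
  classical
  -- Uniform convergence to `c` passes to the facet and identifies the trace from every adjacent
  -- element with the same function `c`. Facets with a single element lie in the frontier of `Ω`,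
  -- where `c` vanishes.
  have key : ∀ K ∈ M.elements, F ⊆ K → trace (interior (hull K)) f
      =ᵐ[μHE[d - 1].restrict (hull F)] c := by
    intro K hK hFK
    obtain ⟨G, ψ, ε, h1, hψ, h2, h3, hε, h4⟩ := h K hK
    have hcc := (continuousOn_of_uniform (fun n => (hψ n).continuous) hε h4).mono (hull_mono hFK)
    have hfin : IsFiniteMeasure ((μHE[d - 1] : Measure (Space d)).restrict (hull F)) := by
      obtain ⟨z, hz, rfl⟩ := exists_erase_eq hF hK hFK
      exact ⟨by simpa using (isSimplex hK).measure_facet_lt_top hd hz⟩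
    refine h1.trace_ae_eq hd (isSimplex hK) hψ h2 h3 (facet_subset_frontier hF hK hFK)
      (hcc.aestronglyMeasurable (measurableSet_hull F)) ?_
    exact TendstoL2.of_tendstoUniformly_bound hε fun n =>
      ae_restrict_of_forall_mem (measurableSet_hull F) fun x hx => h4 n x (hull_mono hFK hx)
  rcases jump_cases hF with ⟨-, K, hK, K', hK', -, hFK, hFK', hj⟩ | ⟨hns, K, hK, hFK, hj⟩
  · filter_upwards [key K hK hFK, key K' hK' hFK'] with x h1 h2
    rw [hj, h1, h2, sub_self]
  · filter_upwards [key K hK hFK, ae_restrict_mem (measurableSet_hull F)] with x h1 hx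
    rw [hj, h1, hc x (hull_subset_frontier hd hΩ hF hns hx)]

/-- The jumps of derivatives of `H²` functions vanish on interior facets. -/
lemma jump_grad_eq_zero (hΩ : IsConvexPolytopalDomain Ω) {ψ : ℕ → Space d → ℝ} {v : Space d → ℝ}
    {G : Fin d → Space d → ℝ} {H : Fin d → Fin d → Space d → ℝ} (h : H2Limit Ω ψ v G H) {i : Fin d}
    (hf : ∀ K ∈ M.elements, G i =ᵐ[volume.restrict (interior (hull K))] f)
    (hF : F ∈ M.interiorFacets) :
    M.jump F f =ᵐ[μHE[d - 1].restrict (hull F)] fun _ => 0 := by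
  have hFf := mem_facets_of_interior hF
  -- The functions `pderiv i (ψ n)` are smooth across the facet, so one and the same sequence
  -- converges to the traces from both sides.
  have key : ∀ K ∈ M.elements, F ⊆ K → TendstoL2 (μHE[d - 1].restrict (hull F))
      (fun n => pderiv i (ψ n)) (trace (interior (hull K)) f) ∧
      AEStronglyMeasurable (trace (interior (hull K)) f) (μHE[d - 1].restrict (hull F)) := by
    intro K hK hFK
    have h1 := h.mono (interior_hull_subset hΩ hK)
    have h2 := (h1.h1Approx_grad i).congr (hf K hK) fun _ => EventuallyEq.rfl
    exact ⟨(h2.tendsto_trace hd (isSimplex hK) (fun n => contDiff_pderiv (h.smooth n) i)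
      ((h1.lim_grad i).congr (fun _ => EventuallyEq.rfl) (hf K hK)) (h1.lim_hess i)).mono_measure
        (restrict_facet_le hFf hK hFK),
      (h2.memLp_trace hd (isSimplex hK)).1.mono_measure (restrict_facet_le hFf hK hFK)⟩
  rcases jump_cases hFf with ⟨-, K, hK, K', hK', -, hFK, hFK', hj⟩ | ⟨hns, K, hK, hFK, hj⟩
  · have h1 := (key K hK hFK).1.unique (key K' hK' hFK').1
      (fun n => (continuous_pderiv (h.smooth n) i).aestronglyMeasurable) (key K hK hFK).2
      (key K' hK' hFK').2
    filter_upwards [h1] with x hx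
    rw [hj, hx, sub_self]
  · simp only [interiorFacets, Finset.mem_filter] at hF
    exact absurd hF.2 hns

end Mesh

/-! ### The mesh norm -/

lemma integrable_sq_of_memLp {X : Type*} [MeasurableSpace X] {μ : Measure X} {f : X → ℝ}
    (hf : MemLp f 2 μ) : Integrable (fun x => f x ^ 2) μ :=
  (memLp_two_iff_integrable_sq hf.1).1 hf

lemma integral_sq_le_two_mul {X : Type*} [MeasurableSpace X] {μ : Measure X} {f g k : X → ℝ}
    (hf : MemLp f 2 μ) (hg : MemLp g 2 μ) (hk : k =ᵐ[μ] fun x => f x - g x) :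
    ∫ x, k x ^ 2 ∂μ ≤ 2 * (∫ x, f x ^ 2 ∂μ) + 2 * ∫ x, g x ^ 2 ∂μ := by
  have i1 := integrable_sq_of_memLp hf
  have i2 := integrable_sq_of_memLp hg
  rw [← integral_const_mul, ← integral_const_mul,
    ← integral_add (i1.const_mul 2) (i2.const_mul 2)]
  have hk' : MemLp k 2 μ := (hf.sub hg).ae_eq hk.symm
  refine integral_mono_ae (integrable_sq_of_memLp hk') ((i1.const_mul 2).add (i2.const_mul 2)) ?_
  filter_upwards [hk] with x hx
  simp only [hx]
  nlinarith [sq_nonneg (f x + g x)]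

namespace Mesh
variable {d : ℕ} {Ω : Set (Space d)} {M : Mesh Ω} {K F : Finset (Space d)}
  {f g k : Space d → ℝ}

lemma facetSize_nonneg (F : Finset (Space d)) : 0 ≤ facetSize F :=
  Real.rpow_nonneg measureReal_nonneg _

lemma ae_of_elements (hΩ : IsConvexPolytopalDomain Ω)
    (h : ∀ K ∈ M.elements, f =ᵐ[volume.restrict (interior (hull K))] g) :
    f =ᵐ[volume.restrict Ω] g := by
  rw [← restrict_brokenDomain (M := M) hΩ, brokenDomain]
  exact (ae_restrict_biUnion_finset_iff _ _ _).2 h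

lemma BrokenH2.memLp_weakDeriv (hΩ : IsConvexPolytopalDomain Ω) (h : M.BrokenH2 f) (i : Fin d) :
    MemLp (weakDeriv M.brokenDomain i f) 2 (volume.restrict Ω) :=
  memLp_of_elements hΩ fun _ hK => (h.h1Approx_weakDeriv hK i).memLp

lemma BrokenH2.memLp_weakHess (hΩ : IsConvexPolytopalDomain Ω) (h : M.BrokenH2 f) (i j : Fin d) :
    MemLp (weakHess M.brokenDomain i j f) 2 (volume.restrict Ω) :=
  memLp_of_elements hΩ fun _ hK => (h.h1Approx_weakDeriv hK i).memLp_grad j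

lemma BrokenH2.weakDeriv_sub (hf : M.BrokenH2 f) (hg : M.BrokenH2 g)
    (hk : ∀ K ∈ M.elements, k =ᵐ[volume.restrict (interior (hull K))] fun x => f x - g x)
    (i : Fin d) : ∀ K ∈ M.elements, weakDeriv M.brokenDomain i k
      =ᵐ[volume.restrict (interior (hull K))]
      fun x => weakDeriv M.brokenDomain i f x - weakDeriv M.brokenDomain i g x := by
  have key : ∀ K ∈ M.elements, IsWeakDeriv (interior (hull K)) i k
      fun x => weakDeriv M.brokenDomain i f x - weakDeriv M.brokenDomain i g x := fun K hK =>
    (((hf.brokenH1.h1Approx hK).weak i).sub ((hg.brokenH1.h1Approx hK).weak i)).congr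
      (hk K hK).symm EventuallyEq.rfl
  exact fun K hK => weakDeriv_ae_eq_element (fun K hK => ⟨_, key K hK⟩) hK (key K hK)

lemma BrokenH2.weakHess_sub (hf : M.BrokenH2 f) (hg : M.BrokenH2 g)
    (hk : ∀ K ∈ M.elements, k =ᵐ[volume.restrict (interior (hull K))] fun x => f x - g x)
    (i j : Fin d) : ∀ K ∈ M.elements, weakHess M.brokenDomain i j k
      =ᵐ[volume.restrict (interior (hull K))]
      fun x => weakHess M.brokenDomain i j f x - weakHess M.brokenDomain i j g x := by
  have key : ∀ K ∈ M.elements, IsWeakDeriv (interior (hull K)) j (weakDeriv M.brokenDomain i k)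
      fun x => weakHess M.brokenDomain i j f x - weakHess M.brokenDomain i j g x := fun K hK =>
    (((hf.h1Approx_weakDeriv hK i).weak j).sub ((hg.h1Approx_weakDeriv hK i).weak j)).congr
      (hf.weakDeriv_sub hg hk i K hK).symm EventuallyEq.rfl
  exact fun K hK => weakDeriv_ae_eq_element (fun K hK => ⟨_, key K hK⟩) hK (key K hK)

lemma jumpSq_nonneg (M : Mesh Ω) (v : L2 Ω) : 0 ≤ M.jumpSq v := by
  refine add_nonneg (Finset.sum_nonneg fun F _ => integral_nonneg fun x => ?_)
    (Finset.sum_nonneg fun F _ => integral_nonneg fun x => ?_)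
  · exact mul_nonneg (inv_nonneg.2 (facetSize_nonneg F)) (Finset.sum_nonneg fun i _ => sq_nonneg _)
  · exact mul_nonneg (inv_nonneg.2 (pow_nonneg (facetSize_nonneg F) 3)) (sq_nonneg _)

/-- The part of the squared mesh norm that is an integral over `Ω`. -/
def volSq (M : Mesh Ω) (v : Space d → ℝ) : ℝ :=
  (∑ i, ∑ j, ∫ x in Ω, weakHess M.brokenDomain i j v x ^ 2) +
    (∑ i, ∫ x in Ω, weakDeriv M.brokenDomain i v x ^ 2) + ∫ x in Ω, v x ^ 2

lemma integral_sq_nonneg {X : Type*} [MeasurableSpace X] (μ : Measure X) (f : X → ℝ) :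
    0 ≤ ∫ x, f x ^ 2 ∂μ := integral_nonneg fun _ => sq_nonneg _

lemma volSq_nonneg (M : Mesh Ω) (v : Space d → ℝ) : 0 ≤ M.volSq v :=
  add_nonneg (add_nonneg (Finset.sum_nonneg fun _ _ => Finset.sum_nonneg fun _ _ =>
    integral_sq_nonneg _ _) (Finset.sum_nonneg fun _ _ => integral_sq_nonneg _ _))
    (integral_sq_nonneg _ _)

/-- Elementwise `H²` regularity makes all terms integrable, so that the integral splits into one
integral for each derivative; this is the form in which the norm is estimated below. -/
lemma meshNorm_sq (hΩ : IsConvexPolytopalDomain Ω) {v : L2 Ω} (h : M.BrokenH2 v) :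
    M.meshNorm v ^ 2 = M.volSq v + M.jumpSq v := by
  have h2 := fun i j => integrable_sq_of_memLp (h.memLp_weakHess hΩ i j)
  have h1 := fun i => integrable_sq_of_memLp (h.memLp_weakDeriv hΩ i)
  have h0 := integrable_sq_of_memLp (Lp.memLp v)
  have s2 : Integrable (fun x => ∑ i, ∑ j, weakHess M.brokenDomain i j v x ^ 2)
      (volume.restrict Ω) :=
    integrable_finsetSum _ fun i _ => integrable_finsetSum _ fun j _ => h2 i j
  have s1 : Integrable (fun x => ∑ i, weakDeriv M.brokenDomain i v x ^ 2) (volume.restrict Ω) :=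
    integrable_finsetSum _ fun i _ => h1 i
  have e : (∫ x in Ω, ((∑ i, ∑ j, weakHess M.brokenDomain i j v x ^ 2) +
      (∑ i, weakDeriv M.brokenDomain i v x ^ 2) + v x ^ 2)) = M.volSq v := by
    have s12 : Integrable (fun x => (∑ i, ∑ j, weakHess M.brokenDomain i j v x ^ 2) +
        ∑ i, weakDeriv M.brokenDomain i v x ^ 2) (volume.restrict Ω) := s2.add s1
    rw [integral_add s12 h0, integral_add s2 s1, integral_finsetSum _ fun i _ => h1 i,
      integral_finsetSum _ fun i _ => integrable_finsetSum _ fun j _ => h2 i j, volSq]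
    simp only [integral_finsetSum _ fun j _ => h2 _ j]
  rw [meshNorm, e, Real.sq_sqrt (add_nonneg (M.volSq_nonneg v) (M.jumpSq_nonneg v))]

lemma volSq_sub_le (hΩ : IsConvexPolytopalDomain Ω) (hf : M.BrokenH2 f) (hg : M.BrokenH2 g)
    (lf : MemLp f 2 (volume.restrict Ω)) (lg : MemLp g 2 (volume.restrict Ω))
    (hk : k =ᵐ[volume.restrict Ω] fun x => f x - g x) :
    M.volSq k ≤ 2 * M.volSq f + 2 * M.volSq g := by
  have hk' := fun K hK => ae_element_of_ae (M := M) (K := K) hΩ hK hk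
  have t2 := fun i j => integral_sq_le_two_mul (hf.memLp_weakHess hΩ i j)
    (hg.memLp_weakHess hΩ i j) (ae_of_elements hΩ (hf.weakHess_sub hg hk' i j))
  have t1 := fun i => integral_sq_le_two_mul (hf.memLp_weakDeriv hΩ i)
    (hg.memLp_weakDeriv hΩ i) (ae_of_elements hΩ (hf.weakDeriv_sub hg hk' i))
  have t0 := integral_sq_le_two_mul lf lg hk
  have u2 := Finset.sum_le_sum fun i (_ : i ∈ Finset.univ) =>
    Finset.sum_le_sum fun j (_ : j ∈ Finset.univ) => t2 i j
  have u1 := Finset.sum_le_sum fun i (_ : i ∈ Finset.univ) => t1 i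
  simp only [Finset.sum_add_distrib, ← Finset.mul_sum] at u1 u2
  unfold volSq
  linarith

lemma jumpSq_eq (hd : 1 ≤ d) {v : L2 Ω} (h : M.BrokenH2 v) : M.jumpSq v =
    (∑ F ∈ M.interiorFacets, (facetSize F)⁻¹ * ∑ i, ∫ x in hull F,
      M.jump F (weakDeriv M.brokenDomain i v) x ^ 2 ∂μHE[d - 1]) +
    ∑ F ∈ M.facets, (facetSize F ^ 3)⁻¹ * ∫ x in hull F, M.jump F v x ^ 2 ∂μHE[d - 1] := by
  unfold jumpSq
  congr 1
  · refine Finset.sum_congr rfl fun F hF => ?_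
    rw [integral_const_mul, integral_finsetSum]
    exact fun i _ => integrable_sq_of_memLp
      ((h.brokenH1_weakDeriv i).memLp_jump hd (mem_facets_of_interior hF))
  · exact Finset.sum_congr rfl fun F hF => integral_const_mul _ _

lemma jumpSq_sub_le (hd : 1 ≤ d) (hΩ : IsConvexPolytopalDomain Ω) {f g : L2 Ω}
    (hf : M.BrokenH2 f) (hg : M.BrokenH2 g) :
    M.jumpSq (f - g) ≤ 2 * M.jumpSq f + 2 * M.jumpSq g := by
  have hk := Lp.coeFn_sub f g
  have hk' := fun K hK => ae_element_of_ae (M := M) (K := K) hΩ hK hk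
  have hb : M.BrokenH2 (f - g : L2 Ω) := (hf.sub hg).congr hΩ hk.symm
  rw [jumpSq_eq hd hf, jumpSq_eq hd hg, jumpSq_eq hd hb]
  have t1 : ∀ F ∈ M.interiorFacets, _ ≤ _ := fun F hF =>
    mul_le_mul_of_nonneg_left (Finset.sum_le_sum fun i (_ : i ∈ Finset.univ) =>
      integral_sq_le_two_mul ((hf.brokenH1_weakDeriv i).memLp_jump hd (mem_facets_of_interior hF))
        ((hg.brokenH1_weakDeriv i).memLp_jump hd (mem_facets_of_interior hF))
        (jump_sub hd (hf.brokenH1_weakDeriv i) (hg.brokenH1_weakDeriv i)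
          (hf.weakDeriv_sub hg hk' i) (mem_facets_of_interior hF)))
      (inv_nonneg.2 (facetSize_nonneg F))
  have t0 : ∀ F ∈ M.facets, _ ≤ _ := fun F hF =>
    mul_le_mul_of_nonneg_left (integral_sq_le_two_mul (hf.brokenH1.memLp_jump hd hF)
        (hg.brokenH1.memLp_jump hd hF) (jump_sub hd hf.brokenH1 hg.brokenH1 hk' hF))
      (inv_nonneg.2 (pow_nonneg (facetSize_nonneg F) 3))
  have u1 := Finset.sum_le_sum t1
  have u0 := Finset.sum_le_sum t0
  simp only [Finset.sum_add_distrib, ← Finset.mul_sum, mul_add, mul_left_comm _ (2 : ℝ)] at u1 u0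
  linarith

/-- A quasi-triangle inequality for the mesh norm. -/
lemma meshNorm_sub_sq_le (hd : 1 ≤ d) (hΩ : IsConvexPolytopalDomain Ω) {f g : L2 Ω}
    (hf : M.BrokenH2 f) (hg : M.BrokenH2 g) :
    M.meshNorm (f - g) ^ 2 ≤ 2 * M.meshNorm f ^ 2 + 2 * M.meshNorm g ^ 2 := by
  have hk := Lp.coeFn_sub f g
  have hb : M.BrokenH2 (f - g : L2 Ω) := (hf.sub hg).congr hΩ hk.symm
  rw [meshNorm_sq hΩ hf, meshNorm_sq hΩ hg, meshNorm_sq hΩ hb]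
  have h1 := jumpSq_sub_le hd hΩ hf hg
  have h2 := volSq_sub_le hΩ hf hg (Lp.memLp f) (Lp.memLp g) hk
  linarith

lemma brokenH2_of_mem_dgSpace (hΩ : IsConvexPolytopalDomain Ω) {p : ℕ} {v : L2 Ω}
    (hv : v ∈ M.dgSpace p) : M.BrokenH2 v := by
  classical
  choose! q _ hq using hv
  refine brokenH2_of_piecewise (q := fun K (x : Space d) => MvPolynomial.eval (fun i => x i) (q K))
    (fun K => ?_) fun K hK => ?_
  · induction q K using MvPolynomial.induction_on with
    | C a => simpa using contDiff_const
    | add a b ha hb => simpa using ha.add hb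
    | mul_X a i ha => simpa using ha.mul (contDiff_coord i)
  · have h1 := ae_mono (Measure.restrict_mono (interior_hull_subset hΩ hK) le_rfl) (hq K hK)
    filter_upwards [h1, ae_restrict_mem isOpen_interior.measurableSet] with x h2 hx
    exact (h2 (interior_subset hx)).symm

lemma brokenH2_of_mem_femSpace (hΩ : IsConvexPolytopalDomain Ω) {p : ℕ} {s : Fin 2} {v : L2 Ω}
    (hv : v ∈ M.femSpace p s) : M.BrokenH2 v := by
  refine brokenH2_of_mem_dgSpace (p := p) hΩ ?_
  unfold femSpace at hv
  split_ifs at hv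
  exacts [hv, hv.1]

/-! ### Shape-regular meshes -/

end Mesh

section shape
variable {d : ℕ} {K F : Finset (Space d)}

/-- The volume of the unit ball. -/
def unitBallVolume (d : ℕ) : ℝ := volume.real (Metric.ball (0 : Space d) 1)

lemma unitBallVolume_pos (d : ℕ) : 0 < unitBallVolume d :=
  ENNReal.toReal_pos (Metric.measure_ball_pos _ _ one_pos).ne' measure_ball_lt_top.ne

lemma volume_hull_ge {x : Space d} {r : ℝ} (hr : 0 ≤ r) (h : Metric.closedBall x r ⊆ hull K) :
    r ^ d * unitBallVolume d ≤ volume.real (hull K) := by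
  have h1 := Measure.addHaar_real_closedBall (volume : Measure (Space d)) x hr
  rw [finrank_euclideanSpace_fin] at h1
  rw [unitBallVolume, ← h1]
  exact measureReal_mono h (isCompact_hull K).measure_lt_top.ne

lemma radius_le_diam (hd : 1 ≤ d) {x : Space d} {r : ℝ} (hr : 0 ≤ r)
    (h : Metric.closedBall x r ⊆ hull K) : r ≤ Metric.diam (hull K) := by
  have hx : x ∈ hull K := h (Metric.mem_closedBall_self hr)
  have hy : x + EuclideanSpace.single ⟨0, hd⟩ r ∈ hull K := h (by simp [abs_of_nonneg hr])
  have := Metric.dist_le_diam_of_mem (isCompact_hull K).isBounded hy hx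
  simpa [abs_of_nonneg hr] using this

/-- Shape-regular simplices contain large balls. -/
lemma IsSimplex.exists_ball (hd : 1 ≤ d) (hK : IsSimplex K) {σ : ℝ} (hσ : 0 ≤ σ)
    (h : Metric.diam (hull K) / inscribedDiam (hull K) ≤ σ) :
    ∃ (x : Space d) (r : ℝ), 0 < r ∧ Metric.closedBall x r ⊆ hull K ∧
      Metric.diam (hull K) ≤ 4 * σ * r := by
  set S : Set ℝ := {δ : ℝ | ∃ x : Space d, ∃ r : ℝ, 0 ≤ r ∧ δ = 2 * r ∧
    Metric.closedBall x r ⊆ hull K}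
  have hρ : inscribedDiam (hull K) = sSup S := rfl
  rw [hρ] at h
  have hb : BddAbove S := by
    refine ⟨2 * Metric.diam (hull K), ?_⟩
    rintro _ ⟨x, r, hr, rfl, hx⟩
    have := radius_le_diam hd hr hx
    linarith
  obtain ⟨x₀, hx₀⟩ := hK.interior_nonempty
  obtain ⟨r, hr, hball⟩ := Metric.nhds_basis_closedBall.mem_iff.1
    (mem_interior_iff_mem_nhds.1 hx₀)
  have hmem : 2 * r ∈ S := ⟨x₀, r, hr.le, rfl, hball⟩
  have hpos : 0 < sSup S := (by linarith : 0 < 2 * r).trans_le (le_csSup hb hmem)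
  -- It suffices to take a ball whose diameter `2 t` exceeds half of the supremum, and attainment
  -- need not be shown. The loss is the factor in `4 * σ`.
  obtain ⟨_, ⟨x, t, ht, rfl, hx⟩, hlt⟩ := exists_lt_of_lt_csSup ⟨_, hmem⟩ (half_lt_self hpos)
  refine ⟨x, t, by linarith, hx, ?_⟩
  rw [div_le_iff₀ hpos] at h
  nlinarith

/-- On shape-regular simplices, the diameter is controlled by the element size. -/
lemma diam_le_elementSize (hd : 1 ≤ d) {x : Space d} {r s : ℝ} (hr : 0 < r) (hs : 0 ≤ s)
    (h : Metric.closedBall x r ⊆ hull K) (hD : Metric.diam (hull K) ≤ s * r) :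
    Metric.diam (hull K) ≤ s / unitBallVolume d ^ (1 / (d : ℝ)) * Mesh.elementSize K := by
  have h1 := volume_hull_ge hr.le h
  have hω := unitBallVolume_pos d
  have hω' : 0 < unitBallVolume d ^ (1 / (d : ℝ)) := Real.rpow_pos_of_pos hω _
  have hd0 : (d : ℝ) ≠ 0 := by positivity
  have h2 : r * unitBallVolume d ^ (1 / (d : ℝ)) ≤ Mesh.elementSize K := by
    refine le_trans (le_of_eq ?_) (Real.rpow_le_rpow (by positivity) h1 (by positivity))
    rw [Real.mul_rpow (by positivity) hω.le, ← Real.rpow_natCast, ← Real.rpow_mul hr.le,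
      mul_one_div_cancel hd0, Real.rpow_one]
  calc Metric.diam (hull K) ≤ s * r := hD
    _ ≤ s * (Mesh.elementSize K / unitBallVolume d ^ (1 / (d : ℝ))) := by
      gcongr
      rwa [le_div_iff₀ hω']
    _ = _ := by ring

/-- The constant in the scaled trace inequality. -/
def facetConst (d : ℕ) (s : ℝ) : ℝ :=
  (1 + Real.sqrt (unitBallVolume (d - 1))) * s ^ d / unitBallVolume d

lemma facetConst_nonneg (d : ℕ) {s : ℝ} (hs : 0 ≤ s) : 0 ≤ facetConst d s := by
  have := unitBallVolume_pos d
  unfold facetConst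
  positivity

/-- Scaling: `h_F⁻¹ |F|` is `h_F^(d-2)`, up to the case of an empty measure, and thus increases with
`|F|`. An upper bound for `|F|` by the diameter is enough and no lower bound for the facet is
required. The resulting power `D^d` is comparable with the volume through the inscribed ball. -/
lemma IsSimplex.facetSize_inv_mul_le [DecidableEq (Space d)] (hd : d = 2 ∨ d = 3)
    (hK : IsSimplex K) {z : Space d}
    (hz : z ∈ K) {x : Space d} {r s : ℝ} (hr : 0 < r) (hs : 0 ≤ s)
    (h : Metric.closedBall x r ⊆ hull K) (hD : Metric.diam (hull K) ≤ s * r) :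
    (Mesh.facetSize (K.erase z))⁻¹ * ((μHE[d - 1] : Measure (Space d)).real (hull (K.erase z)) *
      Metric.diam (hull K) ^ 2) ≤ facetConst d s * volume.real (hull K) := by
  have hd1 : 1 ≤ d := by omega
  set S := (μHE[d - 1] : Measure (Space d)).real (hull (K.erase z)) with hS
  set D := Metric.diam (hull K) with hDdef
  have hS0 : 0 ≤ S := measureReal_nonneg
  have hD0 : 0 ≤ D := Metric.diam_nonneg
  have hω := unitBallVolume_pos d
  have hω' := unitBallVolume_pos (d - 1)
  have hSle : S ≤ D ^ (d - 1) * unitBallVolume (d - 1) := by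
    have h1 := hK.measure_facet_le hd1 hz
    have hdm : Metric.diam (hull (K.erase z)) ≤ D :=
      Metric.diam_mono (hull_mono (Finset.erase_subset _ _)) (isCompact_hull K).isBounded
    have h2 := ENNReal.toReal_mono (ENNReal.mul_ne_top ENNReal.ofReal_ne_top
      measure_ball_lt_top.ne) h1
    rw [ENNReal.toReal_mul, ENNReal.toReal_ofReal (pow_nonneg Metric.diam_nonneg _)] at h2
    refine h2.trans ?_
    exact mul_le_mul_of_nonneg_right (pow_le_pow_left₀ Metric.diam_nonneg hdm _)
      ENNReal.toReal_nonneg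
  have key : (Mesh.facetSize (K.erase z))⁻¹ * S ≤
      (1 + Real.sqrt (unitBallVolume (d - 1))) * D ^ (d - 2) := by
    rcases hd with rfl | rfl
    · have : Mesh.facetSize (K.erase z) = S := by
        rw [Mesh.facetSize]; norm_num [hS]
      rw [this]
      -- An inequality only: if `S = 0`, the left side is `0` since the inverse of zero is zero.
      have h1 : S⁻¹ * S ≤ 1 := by
        rcases eq_or_ne S 0 with h0 | h0
        · simp [h0]
        · rw [inv_mul_cancel₀ h0]
      have h2 := Real.sqrt_nonneg (unitBallVolume (2 - 1))
      rw [Nat.sub_self, pow_zero, mul_one]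
      linarith
    · have e : Mesh.facetSize (K.erase z) = Real.sqrt S := by
        rw [Mesh.facetSize, Real.sqrt_eq_rpow]; norm_num [hS]
      rw [e, inv_mul_eq_div, Real.div_sqrt]
      have h1 : Real.sqrt S ≤ D * Real.sqrt (unitBallVolume (3 - 1)) := by
        refine (Real.sqrt_le_sqrt hSle).trans (le_of_eq ?_)
        rw [Real.sqrt_mul (by positivity)]
        norm_num [Real.sqrt_sq hD0]
      norm_num at h1 ⊢
      linarith
  have hV := volume_hull_ge hr.le h
  have hDd : D ^ (d - 2) * D ^ 2 = D ^ d := by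
    rw [← pow_add]; congr 1; omega
  calc (Mesh.facetSize (K.erase z))⁻¹ * (S * D ^ 2) = (Mesh.facetSize (K.erase z))⁻¹ * S * D ^ 2 := by ring
    _ ≤ (1 + Real.sqrt (unitBallVolume (d - 1))) * D ^ (d - 2) * D ^ 2 := by gcongr
    _ = (1 + Real.sqrt (unitBallVolume (d - 1))) * D ^ d := by rw [mul_assoc, hDd]
    _ ≤ (1 + Real.sqrt (unitBallVolume (d - 1))) * (s * r) ^ d := by gcongr
    _ = facetConst d s * (r ^ d * unitBallVolume d) := by
      rw [facetConst, mul_pow]; field_simp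
    _ ≤ _ := by gcongr; exact facetConst_nonneg d hs

end shape

namespace Mesh
variable {d : ℕ} {Ω : Set (Space d)} {M : Mesh Ω} {K : Finset (Space d)}

lemma exists_ball (hd : 1 ≤ d) {σ : ℝ} (hσ : 0 ≤ σ) (h : M.shapeRegularity ≤ σ)
    (hK : K ∈ M.elements) :
    ∃ (x : Space d) (r : ℝ), 0 < r ∧ Metric.closedBall x r ⊆ hull K ∧
      Metric.diam (hull K) ≤ 4 * σ * r := by
  refine (isSimplex hK).exists_ball hd hσ (le_trans ?_ h)
  exact le_csSup (M.elements.finite_toSet.image _).bddAbove ⟨K, hK, rfl⟩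

lemma elementSize_le (hK : K ∈ M.elements) : elementSize K ≤ M.meshSize :=
  le_csSup (M.elements.finite_toSet.image _).bddAbove ⟨K, hK, rfl⟩

lemma diam_le_meshSize (hd : 1 ≤ d) {σ : ℝ} (hσ : 0 ≤ σ) (h : M.shapeRegularity ≤ σ)
    (hK : K ∈ M.elements) :
    Metric.diam (hull K) ≤ 4 * σ / unitBallVolume d ^ (1 / (d : ℝ)) * M.meshSize := by
  obtain ⟨x, r, hr, hx, hD⟩ := exists_ball hd hσ h hK
  have := unitBallVolume_pos d
  refine (diam_le_elementSize hd hr (by positivity) hx hD).trans ?_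
  gcongr
  exact elementSize_le hK

end Mesh

/-! ### Interpolation in the mesh norm -/

namespace Mesh

/-- `u` is the limit in `H²(Ω)` of the smooth functions `w n`, which converge uniformly to `vc`, and
`vc` vanishes on the boundary. -/
structure ZeroLimit {d : ℕ} (Ω : Set (Space d)) (w : ℕ → Space d → ℝ) (u : Space d → ℝ)
    (G : Fin d → Space d → ℝ) (H : Fin d → Fin d → Space d → ℝ) (vc : Space d → ℝ)
    (ε : ℕ → ℝ) : Prop where
  lim : H2Limit Ω w u G H
  tendsto_zero : Tendsto ε atTop (𝓝 0)
  uniform : ∀ n, ∀ x ∈ closure Ω, |w n x - vc x| ≤ ε n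
  boundary : ∀ x ∈ frontier Ω, vc x = 0

section
variable {d : ℕ} {Ω : Set (Space d)} {M : Mesh Ω} {K F : Finset (Space d)}
  {w : ℕ → Space d → ℝ} {u : Space d → ℝ} {G : Fin d → Space d → ℝ}
  {H : Fin d → Fin d → Space d → ℝ} {vc : Space d → ℝ} {ε : ℕ → ℝ}

namespace ZeroLimit

lemma brokenH2 (h : ZeroLimit Ω w u G H vc ε) (hΩ : IsConvexPolytopalDomain Ω) : M.BrokenH2 u :=
  fun _ hK =>
  let hK' := h.lim.mono (interior_hull_subset hΩ hK)
  ⟨G, H, hK'.h1Approx, hK'.h1Approx_grad⟩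

lemma weakDeriv_ae_eq (h : ZeroLimit Ω w u G H vc ε) (hΩ : IsConvexPolytopalDomain Ω)
    (hK : K ∈ M.elements) (i : Fin d) :
    weakDeriv M.brokenDomain i u =ᵐ[volume.restrict (interior (hull K))] G i :=
  (h.brokenH2 hΩ).brokenH1.weakDeriv_ae_eq hK
    ((h.lim.mono (interior_hull_subset hΩ hK)).h1Approx.weak i)

lemma weakHess_ae_eq (h : ZeroLimit Ω w u G H vc ε) (hΩ : IsConvexPolytopalDomain Ω)
    (hK : K ∈ M.elements) (i j : Fin d) :
    weakHess M.brokenDomain i j u =ᵐ[volume.restrict (interior (hull K))] H i j :=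
  (h.brokenH2 hΩ).weakHess_ae_eq hK
    ((h.lim.mono (interior_hull_subset hΩ hK)).h1Approx.weak i)
    (((h.lim.mono (interior_hull_subset hΩ hK)).h1Approx_grad i).weak j)

lemma jump_ae_eq_zero (h : ZeroLimit Ω w u G H vc ε) (hd : 1 ≤ d) (hΩ : IsConvexPolytopalDomain Ω)
    (hF : F ∈ M.facets) : M.jump F u =ᵐ[μHE[d - 1].restrict (hull F)] fun _ => 0 :=
  jump_eq_zero hd hΩ h.boundary (fun _ hK =>
    let hK' := h.lim.mono (interior_hull_subset hΩ hK)
    ⟨G, w, ε, hK'.h1Approx, h.lim.smooth, hK'.lim, hK'.lim_grad, h.tendsto_zero,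
      fun n x hx => h.uniform n x (hull_subset_closure hK hx)⟩) hF

lemma jump_grad_ae_eq_zero (h : ZeroLimit Ω w u G H vc ε) (hd : 1 ≤ d)
    (hΩ : IsConvexPolytopalDomain Ω) (hF : F ∈ M.interiorFacets) (i : Fin d) :
    M.jump F (weakDeriv M.brokenDomain i u) =ᵐ[μHE[d - 1].restrict (hull F)] fun _ => 0 :=
  jump_grad_eq_zero hd hΩ h.lim (fun _ hK => (h.weakDeriv_ae_eq hΩ hK i).symm) hF

end ZeroLimit

variable {v : Space d → ℝ}

lemma interp_ae_eq (hΩ : IsConvexPolytopalDomain Ω)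
    (hv : v =ᵐ[volume.restrict Ω] M.feInterp vc) (hK : K ∈ M.elements) :
    interp K vc =ᵐ[volume.restrict (interior (hull K))] v := by
  filter_upwards [ae_element_of_ae hΩ hK hv, ae_restrict_mem isOpen_interior.measurableSet]
    with x h1 hx
  rw [h1, feInterp_eq hK (interior_subset hx)]

lemma brokenH2_feInterp (hΩ : IsConvexPolytopalDomain Ω)
    (hv : v =ᵐ[volume.restrict Ω] M.feInterp vc) : M.BrokenH2 v :=
  brokenH2_of_piecewise (fun K => contDiff_interp K vc) fun _ hK => interp_ae_eq hΩ hv hK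

lemma isWeakDeriv_feInterp (hΩ : IsConvexPolytopalDomain Ω)
    (hv : v =ᵐ[volume.restrict Ω] M.feInterp vc) (hK : K ∈ M.elements) (i : Fin d) :
    IsWeakDeriv (interior (hull K)) i v (pderiv i (interp K vc)) :=
  (IsWeakDeriv.of_contDiff (contDiff_interp K vc) i).congr (interp_ae_eq hΩ hv hK)
    EventuallyEq.rfl

lemma h1Approx_of_contDiff {ψ : Space d → ℝ} (hψ : ContDiff ℝ ∞ ψ) :
    H1Approx (interior (hull K)) ψ fun i => pderiv i ψ :=
  ⟨fun i => IsWeakDeriv.of_contDiff hψ i, memLp_interior_hull hψ.continuous K,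
    fun i => memLp_interior_hull (continuous_pderiv hψ i) K, fun _ => ψ, fun _ => hψ,
    TendstoL2.const _, fun _ => TendstoL2.const _⟩

/-- On each element the constant sequence `interp K vc` is a smooth approximation with uniform error
zero, and these polynomials agree on common faces. -/
lemma jump_feInterp_ae_eq_zero (hd : 1 ≤ d) (hΩ : IsConvexPolytopalDomain Ω)
    (hvc : ∀ x ∈ frontier Ω, vc x = 0)
    (hv : v =ᵐ[volume.restrict Ω] M.feInterp vc) (hF : F ∈ M.facets) :
    M.jump F v =ᵐ[μHE[d - 1].restrict (hull F)] fun _ => 0 := by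
  refine jump_eq_zero hd hΩ (c := M.feInterp vc) (fun y hy =>
    feInterp_eq_zero hΩ hvc fun hy' => ?_) (fun K hK => ?_) hF
  · rw [hΩ.isOpen.frontier_eq] at hy
    exact hy.2 hy'
  · refine ⟨fun i => pderiv i (interp K vc), fun _ => interp K vc, fun _ => 0,
      (h1Approx_of_contDiff (contDiff_interp K vc)).congr (interp_ae_eq hΩ hv hK)
        fun _ => EventuallyEq.rfl, fun _ => contDiff_interp K vc,
      (TendstoL2.const _).congr (fun _ => EventuallyEq.rfl) (interp_ae_eq hΩ hv hK),
      fun i => TendstoL2.const _, tendsto_const_nhds, fun n x hx => ?_⟩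
    rw [feInterp_eq hK hx]
    simp

end

/-! ### Error of the interpolant on elements and facets -/

section estimate
variable {d : ℕ} {Ω : Set (Space d)} {M : Mesh Ω} {K F : Finset (Space d)}
  {w : ℕ → Space d → ℝ} {u v : L2 Ω} {G : Fin d → Space d → ℝ}
  {H : Fin d → Fin d → Space d → ℝ} {vc : Space d → ℝ} {ε : ℕ → ℝ}

/-- The jumps of the interpolant are those of the interpolation error. -/
lemma jumpSeminorm_feInterp_le (hd : 1 ≤ d) (hΩ : IsConvexPolytopalDomain Ω)
    (h : ZeroLimit Ω w u G H vc ε) (hv : v =ᵐ[volume.restrict Ω] M.feInterp vc) :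
    M.jumpSeminorm v ≤ M.meshNorm (u - v) := by
  have hu2 := h.brokenH2 (M := M) hΩ
  have hv2 := brokenH2_feInterp hΩ hv
  have hk := Lp.coeFn_sub u v
  have hk' := fun K hK => ae_element_of_ae (M := M) (K := K) hΩ hK hk
  have hb : M.BrokenH2 (u - v : L2 Ω) := (hu2.sub hv2).congr hΩ hk.symm
  have e : M.jumpSq v = M.jumpSq (u - v) := by
    rw [jumpSq_eq hd hv2, jumpSq_eq hd hb]
    congr 1
    · refine Finset.sum_congr rfl fun F hF => ?_
      congr 1
      refine Finset.sum_congr rfl fun i _ => integral_congr_ae ?_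
      filter_upwards [jump_sub hd (hu2.brokenH1_weakDeriv i) (hv2.brokenH1_weakDeriv i)
        (hu2.weakDeriv_sub hv2 hk' i) (mem_facets_of_interior hF),
        h.jump_grad_ae_eq_zero hd hΩ hF i] with x h1 h2
      rw [h1, h2]
      ring
    · refine Finset.sum_congr rfl fun F hF => ?_
      congr 1
      refine integral_congr_ae ?_
      filter_upwards [jump_sub hd hu2.brokenH1 hv2.brokenH1 hk' hF,
        h.jump_ae_eq_zero hd hΩ hF] with x h1 h2
      rw [h1, h2]
      ring
  refine Real.sqrt_le_sqrt ?_
  rw [e]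
  exact le_add_of_nonneg_left (integral_nonneg fun x => add_nonneg (add_nonneg
    (Finset.sum_nonneg fun _ _ => Finset.sum_nonneg fun _ _ => sq_nonneg _)
    (Finset.sum_nonneg fun _ _ => sq_nonneg _)) (sq_nonneg _))

/-- The squared distance of the Hessian to constants. -/
def oscSq (H : Fin d → Fin d → Space d → ℝ) (A : Fin d → Fin d → ℝ) (K : Finset (Space d)) : ℝ :=
  ∑ i, ∑ j, ∫ y in interior (hull K), (H i j y - A i j) ^ 2

lemma oscSq_nonneg (H : Fin d → Fin d → Space d → ℝ) (A : Fin d → Fin d → ℝ)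
    (K : Finset (Space d)) : 0 ≤ oscSq H A K :=
  Finset.sum_nonneg fun _ _ => Finset.sum_nonneg fun _ _ => integral_sq_nonneg _ _

/-- The constant of the trace inequality for the interpolation error. -/
def traceConst (d : ℕ) (s : ℝ) : ℝ :=
  4 * 2 ^ (d - 1) * (2 * interpConst d s) * facetConst d s

lemma traceConst_nonneg (d : ℕ) {s : ℝ} (hs : 0 ≤ s) : 0 ≤ traceConst d s := by
  have h1 := facetConst_nonneg d hs
  have h2 := (interpConst_pos d s).le
  unfold traceConst
  positivity

variable {s r : ℝ} {x₀ : Space d} {A : Fin d → Fin d → ℝ}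

/-- Carries the local interpolation estimate over to the broken weak derivatives of `u - v`, which
agree almost everywhere on the element with the differences of derivatives used there. -/
lemma element_error (hd : d ≤ 3) (hΩ : IsConvexPolytopalDomain Ω)
    (h : ZeroLimit Ω w u G H vc ε) (hv : v =ᵐ[volume.restrict Ω] M.feInterp vc)
    (hK : K ∈ M.elements) (hr : 0 < r) (hball : Metric.closedBall x₀ r ⊆ hull K)
    (hD : Metric.diam (hull K) ≤ s * r) (hA : ∀ i j, A i j = A j i) :
    (∫ y in interior (hull K), (u - v : L2 Ω) y ^ 2) ≤
      interpConst d s * Metric.diam (hull K) ^ 4 * oscSq H A K ∧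
    (∑ i, ∫ y in interior (hull K), weakDeriv M.brokenDomain i (u - v : L2 Ω) y ^ 2) ≤
      interpConst d s * Metric.diam (hull K) ^ 2 * oscSq H A K ∧
    (∑ i, ∑ j, ∫ y in interior (hull K), weakHess M.brokenDomain i j (u - v : L2 Ω) y ^ 2) ≤
      interpConst d s * oscSq H A K := by
  obtain ⟨h0, h1, h2⟩ := H2Limit.interp_error hd (isSimplex hK) hr hball hD
    (h.lim.mono (interior_hull_subset hΩ hK)) h.tendsto_zero
    (fun n x hx => h.uniform n x (hull_subset_closure hK hx)) hA rfl
  have hu2 := h.brokenH2 (M := M) hΩ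
  have hv2 := brokenH2_feInterp hΩ hv
  have hk' := fun K hK => ae_element_of_ae (M := M) (K := K) hΩ hK (Lp.coeFn_sub u v)
  refine ⟨le_trans (le_of_eq ?_) h0, le_trans (le_of_eq ?_) h1, le_trans (le_of_eq ?_) h2⟩
  · refine integral_congr_ae ?_
    filter_upwards [hk' K hK, interp_ae_eq hΩ hv hK] with x e1 e2
    rw [e1, e2, Pi.sub_apply]
  · refine Finset.sum_congr rfl fun i _ => integral_congr_ae ?_
    filter_upwards [hu2.weakDeriv_sub hv2 hk' i K hK, h.weakDeriv_ae_eq hΩ hK i,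
      hv2.brokenH1.weakDeriv_ae_eq hK (isWeakDeriv_feInterp hΩ hv hK i)] with x e1 e2 e3
    rw [e1, e2, e3]
  · refine Finset.sum_congr rfl fun i _ => Finset.sum_congr rfl fun j _ => integral_congr_ae ?_
    filter_upwards [hu2.weakHess_sub hv2 hk' i j K hK, h.weakHess_ae_eq hΩ hK i j,
      hv2.weakHess_ae_eq hK (isWeakDeriv_feInterp hΩ hv hK i)
        (IsWeakDeriv.of_contDiff (contDiff_pderiv (contDiff_interp K vc) i) j)] with x e1 e2 e3
    rw [e1, e2, e3]

/-- The trace inequality is applied to each first derivative of the error. The gradient term and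
`D²` times the Hessian term are both of order `D² N`, hence the factor `2`, and `h_F⁻¹ |F| D²` is
compensated by the volume of the element. -/
lemma facet_error (hd : d = 2 ∨ d = 3) (hΩ : IsConvexPolytopalDomain Ω)
    (h : ZeroLimit Ω w u G H vc ε) (hv : v =ᵐ[volume.restrict Ω] M.feInterp vc)
    (hK : K ∈ M.elements) (hr : 0 < r) (hs : 0 ≤ s) (hball : Metric.closedBall x₀ r ⊆ hull K)
    (hD : Metric.diam (hull K) ≤ s * r) (hA : ∀ i j, A i j = A j i)
    (hF : F ∈ M.facets) (hFK : F ⊆ K) :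
    (facetSize F)⁻¹ * ∑ i, ∫ x in hull F, trace (interior (hull K))
      (weakDeriv M.brokenDomain i (u - v : L2 Ω)) x ^ 2 ∂μHE[d - 1] ≤
      traceConst d s * oscSq H A K := by
  classical
  have hd1 : 1 ≤ d := by omega
  obtain ⟨z, hz, rfl⟩ := exists_erase_eq hF hK hFK
  obtain ⟨-, h1, h2⟩ := element_error (by omega) hΩ h hv hK hr hball hD hA
  have hb : M.BrokenH2 (u - v : L2 Ω) :=
    ((h.brokenH2 hΩ).sub (brokenH2_feInterp hΩ hv)).congr hΩ (Lp.coeFn_sub u v).symm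
  set N := oscSq H A K
  set D := Metric.diam (hull K)
  set S := (μHE[d - 1] : Measure (Space d)).real (hull (K.erase z))
  set V := volume.real (hull K)
  have hV : 0 < V := (isSimplex hK).volume_real_pos
  have hN : 0 ≤ N := oscSq_nonneg _ _ _
  have hS : 0 ≤ S := measureReal_nonneg
  have t := Finset.sum_le_sum fun i (_ : i ∈ Finset.univ) =>
    (hb.h1Approx_weakDeriv hK i).integral_trace_sq_le hd1 (isSimplex hK) hz
  rw [← Finset.mul_sum, ← Finset.mul_sum, Finset.sum_add_distrib, ← Finset.mul_sum] at t
  set T := ∑ i, ∫ x in hull (K.erase z), trace (interior (hull K))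
      (weakDeriv M.brokenDomain i (u - v : L2 Ω)) x ^ 2 ∂μHE[d - 1]
  have t1 : V * T ≤ 4 * 2 ^ (d - 1) * S * (2 * interpConst d s * D ^ 2 * N) := by
    refine t.trans (mul_le_mul_of_nonneg_left ?_ (by positivity))
    have := mul_le_mul_of_nonneg_left h2 (sq_nonneg D)
    linarith
  have t2 := (isSimplex hK).facetSize_inv_mul_le hd hz hr hs hball hD
  have hC := (interpConst_pos d s).le
  have hi := inv_nonneg.2 (facetSize_nonneg (K.erase z))
  refine le_of_mul_le_mul_left ?_ hV
  calc V * ((facetSize (K.erase z))⁻¹ * T) = (facetSize (K.erase z))⁻¹ * (V * T) := by ring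
    _ ≤ (facetSize (K.erase z))⁻¹ *
        (4 * 2 ^ (d - 1) * S * (2 * interpConst d s * D ^ 2 * N)) := by gcongr
    _ = 4 * 2 ^ (d - 1) * (2 * interpConst d s) * N *
        ((facetSize (K.erase z))⁻¹ * (S * D ^ 2)) := by ring
    _ ≤ 4 * 2 ^ (d - 1) * (2 * interpConst d s) * N * (facetConst d s * V) := by gcongr
    _ = _ := by rw [traceConst]; ring

/-- The constant of the interpolation estimate in the mesh norm. -/
def meshConst (d : ℕ) (s D : ℝ) : ℝ :=
  interpConst d s * (1 + D ^ 2 + D ^ 4) + 2 ^ (d + 1) * (2 * traceConst d s)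

/-- The interpolation error in the mesh norm. -/
theorem meshNorm_sub_feInterp_sq_le (hd : d = 2 ∨ d = 3) (hΩ : IsConvexPolytopalDomain Ω)
    (h : ZeroLimit Ω w u G H vc ε) (hv : v =ᵐ[volume.restrict Ω] M.feInterp vc) (hs : 0 ≤ s)
    (hball : ∀ K ∈ M.elements, ∃ (x : Space d) (r : ℝ), 0 < r ∧ Metric.closedBall x r ⊆ hull K ∧
      Metric.diam (hull K) ≤ s * r)
    {D : ℝ} (hD : ∀ K ∈ M.elements, Metric.diam (hull K) ≤ D)
    {A : Finset (Space d) → Fin d → Fin d → ℝ} (hA : ∀ K i j, A K i j = A K j i) :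
    M.meshNorm (u - v) ^ 2 ≤ meshConst d s D * ∑ K ∈ M.elements, oscSq H (A K) K := by
  classical
  have hd1 : 1 ≤ d := by omega
  have hb : M.BrokenH2 (u - v : L2 Ω) :=
    ((h.brokenH2 hΩ).sub (brokenH2_feInterp hΩ hv)).congr hΩ (Lp.coeFn_sub u v).symm
  have hC := (interpConst_pos d s).le
  rw [meshNorm_sq hΩ hb, meshConst, add_mul]
  refine add_le_add ?_ ?_
  · have e : ∀ f : Space d → ℝ, MemLp f 2 (volume.restrict Ω) →
        ∫ x in Ω, f x ^ 2 = ∑ K ∈ M.elements, ∫ x in interior (hull K), f x ^ 2 := fun f hf =>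
      setIntegral_eq_sum hΩ fun K hK => integrable_sq_of_memLp
        (hf.mono_measure (Measure.restrict_mono (interior_hull_subset hΩ hK) le_rfl))
    have e' : M.volSq (u - v : L2 Ω) = ∑ K ∈ M.elements,
        ((∑ i, ∑ j, ∫ y in interior (hull K), weakHess M.brokenDomain i j (u - v : L2 Ω) y ^ 2) +
          (∑ i, ∫ y in interior (hull K), weakDeriv M.brokenDomain i (u - v : L2 Ω) y ^ 2) +
          ∫ y in interior (hull K), (u - v : L2 Ω) y ^ 2) := by
      rw [volSq, e _ (Lp.memLp _)]
      simp only [e _ (hb.memLp_weakDeriv hΩ _), e _ (hb.memLp_weakHess hΩ _ _)]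
      simp only [Finset.sum_add_distrib]
      congr 2
      · rw [Finset.sum_comm]
        simp only [Finset.sum_comm (s := M.elements)]
        rw [Finset.sum_comm]
      · rw [Finset.sum_comm]
    rw [e', Finset.mul_sum]
    refine Finset.sum_le_sum fun K hK => ?_
    obtain ⟨x, r, hr, hx, hDr⟩ := hball K hK
    obtain ⟨h0, h1, h2⟩ := element_error (by omega) hΩ h hv hK hr hx hDr (hA K)
    have hN := oscSq_nonneg H (A K) K
    have hDK := hD K hK
    have hD0 : 0 ≤ Metric.diam (hull K) := Metric.diam_nonneg
    have g0 : interpConst d s * Metric.diam (hull K) ^ 4 * oscSq H (A K) K ≤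
        interpConst d s * D ^ 4 * oscSq H (A K) K := by gcongr
    have g1 : interpConst d s * Metric.diam (hull K) ^ 2 * oscSq H (A K) K ≤
        interpConst d s * D ^ 2 * oscSq H (A K) K := by gcongr
    linarith
  · have hT := traceConst_nonneg d hs
    rw [jumpSq_eq hd1 hb]
    -- Neither `u` nor the interpolant has jumps of its values, so the strongly weighted `h_F⁻³`
    -- term contributes nothing.
    have hz : ∑ F ∈ M.facets, (facetSize F ^ 3)⁻¹ *
        ∫ x in hull F, M.jump F (u - v : L2 Ω) x ^ 2 ∂μHE[d - 1] = 0 := by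
      refine Finset.sum_eq_zero fun F hF => ?_
      rw [mul_eq_zero]
      right
      refine integral_eq_zero_of_ae ?_
      filter_upwards [jump_sub hd1 (h.brokenH2 hΩ).brokenH1 (brokenH2_feInterp hΩ hv).brokenH1
        (fun K hK => ae_element_of_ae (M := M) hΩ hK (Lp.coeFn_sub u v)) hF,
        h.jump_ae_eq_zero hd1 hΩ hF, jump_feInterp_ae_eq_zero hd1 hΩ h.boundary hv hF]
        with x e1 e2 e3
      rw [e1, e2, e3]
      simp
    rw [hz, add_zero]
    -- The jump on a facet is bounded by the traces from its two elements. Writing the bound as a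
    -- sum over all elements that contain the facet prepares the exchange of the sums.
    have key : ∀ F ∈ M.interiorFacets, (facetSize F)⁻¹ * ∑ i, ∫ x in hull F,
        M.jump F (weakDeriv M.brokenDomain i (u - v : L2 Ω)) x ^ 2 ∂μHE[d - 1] ≤
        ∑ K ∈ M.elements, if F ⊆ K then 2 * traceConst d s * oscSq H (A K) K else 0 := by
      intro F hF
      have hFf := mem_facets_of_interior hF
      rcases jump_cases hFf with ⟨-, K, hK, K', hK', hne, hFK, hFK', hj⟩ | ⟨hns, -⟩
      swap
      · simp only [interiorFacets, Finset.mem_filter] at hF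
        exact absurd hF.2 hns
      obtain ⟨x, r, hr, hx, hDr⟩ := hball K hK
      obtain ⟨x', r', hr', hx', hDr'⟩ := hball K' hK'
      have f1 := facet_error hd hΩ h hv hK hr hs hx hDr (hA K) hFf hFK
      have f2 := facet_error hd hΩ h hv hK' hr' hs hx' hDr' (hA K') hFf hFK'
      have f3 := mul_le_mul_of_nonneg_left (Finset.sum_le_sum fun i (_ : i ∈ Finset.univ) =>
        integral_sq_le_two_mul ((hb.brokenH1_weakDeriv i).memLp_trace hd1 hFf hK hFK)
          ((hb.brokenH1_weakDeriv i).memLp_trace hd1 hFf hK' hFK')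
          (Eventually.of_forall (hj (weakDeriv M.brokenDomain i (u - v : L2 Ω)))))
        (inv_nonneg.2 (facetSize_nonneg F))
      simp only [Finset.sum_add_distrib, ← Finset.mul_sum, mul_add,
        mul_left_comm _ (2 : ℝ)] at f3
      have f4 : ∑ L ∈ ({K, K'} : Finset (Finset (Space d))),
          (if F ⊆ L then 2 * traceConst d s * oscSq H (A L) L else 0) ≤
          ∑ K ∈ M.elements, if F ⊆ K then 2 * traceConst d s * oscSq H (A K) K else 0 := by
        refine Finset.sum_le_sum_of_subset_of_nonneg ?_ fun L _ _ => ?_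
        · intro L hL
          simp only [Finset.mem_insert, Finset.mem_singleton] at hL
          rcases hL with rfl | rfl <;> assumption
        · have := oscSq_nonneg H (A L) L
          split_ifs
          · positivity
          · exact le_rfl
      rw [Finset.sum_pair hne, if_pos hFK, if_pos hFK'] at f4
      linarith
    refine (Finset.sum_le_sum key).trans ?_
    rw [Finset.sum_comm, Finset.mul_sum]
    refine Finset.sum_le_sum fun K hK => ?_
    have hN := oscSq_nonneg H (A K) K
    rw [← Finset.sum_filter, Finset.sum_const, nsmul_eq_mul]
    -- A crude count: facets of `K` are subsets of its `d + 1` vertices.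
    have hcard : ((M.interiorFacets.filter fun F => F ⊆ K).card : ℝ) ≤ 2 ^ (d + 1) := by
      have h1 : (M.interiorFacets.filter fun F => F ⊆ K) ⊆ K.powerset := fun F hF =>
        Finset.mem_powerset.2 (Finset.mem_filter.1 hF).2
      have h2 := Finset.card_le_card h1
      rw [Finset.card_powerset, (mem_elements.1 hK).2] at h2
      exact_mod_cast h2
    calc _ ≤ (2 : ℝ) ^ (d + 1) * (2 * traceConst d s * oscSq H (A K) K) := by gcongr
      _ = _ := by ring

end estimate
end Mesh

/-! ### Convergence of finite element interpolants -/

section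
variable {d : ℕ} {Ω : Set (Space d)} {w : ℕ → Space d → ℝ} {u : Space d → ℝ}
  {G : Fin d → Space d → ℝ} {H : Fin d → Fin d → Space d → ℝ}

lemma H2Limit.exists_hess_close (hΩ : IsConvexPolytopalDomain Ω) (h : H2Limit Ω w u G H) {η : ℝ}
    (hη : 0 < η) :
    ∃ n, ∑ i, ∑ j, ∫ x in Ω, (H i j x - pderiv j (pderiv i (w n)) x) ^ 2 < η := by
  have hm : ∀ n i j, MemLp (fun x => pderiv j (pderiv i (w n)) x - H i j x) 2
      (volume.restrict Ω) := fun n i j =>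
    (memLp_restrict_of_continuous (continuous_pderiv (contDiff_pderiv (h.smooth n) i) j)
      hΩ.isBounded.isCompact_closure hΩ.isOpen.measurableSet subset_closure
      hΩ.isBounded.measure_lt_top).sub
      (h.memLp_hess i j)
  have t : Tendsto (fun n => ∑ i, ∑ j, (eLpNorm (fun x => pderiv j (pderiv i (w n)) x - H i j x) 2
      (volume.restrict Ω)).toReal ^ 2) atTop (𝓝 (∑ _i : Fin d, ∑ _j : Fin d, (0 : ℝ) ^ 2)) :=
    tendsto_finsetSum _ fun i _ => tendsto_finsetSum _ fun j _ =>
      ((ENNReal.tendsto_toReal ENNReal.zero_ne_top).comp (h.lim_hess i j)).pow 2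
  simp only [eLpNorm_two_toReal_sq (hm _ _ _)] at t
  norm_num at t
  obtain ⟨n, hn⟩ := (t.eventually_lt_const hη).exists
  refine ⟨n, lt_of_eq_of_lt ?_ hn⟩
  refine Finset.sum_congr rfl fun i _ => Finset.sum_congr rfl fun j _ =>
    integral_congr_ae (Eventually.of_forall fun x => ?_)
  simp only
  ring

namespace Mesh

/-- On fine meshes, the Hessian of an `H²` function is almost elementwise constant. -/
lemma exists_oscSq_le (hΩ : IsConvexPolytopalDomain Ω) (h : H2Limit Ω w u G H) {η : ℝ}
    (hη : 0 < η) : ∃ δ > 0, ∀ M : Mesh Ω, (∀ K ∈ M.elements, Metric.diam (hull K) < δ) →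
      ∃ A : Finset (Space d) → Fin d → Fin d → ℝ, (∀ K i j, A K i j = A K j i) ∧
        ∑ K ∈ M.elements, oscSq H (A K) K ≤ η := by
  -- The Hessian is replaced by that of one smooth function, with error `η / 4`. The latter is
  -- uniformly continuous on the closure, so on small elements it is close to its value at a single
  -- point.
  obtain ⟨n, hn⟩ := h.exists_hess_close hΩ (η := η / 4) (by positivity)
  set Q : Space d → Fin d → Fin d → ℝ := fun x i j => pderiv j (pderiv i (w n)) x with hQ
  have hQc : Continuous Q := continuous_pi fun i => continuous_pi fun j =>
    continuous_pderiv (contDiff_pderiv (h.smooth n) i) j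
  have hcpt : IsCompact (closure Ω) := hΩ.isBounded.isCompact_closure
  have huc := hcpt.uniformContinuousOn_of_continuous hQc.continuousOn
  rw [Metric.uniformContinuousOn_iff] at huc
  have hfin : IsFiniteMeasure ((volume : Measure (Space d)).restrict Ω) :=
    ⟨by simpa using hΩ.isBounded.measure_lt_top⟩
  set V := volume.real Ω
  have hV : 0 ≤ V := measureReal_nonneg
  -- Chosen so that freezing the `d²` entries on all of `Ω` costs at most `η / 2` after the factor
  -- `2` from splitting the square; the `+ 1` avoids a zero denominator. The other half comes from
  -- `2 * (η / 4)`.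
  set τ := Real.sqrt (η / (4 * (d ^ 2 * V + 1))) with hτdef
  have hden : 0 < 4 * (d ^ 2 * V + 1) := by positivity
  have hτ : 0 < τ := Real.sqrt_pos.2 (by positivity)
  have hτ2 : 2 * (d ^ 2 * V * τ ^ 2) ≤ η / 2 := by
    rw [hτdef, Real.sq_sqrt (by positivity)]
    rw [mul_div_assoc', mul_div_assoc', div_le_div_iff₀ hden two_pos]
    nlinarith
  obtain ⟨δ, hδ, hclose⟩ := huc τ hτ
  refine ⟨δ, hδ, fun M hM => ?_⟩
  have hx : ∀ K : Finset (Space d), ∃ x, K ∈ M.elements → x ∈ hull K := fun K => by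
    by_cases hK : K ∈ M.elements
    · obtain ⟨x, hx⟩ := (isSimplex hK).interior_nonempty
      exact ⟨x, fun _ => interior_subset hx⟩
    · exact ⟨0, fun h => absurd h hK⟩
  choose x hx using hx
  -- Frozen values of a classical Hessian, hence symmetric, as the reproduction of quadratics
  -- requires.
  refine ⟨fun K => Q (x K), fun K i j => pderiv_comm (h.smooth n) i j (x K), ?_⟩
  have hHQ : ∀ i j, MemLp (fun y => H i j y - Q y i j) 2 (volume.restrict Ω) := fun i j => by
    have hQm : MemLp (fun y => Q y i j) 2 (volume.restrict Ω) :=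
      memLp_restrict_of_continuous (continuous_pderiv (contDiff_pderiv (h.smooth n) i) j)
        hcpt hΩ.isOpen.measurableSet subset_closure hΩ.isBounded.measure_lt_top
    exact (h.memLp_hess i j).sub hQm
  have hloc : ∀ K ∈ M.elements, oscSq H (Q (x K)) K ≤
      2 * (∑ i, ∑ j, ∫ y in interior (hull K), (H i j y - Q y i j) ^ 2) +
      2 * (d ^ 2 * ∫ y in interior (hull K), τ ^ 2) := by
    intro K hK
    have hfK : IsFiniteMeasure ((volume : Measure (Space d)).restrict (interior (hull K))) :=
      ⟨by simpa using (measure_mono interior_subset).trans_lt (isCompact_hull K).measure_lt_top⟩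
    have t : ∀ i j, ∫ y in interior (hull K), (H i j y - Q (x K) i j) ^ 2 ≤
        2 * (∫ y in interior (hull K), (H i j y - Q y i j) ^ 2) +
        2 * ∫ y in interior (hull K), τ ^ 2 := by
      intro i j
      have m1 := (hHQ i j).mono_measure
        (Measure.restrict_mono (interior_hull_subset hΩ hK) le_rfl)
      have m2 : MemLp (fun y => Q (x K) i j - Q y i j) 2
          (volume.restrict (interior (hull K))) :=
        memLp_interior_hull (continuous_const.sub
          (continuous_pderiv (contDiff_pderiv (h.smooth n) i) j)) K
      have t1 := integral_sq_le_two_mul m1 m2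
        (Eventually.of_forall fun y =>
          (by ring : H i j y - Q (x K) i j = (H i j y - Q y i j) - (Q (x K) i j - Q y i j)))
      have t2 : ∫ y in interior (hull K), (Q (x K) i j - Q y i j) ^ 2 ≤
          ∫ y in interior (hull K), τ ^ 2 := by
        refine setIntegral_mono_on (integrable_sq_of_memLp m2) (integrable_const _)
          isOpen_interior.measurableSet fun y hy => ?_
        have hy' := interior_subset hy
        have hd1 : dist (x K) y < δ :=
          (Metric.dist_le_diam_of_mem (isCompact_hull K).isBounded (hx K hK) hy').trans_lt (hM K hK)
        have h1 := hclose _ (hull_subset_closure hK (hx K hK)) _ (hull_subset_closure hK hy') hd1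
        have h2 : |Q (x K) i j - Q y i j| ≤ τ := by
          rw [← Real.dist_eq]
          exact ((dist_le_pi_dist _ _ j).trans (dist_le_pi_dist _ _ i)).trans h1.le
        exact sq_le_sq' (by linarith [neg_abs_le (Q (x K) i j - Q y i j)]) ((le_abs_self _).trans h2)
      linarith
    have u := Finset.sum_le_sum fun i (_ : i ∈ Finset.univ) =>
      Finset.sum_le_sum fun j (_ : j ∈ Finset.univ) => t i j
    simp only [Finset.sum_add_distrib, ← Finset.mul_sum, Finset.sum_const, Finset.card_univ,
      Fintype.card_fin, nsmul_eq_mul] at u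
    refine u.trans (le_of_eq ?_)
    ring
  have e : ∀ i j, ∫ y in Ω, (H i j y - Q y i j) ^ 2 =
      ∑ K ∈ M.elements, ∫ y in interior (hull K), (H i j y - Q y i j) ^ 2 := fun i j =>
    setIntegral_eq_sum hΩ fun K hK => integrable_sq_of_memLp
      ((hHQ i j).mono_measure (Measure.restrict_mono (interior_hull_subset hΩ hK) le_rfl))
  have e1 : ∑ K ∈ M.elements, ∑ i, ∑ j, ∫ y in interior (hull K), (H i j y - Q y i j) ^ 2 < η / 4 := by
    refine lt_of_eq_of_lt ?_ hn
    rw [Finset.sum_comm]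
    refine Finset.sum_congr rfl fun i _ => ?_
    rw [Finset.sum_comm]
    exact Finset.sum_congr rfl fun j _ => (e i j).symm
  have e2 : ∑ K ∈ M.elements, ∫ y in interior (hull K), τ ^ 2 = V * τ ^ 2 := by
    rw [← setIntegral_eq_sum (M := M) hΩ fun K hK =>
      (integrable_const (μ := volume.restrict Ω) (τ ^ 2)).mono_measure
        (Measure.restrict_mono (interior_hull_subset hΩ hK) le_rfl)]
    simp [V]
  refine (Finset.sum_le_sum hloc).trans ?_
  rw [Finset.sum_add_distrib, ← Finset.mul_sum, ← Finset.mul_sum, ← Finset.mul_sum, e2]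
  linarith

end Mesh
end

namespace Mesh
variable {d : ℕ} {Ω : Set (Space d)}

/-- Collects what is needed about `u`: smooth approximations in `H²`, their uniform limit by the
Sobolev embedding, and the vanishing of this limit on the boundary. The derivatives are recorded as
weak derivatives on `Ω` so that they can be compared with elementwise ones. -/
lemma exists_zeroLimit (hd : d ≤ 3) (hΩ : IsConvexPolytopalDomain Ω) {u : L2 Ω}
    (hu : MemH2 Ω u) (hu0 : u ∈ H10 Ω) :
    ∃ w G H vc ε, ZeroLimit Ω w u G H vc ε ∧ (∀ i, IsWeakDeriv Ω i u (G i)) ∧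
      ∀ i j, IsWeakDeriv Ω j (G i) (H i j) := by
  obtain ⟨hm, h1⟩ := hu
  choose G hG hGm h2 using h1
  choose H hH hHm using h2
  obtain ⟨w, hw, l0, l1, l2⟩ := exists_smooth_approx hΩ.isOpen hΩ.convex hΩ.nonempty hm hGm hHm hG hH
  have hl : H2Limit Ω w u G H := ⟨hw, hm, hGm, hHm, l0, l1, l2⟩
  obtain ⟨vc, ε, hε, hvc⟩ := hl.exists_continuous hd hΩ.isOpen hΩ.nonempty hΩ.isBounded hΩ.convex
  exact ⟨w, G, H, vc, ε, ⟨hl, hε, hvc, eq_zero_of_mem_H10 hΩ hl hG hε hvc hu0⟩, hG, hH⟩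

lemma memLp_feInterp (M : Mesh Ω) (hΩ : IsConvexPolytopalDomain Ω) (vc : Space d → ℝ) :
    MemLp (M.feInterp vc) 2 (volume.restrict Ω) := by
  refine memLp_of_elements (M := M) hΩ fun K hK =>
    (memLp_interior_hull (contDiff_interp K vc).continuous K).ae_eq ?_
  filter_upwards [ae_restrict_mem isOpen_interior.measurableSet] with x hx
  rw [feInterp_eq hK (interior_subset hx)]

/-- Finite element functions converge to functions in `H² ∩ H¹₀`, with controlled jumps. -/
theorem exists_tendsto_meshNorm (hd : d = 2 ∨ d = 3) (hΩ : IsConvexPolytopalDomain Ω) {u : L2 Ω}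
    (hu : MemH2 Ω u) (hu0 : u ∈ H10 Ω) {p : ℕ} (hp : 2 ≤ p) (s : Fin 2) (T : ℕ → Mesh Ω)
    (hshape : BddAbove (Set.range fun k => (T k).shapeRegularity))
    (hmesh : Tendsto (fun k => (T k).meshSize) atTop (𝓝 0)) :
    ∃ v : ∀ k, (T k).femSpace p s,
      Tendsto (fun k => (T k).meshNorm (u - v k)) atTop (𝓝 0) ∧
      (∀ k, (T k).jumpSeminorm (v k : L2 Ω) ≤ (T k).meshNorm (u - v k)) := by
  have hd1 : 1 ≤ d := by omega
  obtain ⟨w, G, H, vc, ε, hz, -, -⟩ := exists_zeroLimit (by omega) hΩ hu hu0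
  have hmem := fun k => (T k).memLp_feInterp hΩ vc
  have hv : ∀ k, ((hmem k).toLp : L2 Ω) =ᵐ[volume.restrict Ω] (T k).feInterp vc :=
    fun k => (hmem k).coeFn_toLp
  -- The discrete functions are the interpolants of the continuous representative `vc`; nodal values
  -- of the class `u` itself would not be well defined.
  refine ⟨fun k => ⟨(hmem k).toLp, mem_femSpace_of_ae_eq hΩ hz.boundary hp s _ (hv k)⟩, ?_,
    fun k => jumpSeminorm_feInterp_le hd1 hΩ hz (hv k)⟩
  obtain ⟨σ, hσ⟩ := hshape
  have hreg : ∀ k, (T k).shapeRegularity ≤ max σ 0 := fun k => (hσ ⟨k, rfl⟩).trans (le_max_left _ _)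
  have hσ0 : 0 ≤ max σ 0 := le_max_right _ _
  -- Shape regularity is replaced by a nonnegative bound, and the diameter bound in the constant is
  -- `1`, valid for all large `k`. So `C` does not depend on `k`.
  set C := meshConst d (4 * max σ 0) 1 with hC
  have hC0 : 0 < C := by
    have h1 := interpConst_pos d (4 * max σ 0)
    have h2 := traceConst_nonneg d (s := 4 * max σ 0) (by positivity)
    rw [hC, meshConst]
    positivity
  have hdiam : Tendsto (fun k => 4 * max σ 0 / unitBallVolume d ^ (1 / (d : ℝ)) * (T k).meshSize)
      atTop (𝓝 0) := by
    simpa using hmesh.const_mul (4 * max σ 0 / unitBallVolume d ^ (1 / (d : ℝ)))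
  have hsq : Tendsto (fun k => (T k).meshNorm (u - (hmem k).toLp) ^ 2) atTop (𝓝 0) := by
    refine Metric.tendsto_atTop'.2 fun η hη => ?_
    obtain ⟨δ, hδ, hosc⟩ := exists_oscSq_le hΩ hz.lim (η := η / (2 * C)) (by positivity)
    obtain ⟨N, hN⟩ := eventually_atTop.1 ((hdiam.eventually_lt_const hδ).and
      (hdiam.eventually_lt_const one_pos))
    refine ⟨N, fun k hk => ?_⟩
    obtain ⟨h1, h2⟩ := hN k hk.le
    have hD := fun K hK => diam_le_meshSize (M := T k) (K := K) hd1 hσ0 (hreg k) hK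
    obtain ⟨A, hA, hle⟩ := hosc (T k) fun K hK => (hD K hK).trans_lt h1
    have := meshNorm_sub_feInterp_sq_le hd hΩ hz (hv k) (s := 4 * max σ 0) (by positivity)
      (fun K hK => exists_ball hd1 hσ0 (hreg k) hK) (fun K hK => ((hD K hK).trans_lt h2).le) hA
    rw [Real.dist_eq, sub_zero, abs_of_nonneg (sq_nonneg _)]
    refine this.trans_lt ((mul_le_mul_of_nonneg_left hle hC0.le).trans_lt ?_)
    rw [mul_div_assoc', div_lt_iff₀ (by positivity)]
    nlinarith
  have := hsq.sqrt
  simp only [Real.sqrt_zero] at this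
  refine this.congr fun k => Real.sqrt_sq (Real.sqrt_nonneg _)

end Mesh

/-! ### The Isaacs operator -/

section infsup
variable {A B : Type*} {X Y : A → B → ℝ} {b c δ : ℝ}

lemma bddAbove_of_abs_le {f : B → ℝ} (h : ∀ β, |f β| ≤ b) : BddAbove (Set.range f) :=
  ⟨b, by rintro _ ⟨β, rfl⟩; exact (le_abs_self _).trans (h β)⟩

variable [Nonempty B]

lemma neg_le_ciSup_of_abs_le {f : B → ℝ} (h : ∀ β, |f β| ≤ b) : -b ≤ ⨆ β, f β := by
  obtain ⟨β⟩ := ‹Nonempty B›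
  exact (neg_le_of_abs_le (h β)).trans (le_ciSup (bddAbove_of_abs_le h) β)

lemma bddBelow_iSup_of_abs_le (h : ∀ α β, |X α β| ≤ b) :
    BddBelow (Set.range fun α => ⨆ β, X α β) :=
  ⟨-b, by rintro _ ⟨α, rfl⟩; exact neg_le_ciSup_of_abs_le (h α)⟩

variable [Nonempty A]

/-- The uniform bounds guarantee that all infima and suprema are genuine and not default values of
the conditionally complete order on the reals. -/
lemma iInf_iSup_le_add (hX : ∀ α β, |X α β| ≤ b) (hY : ∀ α β, |Y α β| ≤ c)
    (h : ∀ α β, |X α β - Y α β| ≤ δ) : (⨅ α, ⨆ β, X α β) ≤ (⨅ α, ⨆ β, Y α β) + δ := by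
  rw [← sub_le_iff_le_add]
  refine le_ciInf fun α => ?_
  rw [sub_le_iff_le_add]
  refine (ciInf_le (bddBelow_iSup_of_abs_le hX) α).trans (ciSup_le fun β => ?_)
  have h1 := le_ciSup (bddAbove_of_abs_le (hY α)) β
  have h2 := (le_abs_self _).trans (h α β)
  linarith

lemma abs_iInf_iSup_sub_le (hX : ∀ α β, |X α β| ≤ b) (hY : ∀ α β, |Y α β| ≤ c)
    (h : ∀ α β, |X α β - Y α β| ≤ δ) : |(⨅ α, ⨆ β, X α β) - ⨅ α, ⨆ β, Y α β| ≤ δ := by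
  have h1 := iInf_iSup_le_add hX hY h
  have h2 := iInf_iSup_le_add hY hX fun α β => (abs_sub_comm _ _).trans_le (h α β)
  rw [abs_le]
  constructor <;> linarith

/-- Multiplication by nonnegative weights preserves zero values of inf-sup expressions. -/
lemma iInf_iSup_mul_eq_zero (hX : ∀ α β, |X α β| ≤ b) {γ : A → B → ℝ} (hγ : ∀ α β, 0 ≤ γ α β)
    (hγ' : ∀ α β, γ α β ≤ c) (h : ⨅ α, ⨆ β, X α β = 0) : ⨅ α, ⨆ β, γ α β * X α β = 0 := by
  have hc : 0 ≤ c := by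
    obtain ⟨α⟩ := ‹Nonempty A›
    obtain ⟨β⟩ := ‹Nonempty B›
    exact (hγ α β).trans (hγ' α β)
  have hγX : ∀ α β, |γ α β * X α β| ≤ c * b := fun α β => by
    rw [abs_mul, abs_of_nonneg (hγ α β)]
    exact mul_le_mul (hγ' α β) (hX α β) (abs_nonneg _) hc
  have hS : ∀ α, 0 ≤ ⨆ β, X α β := fun α => h ▸ ciInf_le (bddBelow_iSup_of_abs_le hX) α
  -- Above zero: take `α` whose supremum is below `e / (c + 1)`; multiplication by weights in `[0,
  -- c]` keeps all values at most `e`. Below zero: every supremum is nonnegative, so some `β` has a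
  -- value above `-e / (c + 1)`, and its weighted value is at least `-e`.
  refine le_antisymm (le_of_forall_pos_le_add fun e he => ?_) (le_ciInf fun α => ?_)
  · have hlt : (⨅ α, ⨆ β, X α β) < e / (c + 1) := by rw [h]; positivity
    obtain ⟨α, hα⟩ := exists_lt_of_ciInf_lt hlt
    refine (ciInf_le (bddBelow_iSup_of_abs_le hγX) α).trans (ciSup_le fun β => ?_)
    have h1 := le_ciSup (bddAbove_of_abs_le (hX α)) β
    calc γ α β * X α β ≤ γ α β * (e / (c + 1)) := by
          gcongr
          · exact hγ α β
          · exact h1.trans hα.le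
      _ ≤ c * (e / (c + 1)) := by gcongr; exact hγ' α β
      _ ≤ 0 + e := by
        rw [zero_add, mul_div_assoc', div_le_iff₀ (by positivity)]
        nlinarith
  · refine le_of_forall_pos_le_add fun e he => ?_
    have hlt : -(e / (c + 1)) < ⨆ β, X α β :=
      (neg_lt_zero.2 (by positivity)).trans_le (hS α)
    obtain ⟨β, hβ⟩ := exists_lt_of_lt_ciSup hlt
    have h1 := le_ciSup (bddAbove_of_abs_le (hγX α)) β
    have h2 : γ α β * -(e / (c + 1)) ≤ γ α β * X α β :=
      mul_le_mul_of_nonneg_left hβ.le (hγ α β)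
    have h3 : γ α β * (e / (c + 1)) ≤ c * (e / (c + 1)) := by gcongr; exact hγ' α β
    have h4 : c * (e / (c + 1)) ≤ e := by
      rw [mul_div_assoc', div_le_iff₀ (by positivity)]
      nlinarith
    linarith

end infsup

namespace IsaacsData
variable {d : ℕ} {𝒜 ℬ : Type*} {P : IsaacsData d 𝒜 ℬ} {Ω U : Set (Space d)} {lam ν : ℝ}

/-- The coefficients are bounded. -/
lemma Admissible.exists_bound [TopologicalSpace 𝒜] [TopologicalSpace ℬ] [CompactSpace 𝒜]
    [CompactSpace ℬ] (hP : P.Admissible Ω lam ν) (hΩ : Bornology.IsBounded Ω) :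
    ∃ C : ℝ, 0 ≤ C ∧ ∀ x ∈ Ω, ∀ α β, (∀ i j, |P.a x α β i j| ≤ C) ∧ (∀ i, |P.b x α β i| ≤ C) ∧
      |P.c x α β| ≤ C ∧ |P.f x α β| ≤ C := by
  have hc : IsCompact (closure Ω ×ˢ (Set.univ : Set (𝒜 × ℬ))) :=
    hΩ.isCompact_closure.prod isCompact_univ
  have ha : ∀ i j, ∃ C, ∀ z ∈ closure Ω ×ˢ (Set.univ : Set (𝒜 × ℬ)),
      ‖P.a z.1 z.2.1 z.2.2 i j‖ ≤ C := fun i j =>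
    hc.exists_bound_of_continuousOn ((continuous_id.matrix_elem i j).comp_continuousOn hP.continuous_a)
  have hb : ∀ i, ∃ C, ∀ z ∈ closure Ω ×ˢ (Set.univ : Set (𝒜 × ℬ)),
      ‖P.b z.1 z.2.1 z.2.2 i‖ ≤ C := fun i =>
    hc.exists_bound_of_continuousOn
      ((EuclideanSpace.proj (𝕜 := ℝ) i).continuous.comp_continuousOn hP.continuous_b)
  choose Ca hCa using ha
  choose Cb hCb using hb
  obtain ⟨Cc, hCc⟩ := hc.exists_bound_of_continuousOn hP.continuous_c
  obtain ⟨Cf, hCf⟩ := hc.exists_bound_of_continuousOn hP.continuous_f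
  have s1 : ∀ i j, |Ca i j| ≤ ∑ i, ∑ j, |Ca i j| := fun i j =>
    (Finset.single_le_sum (fun _ _ => abs_nonneg _) (Finset.mem_univ j)).trans
      (Finset.single_le_sum (f := fun i => ∑ j, |Ca i j|)
        (fun _ _ => Finset.sum_nonneg fun _ _ => abs_nonneg _) (Finset.mem_univ i))
  have s2 : ∀ i, |Cb i| ≤ ∑ i, |Cb i| := fun i =>
    Finset.single_le_sum (f := fun i => |Cb i|) (fun _ _ => abs_nonneg _) (Finset.mem_univ i)
  have n1 : 0 ≤ ∑ i, ∑ j, |Ca i j| :=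
    Finset.sum_nonneg fun _ _ => Finset.sum_nonneg fun _ _ => abs_nonneg _
  have n2 : 0 ≤ ∑ i, |Cb i| := Finset.sum_nonneg fun _ _ => abs_nonneg _
  have n3 := abs_nonneg Cc
  have n4 := abs_nonneg Cf
  refine ⟨(∑ i, ∑ j, |Ca i j|) + (∑ i, |Cb i|) + |Cc| + |Cf|, by positivity,
    fun x hx α β => ?_⟩
  have hm : ((x, α, β) : Space d × 𝒜 × ℬ) ∈ closure Ω ×ˢ (Set.univ : Set (𝒜 × ℬ)) :=
    ⟨subset_closure hx, trivial⟩
  refine ⟨fun i j => ?_, fun i => ?_, ?_, ?_⟩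
  · have := (hCa i j _ hm).trans (le_abs_self _)
    rw [Real.norm_eq_abs] at this
    linarith [s1 i j]
  · have := (hCb i _ hm).trans (le_abs_self _)
    rw [Real.norm_eq_abs] at this
    linarith [s2 i]
  · have := (hCc _ hm).trans (le_abs_self _)
    rw [Real.norm_eq_abs] at this
    linarith
  · have := (hCf _ hm).trans (le_abs_self _)
    rw [Real.norm_eq_abs] at this
    linarith

/-- The renormalization function is nonnegative and bounded. -/
lemma Admissible.exists_gamma_bound [TopologicalSpace 𝒜] [TopologicalSpace ℬ] [CompactSpace 𝒜]
    [CompactSpace ℬ] (hd : 1 ≤ d) (hP : P.Admissible Ω lam ν) (hΩ : Bornology.IsBounded Ω) :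
    ∃ C : ℝ, 0 ≤ C ∧ ∀ x ∈ Ω, ∀ α β, 0 ≤ P.gamma lam x α β ∧ P.gamma lam x α β ≤ C := by
  obtain ⟨C, hC, hbd⟩ := hP.exists_bound hΩ
  obtain ⟨lo, hi, hlo, -, hell⟩ := hP.elliptic
  have hlam : 0 ≤ lam := by
    rcases hP.cordes with ⟨-, h, -⟩ | ⟨-, h, -⟩
    exacts [h.ge, h.le]
  -- One constant for both cases of the definition: if `lam = 0`, the term `C / lam` is zero by
  -- convention.
  refine ⟨(d * C + C / lam) / lo ^ 2, by positivity, fun x hx α β => ?_⟩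
  obtain ⟨ha, -, hc, -⟩ := hbd x hx α β
  -- Ellipticity tested with the coordinate vectors. It gives a nonnegative trace in the numerator,
  -- and a single diagonal entry already bounds the Frobenius norm in the denominator from below.
  have hdiag : ∀ i, lo ≤ P.a x α β i i := by
    intro i
    have h := (hell x hx (EuclideanSpace.single i 1) α β).1
    simpa [PiLp.single_apply] using h
  have htr0 : 0 ≤ (P.a x α β).trace :=
    Finset.sum_nonneg fun i _ => hlo.le.trans (hdiag i)
  have htr : (P.a x α β).trace ≤ d * C := by
    refine (Finset.sum_le_card_nsmul _ _ C fun i _ => (le_abs_self _).trans (ha i i)).trans ?_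
    simp
  have hfr : lo ^ 2 ≤ frobSq (P.a x α β) := by
    have h1 : P.a x α β ⟨0, hd⟩ ⟨0, hd⟩ ^ 2 ≤ frobSq (P.a x α β) :=
      (Finset.single_le_sum (f := fun j => P.a x α β ⟨0, hd⟩ j ^ 2) (fun _ _ => sq_nonneg _)
        (Finset.mem_univ _)).trans
        (Finset.single_le_sum (f := fun i => ∑ j, P.a x α β i j ^ 2)
          (fun _ _ => Finset.sum_nonneg fun _ _ => sq_nonneg _) (Finset.mem_univ _))
    exact (pow_le_pow_left₀ hlo.le (hdiag _) 2).trans h1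
  have hfr0 : 0 < frobSq (P.a x α β) := (pow_pos hlo 2).trans_le hfr
  have hc0 := hP.c_nonneg x hx α β
  have hcC := (le_abs_self _).trans hc
  unfold gamma
  split_ifs with h0
  · refine ⟨by positivity, ?_⟩
    rw [h0, div_zero, add_zero]
    gcongr
  · refine ⟨by positivity, ?_⟩
    have hden : lo ^ 2 ≤ frobSq (P.a x α β) + ‖P.b x α β‖ ^ 2 / (2 * lam) +
        P.c x α β ^ 2 / lam ^ 2 := by
      have h1 : 0 ≤ ‖P.b x α β‖ ^ 2 / (2 * lam) := by positivity
      have h2 : 0 ≤ P.c x α β ^ 2 / lam ^ 2 := by positivity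
      linarith
    gcongr

/-- The pointwise size of the derivatives up to second order. -/
def jet (U : Set (Space d)) (v : Space d → ℝ) (x : Space d) : ℝ :=
  (∑ i, ∑ j, |weakHess U i j v x|) + (∑ i, |weakDeriv U i v x|) + |v x|

lemma abs_linear_le {C : ℝ} {a h : Fin d → Fin d → ℝ} {b g : Fin d → ℝ} {c z : ℝ}
    (ha : ∀ i j, |a i j| ≤ C) (hb : ∀ i, |b i| ≤ C) (hc : |c| ≤ C) :
    |(∑ i, ∑ j, a i j * h i j) + (∑ i, b i * g i) - c * z| ≤
      C * ((∑ i, ∑ j, |h i j|) + (∑ i, |g i|) + |z|) := by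
  have h1 : |∑ i, ∑ j, a i j * h i j| ≤ C * ∑ i, ∑ j, |h i j| := by
    refine (Finset.abs_sum_le_sum_abs _ _).trans ?_
    rw [Finset.mul_sum]
    refine Finset.sum_le_sum fun i _ => (Finset.abs_sum_le_sum_abs _ _).trans ?_
    rw [Finset.mul_sum]
    refine Finset.sum_le_sum fun j _ => ?_
    rw [abs_mul]
    exact mul_le_mul_of_nonneg_right (ha i j) (abs_nonneg _)
  have h2 : |∑ i, b i * g i| ≤ C * ∑ i, |g i| := by
    refine (Finset.abs_sum_le_sum_abs _ _).trans ?_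
    rw [Finset.mul_sum]
    refine Finset.sum_le_sum fun i _ => ?_
    rw [abs_mul]
    exact mul_le_mul_of_nonneg_right (hb i) (abs_nonneg _)
  have h3 : |c * z| ≤ C * |z| := by
    rw [abs_mul]
    exact mul_le_mul_of_nonneg_right hc (abs_nonneg _)
  have h4 := abs_sub ((∑ i, ∑ j, a i j * h i j) + (∑ i, b i * g i)) (c * z)
  have h5 := abs_add_le (∑ i, ∑ j, a i j * h i j) (∑ i, b i * g i)
  linarith

end IsaacsData

/-! ### The residual of functions near the exact solution -/

section consistency
variable {d : ℕ} {𝒜 ℬ : Type*} [TopologicalSpace 𝒜] [TopologicalSpace ℬ] [CompactSpace 𝒜]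
  [CompactSpace ℬ] [Nonempty 𝒜] [Nonempty ℬ] {P : IsaacsData d 𝒜 ℬ} {Ω : Set (Space d)} {lam ν : ℝ}

lemma integral_abs_mul_le {X : Type*} [MeasurableSpace X] {μ : Measure X} {f g : X → ℝ}
    (hf : MemLp f 2 μ) (hg : MemLp g 2 μ) :
    ∫ x, |f x| * |g x| ∂μ ≤ Real.sqrt (∫ x, f x ^ 2 ∂μ) * Real.sqrt (∫ x, g x ^ 2 ∂μ) := by
  have h := integral_mul_norm_le_Lp_mul_Lq (μ := μ) (f := f) (g := g) (p := 2) (q := 2)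
    (by constructor <;> norm_num) (by simpa using hf) (by simpa using hg)
  simpa [Real.sqrt_eq_rpow] using h

lemma integrable_abs_mul {X : Type*} [MeasurableSpace X] {μ : Measure X} {f g : X → ℝ}
    (hf : MemLp f 2 μ) (hg : MemLp g 2 μ) : Integrable (fun x => |f x| * |g x|) μ :=
  hf.abs.integrable_mul hg.abs

lemma sqrt_integral_sq {X : Type*} [MeasurableSpace X] {μ : Measure X} (g : Lp ℝ 2 μ) :
    Real.sqrt (∫ x, g x ^ 2 ∂μ) = ‖g‖ := by
  rw [← eLpNorm_two_toReal_sq (Lp.memLp g), Real.sqrt_sq ENNReal.toReal_nonneg, Lp.norm_def]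

namespace Mesh

/-- Cauchy–Schwarz for each of the `d² + d + 1` derivatives of order at most two, every one of which
has `L²` norm at most the mesh norm. -/
lemma integral_jet_mul_le {M : Mesh Ω} (hΩ : IsConvexPolytopalDomain Ω) {v : L2 Ω}
    (h : M.BrokenH2 v) (g : L2 Ω) :
    Integrable (fun x => IsaacsData.jet M.brokenDomain v x * |g x|) (volume.restrict Ω) ∧
    ∫ x in Ω, IsaacsData.jet M.brokenDomain v x * |g x| ≤
      ((d : ℝ) ^ 2 + d + 1) * M.meshNorm v * ‖g‖ := by
  have hn := meshNorm_sq hΩ h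
  have hJ := M.jumpSq_nonneg v
  have n0 := integral_sq_nonneg (volume.restrict Ω) v
  have n1 : ∀ i, 0 ≤ ∫ x in Ω, weakDeriv M.brokenDomain i v x ^ 2 :=
    fun i => integral_sq_nonneg _ _
  have n2 : ∀ i j, 0 ≤ ∫ x in Ω, weakHess M.brokenDomain i j v x ^ 2 :=
    fun i j => integral_sq_nonneg _ _
  have s1 := Finset.sum_nonneg fun i (_ : i ∈ Finset.univ) => n1 i
  have s2 := Finset.sum_nonneg fun i (_ : i ∈ Finset.univ) =>
    Finset.sum_nonneg fun j (_ : j ∈ Finset.univ) => n2 i j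
  have hg := Lp.memLp g
  have key : ∀ f : Space d → ℝ, MemLp f 2 (volume.restrict Ω) →
      ∫ x in Ω, f x ^ 2 ≤ M.meshNorm v ^ 2 →
      ∫ x in Ω, |f x| * |g x| ≤ M.meshNorm v * ‖g‖ := by
    intro f hf hle
    refine (integral_abs_mul_le hf hg).trans ?_
    rw [sqrt_integral_sq g]
    exact mul_le_mul_of_nonneg_right ((Real.sqrt_le_sqrt hle).trans
      (le_of_eq (Real.sqrt_sq (Real.sqrt_nonneg _)))) (norm_nonneg _)
  have m1 := h.memLp_weakDeriv hΩ
  have m2 := h.memLp_weakHess hΩ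
  have k0 := key _ (Lp.memLp v) (by rw [hn, volSq]; linarith)
  have k1 := fun i => key _ (m1 i) (by
    have := Finset.single_le_sum (fun i _ => n1 i) (Finset.mem_univ i)
    rw [hn, volSq]; linarith)
  have k2 := fun i j => key _ (m2 i j) (by
    have h1 := Finset.single_le_sum (fun j _ => n2 i j) (Finset.mem_univ j)
    have h2 := Finset.single_le_sum (f := fun i => ∑ j, ∫ x in Ω,
      weakHess M.brokenDomain i j v x ^ 2) (fun i _ => Finset.sum_nonneg fun j _ => n2 i j)
      (Finset.mem_univ i)
    rw [hn, volSq]; linarith)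
  have i0 := integrable_abs_mul (Lp.memLp v) hg
  have i1 := fun i => integrable_abs_mul (m1 i) hg
  have i2 := fun i j => integrable_abs_mul (m2 i j) hg
  have I1 : Integrable (fun x => ∑ i, |weakDeriv M.brokenDomain i v x| * |g x|)
    (volume.restrict Ω) := integrable_finsetSum _ fun i _ => i1 i
  have I2 : Integrable (fun x => ∑ i, ∑ j, |weakHess M.brokenDomain i j v x| * |g x|)
    (volume.restrict Ω) := integrable_finsetSum _ fun i _ => integrable_finsetSum _ fun j _ => i2 i j
  have I12 : Integrable (fun x => (∑ i, ∑ j, |weakHess M.brokenDomain i j v x| * |g x|) +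
    ∑ i, |weakDeriv M.brokenDomain i v x| * |g x|) (volume.restrict Ω) := I2.add I1
  have e : (fun x => IsaacsData.jet M.brokenDomain v x * |g x|) = fun x =>
      (∑ i, ∑ j, |weakHess M.brokenDomain i j v x| * |g x|) +
      (∑ i, |weakDeriv M.brokenDomain i v x| * |g x|) + |v x| * |g x| := by
    funext x
    simp only [IsaacsData.jet, add_mul, Finset.sum_mul]
  rw [e]
  refine ⟨I12.add i0, ?_⟩
  rw [integral_add I12 i0, integral_add I2 I1, integral_finsetSum _ fun i _ => i1 i,
    integral_finsetSum _ fun i _ => integrable_finsetSum _ fun j _ => i2 i j]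
  simp only [integral_finsetSum _ fun j _ => i2 _ j]
  have u1 := Finset.sum_le_sum fun i (_ : i ∈ Finset.univ) => k1 i
  have u2 := Finset.sum_le_sum fun i (_ : i ∈ Finset.univ) =>
    Finset.sum_le_sum fun j (_ : j ∈ Finset.univ) => k2 i j
  simp only [Finset.sum_const, Finset.card_univ, Fintype.card_fin, nsmul_eq_mul] at u1 u2
  linarith

/-- The residual of functions close to the exact solution. -/
theorem exists_residual_bound (hd : d = 2 ∨ d = 3) (hΩ : IsConvexPolytopalDomain Ω)
    (hP : P.Admissible Ω lam ν) {u : L2 Ω} (hu : P.IsStrongSolution Ω u) :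
    ∃ C : ℝ, 0 ≤ C ∧ ∀ (M : Mesh Ω) (v g : L2 Ω), M.BrokenH2 v →
      |∫ x in Ω, P.opGamma lam M.brokenDomain v x * g x| ≤ C * M.meshNorm (u - v) * ‖g‖ := by
  obtain ⟨C, hC, hbd⟩ := hP.exists_bound hΩ.isBounded
  obtain ⟨Cγ, hCγ, hγ⟩ := hP.exists_gamma_bound (by omega) hΩ.isBounded
  obtain ⟨hu2, hu0, hsol⟩ := hu
  obtain ⟨w, G, H, vc, ε, hz, hG, hH⟩ := exists_zeroLimit (by omega) hΩ hu2 hu0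
  refine ⟨Cγ * C * ((d : ℝ) ^ 2 + d + 1), by positivity, fun M v g hv => ?_⟩
  have hub := hz.brokenH2 (M := M) hΩ
  have hk := Lp.coeFn_sub u v
  have hk' := fun K hK => ae_element_of_ae (M := M) (K := K) hΩ hK hk
  have hb : M.BrokenH2 (u - v : L2 Ω) := (hub.sub hv).congr hΩ hk.symm
  have bound : ∀ (z : Space d → ℝ) (x : Space d), x ∈ Ω → ∀ α β,
      |P.linOp M.brokenDomain α β z x - P.f x α β| ≤ C * IsaacsData.jet M.brokenDomain z x + C := by
    intro z x hx α β
    obtain ⟨h1, h2, h3, h4⟩ := hbd x hx α β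
    have h5 := IsaacsData.abs_linear_le (h := fun i j => weakHess M.brokenDomain i j z x)
      (g := fun i => weakDeriv M.brokenDomain i z x) (z := z x) h1 h2 h3
    exact (abs_sub _ _).trans (add_le_add h5 h4)
  have gbound : ∀ (z : Space d → ℝ) (x : Space d), x ∈ Ω → ∀ α β,
      |P.gamma lam x α β * (P.linOp M.brokenDomain α β z x - P.f x α β)| ≤
        Cγ * (C * IsaacsData.jet M.brokenDomain z x + C) := by
    intro z x hx α β
    obtain ⟨h1, h2⟩ := hγ x hx α β
    rw [abs_mul, abs_of_nonneg h1]
    exact mul_le_mul h2 (bound z x hx α β) (abs_nonneg _) hCγ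
  -- The equation for `u` is stated with weak derivatives on `Ω`, while the scheme uses those on the
  -- broken domain. Both agree almost everywhere with the same functions `G` and `H`.
  have d1 : ∀ᵐ x ∂volume.restrict Ω, ∀ i, weakDeriv Ω i u x = weakDeriv M.brokenDomain i u x := by
    refine ae_all_iff.2 fun i => ?_
    have h1 := weakDeriv_ae_eq hΩ.isOpen (hG i)
    have h2 := ae_of_elements (M := M) hΩ fun K hK => hz.weakDeriv_ae_eq hΩ hK i
    exact h1.trans h2.symm
  have d2 : ∀ᵐ x ∂volume.restrict Ω, ∀ i j,
      weakHess Ω i j u x = weakHess M.brokenDomain i j u x := by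
    refine ae_all_iff.2 fun i => ae_all_iff.2 fun j => ?_
    have h1 : weakHess Ω i j u =ᵐ[volume.restrict Ω] H i j :=
      weakDeriv_ae_eq hΩ.isOpen ((hH i j).congr (weakDeriv_ae_eq hΩ.isOpen (hG i)).symm
        EventuallyEq.rfl)
    have h2 := ae_of_elements (M := M) hΩ fun K hK => hz.weakHess_ae_eq hΩ hK i j
    exact h1.trans h2.symm
  have s1 : ∀ᵐ x ∂volume.restrict Ω, ∀ i, weakDeriv M.brokenDomain i (u - v : L2 Ω) x =
      weakDeriv M.brokenDomain i u x - weakDeriv M.brokenDomain i v x :=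
    ae_all_iff.2 fun i => ae_of_elements hΩ (hub.weakDeriv_sub hv hk' i)
  have s2 : ∀ᵐ x ∂volume.restrict Ω, ∀ i j, weakHess M.brokenDomain i j (u - v : L2 Ω) x =
      weakHess M.brokenDomain i j u x - weakHess M.brokenDomain i j v x :=
    ae_all_iff.2 fun i => ae_all_iff.2 fun j => ae_of_elements hΩ (hub.weakHess_sub hv hk' i j)
  -- Pointwise, `F_γ[u] = 0` and the inf-sup is nonexpansive. The source term cancels in the
  -- difference of the entries, and what remains is linear in the derivatives of `u - v`.
  have main : ∀ᵐ x ∂volume.restrict Ω, ‖P.opGamma lam M.brokenDomain v x * g x‖ ≤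
      Cγ * C * (IsaacsData.jet M.brokenDomain (u - v : L2 Ω) x * |g x|) := by
    filter_upwards [hsol, d1, d2, s1, s2, hk, ae_restrict_mem hΩ.isOpen.measurableSet]
      with x e0 e1 e2 e3 e4 e5 hx
    have hlin : ∀ α β, P.linOp Ω α β u x = P.linOp M.brokenDomain α β u x := fun α β => by
      simp only [IsaacsData.linOp, e1, e2]
    have hFu : P.opGamma lam M.brokenDomain u x = 0 := by
      refine iInf_iSup_mul_eq_zero (bound u x hx) (fun α β => (hγ x hx α β).1)
        (fun α β => (hγ x hx α β).2) ?_
      simpa only [IsaacsData.op, hlin] using e0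
    have hdiff : |P.opGamma lam M.brokenDomain u x - P.opGamma lam M.brokenDomain v x| ≤
        Cγ * (C * IsaacsData.jet M.brokenDomain (u - v : L2 Ω) x) := by
      refine abs_iInf_iSup_sub_le (gbound u x hx) (gbound v x hx) fun α β => ?_
      obtain ⟨h1, h2, h3, h4⟩ := hbd x hx α β
      obtain ⟨h6, h7⟩ := hγ x hx α β
      have h5 := IsaacsData.abs_linear_le (h := fun i j => weakHess M.brokenDomain i j (u - v : L2 Ω) x)
        (g := fun i => weakDeriv M.brokenDomain i (u - v : L2 Ω) x) (z := (u - v : L2 Ω) x) h1 h2 h3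
      have e : P.gamma lam x α β * (P.linOp M.brokenDomain α β u x - P.f x α β) -
          P.gamma lam x α β * (P.linOp M.brokenDomain α β v x - P.f x α β) =
          P.gamma lam x α β * ((∑ i, ∑ j, P.a x α β i j *
            weakHess M.brokenDomain i j (u - v : L2 Ω) x) +
            (∑ i, P.b x α β i * weakDeriv M.brokenDomain i (u - v : L2 Ω) x) -
            P.c x α β * (u - v : L2 Ω) x) := by
        simp only [IsaacsData.linOp, e3, e4, e5, Pi.sub_apply, mul_sub, Finset.sum_sub_distrib]
        ring
      rw [e, abs_mul, abs_of_nonneg h6]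
      exact mul_le_mul h7 h5 (abs_nonneg _) hCγ
    rw [hFu, zero_sub, abs_neg] at hdiff
    rw [norm_mul, Real.norm_eq_abs, Real.norm_eq_abs]
    calc _ ≤ _ := mul_le_mul_of_nonneg_right hdiff (abs_nonneg (g x))
      _ = _ := by ring
  obtain ⟨hint, hle⟩ := integral_jet_mul_le hΩ hb g
  -- Only the dominating function has to be integrable. Measurability of `F_γ[v]` is not needed,
  -- since the integral of a nonmeasurable function is zero by convention.
  have h1 := norm_integral_le_of_norm_le (hint.const_mul (Cγ * C)) main
  rw [Real.norm_eq_abs, integral_const_mul] at h1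
  refine h1.trans ((mul_le_mul_of_nonneg_left hle (by positivity)).trans (le_of_eq ?_))
  ring

end Mesh
end consistency

/-! ### Quasi-optimality of the scheme -/

namespace Mesh

/-- Near-best approximation by solutions of discretely consistent, strongly monotone schemes. -/
theorem meshNorm_sub_le {d : ℕ} {𝒜 ℬ : Type*} {P : IsaacsData d 𝒜 ℬ} {Ω : Set (Space d)} {lam : ℝ}
    (hΩ : IsConvexPolytopalDomain Ω) {M : Mesh Ω} {p : ℕ} {s : Fin 2}
    {u : L2 Ω} {A : M.femSpace p s → M.femSpace p s → ℝ} {CF Ccons CL Cmon : ℝ} (hCF : 0 ≤ CF)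
    (hcons : 0 < Ccons) (hL : 0 < CL) (hmon : 0 < Cmon)
    (hres : ∀ v g : L2 Ω, M.BrokenH2 v →
      |∫ x in Ω, P.opGamma lam M.brokenDomain v x * g x| ≤ CF * M.meshNorm (u - v) * ‖g‖)
    (hA2 : M.DiscretelyConsistent P lam (M.femSpace p s) A Ccons CL)
    (hA3 : M.StronglyMonotone (M.femSpace p s) A Cmon) {uh v : M.femSpace p s}
    (huh : ∀ z, A uh z = 0) (hv : M.jumpSeminorm (v : L2 Ω) ≤ M.meshNorm (u - v)) :
    M.meshNorm ((uh - v : M.femSpace p s) : L2 Ω) ≤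
      Cmon * (CF * CL + Ccons) * M.meshNorm (u - v) := by
  obtain ⟨L, hL1, hL2⟩ := hA2
  set e : M.femSpace p s := uh - v with he
  set E := M.meshNorm (e : L2 Ω) with hE
  set δ := M.meshNorm (u - v) with hδ
  have hE0 : 0 ≤ E := Real.sqrt_nonneg _
  have hδ0 : 0 ≤ δ := Real.sqrt_nonneg _
  -- Monotonicity for the pair `uh`, `v`. As `uh` solves the discrete problem, only `-A v e`
  -- remains, which consistency splits into the residual tested with `L e` and the jumps of `v`.
  have h1 : Cmon⁻¹ * E ^ 2 ≤ A uh e - A v e := hA3 uh v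
  rw [huh e, zero_sub] at h1
  have h2 := hL1 v e
  have h3 := hres v (L e) (brokenH2_of_mem_femSpace hΩ v.2)
  have h4 : CF * δ * ‖L e‖ ≤ CF * δ * (CL * E) :=
    mul_le_mul_of_nonneg_left (hL2 e) (by positivity)
  have h5 : Ccons * M.jumpSeminorm (v : L2 Ω) * E ≤ Ccons * δ * E := by gcongr
  have h6 : Cmon⁻¹ * E ^ 2 ≤ (CF * CL + Ccons) * δ * E := by
    have h7 := (abs_le.1 h2).1
    have h8 := (abs_le.1 h3).1
    nlinarith
  have h9 : E ^ 2 ≤ Cmon * (CF * CL + Ccons) * δ * E := by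
    rw [inv_mul_le_iff₀ hmon] at h6
    linarith
  -- The estimate is quadratic in `E` on the left and linear on the right; one factor `E` is
  -- cancelled unless it is zero, when the claim is trivial.
  rcases hE0.eq_or_lt with h0 | h0
  · rw [← h0]
    positivity
  · refine le_of_mul_le_mul_right ?_ h0
    rw [← sq]
    exact h9

end Mesh

end IsaacsFEM

end

/-! ### Convergence of the numerical solutions -/

theorem corollary4p5 {d : ℕ} (hd : d = 2 ∨ d = 3)
    {𝒜 ℬ : Type*} [MetricSpace 𝒜] [CompactSpace 𝒜] [Nonempty 𝒜]
    [MetricSpace ℬ] [CompactSpace ℬ] [Nonempty ℬ]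
    (Ω : Set (Space d)) (hΩ : IsConvexPolytopalDomain Ω)
    (P : IsaacsData d 𝒜 ℬ) (lam ν : ℝ) (hP : P.Admissible Ω lam ν)
    -- the exact solution in `H²(Ω) ∩ H¹₀(Ω)`
    (u : L2 Ω) (hu : P.IsStrongSolution Ω u)
    (p : ℕ) (hp : 2 ≤ p) (s : Fin 2)
    -- a shape-regular sequence of meshes with mesh-size tending to `0`
    (T : ℕ → Mesh Ω)
    (hshape : BddAbove (Set.range fun k => (T k).shapeRegularity))
    (hmesh : Tendsto (fun k => (T k).meshSize) atTop (𝓝 0))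
    -- nonlinear forms that are linear in the second argument
    (A : ∀ k, (T k).femSpace p s → (T k).femSpace p s → ℝ)
    (hlin : ∀ k w, IsLinearMap ℝ (A k w))
    -- the three assumptions, with constants that are positive and uniformly bounded in `k`
    (CLip Ccons CL Cmon : ℕ → ℝ)
    (hpos : ∀ k, 0 < CLip k ∧ 0 < Ccons k ∧ 0 < CL k ∧ 0 < Cmon k)
    (hCLip : BddAbove (Set.range CLip)) (hCcons : BddAbove (Set.range Ccons))
    (hCL : BddAbove (Set.range CL)) (hCmon : BddAbove (Set.range Cmon))
    (hA1 : ∀ k, (T k).LipschitzForm ((T k).femSpace p s) (A k) (CLip k))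
    (hA2 : ∀ k, (T k).DiscretelyConsistent P lam ((T k).femSpace p s) (A k) (Ccons k) (CL k))
    (hA3 : ∀ k, (T k).StronglyMonotone ((T k).femSpace p s) (A k) (Cmon k))
    -- the numerical solutions
    (uh : ∀ k, (T k).femSpace p s) (huh : ∀ k v, A k (uh k) v = 0) :
    Tendsto (fun k => (T k).meshNorm (u - (uh k : L2 Ω))) atTop (𝓝 0) := by
  obtain ⟨CF, hCF, hres⟩ := Mesh.exists_residual_bound hd hΩ hP hu
  obtain ⟨v, hv, hvJ⟩ := Mesh.exists_tendsto_meshNorm hd hΩ hu.1 hu.2.1 hp s T hshape hmesh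
  obtain ⟨B₁, hB₁⟩ := hCcons
  obtain ⟨B₂, hB₂⟩ := hCL
  obtain ⟨B₃, hB₃⟩ := hCmon
  have b₁ : ∀ k, Ccons k ≤ B₁ := fun k => hB₁ ⟨k, rfl⟩
  have b₂ : ∀ k, CL k ≤ B₂ := fun k => hB₂ ⟨k, rfl⟩
  have b₃ : ∀ k, Cmon k ≤ B₃ := fun k => hB₃ ⟨k, rfl⟩
  have hd1 : 1 ≤ d := by omega
  obtain ⟨w, G, H, vc, ε, hz, -, -⟩ := Mesh.exists_zeroLimit (by omega) hΩ hu.1 hu.2.1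
  -- The quasi-optimality constant evaluated at the upper bounds of the constants of the scheme; it
  -- is independent of `k`.
  set B := B₃ * (CF * B₂ + B₁) with hB
  have key : ∀ k, (T k).meshNorm (u - (uh k : L2 Ω)) ^ 2 ≤
      (2 + 2 * B ^ 2) * (T k).meshNorm (u - (v k : L2 Ω)) ^ 2 := by
    intro k
    obtain ⟨-, h1, h2, h3⟩ := hpos k
    have hN : 0 ≤ (T k).meshNorm (u - (v k : L2 Ω)) := Real.sqrt_nonneg _
    have h4 := Mesh.meshNorm_sub_le hΩ hCF h1 h2 h3 (hres (T k)) (hA2 k) (hA3 k) (huh k) (hvJ k)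
    have h5 : Cmon k * (CF * CL k + Ccons k) ≤ B := by
      have := b₁ k
      have := b₂ k
      have := b₃ k
      have : 0 ≤ B₃ := h3.le.trans (b₃ k)
      rw [hB]
      gcongr
    have h6 := h4.trans (mul_le_mul_of_nonneg_right h5 hN)
    have h7 : (T k).meshNorm ((uh k - v k : (T k).femSpace p s) : L2 Ω) ^ 2 ≤
        (B * (T k).meshNorm (u - (v k : L2 Ω))) ^ 2 := pow_le_pow_left₀ (Real.sqrt_nonneg _) h6 2
    have hv2 := Mesh.brokenH2_of_mem_femSpace hΩ (v k).2
    have hub := hz.brokenH2 (M := T k) hΩ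
    have h8 := Mesh.meshNorm_sub_sq_le hd1 hΩ
      ((hub.sub hv2).congr hΩ (Lp.coeFn_sub u (v k : L2 Ω)).symm)
      (Mesh.brokenH2_of_mem_femSpace hΩ (uh k - v k).2)
    -- The error is split as `(u - v) - (uh - v)`, so that the quasi-triangle inequality for squares
    -- applies; this is the origin of `2 + 2 * B ^ 2`.
    have h9 : u - (v k : L2 Ω) - ((uh k - v k : (T k).femSpace p s) : L2 Ω) = u - uh k := by
      rw [Submodule.coe_sub]
      abel
    rw [h9] at h8
    rw [mul_pow] at h7
    linarith
  have hsq : Tendsto (fun k => (T k).meshNorm (u - (uh k : L2 Ω)) ^ 2) atTop (𝓝 0) := by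
    refine squeeze_zero (fun k => sq_nonneg _) key ?_
    simpa using (hv.pow 2).const_mul (2 + 2 * B ^ 2)
  have := hsq.sqrt
  simp only [Real.sqrt_zero] at this
  exact this.congr fun k => Real.sqrt_sq (Real.sqrt_nonneg _)
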